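/- **Setting.** Let $A$ be a sectorial operator on a complex Banach space $X$: $A$ is closed and densely defined, and there are $b\in\mathbb R$, $\phi\in(0,\pi/2)$, $K\ge 1$ such that every $z\ne b$ with $\phi\le|\arg(z-b)|\le\pi$ lies in the resolvent set of $A$ and $\|(z-A)^{-1}\|\le K/|z-b|$. Let $a\in\mathbb R$ be such that $\operatorname{Re}\sigma(\Lambda)>0$ for $\Lambda=A+aI$. For $0\le\alpha<1$ let $X^\alpha=D(\Lambda^\alpha)$ with the norm $\|u\|_\alpha=\|\Lambda^\alpha u\|$, where $\Lambda^0=I$ and, for $\alpha>0$, $\Lambda^{\alpha}$ is the inverse of $\Lambda^{-\alpha}=\Gamma(\alpha)^{-1}\int_0^\infty t^{\alpha-1}e^{-\Lambda t}\,dt$. Let $\lambda_0$ be an eigenvalue of $A$ and $\beta_1<\operatorname{Re}\lambda_0<\beta_2$ real numbers such that $\sigma(A)=\sigma^1\cup\{\lambda_0\}\cup\sigma^3$ with $\sigma^1=\sigma(A)\cap\{\operatorname{Re}z\le\beta_1\}$ and $\sigma^3=\sigma(A)\cap\{\operatorname{Re}z\ge\beta_2\}$. Let $P_1,P_2$ be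 the Riesz spectral projections of $\sigma^1$ and $\{\lambda_0\}$, $P_3=I-P_1-P_2$, and $X^i=P_iX$; assume that $X^1$ and $X^2$ are finite dimensional (so $\lambda_0$ has finite algebraic multiplicity). Put $X_i^\alpha=X^i\cap X^\alpha$ and $X_{13}^\alpha=X_1^\alpha\oplus X_3^\alpha$. Fix $0<\beta<\min\{\operatorname{Re}\lambda_0-\beta_1,\ \beta_2-\operatorname{Re}\lambda_0\}$ and let $J=(\operatorname{Re}\lambda_0-\frac14\beta,\ \operatorname{Re}\lambda_0+\frac14\beta)$. For $\lambda\in J$ let $A^i$ be the part of $A-\lambda I$ in $X^i$. For $\lambda\in J$ and $\alpha\in[0,1)$ we say that $M$ is *admissible* for $(\lambda,\alpha)$ if $$\|\Lambda^\alpha e^{-A^1t}P_1\|\le Me^{\frac34\beta t},\quad \|e^{-A^1t}P_1\|\le Me^{\frac34\beta t}\qquad(t\le 0),$$ $$\|\Lambda^\alpha e^{-A^2t}P_2\|\le Me^{\frac14\beta|t|},\quad \|e^{-A^2t}P_2\|\le Me^{\frac14\beta|t|}\qquad(t\in\mathbb R),$$ $$\|\Lambda^\alpha e^{-A^3t}P_3\Lambda^{-\alpha}\|\le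 Me^{-\frac34\beta t},\quad \|\Lambda^\alpha e^{-A^3t}P_3\|\le Mt^{-\alpha}e^{-\frac34\beta t}\qquad(t>0).$$ For $\mu\in(\frac14\beta,\frac34\beta)$ put $$F_\mu=M\Big[\int_0^\infty e^{-(\mu-\frac14\beta)s}\,ds+\int_0^\infty(1+s^{-\alpha})e^{-(\frac34\beta-\mu)s}\,ds\Big],$$ and let $\mathcal X_\mu$ be the space of all $u\in C(\mathbb R;X^\alpha)$ with $\sup_{t}e^{-\mu|t|}\|u(t)\|_\alpha<\infty$. For $f:X^\alpha\to X$ consider the equation $u_t+Au=\lambda u+f(u)$. A solution on $[0,T)$ is a continuous function $u:[0,T)\to X^\alpha$ that is differentiable in $X$, takes values in $D(A)$ and satisfies the equation on $(0,T)$; a full solution is a continuous $u:\mathbb R\to X^\alpha$ with these properties on $\mathbb R$. **Theorem 3.1.** 1. For every $\theta<\frac14\beta$ there is an $M>0$ that is admissible for all $\lambda$ with $|\lambda-\operatorname{Re}\lambda_0|\le\theta$ and all $\alpha\in[0,1)$. If $\lambda_0$ is semisimple (that is, $A=\lambda_0I$ on $X^2$), there is an $M>0$ that is admissible for all $\lambda\in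 J$ and all $\alpha\in[0,1)$. 2. Let $\alpha\in[0,1)$, $\lambda\in J$, let $M$ be admissible for $(\lambda,\alpha)$, and let $\mu\in(\frac14\beta,\frac34\beta)$. Let $f:X^\alpha\to X$ be Lipschitz continuous with a Lipschitz constant $L_f$ such that $F_\mu L_f<1$. Then the equation generates a global semiflow $\Phi_\lambda$ on $X^\alpha$ (continuous on $[0,\infty)\times X^\alpha$; $t\mapsto\Phi_\lambda(t)u_0$ is a solution on $[0,\infty)$ for each $u_0\in X^\alpha$, and every solution on an interval $[0,T)$ starting from $u_0$ agrees with it there), and there is a Lipschitz continuous map $\xi_\lambda:X_2^\alpha\to X_{13}^\alpha$ such that $$\mathcal M_\lambda=\{w+\xi_\lambda(w):\ w\in X_2^\alpha\}$$ is invariant, $\Phi_\lambda(t)\mathcal M_\lambda=\mathcal M_\lambda$ for all $t\ge0$. Moreover, $\mathcal M_\lambda$ is the set of all values $u(0)$ of full solutions $u\in\mathcal X_\mu$. -/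

import Mathlib

open Set Filter Topology MeasureTheory
open scoped NNReal

noncomputable section

namespace SectorialIM

variable {X : Type*} [NormedAddCommGroup X] [NormedSpace ℂ X]

/-! ### Resolvent, spectrum, sectorial operators -/

/-- `R` is a bounded two-sided inverse of `z I - A`. -/
def IsResolventAt (A : X →ₗ.[ℂ] X) (z : ℂ) (R : X →L[ℂ] X) : Prop :=
  (∀ x : X, ∃ h : R x ∈ A.domain, z • R x - A ⟨R x, h⟩ = x) ∧
    ∀ x : A.domain, R (z • (x : X) - A x) = x

/-- The resolvent set of the unbounded operator `A`. -/
def resolventSet (A : X →ₗ.[ℂ] X) : Set ℂ := {z | ∃ R : X →L[ℂ] X, IsResolventAt A z R}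

/-- The spectrum `σ(A)`. -/
def spectrum (A : X →ₗ.[ℂ] X) : Set ℂ := (resolventSet A)ᶜ

open Classical in
/-- The resolvent `(z I - A)⁻¹` (only meaningful for `z` in the resolvent set). -/
def resolvent (A : X →ₗ.[ℂ] X) (z : ℂ) : X →L[ℂ] X :=
  if h : z ∈ resolventSet A then h.choose else 0

/-- `A` is closed and densely defined, the sector
`{z : φ ≤ |arg (z - b)| ≤ π, z ≠ b}` lies in the resolvent set, and
`‖(z - A)⁻¹‖ ≤ K / |z - b|` on this sector. -/
structure IsSectorialWith (A : X →ₗ.[ℂ] X) (b φ K : ℝ) : Prop where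
  closed : A.IsClosed
  dense : Dense (A.domain : Set X)
  angle_pos : 0 < φ
  angle_lt : φ < Real.pi / 2
  one_le : 1 ≤ K
  mem_resolventSet : ∀ z : ℂ, z ≠ b → φ ≤ |Complex.arg (z - b)| → z ∈ resolventSet A
  norm_resolvent_le : ∀ z : ℂ, z ≠ b → φ ≤ |Complex.arg (z - b)| →
    ‖resolvent A z‖ ≤ K / ‖z - b‖

/-- Sectorial operators. -/
def IsSectorial (A : X →ₗ.[ℂ] X) : Prop := ∃ b φ K : ℝ, IsSectorialWith A b φ K

/-- `z₀` is an eigenvalue of `A`. -/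
def IsEigenvalue (A : X →ₗ.[ℂ] X) (z₀ : ℂ) : Prop :=
  ∃ x : A.domain, (x : X) ≠ 0 ∧ A x = z₀ • (x : X)

/-! ### The semigroup `e^{-At}` -/

/-- The boundary of the sector of half-angle `φ` with vertex `b - 1`, opening to the right;
it is run through upwards. -/
def sectorPath (b φ s : ℝ) : ℂ :=
  ((b - 1 + |s| * Real.cos φ : ℝ) : ℂ) + ((s * Real.sin φ : ℝ) : ℂ) * Complex.I

/-- The velocity of `sectorPath` (away from the vertex). -/
def sectorVel (φ s : ℝ) : ℂ :=
  ((SignType.sign s : ℝ) * Real.cos φ : ℝ) + ((Real.sin φ : ℝ) : ℂ) * Complex.I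

open Classical in
/-- The analytic semigroup `e^{-At}`, `t ≥ 0`, generated by `-A` for a sectorial operator `A`:
for `t > 0` it is the Dunford integral `(2πi)⁻¹ ∫ e^{-zt} (z - A)⁻¹ dz` over the boundary of a
sector around the spectrum, run through with the spectrum on the left-hand side (whence the minus
sign, as `sectorPath` has it on the right-hand side); for `t = 0` it is the identity. The sector
is one that witnesses that `A` is sectorial; the value does not depend on it. -/
def semigroup (A : X →ₗ.[ℂ] X) (t : ℝ) : X →L[ℂ] X :=
  if h : ∃ p : ℝ × ℝ, ∃ K : ℝ, IsSectorialWith A p.1 p.2 K then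
    if t = 0 then ContinuousLinearMap.id ℂ X
    else
      -((2 * Real.pi * Complex.I : ℂ)⁻¹ • ∫ s : ℝ,
        (Complex.exp (-(sectorPath h.choose.1 h.choose.2 s * t)) * sectorVel h.choose.2 s) •
          resolvent A (sectorPath h.choose.1 h.choose.2 s))
  else 0

/-! ### Fractional powers of `Λ = A + a I` and the spaces `X^α` -/

open Classical in
/-- `Λ^{-α} = Γ(α)⁻¹ ∫_0^∞ t^{α-1} e^{-Λt} dt` for `α > 0`, where `Λ = A + a I`, so that
`e^{-Λt} = e^{-at} e^{-At}`; and `Λ^0 = I`. -/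
def negFracPow (A : X →ₗ.[ℂ] X) (a α : ℝ) : X →L[ℂ] X :=
  if α = 0 then ContinuousLinearMap.id ℂ X
  else ((Real.Gamma α)⁻¹ : ℂ) •
    ∫ t in Ioi (0 : ℝ), ((t ^ (α - 1) * Real.exp (-(a * t)) : ℝ) : ℂ) • semigroup A t

/-- `X^α = D(Λ^α) = R(Λ^{-α})`, as a type of its own, since it carries its own norm. -/
def FracSpace (A : X →ₗ.[ℂ] X) (a α : ℝ) : Type _ :=
  LinearMap.range (negFracPow A a α : X →ₗ[ℂ] X)

instance (A : X →ₗ.[ℂ] X) (a α : ℝ) : AddCommGroup (FracSpace A a α) :=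
  inferInstanceAs (AddCommGroup (LinearMap.range (negFracPow A a α : X →ₗ[ℂ] X)))

instance (A : X →ₗ.[ℂ] X) (a α : ℝ) : Module ℂ (FracSpace A a α) :=
  inferInstanceAs (Module ℂ (LinearMap.range (negFracPow A a α : X →ₗ[ℂ] X)))

/-- The inclusion `X^α ⊆ X`. -/
def FracSpace.incl (A : X →ₗ.[ℂ] X) (a α : ℝ) : FracSpace A a α →ₗ[ℂ] X :=
  (LinearMap.range (negFracPow A a α : X →ₗ[ℂ] X)).subtype

open Classical in
/-- `Λ^α : X^α → X`, the inverse of `Λ^{-α}`. (If `Λ^{-α}` is not injective, which does not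
happen for a sectorial operator with `Re σ(Λ) > 0` and `α ≥ 0`, the inclusion is used instead.) -/
def fracPow (A : X →ₗ.[ℂ] X) (a α : ℝ) : FracSpace A a α →ₗ[ℂ] X :=
  if h : Function.Injective (negFracPow A a α : X →ₗ[ℂ] X) then
    ((LinearEquiv.ofInjective (negFracPow A a α : X →ₗ[ℂ] X) h).symm :
      LinearMap.range (negFracPow A a α : X →ₗ[ℂ] X) →ₗ[ℂ] X)
  else FracSpace.incl A a α

theorem fracPow_injective (A : X →ₗ.[ℂ] X) (a α : ℝ) :
    Function.Injective (fracPow A a α) := by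
  by_cases h : Function.Injective (negFracPow A a α : X →ₗ[ℂ] X)
  · have e : fracPow A a α =
        ((LinearEquiv.ofInjective (negFracPow A a α : X →ₗ[ℂ] X) h).symm :
          LinearMap.range (negFracPow A a α : X →ₗ[ℂ] X) →ₗ[ℂ] X) := dif_pos h
    rw [e]
    exact (LinearEquiv.ofInjective (negFracPow A a α : X →ₗ[ℂ] X) h).symm.injective
  · have e : fracPow A a α = FracSpace.incl A a α := dif_neg h
    rw [e]
    exact Subtype.val_injective

/-- The norm `‖u‖_α = ‖Λ^α u‖` of `X^α`. -/
instance (A : X →ₗ.[ℂ] X) (a α : ℝ) : NormedAddCommGroup (FracSpace A a α) :=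
  NormedAddCommGroup.induced _ _ (fracPow A a α) (fracPow_injective A a α)

instance (A : X →ₗ.[ℂ] X) (a α : ℝ) : NormedSpace ℂ (FracSpace A a α) :=
  NormedSpace.induced ℂ (FracSpace A a α) X (fracPow A a α)

/-! ### Spectral subspaces -/

/-- The circle of centre `c` and radius `r` separates the part `S` of the spectrum (inside) from
the rest of the spectrum (outside). -/
def Encloses (A : X →ₗ.[ℂ] X) (S : Set ℂ) (c : ℂ) (r : ℝ) : Prop :=
  0 < r ∧ S ⊆ Metric.ball c r ∧ spectrum A ∩ Metric.closedBall c r = S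

open Classical in
/-- The Riesz-Dunford integral `(2πi)⁻¹ ∮ g(z) (z - A)⁻¹ dz` over a circle that encloses the part
`S` of the spectrum and no other point of it. For entire `g` this is `g(A|_Y) P`, where `P` is the
spectral projection that belongs to `S` and `Y` is its range. -/
def dunford (A : X →ₗ.[ℂ] X) (S : Set ℂ) (g : ℂ → ℂ) : X →L[ℂ] X :=
  if h : ∃ p : ℂ × ℝ, Encloses A S p.1 p.2 then
    (2 * Real.pi * Complex.I : ℂ)⁻¹ •
      ∮ z in C(h.choose.1, h.choose.2), g z • resolvent A z
  else 0

/-- The spectral projection (Riesz projection) that belongs to the part `S` of the spectrum. -/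
def spectralProj (A : X →ₗ.[ℂ] X) (S : Set ℂ) : X →L[ℂ] X := dunford A S (fun _ => 1)

/-- `σ¹ = σ(A) ∩ {Re z ≤ β₁}`. -/
def sigma1 (A : X →ₗ.[ℂ] X) (β₁ : ℝ) : Set ℂ := spectrum A ∩ {z | z.re ≤ β₁}

/-- `σ³ = σ(A) ∩ {Re z ≥ β₂}`. -/
def sigma3 (A : X →ₗ.[ℂ] X) (β₂ : ℝ) : Set ℂ := spectrum A ∩ {z | β₂ ≤ z.re}

/-- The projection onto `X¹`. -/
def P1 (A : X →ₗ.[ℂ] X) (β₁ : ℝ) : X →L[ℂ] X := spectralProj A (sigma1 A β₁)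

/-- The projection onto `X²`. -/
def P2 (A : X →ₗ.[ℂ] X) (z₀ : ℂ) : X →L[ℂ] X := spectralProj A {z₀}

/-- The projection onto `X³`. -/
def P3 (A : X →ₗ.[ℂ] X) (β₁ : ℝ) (z₀ : ℂ) : X →L[ℂ] X :=
  ContinuousLinearMap.id ℂ X - P1 A β₁ - P2 A z₀

/-- `X_i^α = X^i ∩ X^α`, where `X^i` is the range of the projection `P`. -/
def fracPart (A : X →ₗ.[ℂ] X) (a α : ℝ) (P : X →L[ℂ] X) : Submodule ℂ (FracSpace A a α) :=
  (LinearMap.range (P : X →ₗ[ℂ] X)).comap (FracSpace.incl A a α)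

/-- `X_2^α`. -/
abbrev X2 (A : X →ₗ.[ℂ] X) (a α : ℝ) (z₀ : ℂ) : Submodule ℂ (FracSpace A a α) :=
  fracPart A a α (P2 A z₀)

/-- `X_{13}^α = X_1^α ⊕ X_3^α`. -/
abbrev X13 (A : X →ₗ.[ℂ] X) (a α β₁ : ℝ) (z₀ : ℂ) : Submodule ℂ (FracSpace A a α) :=
  fracPart A a α (P1 A β₁) ⊔ fracPart A a α (P3 A β₁ z₀)

/-- `σ(A)` is the union of `σ¹ = σ(A) ∩ {Re z ≤ β₁}`, `{z₀}` and `σ³ = σ(A) ∩ {Re z ≥ β₂}`,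
where `β₁ < Re z₀ < β₂` and `z₀` is an eigenvalue; the spectral subspaces `X¹` and `X²` are finite
dimensional (for `X²`: `z₀` has finite algebraic multiplicity). -/
structure SpectralSplitting (A : X →ₗ.[ℂ] X) (z₀ : ℂ) (β₁ β₂ : ℝ) : Prop where
  lt_re : β₁ < z₀.re
  re_lt : z₀.re < β₂
  eigenvalue : IsEigenvalue A z₀
  spectrum_eq : spectrum A = sigma1 A β₁ ∪ {z₀} ∪ sigma3 A β₂
  finiteDimensional_X1 : FiniteDimensional ℂ (LinearMap.range (P1 A β₁ : X →ₗ[ℂ] X))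
  finiteDimensional_X2 : FiniteDimensional ℂ (LinearMap.range (P2 A z₀ : X →ₗ[ℂ] X))

/-- The eigenvalue `z₀` is semisimple: every vector of `X²` is an eigenvector or zero. -/
def IsSemisimpleEigenvalue (A : X →ₗ.[ℂ] X) (z₀ : ℂ) : Prop :=
  ∀ x : X, ∃ h : P2 A z₀ x ∈ A.domain, A ⟨P2 A z₀ x, h⟩ = z₀ • P2 A z₀ x

/-! ### The exponential estimates -/

/-- `e^{-A¹t} P₁` for `t ∈ ℝ`, where `A¹` is the part of `A - lam I` in `X¹`. -/
def exp1 (A : X →ₗ.[ℂ] X) (β₁ lam t : ℝ) : X →L[ℂ] X :=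
  dunford A (sigma1 A β₁) (fun z => Complex.exp (-((z - lam) * t)))

/-- `e^{-A²t} P₂` for `t ∈ ℝ`, where `A²` is the part of `A - lam I` in `X²`. -/
def exp2 (A : X →ₗ.[ℂ] X) (z₀ : ℂ) (lam t : ℝ) : X →L[ℂ] X :=
  dunford A {z₀} (fun z => Complex.exp (-((z - lam) * t)))

/-- `e^{-A³t} P₃` for `t ≥ 0`, where `A³` is the part of `A - lam I` in `X³`. -/
def exp3 (A : X →ₗ.[ℂ] X) (β₁ : ℝ) (z₀ : ℂ) (lam t : ℝ) : X →L[ℂ] X :=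
  ((Real.exp (lam * t) : ℝ) : ℂ) • (semigroup A t ∘L P3 A β₁ z₀)

/-- `‖Λ^α T‖ ≤ C` : the operator `T` maps `X` into `X^α`, with norm at most `C`. -/
def FracBound (A : X →ₗ.[ℂ] X) (a α : ℝ) (T : X →L[ℂ] X) (C : ℝ) : Prop :=
  ∀ x : X, ∃ y : FracSpace A a α, FracSpace.incl A a α y = T x ∧ ‖y‖ ≤ C * ‖x‖

/-- `‖Λ^α T Λ^{-α}‖ ≤ C` : the operator `T` maps `X^α` into itself, with norm at most `C`. -/
def FracFracBound (A : X →ₗ.[ℂ] X) (a α : ℝ) (T : X →L[ℂ] X) (C : ℝ) : Prop :=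
  ∀ x : FracSpace A a α, ∃ y : FracSpace A a α,
    FracSpace.incl A a α y = T (FracSpace.incl A a α x) ∧ ‖y‖ ≤ C * ‖x‖

/-- The exponential estimates, with constant `M`, for the operator `A - lam I` in the three
spectral subspaces. -/
structure ExpEstimates (A : X →ₗ.[ℂ] X) (a : ℝ) (z₀ : ℂ) (β₁ β lam α M : ℝ) : Prop where
  frac1 : ∀ t : ℝ, t ≤ 0 → FracBound A a α (exp1 A β₁ lam t) (M * Real.exp (3 / 4 * β * t))
  norm1 : ∀ t : ℝ, t ≤ 0 → ‖exp1 A β₁ lam t‖ ≤ M * Real.exp (3 / 4 * β * t)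
  frac2 : ∀ t : ℝ, FracBound A a α (exp2 A z₀ lam t) (M * Real.exp (1 / 4 * β * |t|))
  norm2 : ∀ t : ℝ, ‖exp2 A z₀ lam t‖ ≤ M * Real.exp (1 / 4 * β * |t|)
  fracfrac3 : ∀ t : ℝ, 0 < t →
    FracFracBound A a α (exp3 A β₁ z₀ lam t) (M * Real.exp (-(3 / 4 * β * t)))
  frac3 : ∀ t : ℝ, 0 < t →
    FracBound A a α (exp3 A β₁ z₀ lam t) (M * t ^ (-α) * Real.exp (-(3 / 4 * β * t)))

/-- The constant `F_μ`. -/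
def Fmu (M β α μ : ℝ) : ℝ :=
  M * ((∫ s in Ioi (0 : ℝ), Real.exp (-((μ - 1 / 4 * β) * s))) +
    ∫ s in Ioi (0 : ℝ), (1 + s ^ (-α)) * Real.exp (-((3 / 4 * β - μ) * s)))

/-! ### The evolution equation `u_t + A u = lam u + f(u)` -/

/-- The equation `u_t + A u = lam u + f(u)` holds at every time of the (open) set `I`; the
derivative is taken in `X`. -/
def SolvesOn (A : X →ₗ.[ℂ] X) (a α lam : ℝ) (f : FracSpace A a α → X)
    (u : ℝ → FracSpace A a α) (I : Set ℝ) : Prop :=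
  ∀ t ∈ I, ∃ h : FracSpace.incl A a α (u t) ∈ A.domain,
    HasDerivAt (fun s => FracSpace.incl A a α (u s))
      (-A ⟨FracSpace.incl A a α (u t), h⟩ + (lam : ℂ) • FracSpace.incl A a α (u t) + f (u t)) t

/-- `Φ` is the (global) semiflow on `X^α` generated by the equation: for each `u₀` the function
`t ↦ Φ t u₀` is a solution on `[0,∞)`, and any solution on any `[0,T)` is given by `Φ`. -/
structure IsGeneratedSemiflow (A : X →ₗ.[ℂ] X) (a α lam : ℝ) (f : FracSpace A a α → X)
    (Φ : Flow ℝ≥0 (FracSpace A a α)) : Prop where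
  solves : ∀ u₀ : FracSpace A a α,
    SolvesOn A a α lam f (fun t : ℝ => Φ t.toNNReal u₀) (Ioi 0)
  unique : ∀ (T : ℝ) (u : ℝ → FracSpace A a α), ContinuousOn u (Ico 0 T) →
    SolvesOn A a α lam f u (Ioo 0 T) → ∀ t ∈ Ico 0 T, u t = Φ t.toNNReal (u 0)

/-- `u` is a full solution: continuous from `ℝ` to `X^α`, and satisfies the equation on `ℝ`. -/
def IsFullSolution (A : X →ₗ.[ℂ] X) (a α lam : ℝ) (f : FracSpace A a α → X)
    (u : ℝ → FracSpace A a α) : Prop :=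
  Continuous u ∧ SolvesOn A a α lam f u univ

/-- The exponentially weighted space `𝒳_μ = {u ∈ C(ℝ; X^α) : sup_t e^{-μ|t|} ‖u(t)‖_α < ∞}`. -/
def weightedSpace (A : X →ₗ.[ℂ] X) (a α μ : ℝ) : Set (ℝ → FracSpace A a α) :=
  {u | Continuous u ∧ BddAbove (range fun t : ℝ => Real.exp (-(μ * |t|)) * ‖u t‖)}

/-- The graph `{w + ξ(w) : w ∈ X_2^α}`. -/
def manifold {A : X →ₗ.[ℂ] X} {a α β₁ : ℝ} {z₀ : ℂ}
    (ξ : X2 A a α z₀ → X13 A a α β₁ z₀) : Set (FracSpace A a α) :=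
  range fun w : X2 A a α z₀ => (w : FracSpace A a α) + (ξ w : FracSpace A a α)

end SectorialIM

end

set_option linter.unusedSectionVars false

noncomputable section

namespace SectorialIM

variable {X : Type*} [NormedAddCommGroup X] [NormedSpace ℂ X]

section
/-! ### Relative resolvents -/

/-! The manifold comes from the Lyapunov–Perron method. A full solution with growth at most
`e^{μ|t|}` is determined by its central component at time zero: expressing its expanding component
by an integral from `+∞` and its contracting component by one from `-∞` gives, with `w = P₂ u(0)`,
`u(t) = e^{-A²t} w + ∫_0^t e^{-A²(t-s)} P₂ f(u) ds - ∫_t^∞ e^{-A¹(t-s)} P₁ f(u) ds + ∫_{-∞}^t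
e^{-A³(t-s)} P₃ f(u) ds`. By the exponential estimates the right-hand side is a contraction with
constant `F_μ L_f` in the weighted space, so each `w` has exactly one solution, and it depends
Lipschitz continuously on `w` (`IsTrichotomy.exists_lyapunovPerron`,
`IsTrichotomy.norm_sub_le_of_lyapunovPerron`). Conversely, a full solution in the weighted space
satisfies this equation, because the difference of the two sides is a trajectory of the linear
equation that grows too slowly to have an expanding or contracting component
(`IsTrichotomy.eq_zero_of_forall_semigroup`). Hence `ξ(w) = u(0) - w`, and the manifold is invariant
because the set of these full solutions is invariant under translation in time.

The linear theory is built from the resolvent. Spectral subspaces are not treated as spaces of their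
own: the part of `A` in the range of a projection `Q` is represented by an operator on `X` that
inverts `z - A` there (`IsRelRes`). If such an inverse exists throughout a disc, Cauchy's theorem
kills the circle integral composed with `Q`. This gives idempotence of the Riesz projections, their
independence of the circle, and their mutual orthogonality. The semigroup is a Dunford integral over
a sector contour whose vertex may be moved (`contourInt_shift`). It is determined by its generator
(`IsAnalyticSemigroup.unique`), so the angle may be changed as well; after multiplication by `P₃`
the contour can be pushed to the right past the spectrum that has been removed, which yields the
decay on `X³`.

Fractional powers are handled by conjugation: `Λ^α` is an isometry from `X^α` onto `X`, and in these
coordinates the singular kernel is `Λ^α e^{-Λt} = Λ^{-(1-α)} Λ e^{-Λt}`, a product of bounded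
operators. The constants are uniform in `α` on all of `[0,1)` because the moment inequality
`IsDecaying.exists_norm_fracInt_le` is: the factor `1 / Γ(1-α)` cancels the divergence of `∫_0^τ
t^{-α} dt` as `α → 1`.

Solutions of the differential equation are exchanged for solutions of the variation of constants
formula. One direction integrates the derivative of `e^{-(A-λ)(t-s)} u(s)`; the other needs the
Hölder continuity of mild solutions at positive times, which makes the Duhamel integral
differentiable. In mild form, existence, uniqueness and the semiflow property follow from a
contraction in a space with a large exponential weight. -/

/-- `G` inverts `z - A` on the range of `Q`: `(z - A) G = Q`, `G (z - A) ⊆ Q` and `Q G = G = G Q`. -/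
structure IsRelRes (A : X →ₗ.[ℂ] X) (Q : X →L[ℂ] X) (z : ℂ) (G : X →L[ℂ] X) : Prop where
  mem_graph : ∀ x, (G x, z • G x - Q x) ∈ A.graph
  apply_graph : ∀ x y, (x, y) ∈ A.graph → G (z • x - y) = Q x
  left : Q * G = G
  right : G * Q = G

/-- `A T = B` as operators. -/
def GraphOp (A : X →ₗ.[ℂ] X) (T B : X →L[ℂ] X) : Prop := ∀ x, (T x, B x) ∈ A.graph

/-- `T` commutes with `A`. -/
def GraphComm (A : X →ₗ.[ℂ] X) (T : X →L[ℂ] X) : Prop :=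
  ∀ x y, (x, y) ∈ A.graph → (T x, T y) ∈ A.graph

/-- The resolvent set of the part of `A` in the range of `Q`. -/
def relSet (A : X →ₗ.[ℂ] X) (Q : X →L[ℂ] X) : Set ℂ := {z | ∃ G, IsRelRes A Q z G}

open Classical in
/-- The resolvent of the part of `A` in the range of `Q`, composed with `Q`. -/
def relRes (A : X →ₗ.[ℂ] X) (Q : X →L[ℂ] X) (z : ℂ) : X →L[ℂ] X :=
  if h : z ∈ relSet A Q then h.choose else 0

variable {A : X →ₗ.[ℂ] X} {Q Q' G G' T B : X →L[ℂ] X} {z w p : ℂ}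

theorem graph_snd_inj {x y y' : X} (h : (x, y) ∈ A.graph) (h' : (x, y') ∈ A.graph) : y = y' :=
  LinearPMap.mem_graph_snd_inj A h h' rfl

theorem mem_graph_iff_exists {x y : X} :
    (x, y) ∈ A.graph ↔ ∃ h : x ∈ A.domain, A ⟨x, h⟩ = y := by
  rw [LinearPMap.mem_graph_iff]
  constructor
  · rintro ⟨⟨x', hx'⟩, h1, h2⟩
    obtain rfl : x' = x := h1
    exact ⟨hx', h2⟩
  · rintro ⟨h, h2⟩
    exact ⟨⟨x, h⟩, rfl, h2⟩

theorem IsRelRes.unique (h : IsRelRes A Q z G) (h' : IsRelRes A Q z G') : G = G' := by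
  ext x
  have h1 := h'.apply_graph _ _ (h.mem_graph x)
  have h2 : G' (Q x) = G' x := congrArg (fun T : X →L[ℂ] X => T x) h'.right
  have h3 : Q (G x) = G x := congrArg (fun T : X →L[ℂ] X => T x) h.left
  rw [sub_sub_cancel, h2, h3] at h1
  exact h1.symm

theorem isRelRes_one_iff : IsRelRes A 1 z G ↔ IsResolventAt A z G := by
  constructor
  · intro h
    refine ⟨fun x => ?_, fun x => h.apply_graph _ _ (LinearPMap.mem_graph A x)⟩
    obtain ⟨h1, h2⟩ := mem_graph_iff_exists.1 (h.mem_graph x)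
    exact ⟨h1, by rw [h2]; simp⟩
  · intro h
    refine ⟨fun x => ?_, fun x y hxy => ?_, one_mul _, mul_one _⟩
    · obtain ⟨h1, h2⟩ := h.1 x
      refine mem_graph_iff_exists.2 ⟨h1, ?_⟩
      simp only [one_apply_eq_self]
      nth_rewrite 3 [← h2]
      abel
    · obtain ⟨h1, rfl⟩ := mem_graph_iff_exists.1 hxy
      exact h.2 ⟨x, h1⟩

theorem relSet_one : relSet A 1 = resolventSet A := by
  ext z
  exact exists_congr fun G => isRelRes_one_iff

theorem isRelRes_relRes (h : z ∈ relSet A Q) : IsRelRes A Q z (relRes A Q z) := by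
  rw [relRes, dif_pos h]
  exact h.choose_spec

theorem IsRelRes.mem (h : IsRelRes A Q z G) : z ∈ relSet A Q := ⟨G, h⟩

theorem IsRelRes.eq (h : IsRelRes A Q z G) : relRes A Q z = G :=
  (isRelRes_relRes h.mem).unique h

theorem isRelRes_resolvent (h : z ∈ resolventSet A) : IsRelRes A 1 z (resolvent A z) := by
  rw [resolvent, dif_pos h]
  exact isRelRes_one_iff.2 h.choose_spec

theorem relRes_one (h : z ∈ resolventSet A) : relRes A 1 z = resolvent A z :=
  (isRelRes_resolvent h).eq

theorem resolvent_mem_graph (h : z ∈ resolventSet A) :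
    GraphOp A (resolvent A z) (z • resolvent A z - 1) :=
  (isRelRes_resolvent h).mem_graph

theorem resolvent_apply_graph (h : z ∈ resolventSet A) {x y : X} (hxy : (x, y) ∈ A.graph) :
    resolvent A z (z • x - y) = x :=
  (isRelRes_resolvent h).apply_graph x y hxy

/-- A single point of the resolvent set turns the unbounded relation `y = A x` into an equation
between bounded operators. Such an equation passes through Bochner integrals, so it plays the role
of closedness in everything below. -/
theorem mem_graph_iff (h : p ∈ resolventSet A) {x y : X} :
    (x, y) ∈ A.graph ↔ resolvent A p (p • x - y) = x := by
  refine ⟨resolvent_apply_graph h, fun hx => ?_⟩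
  have := (isRelRes_resolvent h).mem_graph (p • x - y)
  rw [hx] at this
  simpa using this

theorem GraphOp.unique {B' : X →L[ℂ] X} (h : GraphOp A T B) (h' : GraphOp A T B') : B = B' := by
  ext x
  exact graph_snd_inj (h x) (h' x)

theorem GraphOp.mul (h : GraphOp A T B) (S : X →L[ℂ] X) : GraphOp A (T * S) (B * S) :=
  fun x => h (S x)

theorem GraphOp.smul (h : GraphOp A T B) (c : ℂ) : GraphOp A (c • T) (c • B) :=
  fun x => A.graph.smul_mem c (h x)

theorem GraphComm.graphOp (hQ : GraphComm A Q) (h : GraphOp A T B) : GraphOp A (Q * T) (Q * B) :=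
  fun x => hQ _ _ (h x)

theorem GraphComm.mul (hQ : GraphComm A Q) (h : GraphComm A Q') : GraphComm A (Q * Q') :=
  fun _ _ hxy => hQ _ _ (h _ _ hxy)

theorem GraphComm.sub (hQ : GraphComm A Q) (h : GraphComm A Q') : GraphComm A (Q - Q') :=
  fun _ _ hxy => A.graph.sub_mem (hQ _ _ hxy) (h _ _ hxy)

theorem GraphComm.smul (hQ : GraphComm A Q) (c : ℂ) : GraphComm A (c • Q) :=
  fun _ _ hxy => A.graph.smul_mem c (hQ _ _ hxy)

theorem graphComm_one : GraphComm A 1 := fun _ _ hxy => hxy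

theorem IsRelRes.graphComm (h : IsRelRes A Q z G) : GraphComm A G := by
  intro x y hxy
  have h1 := h.apply_graph x y hxy
  have h2 := h.mem_graph x
  rw [map_sub, map_smul] at h1
  rwa [← h1, sub_sub_cancel] at h2

theorem graphComm_resolvent (h : z ∈ resolventSet A) : GraphComm A (resolvent A z) :=
  (isRelRes_resolvent h).graphComm

theorem GraphComm.commute_relRes (hQ' : GraphComm A Q') (hc : Commute Q' Q)
    (h : IsRelRes A Q z G) : Commute Q' G := by
  ext x
  have h1 := h.apply_graph _ _ (hQ' _ _ (h.mem_graph x))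
  have e1 : G (Q' (Q x)) = G (Q' x) := by
    have := congrArg (fun T : X →L[ℂ] X => T x) (show G * (Q' * Q) = G * Q' by
      rw [hc.eq, ← mul_assoc, h.right])
    exact this
  have e2 : Q (Q' (G x)) = Q' (G x) := by
    have := congrArg (fun T : X →L[ℂ] X => T x) (show Q * (Q' * G) = Q' * G by
      rw [← mul_assoc, ← hc.eq, mul_assoc, h.left])
    exact this
  rw [map_sub, map_sub Q', map_smul, map_sub, map_smul, map_smul, sub_sub_cancel, e1, e2] at h1
  exact h1.symm

theorem GraphComm.commute_resolvent (hQ : GraphComm A Q) (h : z ∈ resolventSet A) :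
    Commute Q (resolvent A z) :=
  hQ.commute_relRes (Commute.one_right Q) (isRelRes_resolvent h)

theorem graphComm_iff (h : p ∈ resolventSet A) :
    GraphComm A Q ↔ Commute Q (resolvent A p) := by
  refine ⟨fun hQ => hQ.commute_resolvent h, fun hc x y hxy => ?_⟩
  rw [mem_graph_iff h] at hxy ⊢
  rw [← map_smul, ← map_sub]
  have := congrArg (fun T : X →L[ℂ] X => T (p • x - y)) hc.eq
  simp only [mul_apply_eq_comp, hxy] at this
  exact this.symm

/-- A commuting projection restricts the part of `A` further. The relative resolvent for `P₃ = (1 -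
P₁)(1 - P₂)` is obtained in this way from the one for either factor. -/
theorem IsRelRes.mul (h : IsRelRes A Q z G) (hQ' : GraphComm A Q') (hc : Commute Q' Q)
    (hi : Q' * Q' = Q') : IsRelRes A (Q * Q') z (G * Q') := by
  have hG := hQ'.commute_relRes hc h
  refine ⟨fun x => h.mem_graph (Q' x), fun x y hxy => ?_, ?_, ?_⟩
  · have := h.apply_graph _ _ (hQ' _ _ hxy)
    rw [← map_smul, ← map_sub] at this
    exact this
  · rw [mul_assoc, ← mul_assoc Q' G, hG.eq, mul_assoc G, hi, ← mul_assoc, h.left]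
  · rw [mul_assoc, ← mul_assoc Q' Q, hc.eq, mul_assoc Q, hi, ← mul_assoc, h.right]

theorem isRelRes_resolvent_mul (h : z ∈ resolventSet A) (hQ : GraphComm A Q) (hi : Q * Q = Q) :
    IsRelRes A Q z (resolvent A z * Q) := by
  simpa using (isRelRes_resolvent h).mul hQ (Commute.one_right Q) hi

theorem resolvent_sub (hz : z ∈ resolventSet A) (hw : w ∈ resolventSet A) :
    resolvent A z - resolvent A w = (w - z) • (resolvent A z * resolvent A w) := by
  ext x
  have h1 := resolvent_apply_graph hz (resolvent_mem_graph hw x)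
  simp only [sub_apply, smul_apply,
    one_apply_eq_self, mul_apply_eq_comp] at h1 ⊢
  have h2 : z • (resolvent A w) x - (w • (resolvent A w) x - x) =
      x - (w - z) • (resolvent A w) x := by rw [sub_smul]; abel
  rw [h2, map_sub, map_smul] at h1
  rw [sub_eq_iff_eq_add, ← sub_eq_iff_eq_add', h1]

section Complete
variable [CompleteSpace X]

/-- On the range of `Q` one has `w - A = (z - A)(1 - (z - w) G)`, and the last factor is invertible
by the Neumann series. All bounded operators involved commute. -/
theorem IsRelRes.perturb (h : IsRelRes A Q z G) (hw : ‖(z - w) • G‖ < 1) :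
    IsRelRes A Q w (G * Ring.inverse (1 - (z - w) • G)) := by
  have hu : IsUnit (1 - (z - w) • G) := isUnit_one_sub_of_norm_lt_one hw
  set U := 1 - (z - w) • G with hU
  set V := Ring.inverse U with hV
  have h1 : U * V = 1 := Ring.mul_inverse_cancel U hu
  have h2 : V * U = 1 := Ring.inverse_mul_cancel U hu
  have hGU : Commute G U := by
    rw [hU]; exact (Commute.one_right G).sub_right ((Commute.refl G).smul_right _)
  have hGV : Commute G V := by
    have : G * V = V * U * G * V := by rw [h2, one_mul]
    rw [Commute, SemiconjBy, this, mul_assoc V U G, ← hGU.eq, mul_assoc V, mul_assoc G, h1, mul_one]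
  have hQG : Commute Q G := by rw [Commute, SemiconjBy, h.left, h.right]
  have hQU : Commute Q U := by
    rw [hU]; exact (Commute.one_right Q).sub_right (hQG.smul_right _)
  have hQV : Commute Q V := by
    have : Q * V = V * U * Q * V := by rw [h2, one_mul]
    rw [Commute, SemiconjBy, this, mul_assoc V U Q, ← hQU.eq, mul_assoc V, mul_assoc Q, h1, mul_one]
  have key : Q * U = Q - (z - w) • G := by rw [hU, mul_sub, mul_one, mul_smul_comm, h.left]
  refine ⟨fun x => ?_, fun x y hxy => ?_, ?_, ?_⟩
  · have e : w • (G * V) x - Q x = z • G (V x) - Q (V x) := by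
      have : Q x = Q (V x) - (z - w) • G (V x) := by
        have := congrArg (fun T : X →L[ℂ] X => T (V x)) key
        simp only [mul_apply_eq_comp, sub_apply,
          smul_apply] at this
        rw [← this]
        have h3 := congrArg (fun T : X →L[ℂ] X => T x) h1
        simp only [mul_apply_eq_comp, one_apply_eq_self] at h3
        rw [h3]
      rw [this, sub_smul, mul_apply_eq_comp]
      abel
    rw [e]
    exact h.mem_graph (V x)
  · have e : w • x - y = (z • x - y) - (z - w) • x := by rw [sub_smul]; abel
    have h3 : (V * G) (w • x - y) = V (Q x - (z - w) • G x) := by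
      rw [e, mul_apply_eq_comp, map_sub, h.apply_graph x y hxy, map_smul]
    rw [hGV.eq, h3]
    have := congrArg (fun T : X →L[ℂ] X => T x) (show V * (Q * U) = Q by
      rw [← mul_assoc, ← hQV.eq, mul_assoc, h2, mul_one])
    rw [key] at this
    exact this
  · rw [← mul_assoc, h.left]
  · rw [mul_assoc, ← hQV.eq, ← mul_assoc, h.right]

theorem eventually_isRelRes (h : IsRelRes A Q z G) :
    ∀ᶠ w in 𝓝 z, IsRelRes A Q w (G * Ring.inverse (1 - (z - w) • G)) := by
  have : Tendsto (fun w : ℂ => ‖(z - w) • G‖) (𝓝 z) (𝓝 ‖(z - z) • G‖) := by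
    apply Continuous.tendsto; fun_prop
  simp only [sub_self, zero_smul, norm_zero] at this
  filter_upwards [this.eventually_lt_const one_pos] with w hw
  exact h.perturb hw

theorem isOpen_relSet : IsOpen (relSet A Q) := by
  rw [isOpen_iff_mem_nhds]
  rintro z ⟨G, h⟩
  filter_upwards [eventually_isRelRes h] with w hw using hw.mem

theorem differentiableAt_relRes (h : z ∈ relSet A Q) : DifferentiableAt ℂ (relRes A Q) z := by
  have h := isRelRes_relRes h
  set G := relRes A Q z with hG
  have e : relRes A Q =ᶠ[𝓝 z] fun w => G * Ring.inverse (1 - (z - w) • G) := by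
    filter_upwards [eventually_isRelRes h] with w hw using hw.eq
  refine DifferentiableAt.congr_of_eventuallyEq ?_ e
  have h1 : DifferentiableAt ℂ (fun w : ℂ => 1 - (z - w) • G) z := by fun_prop
  have h2 : DifferentiableAt ℂ Ring.inverse ((fun w : ℂ => 1 - (z - w) • G) z) := by
    apply differentiableAt_inverse
    simp
  exact (h2.comp z h1).const_mul G

theorem isOpen_resolventSet : IsOpen (resolventSet A) := relSet_one (A := A) ▸ isOpen_relSet

theorem isClosed_spectrum : IsClosed (spectrum A) := isOpen_resolventSet.isClosed_compl

theorem differentiableAt_resolvent (h : z ∈ resolventSet A) :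
    DifferentiableAt ℂ (resolvent A) z := by
  refine (differentiableAt_relRes (Q := 1) (A := A) (relSet_one (A := A) ▸ h)).congr_of_eventuallyEq ?_
  filter_upwards [isOpen_resolventSet.mem_nhds h] with w hw using (relRes_one hw).symm

theorem continuousOn_resolvent : ContinuousOn (resolvent A) (resolventSet A) :=
  fun _ h => (differentiableAt_resolvent h).continuousAt.continuousWithinAt

theorem hasDerivAt_resolvent (h : z ∈ resolventSet A) :
    HasDerivAt (resolvent A) (-(resolvent A z * resolvent A z)) z := by
  rw [hasDerivAt_iff_tendsto_slope]
  have h1 : Tendsto (fun w => -(resolvent A w * resolvent A z)) (𝓝[≠] z)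
      (𝓝 (-(resolvent A z * resolvent A z))) := by
    have := (differentiableAt_resolvent h).continuousAt.tendsto
    exact ((this.mul_const (resolvent A z)).neg).mono_left nhdsWithin_le_nhds
  refine h1.congr' ?_
  filter_upwards [self_mem_nhdsWithin, nhdsWithin_le_nhds (isOpen_resolventSet.mem_nhds h)]
    with w hw hw'
  rw [slope_def_module, resolvent_sub hw' h, smul_smul, ← neg_sub w z, mul_neg,
    inv_mul_cancel₀ (sub_ne_zero.2 hw), neg_one_smul]

theorem graph_integral {ι : Type*} [MeasurableSpace ι] {ν : Measure ι} (hp : p ∈ resolventSet A)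
    {f g : ι → X} (hf : Integrable f ν) (hg : Integrable g ν)
    (h : ∀ᵐ s ∂ν, (f s, g s) ∈ A.graph) : (∫ s, f s ∂ν, ∫ s, g s ∂ν) ∈ A.graph := by
  rw [mem_graph_iff hp, ← integral_smul, ← integral_sub (f := fun s => p • f s) (hf.smul p) hg,
    ← ContinuousLinearMap.integral_comp_comm (φ := fun s => p • f s - g s) _
      ((hf.smul p).sub hg)]
  refine integral_congr_ae ?_
  filter_upwards [h] with s hs using (mem_graph_iff hp).1 hs

theorem graphOp_integral {ι : Type*} [MeasurableSpace ι] {ν : Measure ι} (hp : p ∈ resolventSet A)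
    {f g : ι → X →L[ℂ] X} (hf : Integrable f ν) (hg : Integrable g ν)
    (h : ∀ᵐ s ∂ν, GraphOp A (f s) (g s)) : GraphOp A (∫ s, f s ∂ν) (∫ s, g s ∂ν) := by
  intro x
  rw [ContinuousLinearMap.integral_apply hf, ContinuousLinearMap.integral_apply hg]
  refine graph_integral hp (hf.apply_continuousLinearMap x) (hg.apply_continuousLinearMap x) ?_
  filter_upwards [h] with s hs using hs x

theorem graphComm_integral {ι : Type*} [MeasurableSpace ι] {ν : Measure ι} (hp : p ∈ resolventSet A)
    {f : ι → X →L[ℂ] X} (hf : Integrable f ν)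
    (h : ∀ᵐ s ∂ν, GraphComm A (f s)) : GraphComm A (∫ s, f s ∂ν) := by
  intro x y hxy
  rw [ContinuousLinearMap.integral_apply hf, ContinuousLinearMap.integral_apply hf]
  refine graph_integral hp (hf.apply_continuousLinearMap x) (hf.apply_continuousLinearMap y) ?_
  filter_upwards [h] with s hs using hs x y hxy

theorem integral_mul_left {ι : Type*} [MeasurableSpace ι] {ν : Measure ι}
    {f : ι → X →L[ℂ] X} (hf : Integrable f ν) (S : X →L[ℂ] X) :
    ∫ s, S * f s ∂ν = S * ∫ s, f s ∂ν :=
  ContinuousLinearMap.integral_comp_comm (ContinuousLinearMap.mul ℂ (X →L[ℂ] X) S) hf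

theorem integral_mul_right {ι : Type*} [MeasurableSpace ι] {ν : Measure ι}
    {f : ι → X →L[ℂ] X} (hf : Integrable f ν) (S : X →L[ℂ] X) :
    ∫ s, f s * S ∂ν = (∫ s, f s ∂ν) * S :=
  ContinuousLinearMap.integral_comp_comm
    ((ContinuousLinearMap.mul ℂ (X →L[ℂ] X)).flip S) hf

end Complete

end

section
/-! ### Riesz-Dunford integrals over circles -/

/-- The Riesz-Dunford integral `(2πi)⁻¹ ∮ g(z) (z - A)⁻¹ dz` over the circle `C(c, r)`. -/
def circleCalc (A : X →ₗ.[ℂ] X) (c : ℂ) (r : ℝ) (g : ℂ → ℂ) : X →L[ℂ] X :=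
  (2 * Real.pi * Complex.I : ℂ)⁻¹ • ∮ z in C(c, r), g z • resolvent A z

variable {A : X →ₗ.[ℂ] X} {Q Q' G G' T B : X →L[ℂ] X} {z w p c : ℂ} {r : ℝ} {g : ℂ → ℂ}

theorem two_pi_I_ne : (2 * Real.pi * Complex.I : ℂ) ≠ 0 := Complex.two_pi_I_ne_zero

section Complete
variable [CompleteSpace X]

section General

theorem circleIntegrable_iff_integrable {E : Type*} [NormedAddCommGroup E] [NormedSpace ℂ E]
    {f : ℂ → E} (hf : CircleIntegrable f c r) :
    Integrable (fun θ => deriv (circleMap c r) θ • f (circleMap c r θ))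
      (volume.restrict (Ioc 0 (2 * Real.pi))) := by
  have := hf.out
  rwa [intervalIntegrable_iff, uIoc_of_le Real.two_pi_pos.le] at this

theorem circleIntegral_eq_setIntegral {E : Type*} [NormedAddCommGroup E] [NormedSpace ℂ E]
    (f : ℂ → E) : (∮ z in C(c, r), f z) =
      ∫ θ in Ioc 0 (2 * Real.pi), deriv (circleMap c r) θ • f (circleMap c r θ) := by
  rw [circleIntegral, intervalIntegral.integral_of_le Real.two_pi_pos.le]

theorem circleIntegral_mul_left {f : ℂ → X →L[ℂ] X} (hf : CircleIntegrable f c r)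
    (S : X →L[ℂ] X) : (∮ z in C(c, r), S * f z) = S * ∮ z in C(c, r), f z := by
  rw [circleIntegral_eq_setIntegral, circleIntegral_eq_setIntegral,
    ← integral_mul_left (circleIntegrable_iff_integrable hf)]
  simp only [mul_smul_comm]

theorem circleIntegral_mul_right {f : ℂ → X →L[ℂ] X} (hf : CircleIntegrable f c r)
    (S : X →L[ℂ] X) : (∮ z in C(c, r), f z * S) = (∮ z in C(c, r), f z) * S := by
  rw [circleIntegral_eq_setIntegral, circleIntegral_eq_setIntegral,
    ← integral_mul_right (circleIntegrable_iff_integrable hf)]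
  simp only [smul_mul_assoc]

theorem graphOp_circleIntegral (hp : p ∈ resolventSet A) (hr : 0 ≤ r) {f g : ℂ → X →L[ℂ] X}
    (hf : CircleIntegrable f c r) (hg : CircleIntegrable g c r)
    (h : ∀ z ∈ Metric.sphere c r, GraphOp A (f z) (g z)) :
    GraphOp A (∮ z in C(c, r), f z) (∮ z in C(c, r), g z) := by
  rw [circleIntegral_eq_setIntegral, circleIntegral_eq_setIntegral]
  exact graphOp_integral hp (circleIntegrable_iff_integrable hf)
    (circleIntegrable_iff_integrable hg)
    (Eventually.of_forall fun θ => (h _ (circleMap_mem_sphere c hr θ)).smul _)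

theorem graphComm_circleIntegral (hp : p ∈ resolventSet A) (hr : 0 ≤ r) {f : ℂ → X →L[ℂ] X}
    (hf : CircleIntegrable f c r) (h : ∀ z ∈ Metric.sphere c r, GraphComm A (f z)) :
    GraphComm A (∮ z in C(c, r), f z) := by
  rw [circleIntegral_eq_setIntegral]
  exact graphComm_integral hp (circleIntegrable_iff_integrable hf)
    (Eventually.of_forall fun θ => (h _ (circleMap_mem_sphere c hr θ)).smul _)

end General

section Circle

variable (hr : 0 < r) (hs : Metric.sphere c r ⊆ resolventSet A)
include hr hs

theorem center_add_mem_resolventSet : c + r ∈ resolventSet A := by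
  apply hs
  simp [abs_of_pos hr]

theorem circleIntegrable_resolvent (hg : ContinuousOn g (Metric.sphere c r)) :
    CircleIntegrable (fun z => g z • resolvent A z) c r :=
  (hg.smul (continuousOn_resolvent.mono hs)).circleIntegrable hr.le

theorem circleCalc_add {g' : ℂ → ℂ} (hg : ContinuousOn g (Metric.sphere c r))
    (hg' : ContinuousOn g' (Metric.sphere c r)) :
    circleCalc A c r (fun z => g z + g' z) = circleCalc A c r g + circleCalc A c r g' := by
  simp only [circleCalc, add_smul]
  rw [circleIntegral.integral_add (circleIntegrable_resolvent hr hs hg)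
    (circleIntegrable_resolvent hr hs hg'), smul_add]

omit hs in
theorem circleCalc_congr {g' : ℂ → ℂ} (h : EqOn g g' (Metric.sphere c r)) :
    circleCalc A c r g = circleCalc A c r g' := by
  rw [circleCalc, circleCalc]
  congr 1
  exact circleIntegral.integral_congr hr.le fun z hz => by simp only [h hz]

omit hr hs in
theorem circleCalc_const_mul (a : ℂ) :
    circleCalc A c r (fun z => a * g z) = a • circleCalc A c r g := by
  simp only [circleCalc, mul_smul]
  rw [circleIntegral.integral_smul, smul_comm]

theorem graphComm_circleCalc (hg : ContinuousOn g (Metric.sphere c r)) :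
    GraphComm A (circleCalc A c r g) :=
  (graphComm_circleIntegral (center_add_mem_resolventSet hr hs) hr.le
    (circleIntegrable_resolvent hr hs hg)
    fun _ hz => (graphComm_resolvent (hs hz)).smul _).smul _

/-- Integrate `A R(z) = z R(z) - 1` against `g`. The scalar integral of `g` is what the `1`
contributes; it vanishes for entire `g` but not for Cauchy kernels. -/
theorem graphOp_circleCalc (hg : ContinuousOn g (Metric.sphere c r)) :
    GraphOp A (circleCalc A c r g) (circleCalc A c r (fun z => z * g z) -
      ((2 * Real.pi * Complex.I : ℂ)⁻¹ * ∮ z in C(c, r), g z) • 1) := by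
  have h1 := (circleIntegrable_resolvent hr hs (continuousOn_id.mul hg))
  have h2 : CircleIntegrable (fun z => g z • (1 : X →L[ℂ] X)) c r :=
    (hg.smul continuousOn_const).circleIntegrable hr.le
  have := (graphOp_circleIntegral (center_add_mem_resolventSet hr hs) hr.le
    (circleIntegrable_resolvent hr hs hg) (h1.sub h2) fun z hz => by
      have := (resolvent_mem_graph (hs hz)).smul (g z)
      rw [smul_sub, smul_smul, mul_comm] at this
      exact this).smul (2 * Real.pi * Complex.I : ℂ)⁻¹
  simp only [Pi.sub_apply] at this
  rw [circleIntegral.integral_sub h1 h2, circleIntegral.integral_smul_const, smul_sub,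
    smul_smul] at this
  exact this

theorem graphOp_circleCalc_of_differentiable (hg : Differentiable ℂ g) :
    GraphOp A (circleCalc A c r g) (circleCalc A c r (fun z => z * g z)) := by
  have := graphOp_circleCalc hr hs hg.continuous.continuousOn
  rwa [hg.diffContOnCl.circleIntegral_eq_zero hr.le, mul_zero, zero_smul, sub_zero] at this

omit hs in
theorem continuousOn_inv_sub (hz : z ∉ Metric.sphere c r) :
    ContinuousOn (fun w : ℂ => (w - z)⁻¹) (Metric.sphere c r) :=
  ContinuousOn.inv₀ (by fun_prop) fun w hw h => hz (sub_eq_zero.1 h ▸ hw)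

theorem circleCalc_mul_inv_sub (hz : z ∉ Metric.sphere c r) :
    circleCalc A c r (fun w => w * (w - z)⁻¹) =
      circleCalc A c r (fun _ => 1) + z • circleCalc A c r (fun w => (w - z)⁻¹) := by
  rw [← circleCalc_const_mul, ← circleCalc_add (g := fun _ => 1) (g' := fun w => z * (w - z)⁻¹)
    hr hs continuousOn_const (continuousOn_const.mul (continuousOn_inv_sub hr hz))]
  refine circleCalc_congr hr fun w hw => ?_
  have : w - z ≠ 0 := fun h => hz (sub_eq_zero.1 h ▸ hw)
  field_simp
  ring

/-- The Cauchy transform `C` of the resolvent satisfies `(z - A) C = 1 - P` inside the circle, even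
at points of the spectrum, and `(z - A)(-C) = P` outside. It therefore supplies the relative
resolvents on the ranges of `1 - P` and of `P`. -/
theorem graphOp_cauchy_inside (hz : z ∈ Metric.ball c r) :
    GraphOp A (circleCalc A c r (fun w => (w - z)⁻¹))
      (z • circleCalc A c r (fun w => (w - z)⁻¹) - (1 - circleCalc A c r (fun _ => 1))) := by
  have hz' : z ∉ Metric.sphere c r := fun h => (Metric.mem_ball.1 hz).ne h
  have := graphOp_circleCalc hr hs (continuousOn_inv_sub hr hz')
  rw [circleCalc_mul_inv_sub hr hs hz', circleIntegral.integral_sub_inv_of_mem_ball hz,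
    inv_mul_cancel₀ two_pi_I_ne, one_smul] at this
  convert this using 1
  abel

theorem graphOp_cauchy_outside (hz : z ∉ Metric.closedBall c r) :
    GraphOp A (-circleCalc A c r (fun w => (w - z)⁻¹))
      (z • (-circleCalc A c r (fun w => (w - z)⁻¹)) - circleCalc A c r (fun _ => 1)) := by
  have hz' : z ∉ Metric.sphere c r := fun h => hz (Metric.sphere_subset_closedBall h)
  have := (graphOp_circleCalc hr hs (continuousOn_inv_sub hr hz')).smul (-1)
  have h0 : (∮ w in C(c, r), (w - z)⁻¹) = 0 := by
    apply DiffContOnCl.circleIntegral_eq_zero hr.le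
    apply DifferentiableOn.diffContOnCl
    intro w hw
    have hw' : w ∈ Metric.closedBall c r := Metric.closure_ball_subset_closedBall hw
    have : w - z ≠ 0 := fun h => hz (sub_eq_zero.1 h ▸ hw')
    exact (DifferentiableAt.inv (h := fun w : ℂ => w - z) (by fun_prop) this).differentiableWithinAt
  rw [circleCalc_mul_inv_sub hr hs hz', h0, mul_zero, zero_smul, sub_zero, neg_one_smul,
    neg_one_smul] at this
  convert this using 1
  rw [smul_neg]
  abel

/-- Cauchy's theorem: `h` is a holomorphic extension of `R(z) Q` from the circle to the disc. -/
theorem circleCalc_mul_eq_zero {h : ℂ → X →L[ℂ] X} (hc : ContinuousOn h (Metric.closedBall c r))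
    (hd : ∀ z ∈ Metric.ball c r, DifferentiableAt ℂ h z)
    (hh : ∀ z ∈ Metric.sphere c r, h z = resolvent A z * Q) (hg : Differentiable ℂ g) :
    circleCalc A c r g * Q = 0 := by
  rw [circleCalc, smul_mul_assoc,
    ← circleIntegral_mul_right (circleIntegrable_resolvent hr hs hg.continuous.continuousOn)]
  have : (∮ z in C(c, r), (g z • resolvent A z) * Q) = ∮ z in C(c, r), g z • h z :=
    circleIntegral.integral_congr hr.le fun z hz => by simp only [hh z hz, smul_mul_assoc]
  rw [this, Complex.circleIntegral_eq_zero_of_differentiable_on_off_countable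
    (f := fun z => g z • h z) hr.le countable_empty (hg.continuous.continuousOn.smul hc)
    (fun z hz => (hg z).smul (hd z hz.1)), smul_zero]

theorem circleCalc_mul_eq_zero_of_subset_relSet (hQ : Metric.closedBall c r ⊆ relSet A Q)
    (hg : Differentiable ℂ g) : circleCalc A c r g * Q = 0 := by
  refine circleCalc_mul_eq_zero hr hs
    (fun z hz => (differentiableAt_relRes (hQ hz)).continuousAt.continuousWithinAt)
    (fun z hz => differentiableAt_relRes (hQ (Metric.ball_subset_closedBall hz)))
    (fun z hz => ?_) hg
  have h1 := isRelRes_relRes (hQ (Metric.sphere_subset_closedBall hz))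
  ext x
  have h2 := resolvent_apply_graph (hs hz) (h1.mem_graph x)
  rw [sub_sub_cancel] at h2
  exact h2.symm

/-- This is idempotence of the Riesz projection, proved with a single circle: the Cauchy transform
extends `R(z)(1 - P)` holomorphically to the whole disc, across the spectrum, so Cauchy's theorem
applies with `Q = 1 - P`. -/
theorem circleCalc_mul_one_sub (hg : Differentiable ℂ g) :
    circleCalc A c r g * (1 - circleCalc A c r (fun _ => 1)) = 0 := by
  classical
  set P := circleCalc A c r (fun _ => 1) with hP
  have hC : DifferentiableOn ℂ (fun z => circleCalc A c r (fun w => (w - z)⁻¹))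
      (Metric.ball c r) := by
    have h1 : CircleIntegrable (resolvent A) c r :=
      (continuousOn_resolvent.mono hs).circleIntegrable hr.le
    have h2 := (hasFPowerSeriesOn_cauchy_integral (R := ⟨r, hr.le⟩) h1 hr).differentiableOn
    have h3 : Metric.eball c (ENNReal.ofNNReal ⟨r, hr.le⟩) = Metric.ball c r := Metric.eball_coe
    rw [h3] at h2
    exact h2
  have key : ∀ z ∈ Metric.ball c r, z ∈ resolventSet A →
      circleCalc A c r (fun w => (w - z)⁻¹) = resolvent A z * (1 - P) := by
    intro z hz hz'
    ext x
    have h2 := resolvent_apply_graph hz' (graphOp_cauchy_inside hr hs hz x)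
    rw [sub_apply, smul_apply, sub_sub_cancel] at h2
    exact h2.symm
  -- The Cauchy transform is not continuous across the circle, hence the definition by cases; near a
  -- point of the circle both branches equal `R(z)(1 - P)`.
  set h : ℂ → X →L[ℂ] X := fun z => if z ∈ Metric.ball c r then
    circleCalc A c r (fun w => (w - z)⁻¹) else resolvent A z * (1 - P) with hh
  have hd : ∀ z ∈ Metric.ball c r, DifferentiableAt ℂ h z := by
    intro z hz
    refine (hC.differentiableAt (Metric.isOpen_ball.mem_nhds hz)).congr_of_eventuallyEq ?_
    filter_upwards [Metric.isOpen_ball.mem_nhds hz] with w hw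
    simp only [hh, if_pos hw]
  refine circleCalc_mul_eq_zero hr hs (h := h) (fun z hz => ?_) hd (fun z hz => ?_) hg
  · by_cases hz' : z ∈ Metric.ball c r
    · exact (hd z hz').continuousAt.continuousWithinAt
    · have hzs : z ∈ Metric.sphere c r :=
        le_antisymm hz (not_lt.1 hz')
      have h3 : ContinuousAt (fun z => resolvent A z * (1 - P)) z :=
        (differentiableAt_resolvent (hs hzs)).continuousAt.mul continuousAt_const
      refine (h3.congr ?_).continuousWithinAt
      filter_upwards [isOpen_resolventSet.mem_nhds (hs hzs)] with w hw
      by_cases hwb : w ∈ Metric.ball c r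
      · simp only [hh, if_pos hwb, key w hwb hw]
      · simp only [hh, if_neg hwb]
  · have : z ∉ Metric.ball c r := fun h => (Metric.mem_ball.1 h).ne hz
    simp only [hh, if_neg this]

theorem circleCalc_mul_proj (hg : Differentiable ℂ g) :
    circleCalc A c r g * circleCalc A c r (fun _ => 1) = circleCalc A c r g := by
  have := circleCalc_mul_one_sub hr hs hg
  rw [mul_sub, mul_one, sub_eq_zero] at this
  exact this.symm

theorem circleProj_mul_self : circleCalc A c r (fun _ => 1) * circleCalc A c r (fun _ => 1) =
    circleCalc A c r (fun _ => 1) :=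
  circleCalc_mul_proj hr hs (differentiable_const 1)

theorem graphComm_circleProj : GraphComm A (circleCalc A c r (fun _ => 1)) :=
  graphComm_circleCalc hr hs continuousOn_const

theorem GraphComm.commute_circleCalc (hQ : GraphComm A Q)
    (hg : ContinuousOn g (Metric.sphere c r)) : Commute Q (circleCalc A c r g) := by
  have h1 := circleIntegrable_resolvent hr hs hg
  rw [Commute, SemiconjBy, circleCalc, mul_smul_comm, smul_mul_assoc,
    ← circleIntegral_mul_left h1, ← circleIntegral_mul_right h1]
  congr 1
  refine circleIntegral.integral_congr hr.le fun z hz => ?_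
  simp only [mul_smul_comm, smul_mul_assoc, (hQ.commute_resolvent (hs hz)).eq]

theorem mem_relSet_one_sub_circleProj (hz : z ∈ Metric.ball c r) :
    z ∈ relSet A (1 - circleCalc A c r (fun _ => 1)) := by
  set P := circleCalc A c r (fun _ => 1) with hP
  set C := circleCalc A c r (fun w => (w - z)⁻¹) with hC
  have hz' : z ∉ Metric.sphere c r := fun h => (Metric.mem_ball.1 hz).ne h
  have hi : (1 - P) * (1 - P) = 1 - P := by
    have := circleProj_mul_self hr hs (A := A)
    rw [← hP] at this
    noncomm_ring [this]
  have hcomm : Commute P C := (graphComm_circleProj hr hs).commute_circleCalc hr hs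
    (continuousOn_inv_sub hr hz')
  have hcomm' : Commute (1 - P) C := (Commute.one_left C).sub_left hcomm
  have hgr := graphOp_cauchy_inside hr hs hz
  refine ⟨C * (1 - P), fun x => ?_, fun x y hxy => ?_, ?_, ?_⟩
  · have := (hgr.mul (1 - P)) x
    rwa [sub_mul, hi, smul_mul_assoc] at this
  · have h1 := hgr.mul (1 - P)
    rw [sub_mul, hi, smul_mul_assoc] at h1
    have h2 := h1 x
    have hc : GraphComm A (C * (1 - P)) :=
      (graphComm_circleCalc hr hs (continuousOn_inv_sub hr hz')).mul
        (graphComm_one.sub (graphComm_circleProj hr hs))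
    have h3 := graph_snd_inj h2 (hc _ _ hxy)
    rw [map_sub, map_smul, ← h3, sub_apply, smul_apply]
    exact sub_sub_cancel _ _
  · rw [← mul_assoc, hcomm'.eq, mul_assoc, hi]
  · rw [mul_assoc, hi]

theorem mem_relSet_circleProj (hz : z ∉ Metric.closedBall c r) :
    z ∈ relSet A (circleCalc A c r (fun _ => 1)) := by
  set P := circleCalc A c r (fun _ => 1) with hP
  set C := -circleCalc A c r (fun w => (w - z)⁻¹) with hC
  have hz' : z ∉ Metric.sphere c r := fun h => hz (Metric.sphere_subset_closedBall h)
  have hi : P * P = P := circleProj_mul_self hr hs (A := A)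
  have hcomm : Commute P C := ((graphComm_circleProj hr hs).commute_circleCalc hr hs
    (continuousOn_inv_sub hr hz')).neg_right
  have hgr := graphOp_cauchy_outside hr hs hz
  have h1 := hgr.mul P
  rw [sub_mul, hi, smul_mul_assoc] at h1
  have hC' : GraphComm A C := by
    have := (graphComm_circleCalc hr hs (continuousOn_inv_sub hr hz')).smul (-1)
    rwa [neg_one_smul] at this
  refine ⟨C * P, fun x => h1 x, fun x y hxy => ?_, ?_, ?_⟩
  · have h2 := h1 x
    have hc : GraphComm A (C * P) := hC'.mul (graphComm_circleProj hr hs)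
    have h3 := graph_snd_inj h2 (hc _ _ hxy)
    rw [map_sub, map_smul, ← h3, sub_apply, smul_apply]
    exact sub_sub_cancel _ _
  · rw [← mul_assoc, hcomm.eq, mul_assoc, hi]
  · rw [mul_assoc, hi]

theorem norm_circleCalc_le {C : ℝ} (h : ∀ z ∈ Metric.sphere c r, ‖g z • resolvent A z‖ ≤ C) :
    ‖circleCalc A c r g‖ ≤ r * C :=
  circleIntegral.norm_two_pi_i_inv_smul_integral_le_of_norm_le_const hr.le h

theorem exists_norm_resolvent_le_sphere :
    ∃ C, 0 ≤ C ∧ ∀ z ∈ Metric.sphere c r, ‖resolvent A z‖ ≤ C := by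
  obtain ⟨C, hC⟩ := (isCompact_sphere c r).exists_bound_of_continuousOn
    (continuousOn_resolvent.mono hs)
  exact ⟨C, (norm_nonneg _).trans (hC _ (by simp [abs_of_pos hr] : c + r ∈ Metric.sphere c r)), hC⟩

theorem hasDerivAt_circleCalc_exp (lam t : ℝ) :
    HasDerivAt (fun t : ℝ => circleCalc A c r (fun z => Complex.exp (-((z - lam) * t))))
      (-circleCalc A c r (fun z => (z - lam) * Complex.exp (-((z - lam) * t)))) t := by
  obtain ⟨C, hC0, hC⟩ := exists_norm_resolvent_le_sphere hr hs
  obtain ⟨m, hm⟩ := (isCompact_sphere c r).exists_bound_of_continuousOn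
    (f := fun z : ℂ => z - lam) (by fun_prop)
  have hm0 : 0 ≤ m := (norm_nonneg _).trans (hm _ (by simp [abs_of_pos hr] :
    c + r ∈ Metric.sphere c r))
  have hcont : ∀ t : ℝ, Continuous fun θ => deriv (circleMap c r) θ •
      (Complex.exp (-((circleMap c r θ - lam) * t)) • resolvent A (circleMap c r θ)) := by
    intro t
    have h1 : Continuous fun θ => resolvent A (circleMap c r θ) :=
      continuousOn_resolvent.comp_continuous (continuous_circleMap c r)
        fun θ => hs (circleMap_mem_sphere c hr.le θ)
    simp only [deriv_circleMap]
    fun_prop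
  have hcont' : Continuous fun θ => deriv (circleMap c r) θ •
      ((-(circleMap c r θ - lam) * Complex.exp (-((circleMap c r θ - lam) * t))) •
        resolvent A (circleMap c r θ)) := by
    have h1 : Continuous fun θ => resolvent A (circleMap c r θ) :=
      continuousOn_resolvent.comp_continuous (continuous_circleMap c r)
        fun θ => hs (circleMap_mem_sphere c hr.le θ)
    simp only [deriv_circleMap]
    fun_prop
  have key := (intervalIntegral.hasDerivAt_integral_of_dominated_loc_of_deriv_le
    (𝕜 := ℝ) (μ := volume) (a := 0) (b := 2 * Real.pi) (x₀ := t) (s := Metric.ball t 1)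
    (bound := fun _ => r * (m * Real.exp (m * (|t| + 1)) * C))
    (F := fun t θ => deriv (circleMap c r) θ •
      (Complex.exp (-((circleMap c r θ - lam) * t)) • resolvent A (circleMap c r θ)))
    (F' := fun t θ => deriv (circleMap c r) θ •
      ((-(circleMap c r θ - lam) * Complex.exp (-((circleMap c r θ - lam) * t))) •
        resolvent A (circleMap c r θ)))
    (Metric.ball_mem_nhds t one_pos)
    (Eventually.of_forall fun t => (hcont t).aestronglyMeasurable)
    ((hcont t).intervalIntegrable _ _) hcont'.aestronglyMeasurable
    (Eventually.of_forall fun θ _ x hx => ?_) intervalIntegrable_const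
    (Eventually.of_forall fun θ _ x hx => ?_)).2
  · refine (key.fun_const_smul (2 * Real.pi * Complex.I : ℂ)⁻¹).congr_deriv ?_
    simp only [circleCalc]
    rw [← smul_neg]
    congr 1
    simp only [circleIntegral]
    rw [← intervalIntegral.integral_neg]
    congr 1
    ext1 θ
    rw [neg_mul, neg_smul, smul_neg]
  · have hθ := circleMap_mem_sphere c hr.le θ
    rw [norm_smul, norm_smul, norm_mul, norm_neg, deriv_circleMap]
    have e1 : ‖circleMap 0 r θ * Complex.I‖ = r := by simp [abs_of_pos hr]
    rw [e1]
    have hx' : |x| ≤ |t| + 1 := by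
      have := Metric.mem_ball.1 hx
      rw [Real.dist_eq] at this
      have := abs_sub_abs_le_abs_sub x t
      linarith
    have e2 : ‖Complex.exp (-((circleMap c r θ - lam) * x))‖ ≤ Real.exp (m * (|t| + 1)) := by
      refine (Complex.norm_exp_le_exp_norm _).trans (Real.exp_le_exp.2 ?_)
      rw [norm_neg, norm_mul, Complex.norm_real, Real.norm_eq_abs]
      gcongr
      exact hm _ hθ
    gcongr
    · exact hm _ hθ
    · exact hC _ hθ
  · have h3 : HasDerivAt (fun t : ℝ => Complex.exp (-((circleMap c r θ - lam) * t)))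
        (-(circleMap c r θ - lam) * Complex.exp (-((circleMap c r θ - lam) * x))) x := by
      have h4 : HasDerivAt (fun t : ℝ => -((circleMap c r θ - lam) * (t : ℂ)))
          (-((circleMap c r θ - lam) * 1)) x :=
        ((Complex.ofRealCLM.hasDerivAt).const_mul _).neg
      have := h4.cexp
      rw [mul_one, mul_comm] at this
      exact this
    exact (h3.smul_const (resolvent A (circleMap c r θ))).fun_const_smul (deriv (circleMap c r) θ)

end Circle

/-- A linear differential equation `E' = M E` in a Banach algebra has only the solution
`exp(tM) E(0)`. -/
theorem eq_exp_smul_mul {𝔸 : Type*} [NormedRing 𝔸] [NormedAlgebra ℝ 𝔸] [CompleteSpace 𝔸]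
    {E : ℝ → 𝔸} {M : 𝔸} (h : ∀ t, HasDerivAt E (M * E t) t) (t : ℝ) :
    E t = NormedSpace.exp (t • M) * E 0 := by
  have hd : ∀ s : ℝ, HasDerivAt (fun s : ℝ => NormedSpace.exp ((-s) • M) * E s) 0 s := by
    intro s
    have h1 : HasDerivAt (fun s : ℝ => NormedSpace.exp ((-s) • M))
        (-(NormedSpace.exp ((-s) • M) * M)) s := by
      have := (hasDerivAt_exp_smul_const M (-s)).scomp s (hasDerivAt_neg s)
      rw [neg_one_smul] at this
      exact this
    have h2 := h1.mul (h s)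
    refine h2.congr_deriv ?_
    rw [neg_mul, mul_assoc]
    abel
  have h3 := is_const_of_deriv_eq_zero (fun s => (hd s).differentiableAt) (fun s => (hd s).deriv) t 0
  simp only [neg_zero, zero_smul, NormedSpace.exp_zero, one_mul] at h3
  rw [← h3, ← mul_assoc]
  have : NormedSpace.exp (t • M) * NormedSpace.exp ((-t) • M) = 1 := by
    let _ : NormedAlgebra ℚ 𝔸 := NormedAlgebra.restrictScalars ℚ ℝ 𝔸
    rw [← NormedSpace.exp_add_of_commute, neg_smul, add_neg_cancel, NormedSpace.exp_zero]
    exact ((Commute.refl M).smul_left t).smul_right (-t)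
  rw [this, one_mul]

/-- The integral solves `E' = (lam - B) E` with `E 0 = P` and the bounded operator `B = A P`. The
right-hand side involves only `P` and `A P`, neither of which depends on the circle, and so the
exponentials do not either. -/
theorem circleCalc_exp_eq (hr : 0 < r) (hs : Metric.sphere c r ⊆ resolventSet A) (lam t : ℝ) :
    circleCalc A c r (fun z => Complex.exp (-((z - lam) * t))) =
      NormedSpace.exp (t • ((lam : ℂ) • 1 - circleCalc A c r (fun z => z))) *
        circleCalc A c r (fun _ => 1) := by
  set E : ℝ → X →L[ℂ] X := fun t => circleCalc A c r (fun z => Complex.exp (-((z - lam) * t)))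
    with hE
  set P := circleCalc A c r (fun _ => 1) with hP
  set B := circleCalc A c r (fun z => z) with hB
  have hE0 : E 0 = P := by simp [hE, hP]
  have hd : ∀ t : ℝ, Differentiable ℂ fun z : ℂ => Complex.exp (-((z - lam) * t)) := by
    intro t; fun_prop
  have h1 : ∀ t, HasDerivAt E (((lam : ℂ) • 1 - B) * E t) t := by
    intro t
    -- `A E(t)` is computed twice, under the integral and as `(A P) E(t)`; comparison replaces the
    -- factor `z` under the integral by the operator `B`.
    have e1 : GraphOp A (E t) (circleCalc A c r (fun z => z * Complex.exp (-((z - lam) * t)))) :=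
      graphOp_circleCalc_of_differentiable hr hs (hd t)
    have e2 : GraphOp A (P * E t) (B * E t) := by
      have := (graphOp_circleCalc_of_differentiable hr hs (differentiable_const (1 : ℂ))).mul (E t)
      simpa using this
    have e3 : P * E t = E t := by
      rw [((graphComm_circleProj hr hs).commute_circleCalc hr hs
        (hd t).continuous.continuousOn).eq]
      exact circleCalc_mul_proj hr hs (hd t)
    rw [e3] at e2
    have e4 := e1.unique e2
    have := hasDerivAt_circleCalc_exp hr hs lam t
    convert this using 1
    have e5 : circleCalc A c r (fun z => (z - lam) * Complex.exp (-((z - lam) * t))) =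
        B * E t + (-(lam : ℂ)) • E t := by
      rw [← e4, ← circleCalc_const_mul, ← circleCalc_add hr hs (by fun_prop) (by fun_prop)]
      congr 1
      ext z
      ring
    rw [e5, sub_mul, smul_mul_assoc, one_mul, neg_smul]
    abel
  rw [← hE0]
  exact eq_exp_smul_mul h1 t

end Complete

end

section
/-! ### Spectral projections -/

variable {A : X →ₗ.[ℂ] X} {Q Q' G G' T B : X →L[ℂ] X} {z w p c c' : ℂ} {r r' : ℝ} {S S' : Set ℂ}
  {b φ K β₁ β₂ : ℝ} {z₀ : ℂ}

theorem Encloses.sphere_subset (h : Encloses A S c r) :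
    Metric.sphere c r ⊆ resolventSet A := by
  intro z hz
  by_contra hz'
  have h1 : z ∈ S := h.2.2 ▸ ⟨hz', Metric.sphere_subset_closedBall hz⟩
  exact (Metric.mem_ball.1 (h.2.1 h1)).ne hz

section Complete
variable [CompleteSpace X]

theorem isRelRes_of_mem_resolventSet (hz : z ∈ resolventSet A) (hQ : GraphComm A Q)
    (hi : Q * Q = Q) : z ∈ relSet A Q := (isRelRes_resolvent_mul hz hQ hi).mem

theorem mul_self_one_sub (hi : Q * Q = Q) : (1 - Q) * (1 - Q) = 1 - Q := by
  noncomm_ring [hi]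

theorem Encloses.mem_relSet_one_sub (h : Encloses A S c r) (hz : z ∈ resolventSet A ∪ S) :
    z ∈ relSet A (1 - circleCalc A c r (fun _ => 1)) := by
  rcases hz with hz | hz
  · exact isRelRes_of_mem_resolventSet hz
      (graphComm_one.sub (graphComm_circleProj h.1 h.sphere_subset))
      (mul_self_one_sub (circleProj_mul_self h.1 h.sphere_subset))
  · exact mem_relSet_one_sub_circleProj h.1 h.sphere_subset (h.2.1 hz)

theorem Encloses.mem_relSet (h : Encloses A S c r) (hz : z ∉ S) :
    z ∈ relSet A (circleCalc A c r (fun _ => 1)) := by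
  by_cases hz' : z ∈ resolventSet A
  · exact isRelRes_of_mem_resolventSet hz' (graphComm_circleProj h.1 h.sphere_subset)
      (circleProj_mul_self h.1 h.sphere_subset)
  · refine mem_relSet_circleProj h.1 h.sphere_subset fun hc => hz ?_
    rw [← h.2.2]
    exact ⟨hz', hc⟩

theorem Encloses.closedBall_subset (h : Encloses A S c r) :
    Metric.closedBall c r ⊆ resolventSet A ∪ S := by
  intro z hz
  by_cases hz' : z ∈ resolventSet A
  · exact Or.inl hz'
  · exact Or.inr (h.2.2 ▸ ⟨hz', hz⟩)

/-- On the range of `1 - P'` no spectrum is left inside the first circle, so `P (1 - P') = 0`.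
Exchanging the circles gives independence of the circle, and the same argument with disjoint parts
gives orthogonality. -/
theorem Encloses.proj_mul (h : Encloses A S c r) (h' : Encloses A S c' r') :
    circleCalc A c r (fun _ => 1) * circleCalc A c' r' (fun _ => 1) =
      circleCalc A c r (fun _ => 1) := by
  have := circleCalc_mul_eq_zero_of_subset_relSet h.1 h.sphere_subset
    (Q := 1 - circleCalc A c' r' (fun _ => 1))
    (fun z hz => h'.mem_relSet_one_sub (h.closedBall_subset hz)) (differentiable_const (1 : ℂ))
  rw [mul_sub, mul_one, sub_eq_zero] at this
  exact this.symm

theorem Encloses.proj_eq (h : Encloses A S c r) (h' : Encloses A S c' r') :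
    circleCalc A c r (fun _ => 1) = circleCalc A c' r' (fun _ => 1) := by
  rw [← h.proj_mul h', ((graphComm_circleProj h.1 h.sphere_subset).commute_circleCalc h'.1
    h'.sphere_subset continuousOn_const).eq, h'.proj_mul h]

theorem Encloses.proj_mul_eq_zero (h : Encloses A S c r) (h' : Encloses A S' c' r')
    (hd : Disjoint S S') :
    circleCalc A c r (fun _ => 1) * circleCalc A c' r' (fun _ => 1) = 0 := by
  refine circleCalc_mul_eq_zero_of_subset_relSet h.1 h.sphere_subset (fun z hz => ?_)
    (differentiable_const (1 : ℂ))
  rcases h.closedBall_subset hz with hz' | hz'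
  · exact isRelRes_of_mem_resolventSet hz' (graphComm_circleProj h'.1 h'.sphere_subset)
      (circleProj_mul_self h'.1 h'.sphere_subset)
  · exact h'.mem_relSet fun h'' => (disjoint_left.1 hd) hz' h''

theorem Encloses.circleCalc_id_eq (h : Encloses A S c r) (h' : Encloses A S c' r') :
    circleCalc A c r (fun z => z) = circleCalc A c' r' (fun z => z) := by
  have h1 := graphOp_circleCalc_of_differentiable h.1 h.sphere_subset (differentiable_const (1 : ℂ))
  have h2 := graphOp_circleCalc_of_differentiable h'.1 h'.sphere_subset
    (differentiable_const (1 : ℂ))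
  rw [h.proj_eq h'] at h1
  simpa using h1.unique h2

theorem Encloses.spectralProj_eq (h : Encloses A S c r) :
    spectralProj A S = circleCalc A c r (fun _ => 1) := by
  have hex : ∃ p : ℂ × ℝ, Encloses A S p.1 p.2 := ⟨(c, r), h⟩
  rw [spectralProj, dunford, dif_pos hex]
  exact hex.choose_spec.proj_eq h

theorem Encloses.dunford_exp_eq_exp (h : Encloses A S c r) (lam t : ℝ) :
    dunford A S (fun z => Complex.exp (-((z - lam) * t))) =
      NormedSpace.exp (t • ((lam : ℂ) • 1 - circleCalc A c r (fun z => z))) *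
        spectralProj A S := by
  have hex : ∃ p : ℂ × ℝ, Encloses A S p.1 p.2 := ⟨(c, r), h⟩
  rw [h.spectralProj_eq, dunford, dif_pos hex, ← hex.choose_spec.proj_eq h,
    ← hex.choose_spec.circleCalc_id_eq h]
  exact circleCalc_exp_eq hex.choose_spec.1 hex.choose_spec.sphere_subset lam t

theorem Encloses.dunford_exp_eq (h : Encloses A S c r) (lam t : ℝ) :
    dunford A S (fun z => Complex.exp (-((z - lam) * t))) =
      circleCalc A c r (fun z => Complex.exp (-((z - lam) * t))) := by
  rw [h.dunford_exp_eq_exp, h.spectralProj_eq]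
  exact (circleCalc_exp_eq h.1 h.sphere_subset lam t).symm

end Complete

/-! ### The location of the spectrum -/

/-- Multiply `sin (φ - |arg|) > 0` by the modulus. From here on sectors are described by linear
inequalities instead of arguments. -/
theorem abs_im_mul_cos_lt (hz : z ≠ b) (hφ : φ < Real.pi / 2) (h : |Complex.arg (z - b)| < φ) :
    |z.im| * Real.cos φ < (z.re - b) * Real.sin φ := by
  set w := z - b with hw
  have hw0 : 0 < ‖w‖ := norm_pos_iff.2 (sub_ne_zero.2 hz)
  have h1 : w.re = ‖w‖ * Real.cos |w.arg| := by
    rw [Real.cos_abs, Complex.norm_mul_cos_arg]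
  have h2 : |w.im| = ‖w‖ * Real.sin |w.arg| := by
    have h0 : 0 ≤ Real.sin |w.arg| :=
      Real.sin_nonneg_of_nonneg_of_le_pi (abs_nonneg _) (Complex.abs_arg_le_pi w)
    rw [← Complex.norm_mul_sin_arg w, abs_mul, abs_of_pos hw0]
    congr 1
    rcases abs_cases w.arg with ⟨h, _⟩ | ⟨h, _⟩
    · rw [h] at h0 ⊢; exact abs_of_nonneg h0
    · rw [h, Real.sin_neg] at h0 ⊢
      exact abs_of_nonpos (by linarith)
  have h3 : z.re - b = w.re := by simp [hw]
  have h4 : z.im = w.im := by simp [hw]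
  rw [h3, h4, h1, h2]
  have h5 : 0 < Real.sin (φ - |w.arg|) :=
    Real.sin_pos_of_pos_of_lt_pi (by linarith) (by linarith [abs_nonneg w.arg, Real.pi_pos])
  rw [Real.sin_sub] at h5
  nlinarith

theorem IsSectorialWith.mem_resolventSet_of_le (hA : IsSectorialWith A b φ K) (hz : z ≠ b)
    (h : (z.re - b) * Real.sin φ ≤ |z.im| * Real.cos φ) :
    z ∈ resolventSet A ∧ ‖resolvent A z‖ ≤ K / ‖z - b‖ := by
  have h1 : φ ≤ |Complex.arg (z - b)| := by
    by_contra hc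
    exact absurd (abs_im_mul_cos_lt hz hA.angle_lt (not_le.1 hc)) (not_lt.2 h)
  exact ⟨hA.mem_resolventSet z hz h1, hA.norm_resolvent_le z hz h1⟩

theorem IsSectorialWith.abs_im_le_of_mem_spectrum (hA : IsSectorialWith A b φ K)
    (hz : z ∈ spectrum A) : |z.im| * Real.cos φ ≤ (z.re - b) * Real.sin φ := by
  by_contra hc
  rw [not_le] at hc
  have hzb : z ≠ b := by
    rintro rfl
    simp at hc
  exact hz (hA.mem_resolventSet_of_le hzb hc.le).1

theorem IsSectorialWith.sin_pos (hA : IsSectorialWith A b φ K) : 0 < Real.sin φ :=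
  Real.sin_pos_of_pos_of_lt_pi hA.angle_pos (by linarith [hA.angle_lt, Real.pi_pos])

theorem IsSectorialWith.cos_pos (hA : IsSectorialWith A b φ K) : 0 < Real.cos φ :=
  Real.cos_pos_of_mem_Ioo ⟨by linarith [hA.angle_pos, Real.pi_pos], hA.angle_lt⟩

theorem IsSectorialWith.le_re_of_mem_spectrum (hA : IsSectorialWith A b φ K)
    (hz : z ∈ spectrum A) : b ≤ z.re := by
  have h1 := hA.abs_im_le_of_mem_spectrum hz
  have h2 : 0 ≤ |z.im| * Real.cos φ := mul_nonneg (abs_nonneg _) hA.cos_pos.le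
  have := nonneg_of_mul_nonneg_left (h2.trans h1) hA.sin_pos
  linarith

/-- The spectrum in a left half-plane is bounded. -/
theorem IsSectorialWith.exists_norm_le (hA : IsSectorialWith A b φ K) (m : ℝ) :
    ∃ C, ∀ z ∈ spectrum A, z.re ≤ m → ‖z‖ ≤ C := by
  refine ⟨|b| + |m| + (m - b) * Real.sin φ / Real.cos φ, fun z hz hm => ?_⟩
  have h1 := hA.le_re_of_mem_spectrum hz
  have h2 := hA.abs_im_le_of_mem_spectrum hz
  have h3 : |z.im| ≤ (m - b) * Real.sin φ / Real.cos φ := by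
    rw [le_div_iff₀ hA.cos_pos]
    exact h2.trans (mul_le_mul_of_nonneg_right (by linarith) hA.sin_pos.le)
  have h4 : |z.re| ≤ |b| + |m| := by
    rw [abs_le]
    constructor
    · linarith [neg_abs_le b, abs_nonneg m]
    · linarith [le_abs_self m, abs_nonneg b]
  exact (Complex.norm_le_abs_re_add_abs_im z).trans (add_le_add h4 h3)

/-- A bounded set in the half-plane `Re z ≤ m₁` lies in a disc inside `Re z ≤ m₂`. -/
theorem exists_ball_of_bounded {m₁ m₂ C : ℝ} (hm : m₁ < m₂) :
    ∃ c : ℂ, ∃ r : ℝ, 0 < r ∧ (∀ z : ℂ, z.re ≤ m₁ → ‖z‖ ≤ C → z ∈ Metric.ball c r) ∧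
      ∀ z ∈ Metric.closedBall c r, z.re ≤ m₂ := by
  set D := (C + |m₂|) ^ 2 with hD
  have hη : 0 < m₂ - m₁ := sub_pos.2 hm
  -- With centre `m₂ - r` the open disc is `|z - m₂|² < 2r (m₂ - Re z)`. This radius makes the
  -- right-hand side at least `D + 1` for `Re z ≤ m₁`, while `D` bounds the left-hand side.
  set r := (D + 1) / (2 * (m₂ - m₁)) with hr
  have hD0 : 0 ≤ D := sq_nonneg _
  have hr0 : 0 < r := by positivity
  refine ⟨((m₂ - r : ℝ) : ℂ), r, hr0, fun z hz hz' => ?_, fun z hz => ?_⟩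
  · rw [Metric.mem_ball, Complex.dist_eq_re_im, Real.sqrt_lt' hr0]
    simp only [Complex.ofReal_re, Complex.ofReal_im, sub_zero]
    have h1 : (z.re - m₂) ^ 2 + z.im ^ 2 ≤ D := by
      have h2 : ‖z - (m₂ : ℂ)‖ ≤ C + |m₂| := by
        refine (norm_sub_le _ _).trans (add_le_add hz' ?_)
        rw [Complex.norm_real, Real.norm_eq_abs]
      have h3 : ‖z - (m₂ : ℂ)‖ ^ 2 = (z.re - m₂) ^ 2 + z.im ^ 2 := by
        rw [← Complex.normSq_eq_norm_sq, Complex.normSq_apply]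
        simp
        ring
      rw [← h3]
      exact pow_le_pow_left₀ (norm_nonneg _) h2 2
    have h4 : 2 * r * (m₂ - m₁) = D + 1 := by
      rw [hr]; field_simp
    nlinarith
  · rw [Metric.mem_closedBall, dist_eq_norm] at hz
    have := (Complex.abs_re_le_norm _).trans hz
    rw [Complex.sub_re, Complex.ofReal_re] at this
    linarith [le_abs_self (z.re - (m₂ - r))]

theorem SpectralSplitting.encloses_sigma1 (h : SpectralSplitting A z₀ β₁ β₂)
    (hA : IsSectorialWith A b φ K) {m : ℝ} (hm : β₁ < m) (hm' : m < z₀.re) :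
    ∃ c : ℂ, ∃ r : ℝ, Encloses A (sigma1 A β₁) c r ∧ ∀ z ∈ Metric.closedBall c r, z.re ≤ m := by
  obtain ⟨C, hC⟩ := hA.exists_norm_le β₁
  obtain ⟨c, r, hr, h1, h2⟩ := exists_ball_of_bounded (C := C) hm
  refine ⟨c, r, ⟨hr, fun z hz => h1 z hz.2 (hC z hz.1 hz.2), ?_⟩, h2⟩
  ext z
  constructor
  · rintro ⟨hz, hz'⟩
    have h3 := h2 z hz'
    have h4 := h.spectrum_eq ▸ hz
    rcases h4 with (h4 | h4) | h4
    · exact h4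
    · rw [mem_singleton_iff.1 h4] at h3; linarith
    · have := h4.2
      have := h.re_lt
      simp only [mem_ofPred_eq] at *
      linarith
  · exact fun hz => ⟨hz.1, Metric.ball_subset_closedBall (h1 z hz.2 (hC z hz.1 hz.2))⟩

theorem IsEigenvalue.mem_spectrum (h : IsEigenvalue A z₀) : z₀ ∈ spectrum A := by
  intro hz
  obtain ⟨x, hx, hx'⟩ := h
  have := resolvent_apply_graph hz (LinearPMap.mem_graph A x)
  rw [hx', sub_self, map_zero] at this
  exact hx this.symm

theorem SpectralSplitting.encloses_singleton (h : SpectralSplitting A z₀ β₁ β₂)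
    {r : ℝ} (hr : 0 < r) (h1 : r < z₀.re - β₁) (h2 : r < β₂ - z₀.re) :
    Encloses A {z₀} z₀ r := by
  refine ⟨hr, by simpa using hr, ?_⟩
  ext z
  constructor
  · rintro ⟨hz, hz'⟩
    rw [Metric.mem_closedBall, dist_eq_norm] at hz'
    have h3 := (Complex.abs_re_le_norm _).trans hz'
    rw [Complex.sub_re, abs_le] at h3
    rcases h.spectrum_eq ▸ hz with (h4 | h4) | h4
    · have := h4.2
      simp only [mem_ofPred_eq] at this
      linarith
    · exact h4
    · have := h4.2
      simp only [mem_ofPred_eq] at this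
      linarith
  · rintro rfl
    exact ⟨h.eigenvalue.mem_spectrum, Metric.mem_closedBall_self hr.le⟩

theorem SpectralSplitting.disjoint (h : SpectralSplitting A z₀ β₁ β₂) :
    Disjoint (sigma1 A β₁) {z₀} := by
  rw [disjoint_singleton_right]
  intro hz
  exact absurd hz.2 (not_le.2 h.lt_re)

end

section
/-! ### Integrals over sector contours -/

/-- The boundary of the sector of half-angle `φ` with vertex `0`. -/
def ray (φ s : ℝ) : ℂ := ((|s| * Real.cos φ : ℝ) : ℂ) + ((s * Real.sin φ : ℝ) : ℂ) * Complex.I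

/-- The integral of `F` over the boundary of the sector with vertex `v`. -/
def contourInt {E : Type*} [NormedAddCommGroup E] [NormedSpace ℂ E] (φ : ℝ) (F : ℂ → E) (v : ℝ) :
    E := ∫ s : ℝ, sectorVel φ s • F (v + ray φ s)

section Contour

variable {E : Type*} [NormedAddCommGroup E] [NormedSpace ℂ E] {φ : ℝ} {F F' : ℂ → E}

@[simp] theorem ray_re (φ s : ℝ) : (ray φ s).re = |s| * Real.cos φ := by
  simp [ray, -Complex.ofReal_mul, -Complex.ofReal_cos, -Complex.ofReal_sin]

@[simp] theorem ray_im (φ s : ℝ) : (ray φ s).im = s * Real.sin φ := by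
  simp [ray, -Complex.ofReal_mul, -Complex.ofReal_cos, -Complex.ofReal_sin]

@[simp] theorem ray_zero (φ : ℝ) : ray φ 0 = 0 := by simp [ray]

theorem continuous_ray (φ : ℝ) : Continuous (ray φ) := by unfold ray; fun_prop

theorem measurable_sectorVel (φ : ℝ) : Measurable (sectorVel φ) := by
  unfold sectorVel
  have h : Measurable fun s : ℝ => ((SignType.sign s : SignType) : ℝ) := by
    have : (fun s : ℝ => ((SignType.sign s : SignType) : ℝ)) =
        fun s => if 0 < s then 1 else if s < 0 then -1 else 0 := by
      ext s
      rw [sign_apply]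
      split_ifs <;> simp
    rw [this]
    exact Measurable.ite measurableSet_Ioi measurable_const
      (Measurable.ite measurableSet_Iio measurable_const measurable_const)
  have h2 : Measurable fun s : ℝ => ((SignType.sign s : SignType) : ℝ) * Real.cos φ :=
    h.mul_const _
  exact (Complex.measurable_ofReal.comp h2).add_const _

theorem norm_sectorVel_le (φ s : ℝ) : ‖sectorVel φ s‖ ≤ 1 := by
  have h1 : ‖sectorVel φ s‖ ^ 2 ≤ 1 := by
    rw [← Complex.normSq_eq_norm_sq, Complex.normSq_apply]
    have h2 : (sectorVel φ s).re = (SignType.sign s : ℝ) * Real.cos φ := by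
      simp [sectorVel, -Complex.ofReal_mul, -Complex.ofReal_cos, -Complex.ofReal_sin]
    have h3 : (sectorVel φ s).im = Real.sin φ := by
      simp [sectorVel, -Complex.ofReal_mul, -Complex.ofReal_cos, -Complex.ofReal_sin]
    rw [h2, h3]
    have h4 := Real.sin_sq_add_cos_sq φ
    rcases lt_trichotomy s 0 with h | rfl | h
    · simp [h]; nlinarith
    · simp; nlinarith [sq_nonneg (Real.cos φ)]
    · simp [h]; nlinarith
  exact (sq_le_one_iff₀ (norm_nonneg _)).1 h1

theorem hasDerivAt_ray {s : ℝ} (hs : s ≠ 0) : HasDerivAt (ray φ) (sectorVel φ s) s := by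
  have h1 : HasDerivAt (fun s : ℝ => |s| * Real.cos φ) ((SignType.sign s : ℝ) * Real.cos φ) s :=
    (hasDerivAt_abs hs).mul_const _
  have h2 : HasDerivAt (fun s : ℝ => s * Real.sin φ) (1 * Real.sin φ) s :=
    (hasDerivAt_id s).mul_const _
  have := h1.ofReal_comp.add (h2.ofReal_comp.mul_const Complex.I)
  rw [one_mul] at this
  exact this

theorem integrable_sectorVel_smul {f : ℝ → E} {g : ℝ → ℝ} (hf : AEStronglyMeasurable f)
    (hg : Integrable g) (h : ∀ s, ‖f s‖ ≤ g s) : Integrable fun s => sectorVel φ s • f s := by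
  refine hg.mono' ((measurable_sectorVel φ).aestronglyMeasurable.smul hf)
    (Eventually.of_forall fun s => ?_)
  rw [norm_smul]
  calc _ ≤ 1 * ‖f s‖ := by gcongr; exact norm_sectorVel_le φ s
    _ ≤ g s := by rw [one_mul]; exact h s

theorem norm_contourInt_le {v : ℝ} {g : ℝ → ℝ} (hg : Integrable g)
    (h : ∀ s, ‖F (v + ray φ s)‖ ≤ g s) : ‖contourInt φ F v‖ ≤ ∫ s, g s := by
  refine norm_integral_le_of_norm_le hg (Eventually.of_forall fun s => ?_)
  rw [norm_smul]
  calc _ ≤ 1 * ‖F (v + ray φ s)‖ := by gcongr; exact norm_sectorVel_le φ s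
    _ ≤ g s := by rw [one_mul]; exact h s

/-- The path has a corner at `s = 0`, so the fundamental theorem is applied on the two rays and the
values at the vertex cancel. -/
theorem contourInt_deriv [CompleteSpace E] {v : ℝ} {m₁ m₂ : E}
    (hd : ∀ s, HasDerivAt F (F' (v + ray φ s)) (v + ray φ s))
    (hi : Integrable fun s => sectorVel φ s • F' (v + ray φ s))
    (h1 : Tendsto (fun s => F (v + ray φ s)) atBot (𝓝 m₁))
    (h2 : Tendsto (fun s => F (v + ray φ s)) atTop (𝓝 m₂)) :
    contourInt φ F' v = m₂ - m₁ := by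
  have hc : Continuous fun s => F (v + ray φ s) := by
    rw [continuous_iff_continuousAt]
    intro s
    exact ContinuousAt.comp (f := fun s : ℝ => (v : ℂ) + ray φ s) (hd s).continuousAt
      (continuous_const.add (continuous_ray φ)).continuousAt
  have hd' : ∀ s ≠ 0, HasDerivAt (fun s => F (v + ray φ s)) (sectorVel φ s • F' (v + ray φ s)) s :=
    fun s hs => (hd s).scomp s ((hasDerivAt_ray hs).const_add _)
  rw [contourInt, ← setIntegral_univ, ← Set.Iic_union_Ioi (a := 0),
    setIntegral_union (Iic_disjoint_Ioi le_rfl) measurableSet_Ioi hi.integrableOn hi.integrableOn,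
    integral_Iic_of_hasDerivAt_of_tendsto hc.continuousWithinAt
      (fun s hs => hd' s (ne_of_lt hs)) hi.integrableOn h1,
    integral_Ioi_of_hasDerivAt_of_tendsto hc.continuousWithinAt
      (fun s hs => hd' s (ne_of_gt hs)) hi.integrableOn h2]
  abel

theorem integrable_div_one_add_sq (C : ℝ) : Integrable fun s : ℝ => C / (1 + s ^ 2) := by
  simpa [div_eq_mul_inv] using integrable_inv_one_add_sq.const_mul C

theorem tendsto_div_one_add_sq_atTop (C : ℝ) :
    Tendsto (fun s : ℝ => C / (1 + s ^ 2)) atTop (𝓝 0) :=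
  tendsto_const_nhds.div_atTop (tendsto_atTop_add_const_left _ _ (tendsto_pow_atTop two_ne_zero))

theorem tendsto_div_one_add_sq_atBot (C : ℝ) :
    Tendsto (fun s : ℝ => C / (1 + s ^ 2)) atBot (𝓝 0) := by
  have := (tendsto_div_one_add_sq_atTop C).comp tendsto_neg_atBot_atTop
  simpa [Function.comp_def] using this

/-- A contour integral of a holomorphic function does not change when the contour is shifted. -/
theorem contourInt_shift [CompleteSpace E] {V : Set ℝ} (hV : IsOpen V) (hc : IsPreconnected V)
    (hd : ∀ v ∈ V, ∀ s, HasDerivAt F (F' (v + ray φ s)) (v + ray φ s))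
    (hb : ∀ v₀ ∈ V, ∃ C : ℝ, ∀ᶠ v in 𝓝 v₀, ∀ s, ‖F ((v : ℝ) + ray φ s)‖ ≤ C / (1 + s ^ 2) ∧
      ‖F' ((v : ℝ) + ray φ s)‖ ≤ C / (1 + s ^ 2)) {v v' : ℝ} (hv : v ∈ V) (hv' : v' ∈ V) :
    contourInt φ F v = contourInt φ F v' := by
  have hcont : ∀ v ∈ V, Continuous fun s => F (v + ray φ s) := by
    intro v hv
    rw [continuous_iff_continuousAt]
    intro s
    exact ContinuousAt.comp (f := fun s : ℝ => (v : ℂ) + ray φ s) (hd v hv s).continuousAt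
      (continuous_const.add (continuous_ray φ)).continuousAt
  have hmeas : ∀ v ∈ V, StronglyMeasurable fun s => F' (v + ray φ s) := by
    intro v hv
    have h1 : (fun s => F' (v + ray φ s)) = fun s => deriv F (v + ray φ s) := by
      ext s; exact (hd v hv s).deriv.symm
    rw [h1]
    exact (stronglyMeasurable_deriv F).comp_measurable
      (continuous_const.add (continuous_ray φ)).measurable
  -- The derivative in the vertex is the contour integral of `F'`, which is the difference of the
  -- limits of `F` at the two ends, both zero.
  have key : ∀ v ∈ V, HasDerivAt (contourInt φ F) 0 v := by
    intro v₀ hv₀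
    obtain ⟨C, hC⟩ := hb v₀ hv₀
    have hC0 := hC.self_of_nhds
    have h1 := hasDerivAt_integral_of_dominated_loc_of_deriv_le (𝕜 := ℝ) (μ := volume)
      (F := fun v s => sectorVel φ s • F ((v : ℝ) + ray φ s))
      (F' := fun v s => sectorVel φ s • F' ((v : ℝ) + ray φ s)) (x₀ := v₀)
      (bound := fun s => C / (1 + s ^ 2)) (hC.and (hV.mem_nhds hv₀))
      (by
        filter_upwards [hV.mem_nhds hv₀] with v hv
        exact (measurable_sectorVel φ).aestronglyMeasurable.smul (hcont v hv).aestronglyMeasurable)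
      (integrable_sectorVel_smul (hcont v₀ hv₀).aestronglyMeasurable (integrable_div_one_add_sq C)
        fun s => (hC0 s).1)
      ((measurable_sectorVel φ).aestronglyMeasurable.smul (hmeas v₀ hv₀).aestronglyMeasurable)
      (Eventually.of_forall fun s v hv => by
        rw [norm_smul]
        calc _ ≤ 1 * ‖F' (v + ray φ s)‖ := by gcongr; exact norm_sectorVel_le φ s
          _ ≤ _ := by rw [one_mul]; exact (hv.1 s).2)
      (integrable_div_one_add_sq C)
      (Eventually.of_forall fun s v hv => by
        have h2 : HasDerivAt (fun v : ℝ => (v : ℂ) + ray φ s) 1 v :=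
          (Complex.ofRealCLM.hasDerivAt).add_const _
        have h3 := (hd v hv.2 s).scomp v h2
        rw [one_smul] at h3
        exact h3.fun_const_smul (sectorVel φ s))
    have h2 : contourInt φ F' v₀ = 0 := by
      rw [contourInt_deriv (hd v₀ hv₀) h1.1 (m₁ := 0) (m₂ := 0), sub_zero]
      · exact squeeze_zero_norm (fun s => (hC0 s).1) (tendsto_div_one_add_sq_atBot C)
      · exact squeeze_zero_norm (fun s => (hC0 s).1) (tendsto_div_one_add_sq_atTop C)
    rw [← h2]
    exact h1.2
  exact hV.is_const_of_deriv_eq_zero hc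
    (fun v hv => (key v hv).differentiableAt.differentiableWithinAt)
    (fun v hv => (key v hv).deriv) hv hv'

theorem exists_exp_neg_abs_le {κ : ℝ} (hκ : 0 < κ) :
    ∃ C : ℝ, 0 ≤ C ∧ ∀ s : ℝ, Real.exp (-(κ * |s|)) ≤ C / (1 + s ^ 2) := by
  refine ⟨1 + 2 / κ ^ 2, by positivity, fun s => ?_⟩
  have h1 := Real.quadratic_le_exp_of_nonneg (mul_nonneg hκ.le (abs_nonneg s))
  rw [le_div_iff₀ (by positivity), Real.exp_neg, inv_mul_le_iff₀ (Real.exp_pos _)]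
  have h2 : 1 + s ^ 2 ≤ (1 + (κ * |s|) ^ 2 / 2) * (1 + 2 / κ ^ 2) := by
    have : (1 + (κ * |s|) ^ 2 / 2) * (1 + 2 / κ ^ 2) =
        1 + s ^ 2 + 2 / κ ^ 2 + (κ * |s|) ^ 2 / 2 := by
      rw [mul_pow, sq_abs]; field_simp; ring
    rw [this]
    have : 0 ≤ 2 / κ ^ 2 + (κ * |s|) ^ 2 / 2 := by positivity
    linarith
  refine h2.trans (mul_le_mul_of_nonneg_right ?_ (by positivity))
  linarith [mul_nonneg hκ.le (abs_nonneg s)]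

theorem integrable_exp_neg_abs {κ : ℝ} (hκ : 0 < κ) :
    Integrable fun s : ℝ => Real.exp (-(κ * |s|)) := by
  obtain ⟨C, _, hC⟩ := exists_exp_neg_abs_le hκ
  refine (integrable_div_one_add_sq C).mono' (by fun_prop) (Eventually.of_forall fun s => ?_)
  rw [Real.norm_eq_abs, abs_of_pos (Real.exp_pos _)]
  exact hC s

theorem integral_exp_neg_abs {κ : ℝ} (hκ : 0 < κ) :
    ∫ s : ℝ, Real.exp (-(κ * |s|)) = 2 / κ := by
  rw [integral_comp_abs (f := fun s => Real.exp (-(κ * s)))]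
  have := integral_exp_mul_Ioi (a := -κ) (by linarith) 0
  simp only [neg_mul, mul_zero, Real.exp_zero] at this
  rw [this]
  field_simp

theorem norm_cexp_neg_mul (v t s : ℝ) : ‖Complex.exp (-(((v : ℂ) + ray φ s) * t))‖ =
    Real.exp (-(v * t)) * Real.exp (-((Real.cos φ * t) * |s|)) := by
  rw [Complex.norm_exp, ← Real.exp_add]
  congr 1
  simp
  ring

end Contour

/-! ### A scalar residue on the sector contour -/

section Scalar

variable {φ : ℝ}

theorem tendsto_ray_cobounded_aux (hφ : 0 < Real.cos φ) {l : Filter ℝ}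
    (hl : Tendsto (fun s : ℝ => |s|) l atTop) :
    Tendsto (fun s => (1 - ray φ s) / (1 + ray φ s)) l (𝓝 (-1)) := by
  have h1 : ∀ s, (1 - ray φ s) / (1 + ray φ s) = 2 * (1 + ray φ s)⁻¹ + (-1) := by
    intro s
    have : 1 + ray φ s ≠ 0 := by
      intro h
      have := congrArg Complex.re h
      simp at this
      nlinarith [mul_nonneg (abs_nonneg s) hφ.le]
    field_simp
    ring
  simp only [h1]
  have h2 : Tendsto (fun s => (1 + ray φ s)⁻¹) l (𝓝 0) := by
    have h3 : Tendsto (fun s => |s| * Real.cos φ) l atTop := hl.atTop_mul_const hφ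
    have h4 : Tendsto (fun s => ‖1 + ray φ s‖) l atTop := by
      refine tendsto_atTop_mono (fun s => ?_) h3
      refine le_trans ?_ (Complex.re_le_norm _)
      simp
    exact tendsto_inv₀_cobounded.comp (tendsto_norm_atTop_iff_cobounded.1 h4)
  simpa using (h2.const_mul 2).add_const (-1)

/-- An explicit primitive is `½ log ((1 - z) / (1 + z))`. Along the contour the Möbius image stays
in the slit plane and tends to `-1`, from the lower half-plane at the upper end and from the upper
half-plane at the lower end; the jump of the logarithm gives `-πi`. -/
theorem contourInt_residue (hφ : 0 < Real.cos φ) (hφ' : 0 < Real.sin φ)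
    (hi : Integrable fun s => sectorVel φ s • ((0 : ℝ) + ray φ s - 1)⁻¹ * ((0 : ℝ) + ray φ s + 1)⁻¹) :
    contourInt φ (fun z => (z - 1)⁻¹ * (z + 1)⁻¹) 0 = -(Real.pi * Complex.I) := by
  set F : ℂ → ℂ := fun z => 2⁻¹ * Complex.log ((1 - z) / (1 + z)) with hF
  have hre : ∀ s, (1 + ray φ s) ≠ 0 := by
    intro s h
    have := congrArg Complex.re h
    simp at this
    nlinarith [mul_nonneg (abs_nonneg s) hφ.le]
  have him : ∀ s, ((1 - ray φ s) / (1 + ray φ s)).im =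
      -(2 * s * Real.sin φ) / Complex.normSq (1 + ray φ s) := by
    intro s
    have := Complex.normSq_pos.2 (hre s)
    rw [Complex.div_im]
    simp
    field_simp
    ring
  have hslit : ∀ s, (1 - ray φ s) / (1 + ray φ s) ∈ Complex.slitPlane := by
    intro s
    by_cases hs : s = 0
    · simp [hs]
    · refine Or.inr ?_
      rw [him]
      have := Complex.normSq_pos.2 (hre s)
      exact div_ne_zero (neg_ne_zero.2 (by positivity)) this.ne'
  have hne : ∀ s, (1 - ray φ s) ≠ 0 := by
    intro s h
    have := hslit s
    rw [h, zero_div] at this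
    exact Complex.zero_notMem_slitPlane this
  have hd : ∀ s : ℝ, HasDerivAt F ((((0 : ℝ) : ℂ) + ray φ s - 1)⁻¹ * (((0 : ℝ) : ℂ) + ray φ s + 1)⁻¹)
      (((0 : ℝ) : ℂ) + ray φ s) := by
    intro s
    rw [Complex.ofReal_zero, zero_add]
    set z := ray φ s with hz
    have h1 : HasDerivAt (fun z : ℂ => (1 - z) / (1 + z))
        ((-1 * (1 + z) - (1 - z) * 1) / (1 + z) ^ 2) z :=
      ((hasDerivAt_id z).const_sub 1).div ((hasDerivAt_id z).const_add 1) (hre s)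
    have h2 := (h1.clog (hslit s)).const_mul (2⁻¹ : ℂ)
    refine h2.congr_deriv ?_
    have e1 := hre s
    have e2 := hne s
    have e3 : z - 1 ≠ 0 := fun h => e2 (by linear_combination -h)
    have e4 : z + 1 ≠ 0 := fun h => e1 (by linear_combination h)
    rw [← hz] at e1 e2
    field_simp
    ring
  have hn1 : (-1 : ℂ).re < 0 := by simp
  have hn2 : (-1 : ℂ).im = 0 := by simp
  have htop : Tendsto (fun s => F (((0 : ℝ) : ℂ) + ray φ s)) atTop
      (𝓝 (2⁻¹ * (-(Real.pi * Complex.I)))) := by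
    refine Tendsto.const_mul _ ?_
    have h1 := Complex.tendsto_log_nhdsWithin_im_neg_of_re_neg_of_im_zero hn1 hn2
    simp only [norm_neg, norm_one, Real.log_one, Complex.ofReal_zero, zero_sub] at h1
    refine h1.comp (tendsto_nhdsWithin_iff.2 ⟨?_, ?_⟩)
    · simpa using tendsto_ray_cobounded_aux hφ tendsto_abs_atTop_atTop
    · filter_upwards [eventually_gt_atTop 0] with s hs
      simp only [Complex.ofReal_zero, zero_add, him]
      exact div_neg_of_neg_of_pos (neg_neg_of_pos (by positivity)) (Complex.normSq_pos.2 (hre s))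
  have hbot : Tendsto (fun s => F (((0 : ℝ) : ℂ) + ray φ s)) atBot
      (𝓝 (2⁻¹ * (Real.pi * Complex.I))) := by
    refine Tendsto.const_mul _ ?_
    have h1 := Complex.tendsto_log_nhdsWithin_im_nonneg_of_re_neg_of_im_zero hn1 hn2
    simp only [norm_neg, norm_one, Real.log_one, Complex.ofReal_zero, zero_add] at h1
    refine h1.comp (tendsto_nhdsWithin_iff.2 ⟨?_, ?_⟩)
    · simpa using tendsto_ray_cobounded_aux hφ tendsto_abs_atBot_atTop
    · filter_upwards [eventually_lt_atBot 0] with s hs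
      simp only [Complex.ofReal_zero, zero_add, him]
      refine div_nonneg (neg_nonneg.2 ?_) (Complex.normSq_nonneg _)
      nlinarith
  rw [contourInt_deriv (F := F) hd (by simpa only [smul_eq_mul, mul_assoc] using hi) hbot htop]
  ring

end Scalar

end

section
/-! ### The Dunford integral for the semigroup -/

/-- The Dunford integral of `e^{-zt}` over the sector contour with vertex `b - 1`. -/
def dunfordExp (A : X →ₗ.[ℂ] X) (b φ t : ℝ) : X →L[ℂ] X :=
  -((2 * Real.pi * Complex.I : ℂ)⁻¹ •
    contourInt φ (fun z => Complex.exp (-(z * t)) • resolvent A z) (b - 1))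

variable {A : X →ₗ.[ℂ] X} {b φ K v t s : ℝ}

namespace IsSectorialWith

section Basic

variable (hA : IsSectorialWith A b φ K)
include hA

theorem one_sub_cos_pos : 0 < 1 - Real.cos φ := by
  have h1 := hA.sin_pos
  have h2 := hA.cos_pos
  have h3 := Real.sin_sq_add_cos_sq φ
  nlinarith

/-- By the law of cosines the square is `s² + d² - 2|s| d cos φ` with `d = b - v`, and `2|s| d ≤ s²
+ d²`. -/
theorem sq_norm_contour_ge (v s : ℝ) :
    (1 - Real.cos φ) * (s ^ 2 + (b - v) ^ 2) ≤ ‖(v : ℂ) + ray φ s - b‖ ^ 2 := by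
  rw [← Complex.normSq_eq_norm_sq, Complex.normSq_apply]
  have h1 : ((v : ℂ) + ray φ s - b).re = |s| * Real.cos φ - (b - v) := by simp; ring
  have h2 : ((v : ℂ) + ray φ s - b).im = s * Real.sin φ := by simp
  rw [h1, h2]
  have h3 := Real.sin_sq_add_cos_sq φ
  have h4 := sq_abs s
  have h5 : s * Real.sin φ * (s * Real.sin φ) = |s| ^ 2 * (1 - Real.cos φ ^ 2) := by
    rw [h4]; linear_combination s ^ 2 * h3
  rw [h5, ← h4]
  have := hA.cos_pos
  have : 0 ≤ Real.cos φ * (|s| - (b - v)) ^ 2 := by positivity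
  nlinarith

theorem norm_contour_ge (v s : ℝ) :
    √(1 - Real.cos φ) * (b - v) ≤ ‖(v : ℂ) + ray φ s - b‖ := by
  have h0 := hA.one_sub_cos_pos
  refine le_of_sq_le_sq ?_ (norm_nonneg _)
  rw [mul_pow, Real.sq_sqrt h0.le]
  refine le_trans ?_ (hA.sq_norm_contour_ge v s)
  gcongr
  nlinarith [sq_nonneg s]

theorem norm_contour_pos (hv : v < b) (s : ℝ) : 0 < ‖(v : ℂ) + ray φ s - b‖ :=
  lt_of_lt_of_le (mul_pos (Real.sqrt_pos.2 hA.one_sub_cos_pos) (sub_pos.2 hv))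
    (hA.norm_contour_ge v s)

theorem contour_mem (hv : v < b) (s : ℝ) : (v : ℂ) + ray φ s ∈ resolventSet A ∧
    ‖resolvent A (v + ray φ s)‖ ≤ K / ‖(v : ℂ) + ray φ s - b‖ := by
  refine hA.mem_resolventSet_of_le ?_ ?_
  · exact sub_ne_zero.1 (norm_pos_iff.1 (hA.norm_contour_pos hv s))
  · have h1 : ((v : ℂ) + ray φ s).re = v + |s| * Real.cos φ := by simp
    have h2 : ((v : ℂ) + ray φ s).im = s * Real.sin φ := by simp
    rw [h1, h2, abs_mul, abs_of_pos hA.sin_pos]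
    have := mul_pos (sub_pos.2 hv) hA.sin_pos
    nlinarith

theorem K_pos : 0 < K := zero_lt_one.trans_le hA.one_le

theorem norm_resolvent_contour_le (hv : v < b) (s : ℝ) :
    ‖resolvent A (v + ray φ s)‖ ≤ K / (√(1 - Real.cos φ) * (b - v)) :=
  (hA.contour_mem hv s).2.trans (div_le_div_of_nonneg_left hA.K_pos.le
    (mul_pos (Real.sqrt_pos.2 hA.one_sub_cos_pos) (sub_pos.2 hv)) (hA.norm_contour_ge v s))

end Basic

section Complete

variable [CompleteSpace X] (hA : IsSectorialWith A b φ K)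
include hA

theorem continuous_resolvent_contour (hv : v < b) :
    Continuous fun s => resolvent A (v + ray φ s) :=
  continuousOn_resolvent.comp_continuous (continuous_const.add (continuous_ray φ))
    fun s => (hA.contour_mem hv s).1

/-- The vertex may be placed anywhere to the left of `b`; the norm bounds below use this with
distance `1/t`. -/
theorem dunfordExp_eq (ht : 0 < t) (hv : v < b) :
    dunfordExp A b φ t = -((2 * Real.pi * Complex.I : ℂ)⁻¹ •
      contourInt φ (fun z => Complex.exp (-(z * t)) • resolvent A z) v) := by
  rw [dunfordExp]
  congr 2
  have hb1 : ((b - 1 : ℝ) : ℝ) ∈ Iio b := by simp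
  refine contourInt_shift (V := Iio b)
    (F' := fun z => Complex.exp (-(z * t)) • -(resolvent A z * resolvent A z) +
      (-(t : ℂ) * Complex.exp (-(z * t))) • resolvent A z)
    isOpen_Iio isPreconnected_Iio (fun v hv s => ?_) (fun v₀ hv₀ => ?_) hb1 hv
  · have h1 := hasDerivAt_resolvent (hA.contour_mem hv s).1
    have h2 : HasDerivAt (fun z : ℂ => Complex.exp (-(z * t)))
        (-(t : ℂ) * Complex.exp (-(((v : ℂ) + ray φ s) * t))) ((v : ℂ) + ray φ s) := by
      have := ((hasDerivAt_id ((v : ℂ) + ray φ s)).mul_const (t : ℂ)).neg.cexp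
      refine this.congr_deriv ?_
      simp [mul_comm]
    exact h2.smul h1
  · obtain ⟨C, hC0, hC⟩ := exists_exp_neg_abs_le (mul_pos hA.cos_pos ht)
    have hv₀' : v₀ < b := hv₀
    set d := (b - v₀) / 2 with hd
    have hd0 : 0 < d := by rw [hd]; linarith
    set M := K / (√(1 - Real.cos φ) * d) with hM
    have hη : 0 < √(1 - Real.cos φ) := Real.sqrt_pos.2 hA.one_sub_cos_pos
    have hK := hA.K_pos
    have hM0 : 0 < M := by positivity
    refine ⟨Real.exp (-((v₀ - 1) * t)) * C * (M + M * M + t * M), ?_⟩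
    filter_upwards [Ioo_mem_nhds (show v₀ - 1 < v₀ by linarith) (show v₀ < b - d by linarith)]
      with v hv s
    have hvb : v < b := by linarith [hv.2]
    have hR : ‖resolvent A (v + ray φ s)‖ ≤ M := by
      refine (hA.norm_resolvent_contour_le hvb s).trans ?_
      rw [hM]
      gcongr
      linarith [hv.2]
    have hE : ‖Complex.exp (-(((v : ℂ) + ray φ s) * t))‖ ≤
        Real.exp (-((v₀ - 1) * t)) * (C / (1 + s ^ 2)) := by
      rw [norm_cexp_neg_mul]
      gcongr
      · exact hv.1.le
      · exact hC s
    have hs : (0 : ℝ) < 1 + s ^ 2 := by positivity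
    set e := Real.exp (-((v₀ - 1) * t)) with he
    have he0 : 0 < e := Real.exp_pos _
    have hq : 0 ≤ C / (1 + s ^ 2) := by positivity
    constructor
    · rw [norm_smul]
      calc _ ≤ (e * (C / (1 + s ^ 2))) * M := by gcongr
        _ = e * C * M / (1 + s ^ 2) := by ring
        _ ≤ _ := by
          gcongr
          have : 0 ≤ M * M + t * M := by positivity
          linarith
    · refine (norm_add_le _ _).trans ?_
      have hRR : ‖-(resolvent A (v + ray φ s) * resolvent A (v + ray φ s))‖ ≤ M * M := by
        rw [norm_neg]
        exact (norm_mul_le _ _).trans (by gcongr)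
      have hE2 : ‖-(t : ℂ) * Complex.exp (-(((v : ℂ) + ray φ s) * t))‖ ≤
          t * (e * (C / (1 + s ^ 2))) := by
        rw [norm_mul, norm_neg, Complex.norm_real, Real.norm_eq_abs, abs_of_pos ht]
        gcongr
      rw [norm_smul, norm_smul]
      calc _ ≤ (e * (C / (1 + s ^ 2))) * (M * M) + (t * (e * (C / (1 + s ^ 2)))) * M := by
            gcongr
        _ = e * C * (M * M + t * M) / (1 + s ^ 2) := by ring
        _ ≤ _ := by gcongr; linarith

theorem integrable_contour_exp (ht : 0 < t) {g : ℂ → X →L[ℂ] X} {M : ℝ}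
    (hg : Continuous fun s => g (v + ray φ s)) (hM : ∀ s, ‖g (v + ray φ s)‖ ≤ M) :
    Integrable fun s => sectorVel φ s • Complex.exp (-(((v : ℂ) + ray φ s) * t)) •
      g (v + ray φ s) := by
  have hr := continuous_ray φ
  refine integrable_sectorVel_smul (Continuous.aestronglyMeasurable (Continuous.smul
    (f := fun s => Complex.exp (-(((v : ℂ) + ray φ s) * t))) (by fun_prop) hg))
    (((integrable_exp_neg_abs (mul_pos hA.cos_pos ht)).const_mul
      (Real.exp (-(v * t)))).mul_const M) fun s => ?_
  rw [norm_smul, norm_cexp_neg_mul]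
  gcongr
  exact hM s

theorem norm_contour_exp_le (ht : 0 < t) {g : ℂ → X →L[ℂ] X} {M : ℝ}
    (hM : ∀ s, ‖g (v + ray φ s)‖ ≤ M) :
    ‖contourInt φ (fun z => Complex.exp (-(z * t)) • g z) v‖ ≤
      Real.exp (-(v * t)) * M * (2 / (Real.cos φ * t)) := by
  refine (norm_contourInt_le (((integrable_exp_neg_abs (mul_pos hA.cos_pos ht)).const_mul
      (Real.exp (-(v * t)))).mul_const M) fun s => ?_).trans_eq ?_
  · rw [norm_smul, norm_cexp_neg_mul]
    gcongr
    exact hM s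
  · rw [MeasureTheory.integral_mul_const, MeasureTheory.integral_const_mul, integral_exp_neg_abs (mul_pos hA.cos_pos ht)]
    ring

theorem norm_two_pi_I_inv_smul_le (T : X →L[ℂ] X) :
    ‖-((2 * Real.pi * Complex.I : ℂ)⁻¹ • T)‖ ≤ ‖T‖ := by
  rw [norm_neg, norm_smul, norm_inv]
  have : ‖(2 * Real.pi * Complex.I : ℂ)‖ = 2 * Real.pi := by
    simp [abs_of_pos Real.pi_pos]
  rw [this]
  have h1 : (1 : ℝ) ≤ 2 * Real.pi := by linarith [Real.pi_gt_three]
  calc _ ≤ 1 * ‖T‖ := by gcongr; exact inv_le_one_of_one_le₀ h1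
    _ = _ := one_mul _

/-- With the vertex at `b - 1/t` the exponential contributes `e · e^{-bt}`, the resolvent a multiple
of `t`, and the integral of `e^{-t|s| cos φ}` a multiple of `1/t`; the powers of `t` cancel. -/
theorem exists_norm_dunfordExp_le : ∃ C : ℝ, ∀ t : ℝ, 0 < t →
    ‖dunfordExp A b φ t‖ ≤ C * Real.exp (-(b * t)) := by
  refine ⟨Real.exp 1 * (K / √(1 - Real.cos φ)) * (2 / Real.cos φ), fun t ht => ?_⟩
  have hv : b - 1 / t < b := by have := one_div_pos.2 ht; linarith
  rw [hA.dunfordExp_eq ht hv]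
  refine (hA.norm_two_pi_I_inv_smul_le _).trans
    ((hA.norm_contour_exp_le ht (hA.norm_resolvent_contour_le hv)).trans_eq ?_)
  have h1 : Real.exp (-((b - 1 / t) * t)) = Real.exp 1 * Real.exp (-(b * t)) := by
    rw [← Real.exp_add]
    congr 1
    field_simp
    ring
  have h2 : b - (b - 1 / t) = 1 / t := by ring
  have := hA.cos_pos
  have hη : 0 < √(1 - Real.cos φ) := Real.sqrt_pos.2 hA.one_sub_cos_pos
  rw [h1, h2]
  field_simp

theorem contourInt_exp_eq_zero (ht : 0 < t) (v : ℝ) :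
    contourInt φ (fun z => Complex.exp (-(z * t))) v = 0 := by
  have hr := continuous_ray φ
  obtain ⟨C, hC0, hC⟩ := exists_exp_neg_abs_le (mul_pos hA.cos_pos ht)
  have htc : (t : ℂ) ≠ 0 := Complex.ofReal_ne_zero.2 ht.ne'
  have hb : ∀ s, ‖-(t : ℂ)⁻¹ * Complex.exp (-(((v : ℂ) + ray φ s) * t))‖ ≤
      (t⁻¹ * Real.exp (-(v * t)) * C) / (1 + s ^ 2) := by
    intro s
    rw [norm_mul, norm_neg, norm_inv, Complex.norm_real, Real.norm_eq_abs, abs_of_pos ht,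
      norm_cexp_neg_mul, mul_div_assoc]
    calc _ = t⁻¹ * Real.exp (-(v * t)) * Real.exp (-(Real.cos φ * t * |s|)) := by ring
      _ ≤ _ := by gcongr; exact hC s
  have hd : ∀ s, HasDerivAt (fun z : ℂ => -(t : ℂ)⁻¹ * Complex.exp (-(z * t)))
      (Complex.exp (-(((v : ℂ) + ray φ s) * t))) ((v : ℂ) + ray φ s) := by
    intro s
    have := (((hasDerivAt_id ((v : ℂ) + ray φ s)).mul_const (t : ℂ)).neg.cexp).const_mul (-(t : ℂ)⁻¹)
    refine this.congr_deriv ?_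
    simp
    field_simp
  rw [contourInt_deriv (F' := fun z => Complex.exp (-(z * t))) hd ?_ (squeeze_zero_norm hb (tendsto_div_one_add_sq_atBot _))
    (squeeze_zero_norm hb (tendsto_div_one_add_sq_atTop _)), sub_zero]
  · refine integrable_sectorVel_smul (f := fun s => Complex.exp (-(((v : ℂ) + ray φ s) * t)))
      (Continuous.aestronglyMeasurable (by fun_prop)) ((integrable_exp_neg_abs (mul_pos hA.cos_pos ht)).const_mul (Real.exp (-(v * t))))
      fun s => ?_
    rw [norm_cexp_neg_mul]

/-- `A R(z) = b R(z) + (z - b) R(z) - 1`, and the last term integrates to zero. The middle one is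
bounded by `K` on the contour, which later leaves the factor `1/t` of the derivative. -/
theorem graphOp_dunfordExp (ht : 0 < t) (hv : v < b) :
    GraphOp A (dunfordExp A b φ t) ((b : ℂ) • dunfordExp A b φ t +
      -((2 * Real.pi * Complex.I : ℂ)⁻¹ • contourInt φ
        (fun z => Complex.exp (-(z * t)) • (z - b) • resolvent A z) v)) := by
  have hr := continuous_ray φ
  have hRc := hA.continuous_resolvent_contour hv
  have hi1 := hA.integrable_contour_exp (g := resolvent A) ht hRc
    (hA.norm_resolvent_contour_le hv)
  have hzb : ∀ s, ‖((v : ℂ) + ray φ s - b) • resolvent A (v + ray φ s)‖ ≤ K := by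
    intro s
    rw [norm_smul]
    have h1 := (hA.contour_mem hv s).2
    have h2 := hA.norm_contour_pos hv s
    rwa [le_div_iff₀ h2, mul_comm] at h1
  have hi2 := hA.integrable_contour_exp (g := fun z => (z - b) • resolvent A z) ht
    (by fun_prop) hzb
  have hi3 := hA.integrable_contour_exp (g := fun _ => 1) (v := v) ht continuous_const
    (fun _ => le_rfl)
  have h1 := graphOp_integral (hA.contour_mem hv 0).1 hi1
    ((hi1.smul (b : ℂ)).add (hi2.sub hi3)) (Eventually.of_forall fun s => by
      have := ((resolvent_mem_graph (hA.contour_mem hv s).1).smul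
        (Complex.exp (-(((v : ℂ) + ray φ s) * t)))).smul (sectorVel φ s)
      convert this using 1
      simp only [Pi.add_apply, Pi.sub_apply, Pi.smul_apply]
      rw [smul_comm (b : ℂ), smul_comm (b : ℂ), ← smul_sub, ← smul_sub, ← smul_add, ← smul_add]
      congr 2
      rw [sub_smul]
      abel)
  have h3 : ∫ s, sectorVel φ s • Complex.exp (-(((v : ℂ) + ray φ s) * t)) • (1 : X →L[ℂ] X) = 0 := by
    have := hA.contourInt_exp_eq_zero ht v
    rw [contourInt] at this
    simp only [← smul_assoc] at this ⊢
    rw [integral_smul_const, this, zero_smul]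
  rw [integral_add' (hi1.smul _) (hi2.sub hi3), integral_sub' hi2 hi3, h3, sub_zero] at h1
  simp only [Pi.smul_apply] at h1
  rw [integral_smul] at h1
  have h4 := h1.smul (-(2 * Real.pi * Complex.I : ℂ)⁻¹)
  rw [hA.dunfordExp_eq ht hv]
  convert h4 using 1
  · rw [neg_smul]; rfl
  · rw [smul_add, neg_smul, neg_smul, smul_neg, smul_comm]
    rfl

theorem exists_graphOp_dunfordExp : ∃ C : ℝ, ∀ t : ℝ, 0 < t →
    ∃ Y, GraphOp A (dunfordExp A b φ t) ((b : ℂ) • dunfordExp A b φ t + Y) ∧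
      ‖Y‖ ≤ C * t⁻¹ * Real.exp (-(b * t)) := by
  refine ⟨Real.exp 1 * K * (2 / Real.cos φ), fun t ht => ?_⟩
  have hv : b - 1 / t < b := by have := one_div_pos.2 ht; linarith
  refine ⟨_, hA.graphOp_dunfordExp ht hv, ?_⟩
  have hzb : ∀ s, ‖(((b - 1 / t : ℝ) : ℂ) + ray φ s - b) •
      resolvent A (((b - 1 / t : ℝ) : ℂ) + ray φ s)‖ ≤ K := by
    intro s
    rw [norm_smul]
    have h1 := (hA.contour_mem hv s).2
    have h2 := hA.norm_contour_pos hv s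
    rwa [le_div_iff₀ h2, mul_comm] at h1
  refine (hA.norm_two_pi_I_inv_smul_le _).trans
    ((hA.norm_contour_exp_le (g := fun z => (z - b) • resolvent A z) ht hzb).trans_eq ?_)
  have h1 : Real.exp (-((b - 1 / t) * t)) = Real.exp 1 * Real.exp (-(b * t)) := by
    rw [← Real.exp_add]
    congr 1
    field_simp
    ring
  have := hA.cos_pos
  rw [h1]
  field_simp

theorem graphComm_dunfordExp (ht : 0 < t) : GraphComm A (dunfordExp A b φ t) := by
  have hv : b - 1 < b := by linarith
  have hi := hA.integrable_contour_exp (g := resolvent A) ht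
    (hA.continuous_resolvent_contour hv) (hA.norm_resolvent_contour_le hv)
  have := (graphComm_integral (hA.contour_mem hv 0).1 hi (Eventually.of_forall fun s =>
    ((graphComm_resolvent (hA.contour_mem hv s).1).smul _).smul _)).smul
      (-(2 * Real.pi * Complex.I : ℂ)⁻¹)
  rw [neg_smul] at this
  exact this

theorem hasDerivAt_dunfordExp (ht : 0 < t) {B : X →L[ℂ] X}
    (hB : GraphOp A (dunfordExp A b φ t) B) : HasDerivAt (dunfordExp A b φ) (-B) t := by
  have hr := continuous_ray φ
  have hv : b - 1 < b := by linarith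
  set v := b - 1 with hvd
  have hRc := hA.continuous_resolvent_contour hv
  have hzb : ∀ s, ‖((v : ℂ) + ray φ s - b) • resolvent A (v + ray φ s)‖ ≤ K := by
    intro s
    rw [norm_smul]
    have h1 := (hA.contour_mem hv s).2
    have h2 := hA.norm_contour_pos hv s
    rwa [le_div_iff₀ h2, mul_comm] at h1
  set M := K + |b| * (K / (√(1 - Real.cos φ) * (b - v))) with hM
  have hzR : ∀ s, ‖((v : ℂ) + ray φ s) • resolvent A (v + ray φ s)‖ ≤ M := by
    intro s
    have h1 : ((v : ℂ) + ray φ s) • resolvent A (v + ray φ s) =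
        ((v : ℂ) + ray φ s - b) • resolvent A (v + ray φ s) +
          (b : ℂ) • resolvent A (v + ray φ s) := by rw [sub_smul]; abel
    rw [h1]
    refine (norm_add_le _ _).trans (add_le_add (hzb s) ?_)
    rw [norm_smul, Complex.norm_real, Real.norm_eq_abs]
    gcongr
    exact hA.norm_resolvent_contour_le hv s
  have hi1 := hA.integrable_contour_exp (g := resolvent A) ht hRc
    (hA.norm_resolvent_contour_le hv)
  have hi2 := hA.integrable_contour_exp (g := fun z => (z - b) • resolvent A z) ht
    (by fun_prop) hzb
  have ht2 : 0 < t / 2 := by linarith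
  have key := (hasDerivAt_integral_of_dominated_loc_of_deriv_le (𝕜 := ℝ) (μ := volume)
    (F := fun t s => sectorVel φ s • Complex.exp (-(((v : ℂ) + ray φ s) * (t : ℝ))) •
      resolvent A (v + ray φ s))
    (F' := fun t s => sectorVel φ s • (-((v : ℂ) + ray φ s) *
      Complex.exp (-(((v : ℂ) + ray φ s) * (t : ℝ)))) • resolvent A (v + ray φ s)) (x₀ := t)
    (bound := fun s => Real.exp (|v| * (2 * t)) * Real.exp (-((Real.cos φ * (t / 2)) * |s|)) * M)
    (s := Ioo (t / 2) (2 * t)) (Ioo_mem_nhds (by linarith) (by linarith))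
    (Eventually.of_forall fun t => ((measurable_sectorVel φ).aestronglyMeasurable.smul
      (Continuous.aestronglyMeasurable (by fun_prop)))) hi1
    (((measurable_sectorVel φ).aestronglyMeasurable.smul
      (Continuous.aestronglyMeasurable (by fun_prop))))
    (Eventually.of_forall fun s t' ht' => ?_)
    (((integrable_exp_neg_abs (mul_pos hA.cos_pos ht2)).const_mul _).mul_const M)
    (Eventually.of_forall fun s t' ht' => ?_)).2
  · have h1 := (key.fun_const_smul (2 * Real.pi * Complex.I : ℂ)⁻¹).fun_neg
    refine h1.congr_deriv ?_
    rw [hB.unique (hA.graphOp_dunfordExp ht hv), neg_inj, contourInt, ← smul_neg]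
    have h2 : dunfordExp A b φ t = (2 * Real.pi * Complex.I : ℂ)⁻¹ • -∫ s, sectorVel φ s •
      Complex.exp (-(((v : ℂ) + ray φ s) * t)) • resolvent A (v + ray φ s) := by
      rw [smul_neg]; rfl
    rw [h2, smul_comm, ← smul_add]
    congr 1
    have e0 : (b : ℂ) • ∫ s, sectorVel φ s •
        Complex.exp (-(((v : ℂ) + ray φ s) * t)) • resolvent A (v + ray φ s) =
        ∫ s, ((b : ℂ) • fun s => sectorVel φ s •
        Complex.exp (-(((v : ℂ) + ray φ s) * t)) • resolvent A (v + ray φ s)) s := by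
      rw [← integral_smul]; rfl
    rw [smul_neg, e0, ← neg_add, ← integral_add' (hi1.smul (b : ℂ)) hi2,
      ← MeasureTheory.integral_neg]
    congr 1
    ext1 s
    simp only [Pi.smul_apply, Pi.add_apply]
    rw [smul_comm (b : ℂ), smul_comm (b : ℂ), ← smul_add, ← smul_add, ← smul_neg, ← smul_neg]
    congr 1
    rw [← add_smul, add_sub_cancel, mul_comm, mul_smul, neg_smul]
  · rw [norm_smul, norm_smul, norm_mul, norm_neg, norm_cexp_neg_mul]
    have h0 : t' * |s| ≥ t / 2 * |s| := by gcongr; exact ht'.1.le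
    have e1 : Real.exp (-(v * t')) ≤ Real.exp (|v| * (2 * t)) := by
      apply Real.exp_le_exp.2
      have h5 : |v| * t' ≤ |v| * (2 * t) := by gcongr; exact ht'.2.le
      have h6 : -v * t' ≤ |v| * t' := by
        have : 0 ≤ t' := by linarith [ht'.1]
        gcongr
        exact neg_le_abs v
      linarith
    have e2 : Real.exp (-((Real.cos φ * t') * |s|)) ≤
        Real.exp (-((Real.cos φ * (t / 2)) * |s|)) := by
      apply Real.exp_le_exp.2
      have := mul_le_mul_of_nonneg_left h0 hA.cos_pos.le
      linarith
    have h7 := hzR s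
    rw [norm_smul] at h7
    calc _ ≤ 1 * (‖(v : ℂ) + ray φ s‖ * (Real.exp (-(v * t')) *
          Real.exp (-((Real.cos φ * t') * |s|))) * ‖resolvent A (v + ray φ s)‖) := by
          gcongr
          exact norm_sectorVel_le φ s
      _ = (Real.exp (-(v * t')) * Real.exp (-((Real.cos φ * t') * |s|))) *
          (‖(v : ℂ) + ray φ s‖ * ‖resolvent A (v + ray φ s)‖) := by ring
      _ ≤ _ := by gcongr
  · have h4 : HasDerivAt (fun t : ℝ => -(((v : ℂ) + ray φ s) * (t : ℂ)))
        (-(((v : ℂ) + ray φ s) * 1)) t' :=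
      ((Complex.ofRealCLM.hasDerivAt).const_mul _).neg
    have h5 := h4.cexp
    rw [mul_one, mul_comm] at h5
    exact (h5.smul_const (resolvent A (v + ray φ s))).fun_const_smul (sectorVel φ s)

end Complete

end IsSectorialWith

end

section
/-! ### The semigroup -/

variable {A : X →ₗ.[ℂ] X} {b φ K v t s : ℝ}

namespace IsSectorialWith

section Complete

variable [CompleteSpace X] (hA : IsSectorialWith A b φ K)
include hA

theorem norm_inv_smul_resolvent_contour_le {d : ℝ} (hd : 0 < d) (hv : v ≤ b - d) (s : ℝ) :
    ‖((v : ℂ) + ray φ s - b)⁻¹‖ * ‖resolvent A (v + ray φ s)‖ ≤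
      K / ((1 - Real.cos φ) * min 1 (d ^ 2)) / (1 + s ^ 2) := by
  have hvb : v < b := by linarith
  have h1 := hA.norm_contour_pos hvb s
  have h2 := hA.sq_norm_contour_ge v s
  have h3 := hA.one_sub_cos_pos
  have h4 : min 1 (d ^ 2) * (1 + s ^ 2) ≤ s ^ 2 + (b - v) ^ 2 := by
    have h5 : min 1 (d ^ 2) ≤ 1 := min_le_left _ _
    have h6 : min 1 (d ^ 2) ≤ (b - v) ^ 2 :=
      (min_le_right _ _).trans (pow_le_pow_left₀ hd.le (by linarith) 2)
    nlinarith [sq_nonneg s]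
  have h7 : 0 < min 1 (d ^ 2) := lt_min one_pos (by positivity)
  rw [norm_inv]
  calc _ ≤ ‖(v : ℂ) + ray φ s - b‖⁻¹ * (K / ‖(v : ℂ) + ray φ s - b‖) := by
        gcongr; exact (hA.contour_mem hvb s).2
    _ = K / ‖(v : ℂ) + ray φ s - b‖ ^ 2 := by field_simp
    _ ≤ K / ((1 - Real.cos φ) * (min 1 (d ^ 2) * (1 + s ^ 2))) := by
        have := hA.K_pos
        gcongr
        exact le_trans (by gcongr) h2
    _ = _ := by field_simp

theorem contourInt_inv_smul_resolvent_shift (hv : v < b) :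
    contourInt φ (fun z => (z - b)⁻¹ • resolvent A z) (b - 1) =
      contourInt φ (fun z => (z - b)⁻¹ • resolvent A z) v := by
  have hK := hA.K_pos
  have hne : ∀ v ∈ Iio b, ∀ s, (v : ℂ) + ray φ s - b ≠ 0 := fun v hv s =>
    norm_pos_iff.1 (hA.norm_contour_pos hv s)
  refine contourInt_shift (V := Iio b)
    (F' := fun z => (z - b)⁻¹ • -(resolvent A z * resolvent A z) +
      (-1 / (z - b) ^ 2) • resolvent A z)
    isOpen_Iio isPreconnected_Iio (fun v hv s => ?_) (fun v₀ hv₀ => ?_) (by simp) hv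
  · have h1 : HasDerivAt (fun z : ℂ => (z - b)⁻¹) (-1 / ((v : ℂ) + ray φ s - b) ^ 2)
        ((v : ℂ) + ray φ s) := ((hasDerivAt_id _).sub_const (b : ℂ)).fun_inv (hne v hv s)
    have h2 := hasDerivAt_resolvent (hA.contour_mem hv s).1
    exact h1.smul h2
  · have hv₀' : v₀ < b := hv₀
    set d := (b - v₀) / 2 with hd
    have hd0 : 0 < d := by rw [hd]; linarith
    set C := K / ((1 - Real.cos φ) * min 1 (d ^ 2)) with hC
    set M := K / (√(1 - Real.cos φ) * d) with hM
    have hη : 0 < √(1 - Real.cos φ) := Real.sqrt_pos.2 hA.one_sub_cos_pos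
    have hη' := hA.one_sub_cos_pos
    have hC0 : 0 < C := by
      have : 0 < min 1 (d ^ 2) := lt_min one_pos (by positivity)
      positivity
    have hM0 : 0 < M := by positivity
    refine ⟨C * (1 + M + (√(1 - Real.cos φ) * d)⁻¹), ?_⟩
    filter_upwards [gt_mem_nhds (show v₀ < b - d by linarith)] with v hv s
    have hvb : v < b := by linarith
    have hR : ‖resolvent A (v + ray φ s)‖ ≤ M := by
      refine (hA.norm_resolvent_contour_le hvb s).trans ?_
      rw [hM]
      gcongr
      linarith
    have hI : ‖((v : ℂ) + ray φ s - b)⁻¹‖ ≤ (√(1 - Real.cos φ) * d)⁻¹ := by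
      rw [norm_inv]
      have h8 := hA.norm_contour_ge v s
      have h9 : √(1 - Real.cos φ) * d ≤ √(1 - Real.cos φ) * (b - v) := by
        gcongr; linarith
      exact inv_anti₀ (by positivity) (h9.trans h8)
    have h1 := hA.norm_inv_smul_resolvent_contour_le hd0 hv.le s
    rw [← hC] at h1
    have hs : (0 : ℝ) < 1 + s ^ 2 := by positivity
    have hi : 0 < (√(1 - Real.cos φ) * d)⁻¹ := by positivity
    constructor
    · rw [norm_smul]
      refine h1.trans ?_
      gcongr
      nlinarith
    · have e2 : -1 / ((v : ℂ) + ray φ s - b) ^ 2 =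
          -(((v : ℂ) + ray φ s - b)⁻¹ * ((v : ℂ) + ray φ s - b)⁻¹) := by
        rw [div_eq_mul_inv, sq, mul_inv]; ring
      refine (norm_add_le _ _).trans ?_
      rw [norm_smul, norm_smul, norm_neg, e2, norm_neg, norm_mul (α := ℂ)]
      calc _ ≤ ‖((v : ℂ) + ray φ s - b)⁻¹‖ * (‖resolvent A (v + ray φ s)‖ * M) +
            (√(1 - Real.cos φ) * d)⁻¹ * ‖((v : ℂ) + ray φ s - b)⁻¹‖ *
              ‖resolvent A (v + ray φ s)‖ := by
              gcongr
              exact (norm_mul_le _ _).trans (by gcongr)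
        _ = (‖((v : ℂ) + ray φ s - b)⁻¹‖ * ‖resolvent A (v + ray φ s)‖) *
            (M + (√(1 - Real.cos φ) * d)⁻¹) := by ring
        _ ≤ C / (1 + s ^ 2) * (M + (√(1 - Real.cos φ) * d)⁻¹) := by gcongr
        _ = C * (M + (√(1 - Real.cos φ) * d)⁻¹) / (1 + s ^ 2) := by ring
        _ ≤ _ := by gcongr; linarith

/-- The integrand decays quadratically and is holomorphic along all the contours swept out as the
vertex goes to `-∞`, where the integral tends to zero. -/
theorem contourInt_inv_smul_resolvent :
    contourInt φ (fun z => (z - b)⁻¹ • resolvent A z) (b - 1) = 0 := by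
  have hr := continuous_ray φ
  set F : ℂ → X →L[ℂ] X := fun z => (z - b)⁻¹ • resolvent A z with hF
  have hne : ∀ v ∈ Iio b, ∀ s, (v : ℂ) + ray φ s - b ≠ 0 := fun v hv s =>
    norm_pos_iff.1 (hA.norm_contour_pos hv s)
  have hlim : Tendsto (fun v => contourInt φ F v) atBot (𝓝 (∫ _ : ℝ, (0 : X →L[ℂ] X))) := by
    refine tendsto_integral_filter_of_dominated_convergence
      (fun s => K / ((1 - Real.cos φ) * min 1 (1 ^ 2)) / (1 + s ^ 2)) ?_ ?_
      (integrable_div_one_add_sq _) ?_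
    · filter_upwards [eventually_lt_atBot b] with v hv
      have h2 := hA.continuous_resolvent_contour hv
      exact (measurable_sectorVel φ).aestronglyMeasurable.smul
        (Continuous.aestronglyMeasurable (Continuous.smul
          (Continuous.inv₀ (by fun_prop) (hne v hv)) h2))
    · filter_upwards [eventually_le_atBot (b - 1)] with v hv
      refine Eventually.of_forall fun s => ?_
      rw [norm_smul, hF, norm_smul]
      have h1 := hA.norm_inv_smul_resolvent_contour_le one_pos hv s
      calc _ ≤ 1 * (‖((v : ℂ) + ray φ s - b)⁻¹‖ * ‖resolvent A (v + ray φ s)‖) := by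
            gcongr; exact norm_sectorVel_le φ s
        _ ≤ _ := by rw [one_mul]; exact h1
    · refine Eventually.of_forall fun s => ?_
      have hη : 0 < √(1 - Real.cos φ) := Real.sqrt_pos.2 hA.one_sub_cos_pos
      have h1 : Tendsto (fun v : ℝ => (√(1 - Real.cos φ) * (b - v))⁻¹ *
          (K / (√(1 - Real.cos φ) * (b - v)))) atBot (𝓝 0) := by
        have h2 : Tendsto (fun v : ℝ => √(1 - Real.cos φ) * (b - v)) atBot atTop :=
          (tendsto_atTop_add_const_left _ b tendsto_neg_atBot_atTop).const_mul_atTop hη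
        simpa using (tendsto_inv_atTop_zero.comp h2).mul (tendsto_const_nhds.div_atTop h2)
      refine squeeze_zero_norm' ?_ h1
      filter_upwards [eventually_lt_atBot b] with v hv
      rw [norm_smul, hF, norm_smul]
      have h3 := hA.norm_resolvent_contour_le hv s
      have h4 := inv_anti₀ (mul_pos hη (sub_pos.2 hv)) (hA.norm_contour_ge v s)
      rw [← norm_inv] at h4
      have hb : 0 < b - v := sub_pos.2 hv
      calc _ ≤ 1 * (‖((v : ℂ) + ray φ s - b)⁻¹‖ * ‖resolvent A (v + ray φ s)‖) := by
            gcongr; exact norm_sectorVel_le φ s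
        _ ≤ _ := by rw [one_mul]; gcongr
  rw [integral_zero] at hlim
  refine tendsto_nhds_unique (Tendsto.congr' ?_ tendsto_const_nhds) hlim
  filter_upwards [eventually_lt_atBot b] with v hv using hA.contourInt_inv_smul_resolvent_shift hv

/-- The contour integral of `e^{-zt} / (z - q)` vanishes if the pole `q` lies to the left. -/
theorem contourInt_exp_inv_eq_zero (ht : 0 < t) {q : ℝ} (hv : q < v) :
    contourInt φ (fun z => Complex.exp (-(z * t)) * (z - q)⁻¹) v = 0 := by
  have hr := continuous_ray φ
  set F : ℂ → ℂ := fun z => Complex.exp (-(z * t)) * (z - q)⁻¹ with hF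
  have hre : ∀ v s, q < v → v - q ≤ ‖(v : ℂ) + ray φ s - q‖ := by
    intro v s hv
    refine le_trans ?_ (Complex.re_le_norm _)
    simp only [Complex.sub_re, Complex.add_re, Complex.ofReal_re, ray_re]
    have := mul_nonneg (abs_nonneg s) hA.cos_pos.le
    linarith
  have hne : ∀ v s, q < v → (v : ℂ) + ray φ s - q ≠ 0 := fun v s hv =>
    norm_pos_iff.1 (lt_of_lt_of_le (sub_pos.2 hv) (hre v s hv))
  have hI : ∀ v s, q < v → ‖((v : ℂ) + ray φ s - q)⁻¹‖ ≤ (v - q)⁻¹ := by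
    intro v s hv
    rw [norm_inv]
    exact inv_anti₀ (sub_pos.2 hv) (hre v s hv)
  have hshift : ∀ v' ∈ Ioi q, contourInt φ F v = contourInt φ F v' := by
    intro v' hv'
    refine contourInt_shift (V := Ioi q)
      (F' := fun z => (-(t : ℂ) * Complex.exp (-(z * t))) * (z - q)⁻¹ +
        Complex.exp (-(z * t)) * (-1 / (z - q) ^ 2))
      isOpen_Ioi isPreconnected_Ioi (fun v hv s => ?_) (fun v₀ hv₀ => ?_) hv hv'
    · refine HasDerivAt.mul ?_ (((hasDerivAt_id _).sub_const (q : ℂ)).fun_inv (hne v s hv))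
      have := ((hasDerivAt_id ((v : ℂ) + ray φ s)).mul_const (t : ℂ)).neg.cexp
      refine this.congr_deriv ?_
      simp [mul_comm]
    · obtain ⟨C, hC0, hC⟩ := exists_exp_neg_abs_le (mul_pos hA.cos_pos ht)
      have hv₀' : q < v₀ := hv₀
      set d := (v₀ - q) / 2 with hd
      have hd0 : 0 < d := by rw [hd]; linarith
      set e := Real.exp (-(q * t)) with he
      refine ⟨e * C * (d⁻¹ + t * d⁻¹ + d⁻¹ * d⁻¹), ?_⟩
      filter_upwards [lt_mem_nhds (show q + d < v₀ by linarith)] with v hv s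
      have hqv : q < v := by linarith
      have hi : ‖((v : ℂ) + ray φ s - q)⁻¹‖ ≤ d⁻¹ :=
        (hI v s hqv).trans (inv_anti₀ hd0 (by linarith))
      have hE : ‖Complex.exp (-(((v : ℂ) + ray φ s) * t))‖ ≤ e * (C / (1 + s ^ 2)) := by
        rw [norm_cexp_neg_mul]
        gcongr
        · exact Real.exp_le_exp.2 (neg_le_neg (mul_le_mul_of_nonneg_right hqv.le ht.le))
        · exact hC s
      have hs : (0 : ℝ) < 1 + s ^ 2 := by positivity
      have hq : 0 ≤ e * (C / (1 + s ^ 2)) := by positivity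
      have hd1 : 0 < d⁻¹ := by positivity
      constructor
      · rw [hF, norm_mul]
        calc _ ≤ (e * (C / (1 + s ^ 2))) * d⁻¹ := by gcongr
          _ = e * C * d⁻¹ / (1 + s ^ 2) := by ring
          _ ≤ _ := by
            gcongr
            have : 0 ≤ t * d⁻¹ + d⁻¹ * d⁻¹ := by positivity
            linarith
      · have e2 : -1 / ((v : ℂ) + ray φ s - q) ^ 2 =
            -(((v : ℂ) + ray φ s - q)⁻¹ * ((v : ℂ) + ray φ s - q)⁻¹) := by
          rw [div_eq_mul_inv, sq, mul_inv]; ring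
        refine (norm_add_le _ _).trans ?_
        rw [norm_mul, norm_mul, norm_mul, e2, norm_neg, norm_neg, norm_mul, Complex.norm_real,
          Real.norm_eq_abs, abs_of_pos ht]
        calc _ ≤ t * (e * (C / (1 + s ^ 2))) * d⁻¹ + (e * (C / (1 + s ^ 2))) * (d⁻¹ * d⁻¹) := by
              gcongr
          _ = e * C * (t * d⁻¹ + d⁻¹ * d⁻¹) / (1 + s ^ 2) := by ring
          _ ≤ _ := by gcongr; linarith
  -- With the pole on the left the vertex may move to `+∞`, where `e^{-vt}` kills the integral.
  have hlim : Tendsto (fun v => contourInt φ F v) atTop (𝓝 0) := by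
    have h1 : Tendsto (fun v : ℝ => Real.exp (-(v * t)) * (2 / (Real.cos φ * t))) atTop (𝓝 0) := by
      have := (Real.tendsto_exp_neg_atTop_nhds_zero.comp
        (tendsto_id.atTop_mul_const ht)).mul_const (2 / (Real.cos φ * t))
      simpa [Function.comp_def] using this
    refine squeeze_zero_norm' ?_ h1
    filter_upwards [eventually_ge_atTop (q + 1)] with v hv
    have hqv : q < v := by linarith
    refine (norm_contourInt_le ((integrable_exp_neg_abs (mul_pos hA.cos_pos ht)).const_mul
      (Real.exp (-(v * t)))) fun s => ?_).trans_eq ?_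
    · rw [hF, norm_mul, norm_cexp_neg_mul]
      have h2 : ‖((v : ℂ) + ray φ s - q)⁻¹‖ ≤ 1 :=
        (hI v s hqv).trans (inv_le_one_of_one_le₀ (by linarith))
      exact mul_le_of_le_one_right (by positivity) h2
    · rw [MeasureTheory.integral_const_mul, integral_exp_neg_abs (mul_pos hA.cos_pos ht)]
  refine tendsto_nhds_unique (Tendsto.congr' ?_ tendsto_const_nhds) hlim
  filter_upwards [eventually_gt_atTop q] with v hv using hshift v hv

theorem norm_cexp_contour_le (ht : 0 < t) (ht' : t ≤ 1) (s : ℝ) :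
    ‖Complex.exp (-(((v : ℂ) + ray φ s) * t))‖ ≤ Real.exp |v| := by
  rw [norm_cexp_neg_mul]
  have h1 : Real.exp (-(v * t)) ≤ Real.exp |v| := by
    apply Real.exp_le_exp.2
    calc -(v * t) = -v * t := by ring
      _ ≤ |v| * t := by gcongr; exact neg_le_abs v
      _ ≤ |v| * 1 := by gcongr
      _ = |v| := mul_one _
  have h2 : Real.exp (-((Real.cos φ * t) * |s|)) ≤ 1 := by
    rw [Real.exp_le_one_iff]
    have := hA.cos_pos
    have : 0 ≤ Real.cos φ * t * |s| := by positivity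
    linarith
  calc _ ≤ Real.exp |v| * 1 := by gcongr
    _ = _ := mul_one _

theorem tendsto_cexp_contour (v s : ℝ) :
    Tendsto (fun t : ℝ => Complex.exp (-(((v : ℂ) + ray φ s) * t))) (𝓝[>] 0) (𝓝 1) := by
  have : Continuous fun t : ℝ => Complex.exp (-(((v : ℂ) + ray φ s) * t)) := by fun_prop
  simpa using (this.tendsto 0).mono_left nhdsWithin_le_nhds

/-- At `t = 0` the integrand is not absolutely integrable. Subtracting the kernel with pole at `b -
2`, whose integral is zero for `t > 0`, leaves `2 / ((z - b)(z - b + 2))`, which is; in the variable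
`z - (b - 1)` its poles are `±1` and `contourInt_residue` gives the limit. -/
theorem tendsto_contourInt_exp_inv :
    Tendsto (fun t : ℝ => contourInt φ (fun z => Complex.exp (-(z * t)) * (z - b)⁻¹) (b - 1))
      (𝓝[>] 0) (𝓝 (-(2 * Real.pi * Complex.I))) := by
  have hr := continuous_ray φ
  have hη : 0 < √(1 - Real.cos φ) := Real.sqrt_pos.2 hA.one_sub_cos_pos
  have hv : b - 1 < b := by linarith
  have hκ := hA.cos_pos
  set p : ℂ → ℂ := fun z => (z - 1)⁻¹ * (z + 1)⁻¹ with hp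
  have hle : ∀ s : ℝ, 1 ≤ ‖ray φ s + 1‖ := by
    intro s
    refine le_trans ?_ (Complex.re_le_norm _)
    simp only [Complex.add_re, ray_re, Complex.one_re]
    have := mul_nonneg (abs_nonneg s) hκ.le
    linarith
  have hle2 : ∀ s : ℝ, 1 + s ^ 2 ≤ ‖ray φ s + 1‖ ^ 2 := by
    intro s
    rw [← Complex.normSq_eq_norm_sq, Complex.normSq_apply]
    simp only [Complex.add_re, Complex.add_im, ray_re, ray_im, Complex.one_re, Complex.one_im]
    have h3 := Real.sin_sq_add_cos_sq φ
    have h4 := sq_abs s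
    have h5 := mul_nonneg (abs_nonneg s) hκ.le
    nlinarith
  have hle3 : ∀ s : ℝ, (1 - Real.cos φ) * (1 + s ^ 2) ≤ ‖ray φ s - 1‖ ^ 2 := by
    intro s
    have := hA.sq_norm_contour_ge (b - 1) s
    have e1 : ((b - 1 : ℝ) : ℂ) + ray φ s - b = ray φ s - 1 := by push_cast; ring
    rw [e1] at this
    refine le_trans ?_ this
    apply le_of_eq
    ring
  have hne1 : ∀ s : ℝ, ray φ s + 1 ≠ 0 := fun s => norm_pos_iff.1 (one_pos.trans_le (hle s))
  have hne2 : ∀ s : ℝ, ray φ s - 1 ≠ 0 := fun s => by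
    have h1 := hle3 s
    have h2 := hA.one_sub_cos_pos
    intro h
    rw [h, norm_zero] at h1
    have : 0 < (1 - Real.cos φ) * (1 + s ^ 2) := by positivity
    linarith
  have hpb : ∀ s : ℝ, ‖p (ray φ s)‖ ≤ (√(1 - Real.cos φ))⁻¹ / (1 + s ^ 2) := by
    intro s
    rw [hp, norm_mul, norm_inv, norm_inv, ← mul_inv, ← one_div, div_eq_mul_inv _ (1 + s ^ 2),
      ← mul_inv, ← one_div]
    refine one_div_le_one_div_of_le (by positivity) ?_
    refine le_of_sq_le_sq ?_ (by positivity)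
    rw [mul_pow, mul_pow, Real.sq_sqrt hA.one_sub_cos_pos.le]
    calc _ = ((1 - Real.cos φ) * (1 + s ^ 2)) * (1 + s ^ 2) := by ring
      _ ≤ _ := mul_le_mul (hle3 s) (hle2 s) (by positivity) (by positivity)
  have hpc : Continuous fun s : ℝ => p (ray φ s) :=
    (Continuous.inv₀ (by fun_prop) hne2).mul (Continuous.inv₀ (by fun_prop) hne1)
  have hpi : Integrable fun s => sectorVel φ s • p (ray φ s) :=
    integrable_sectorVel_smul hpc.aestronglyMeasurable (integrable_div_one_add_sq _) hpb
  have hres : contourInt φ p 0 = -(Real.pi * Complex.I) := by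
    refine contourInt_residue hκ hA.sin_pos ?_
    simpa only [hp, Complex.ofReal_zero, zero_add, smul_eq_mul, mul_assoc] using hpi
  -- the integral with the decaying integrand
  have hlim : Tendsto (fun t : ℝ => ∫ s, sectorVel φ s •
      (Complex.exp (-((((b - 1 : ℝ) : ℂ) + ray φ s) * t)) * p (ray φ s))) (𝓝[>] 0)
      (𝓝 (∫ s, sectorVel φ s • p (ray φ s))) := by
    refine tendsto_integral_filter_of_dominated_convergence
      (fun s => Real.exp |b - 1| * ((√(1 - Real.cos φ))⁻¹ / (1 + s ^ 2))) ?_ ?_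
      ((integrable_div_one_add_sq _).const_mul _) ?_
    · refine Eventually.of_forall fun t => ?_
      exact (measurable_sectorVel φ).aestronglyMeasurable.smul
        (Continuous.aestronglyMeasurable (Continuous.mul (by fun_prop) hpc))
    · filter_upwards [Ioc_mem_nhdsGT one_pos] with t ht
      refine Eventually.of_forall fun s => ?_
      rw [norm_smul, norm_mul]
      calc _ ≤ 1 * (Real.exp |b - 1| * ((√(1 - Real.cos φ))⁻¹ / (1 + s ^ 2))) := by
            gcongr
            · exact norm_sectorVel_le φ s
            · exact hA.norm_cexp_contour_le ht.1 ht.2 s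
            · exact hpb s
        _ = _ := one_mul _
    · refine Eventually.of_forall fun s => Tendsto.const_smul ?_ _
      simpa using (hA.tendsto_cexp_contour (b - 1) s).mul_const (p (ray φ s))
  have hval : ∫ s, sectorVel φ s • p (ray φ s) = -(Real.pi * Complex.I) := by
    rw [← hres, contourInt]
    simp
  rw [hval] at hlim
  have := hlim.const_mul 2
  have e3 : (2 : ℂ) * -(Real.pi * Complex.I) = -(2 * Real.pi * Complex.I) := by ring
  rw [e3] at this
  refine this.congr' ?_
  filter_upwards [self_mem_nhdsWithin] with t ht
  have ht : 0 < t := ht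
  have h0 := hA.contourInt_exp_inv_eq_zero ht (show b - 2 < b - 1 by linarith)
  have e4 : ∀ s : ℝ, Complex.exp (-((((b - 1 : ℝ) : ℂ) + ray φ s) * t)) *
      (((b - 1 : ℝ) : ℂ) + ray φ s - b)⁻¹ =
      2 * (Complex.exp (-((((b - 1 : ℝ) : ℂ) + ray φ s) * t)) * p (ray φ s)) +
      Complex.exp (-((((b - 1 : ℝ) : ℂ) + ray φ s) * t)) *
      (((b - 1 : ℝ) : ℂ) + ray φ s - (b - 2 : ℝ))⁻¹ := by
    intro s
    have e5 : ((b - 1 : ℝ) : ℂ) + ray φ s - b = ray φ s - 1 := by push_cast; ring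
    have e6 : ((b - 1 : ℝ) : ℂ) + ray φ s - (b - 2 : ℝ) = ray φ s + 1 := by push_cast; ring
    have h1 := hne1 s
    have h2 := hne2 s
    rw [e5, e6, hp]
    field_simp
    ring
  have hbnd : ∀ s : ℝ, ‖Complex.exp (-((((b - 1 : ℝ) : ℂ) + ray φ s) * t))‖ ≤
      Real.exp (-((b - 1) * t)) * Real.exp (-((Real.cos φ * t) * |s|)) :=
    fun s => (norm_cexp_neg_mul _ _ _).le
  have hE : Integrable fun s : ℝ =>
      Real.exp (-((b - 1) * t)) * Real.exp (-((Real.cos φ * t) * |s|)) :=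
    (integrable_exp_neg_abs (mul_pos hκ ht)).const_mul _
  have hi1 : Integrable fun s => sectorVel φ s •
      (Complex.exp (-((((b - 1 : ℝ) : ℂ) + ray φ s) * t)) * p (ray φ s)) := by
    refine integrable_sectorVel_smul (Continuous.aestronglyMeasurable
      (Continuous.mul (by fun_prop) hpc)) (hE.mul_const (√(1 - Real.cos φ))⁻¹) fun s => ?_
    rw [norm_mul]
    refine mul_le_mul (hbnd s) ((hpb s).trans (div_le_self (by positivity) ?_)) (norm_nonneg _)
      (by positivity)
    nlinarith [sq_nonneg s]
  have hi2 : Integrable fun s => sectorVel φ s •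
      (Complex.exp (-((((b - 1 : ℝ) : ℂ) + ray φ s) * t)) *
      (((b - 1 : ℝ) : ℂ) + ray φ s - (b - 2 : ℝ))⁻¹) := by
    have e6 : ∀ s, ((b - 1 : ℝ) : ℂ) + ray φ s - (b - 2 : ℝ) = ray φ s + 1 := by
      intro s; push_cast; ring
    simp only [e6]
    refine integrable_sectorVel_smul (Continuous.aestronglyMeasurable
      (Continuous.mul (by fun_prop) (Continuous.inv₀ (by fun_prop) hne1)))
      (hE.mul_const 1) fun s => ?_
    rw [norm_mul, norm_inv]
    exact mul_le_mul (hbnd s) (inv_le_one_of_one_le₀ (hle s)) (by positivity) (by positivity)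
  rw [contourInt] at h0 ⊢
  simp only [e4, smul_add]
  have e7 : ∀ s : ℝ, sectorVel φ s • (2 * (Complex.exp (-((((b - 1 : ℝ) : ℂ) + ray φ s) * t)) *
      p (ray φ s))) = 2 * (sectorVel φ s • (Complex.exp (-((((b - 1 : ℝ) : ℂ) + ray φ s) * t)) *
      p (ray φ s))) := by
    intro s; simp only [smul_eq_mul]; ring
  simp only [e7]
  rw [integral_add (hi1.const_mul 2) hi2, h0, add_zero, MeasureTheory.integral_const_mul]

end Complete

end IsSectorialWith

end

/-! ### Strong continuity at time zero and the semigroup law -/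

section
variable {A : X →ₗ.[ℂ] X} {b φ K v t s : ℝ}

section Complete

variable [CompleteSpace X]

namespace IsSectorialWith

variable (hA : IsSectorialWith A b φ K)
include hA

theorem exists_norm_dunfordExp_le_Ioc : ∃ C : ℝ, 0 ≤ C ∧ ∀ t ∈ Ioc (0 : ℝ) 1,
    ‖dunfordExp A b φ t‖ ≤ C := by
  obtain ⟨C, hC⟩ := hA.exists_norm_dunfordExp_le
  refine ⟨|C| * Real.exp |b|, by positivity, fun t ht => (hC t ht.1).trans ?_⟩
  have : Real.exp (-(b * t)) ≤ Real.exp |b| := by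
    apply Real.exp_le_exp.2
    calc -(b * t) = -b * t := by ring
      _ ≤ |b| * t := by have := ht.1.le; gcongr; exact neg_le_abs b
      _ ≤ |b| * 1 := by gcongr; exact ht.2
      _ = |b| := mul_one _
  calc _ ≤ |C| * Real.exp (-(b * t)) := by gcongr; exact le_abs_self C
    _ ≤ _ := by gcongr

/-- `R(z) x = (z - b)⁻¹ (x + R(z) u)` with `u = (A - b) x`. The scalar part tends to the residue;
the other part is dominated by an integrable function, and its limit is the vanishing integral
`contourInt_inv_smul_resolvent`. -/
theorem tendsto_dunfordExp_of_mem_domain {x y : X} (hxy : (x, y) ∈ A.graph) :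
    Tendsto (fun t => dunfordExp A b φ t x) (𝓝[>] 0) (𝓝 x) := by
  have hr := continuous_ray φ
  have hv : b - 1 < b := by linarith
  have hRc := hA.continuous_resolvent_contour hv
  set u := y - (b : ℂ) • x with hu
  have hzb : ∀ s : ℝ, ((b - 1 : ℝ) : ℂ) + ray φ s - b ≠ 0 := fun s =>
    norm_pos_iff.1 (hA.norm_contour_pos hv s)
  have key : ∀ s : ℝ, resolvent A ((b - 1 : ℝ) + ray φ s) x =
      (((b - 1 : ℝ) : ℂ) + ray φ s - b)⁻¹ • x +
        (((b - 1 : ℝ) : ℂ) + ray φ s - b)⁻¹ • resolvent A ((b - 1 : ℝ) + ray φ s) u := by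
    intro s
    have h1 := resolvent_apply_graph (hA.contour_mem hv s).1 hxy
    have h2 : (((b - 1 : ℝ) : ℂ) + ray φ s) • x - y = (((b - 1 : ℝ) : ℂ) + ray φ s - b) • x - u := by
      rw [hu, sub_smul]; abel
    rw [h2, map_sub, map_smul, sub_eq_iff_eq_add] at h1
    rw [← smul_add, ← h1, smul_smul, inv_mul_cancel₀ (hzb s), one_smul]
  have hb := hA.norm_inv_smul_resolvent_contour_le one_pos le_rfl
  set C := K / ((1 - Real.cos φ) * min 1 ((1 : ℝ) ^ 2)) with hC
  have hGc : Continuous fun s : ℝ => (((b - 1 : ℝ) : ℂ) + ray φ s - b)⁻¹ •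
      resolvent A ((b - 1 : ℝ) + ray φ s) :=
    Continuous.smul (Continuous.inv₀ (by fun_prop) hzb) hRc
  have hGb : ∀ s : ℝ, ‖(((b - 1 : ℝ) : ℂ) + ray φ s - b)⁻¹ •
      resolvent A ((b - 1 : ℝ) + ray φ s)‖ ≤ C / (1 + s ^ 2) := by
    intro s; rw [norm_smul]; exact hb s
  have hE : ∀ t ∈ Ioc (0 : ℝ) 1, ∀ s : ℝ,
      ‖Complex.exp (-((((b - 1 : ℝ) : ℂ) + ray φ s) * t)) • (((b - 1 : ℝ) : ℂ) + ray φ s - b)⁻¹ •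
      resolvent A ((b - 1 : ℝ) + ray φ s)‖ ≤ Real.exp |b - 1| * (C / (1 + s ^ 2)) := by
    intro t ht s
    rw [norm_smul]
    gcongr
    · exact hA.norm_cexp_contour_le ht.1 ht.2 s
    · exact hGb s
  have hlim : Tendsto (fun t : ℝ => ∫ s, sectorVel φ s •
      Complex.exp (-((((b - 1 : ℝ) : ℂ) + ray φ s) * t)) • (((b - 1 : ℝ) : ℂ) + ray φ s - b)⁻¹ •
      resolvent A ((b - 1 : ℝ) + ray φ s)) (𝓝[>] 0)
      (𝓝 (∫ s, sectorVel φ s • (((b - 1 : ℝ) : ℂ) + ray φ s - b)⁻¹ •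
      resolvent A ((b - 1 : ℝ) + ray φ s))) := by
    refine tendsto_integral_filter_of_dominated_convergence
      (fun s => Real.exp |b - 1| * (C / (1 + s ^ 2))) ?_ ?_
      ((integrable_div_one_add_sq _).const_mul _) ?_
    · refine Eventually.of_forall fun t => ?_
      exact (measurable_sectorVel φ).aestronglyMeasurable.smul
        (Continuous.aestronglyMeasurable (Continuous.smul
          (f := fun s => Complex.exp (-((((b - 1 : ℝ) : ℂ) + ray φ s) * t))) (by fun_prop) hGc))
    · filter_upwards [Ioc_mem_nhdsGT one_pos] with t ht
      refine Eventually.of_forall fun s => ?_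
      rw [norm_smul]
      calc _ ≤ 1 * (Real.exp |b - 1| * (C / (1 + s ^ 2))) := by
            gcongr
            · exact norm_sectorVel_le φ s
            · exact hE t ht s
        _ = _ := one_mul _
    · refine Eventually.of_forall fun s => Tendsto.const_smul ?_ _
      simpa using (hA.tendsto_cexp_contour (b - 1) s).smul_const
        ((((b - 1 : ℝ) : ℂ) + ray φ s - b)⁻¹ • resolvent A ((b - 1 : ℝ) + ray φ s))
  have h0 := hA.contourInt_inv_smul_resolvent
  rw [contourInt] at h0
  rw [h0] at hlim
  have hlim2 : Tendsto (fun t : ℝ => -((2 * Real.pi * Complex.I : ℂ)⁻¹ •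
      (contourInt φ (fun z => Complex.exp (-(z * t)) * (z - b)⁻¹) (b - 1) • x +
        (∫ s, sectorVel φ s •
      Complex.exp (-((((b - 1 : ℝ) : ℂ) + ray φ s) * t)) • (((b - 1 : ℝ) : ℂ) + ray φ s - b)⁻¹ •
      resolvent A ((b - 1 : ℝ) + ray φ s)) u))) (𝓝[>] 0)
      (𝓝 (-((2 * Real.pi * Complex.I : ℂ)⁻¹ • (-(2 * Real.pi * Complex.I) • x +
        (0 : X →L[ℂ] X) u)))) :=
    (((hA.tendsto_contourInt_exp_inv.smul_const x).add
      (((ContinuousLinearMap.apply ℂ X u).continuous.tendsto _).comp hlim)).const_smul _).neg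
  have hx : -((2 * Real.pi * Complex.I : ℂ)⁻¹ • (-(2 * Real.pi * Complex.I : ℂ) • x +
        (0 : X →L[ℂ] X) u)) = x := by
    rw [zero_apply, add_zero, neg_smul, smul_neg, neg_neg, smul_smul, inv_mul_cancel₀ two_pi_I_ne,
      one_smul]
  rw [hx] at hlim2
  refine hlim2.congr' ?_
  filter_upwards [Ioc_mem_nhdsGT one_pos] with t ht
  have hi := hA.integrable_contour_exp (g := resolvent A) ht.1 hRc
    (hA.norm_resolvent_contour_le hv)
  have hi2 : Integrable fun s : ℝ => sectorVel φ s •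
      Complex.exp (-((((b - 1 : ℝ) : ℂ) + ray φ s) * t)) • (((b - 1 : ℝ) : ℂ) + ray φ s - b)⁻¹ •
      resolvent A ((b - 1 : ℝ) + ray φ s) :=
    integrable_sectorVel_smul (Continuous.aestronglyMeasurable (Continuous.smul
          (f := fun s => Complex.exp (-((((b - 1 : ℝ) : ℂ) + ray φ s) * t))) (by fun_prop) hGc))
      ((integrable_div_one_add_sq C).const_mul _) (hE t ht)
  have hi3 : Integrable fun s : ℝ => sectorVel φ s •
      (Complex.exp (-((((b - 1 : ℝ) : ℂ) + ray φ s) * t)) *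
        (((b - 1 : ℝ) : ℂ) + ray φ s - b)⁻¹) := by
    refine integrable_sectorVel_smul (Continuous.aestronglyMeasurable (Continuous.mul
      (by fun_prop) (Continuous.inv₀ (by fun_prop) hzb)))
      (((integrable_exp_neg_abs (mul_pos hA.cos_pos ht.1)).const_mul
      (Real.exp (-((b - 1) * t)))).mul_const (√(1 - Real.cos φ) * (b - (b - 1)))⁻¹) fun s => ?_
    rw [norm_mul, norm_cexp_neg_mul, norm_inv]
    have hη : 0 < √(1 - Real.cos φ) := Real.sqrt_pos.2 hA.one_sub_cos_pos
    have hη' : 0 < √(1 - Real.cos φ) * (b - (b - 1)) := mul_pos hη (by linarith)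
    gcongr
    exact hA.norm_contour_ge (b - 1) s
  rw [dunfordExp, neg_apply, smul_apply, contourInt, contourInt,
    ContinuousLinearMap.integral_apply hi, ContinuousLinearMap.integral_apply hi2,
    ← integral_smul_const, ← integral_add (hi3.smul_const x) (hi2.apply_continuousLinearMap u)]
  congr 2
  refine integral_congr_ae (Eventually.of_forall fun s => ?_)
  simp only [smul_apply]
  rw [key s]
  simp only [smul_add, smul_smul, smul_eq_mul]

theorem tendsto_dunfordExp (x : X) :
    Tendsto (fun t => dunfordExp A b φ t x) (𝓝[>] 0) (𝓝 x) := by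
  obtain ⟨C, hC0, hC⟩ := hA.exists_norm_dunfordExp_le_Ioc
  rw [Metric.tendsto_nhds]
  intro ε hε
  obtain ⟨y, hy, hyx⟩ := Metric.dense_iff.1 hA.dense x (ε / (2 * (C + 1))) (by positivity)
  have h1 := hA.tendsto_dunfordExp_of_mem_domain (LinearPMap.mem_graph A ⟨y, hyx⟩)
  filter_upwards [Metric.tendsto_nhds.1 h1 (ε / 2) (by positivity), Ioc_mem_nhdsGT one_pos]
    with t ht ht'
  rw [Metric.mem_ball, dist_comm, dist_eq_norm] at hy
  rw [dist_eq_norm] at ht ⊢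
  have e : dunfordExp A b φ t x - x =
      dunfordExp A b φ t (x - y) + (dunfordExp A b φ t y - y) - (x - y) := by
    rw [map_sub]; abel
  rw [e]
  have h3 : ‖dunfordExp A b φ t (x - y)‖ ≤ C * ‖x - y‖ :=
    (ContinuousLinearMap.le_opNorm _ _).trans (by gcongr; exact hC t ht')
  calc _ ≤ ‖dunfordExp A b φ t (x - y)‖ + ‖dunfordExp A b φ t y - y‖ + ‖x - y‖ :=
        (norm_sub_le _ _).trans (by gcongr; exact norm_add_le _ _)
    _ < C * ‖x - y‖ + ε / 2 + ‖x - y‖ := by linarith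
    _ = (C + 1) * ‖x - y‖ + ε / 2 := by ring
    _ < (C + 1) * (ε / (2 * (C + 1))) + ε / 2 := by gcongr
    _ = ε := by field_simp; ring

end IsSectorialWith

/-- The properties of the analytic semigroup `S` generated by `-A`, with `D t = A S(t)`. -/
structure IsAnalyticSemigroup (A : X →ₗ.[ℂ] X) (S D : ℝ → X →L[ℂ] X) : Prop where
  zero : S 0 = 1
  add : ∀ s t, 0 ≤ s → 0 ≤ t → S (s + t) = S s * S t
  graph : ∀ t, 0 < t → GraphOp A (S t) (D t)
  comm : ∀ t, 0 ≤ t → GraphComm A (S t)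
  deriv : ∀ t, 0 < t → HasDerivAt S (-D t) t
  tendsto : ∀ x, Tendsto (fun t => S t x) (𝓝[>] 0) (𝓝 x)
  bound : ∃ C ω : ℝ, 0 < C ∧ ∀ t, 0 < t → ‖S t‖ ≤ C * Real.exp (ω * t) ∧
    ‖D t‖ ≤ C * t⁻¹ * Real.exp (ω * t)

theorem sectorPath_eq (b φ s : ℝ) : sectorPath b φ s = ((b - 1 : ℝ) : ℂ) + ray φ s := by
  simp only [sectorPath, ray]
  push_cast
  ring

theorem exists_semigroup_eq_dunfordExp (hA : IsSectorial A) :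
    ∃ b φ K : ℝ, IsSectorialWith A b φ K ∧ semigroup A 0 = 1 ∧
      ∀ t, 0 < t → semigroup A t = dunfordExp A b φ t := by
  classical
  have hex : ∃ p : ℝ × ℝ, ∃ K : ℝ, IsSectorialWith A p.1 p.2 K := by
    obtain ⟨b, φ, K, h⟩ := hA
    exact ⟨(b, φ), K, h⟩
  obtain ⟨K, hA⟩ := hex.choose_spec
  refine ⟨hex.choose.1, hex.choose.2, K, hA, ?_, fun t ht => ?_⟩
  · rw [semigroup, dif_pos hex, if_pos rfl]; rfl
  · rw [semigroup, dif_pos hex, if_neg ht.ne', dunfordExp, contourInt]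
    congr 3
    ext1 s
    rw [smul_smul, mul_comm, ← sectorPath_eq]

theorem IsSectorialWith.exists_isAnalyticSemigroup (hA : IsSectorialWith A b φ K)
    {S : ℝ → X →L[ℂ] X} (hS0 : S 0 = 1) (hS : ∀ t, 0 < t → S t = dunfordExp A b φ t) :
    ∃ D, IsAnalyticSemigroup A S D := by
  obtain ⟨C₁, hC₁⟩ := hA.exists_norm_dunfordExp_le
  obtain ⟨C₂, hC₂⟩ := hA.exists_graphOp_dunfordExp
  choose Y hY hYn using hC₂
  set D : ℝ → X →L[ℂ] X := fun t => if h : 0 < t then (b : ℂ) • dunfordExp A b φ t + Y t h else 0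
    with hD
  have hDt : ∀ t, ∀ h : 0 < t, D t = (b : ℂ) • dunfordExp A b φ t + Y t h := fun t h => dif_pos h
  have hgraph : ∀ t, 0 < t → GraphOp A (S t) (D t) := by
    intro t ht
    rw [hS t ht, hDt t ht]
    exact hY t ht
  have hcomm : ∀ t, 0 ≤ t → GraphComm A (S t) := by
    intro t ht
    rcases ht.eq_or_lt with rfl | ht
    · rw [hS0]; exact graphComm_one
    · rw [hS t ht]; exact hA.graphComm_dunfordExp ht
  have hderiv : ∀ t, 0 < t → HasDerivAt (S) (-D t) t := by
    intro t ht
    have h1 := hA.hasDerivAt_dunfordExp ht (hS t ht ▸ hgraph t ht)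
    refine h1.congr_of_eventuallyEq ?_
    filter_upwards [lt_mem_nhds ht] with s hs using hS s hs
  have htend : ∀ x, Tendsto (fun t => S t x) (𝓝[>] 0) (𝓝 x) := by
    intro x
    refine (hA.tendsto_dunfordExp x).congr' ?_
    filter_upwards [self_mem_nhdsWithin] with t ht
    rw [hS t ht]
  refine ⟨D, hS0, ?_, hgraph, hcomm, hderiv, htend, ?_⟩
  · have hp := (hA.contour_mem (show b - 1 < b by linarith) 0).1
    have hcm : ∀ s t, 0 < s → 0 < t → S s * D t = D s * S t := by
      intro s t hs ht
      exact ((hcomm s hs.le).graphOp (hgraph t ht)).unique ((hgraph s hs).mul _)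
    intro s t hs ht
    rcases hs.eq_or_lt with rfl | hs
    · rw [hS0, zero_add, one_mul]
    rcases ht.eq_or_lt with rfl | ht
    · rw [hS0, add_zero, mul_one]
    set c := s + t with hc
    -- The semigroup law: `S r * S (c - r)` has derivative zero on `(0, c)`, and letting `r → 0`
    -- identifies the constant as `S c`.
    have hd : ∀ r ∈ Ioo 0 c, HasDerivAt (fun r => S r * S (c - r)) 0 r := by
      intro r hr
      have hr' : 0 < c - r := sub_pos.2 hr.2
      have h1 : HasDerivAt (fun r => S (c - r)) (D (c - r)) r := by
        have := (hderiv _ hr').scomp r ((hasDerivAt_id r).const_sub c)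
        simp only [neg_smul, one_smul, neg_neg] at this
        exact this
      refine ((hderiv r hr.1).mul h1).congr_deriv ?_
      rw [hcm r _ hr.1 hr', neg_mul, neg_add_cancel]
    have hconst : ∀ r ∈ Ioo 0 c, S r * S (c - r) =
        S s * S (c - s) := by
      intro r hr
      refine isOpen_Ioo.is_const_of_deriv_eq_zero isPreconnected_Ioo
        (fun r hr => (hd r hr).differentiableAt.differentiableWithinAt)
        (fun r hr => (hd r hr).deriv) hr ⟨hs, by linarith⟩
    have e : c - s = t := by rw [hc]; ring
    rw [e] at hconst
    ext x
    have hc0 : 0 < c := by positivity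
    have h1 : Tendsto (fun r => S (c - r) (S r x)) (𝓝[>] 0)
        (𝓝 (S c x)) := by
      have h2 : Tendsto (fun r => S (c - r)) (𝓝[>] 0) (𝓝 (S c)) := by
        have h3 : ContinuousAt (S) c := (hderiv c hc0).continuousAt
        have h4 : Tendsto (fun r : ℝ => c - r) (𝓝[>] 0) (𝓝 c) := by
          have : Continuous fun r : ℝ => c - r := by fun_prop
          simpa using (this.tendsto 0).mono_left nhdsWithin_le_nhds
        exact h3.tendsto.comp h4
      exact (isBoundedBilinearMap_apply.continuous.tendsto (_, _)).comp
        (h2.prodMk_nhds (htend x))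
    refine tendsto_nhds_unique h1 (Tendsto.congr' ?_ tendsto_const_nhds)
    filter_upwards [Ioo_mem_nhdsGT hc0] with r hr
    rw [← hconst r hr]
    -- Commuting the factors puts the norm continuous one outside, so that only strong convergence
    -- of `S r x` is needed in the limit.
    have h5 : Commute (S r) (S (c - r)) := by
      have h6 := (graphComm_iff hp).1 (hcomm r hr.1.le)
      have hr' : 0 < c - r := sub_pos.2 hr.2
      rw [hS _ hr', dunfordExp]
      have hv : b - 1 < b := by linarith
      have hi := hA.integrable_contour_exp (g := resolvent A) hr'
        (hA.continuous_resolvent_contour hv) (hA.norm_resolvent_contour_le hv)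
      rw [← smul_neg]
      refine Commute.smul_right (Commute.neg_right ?_) _
      rw [contourInt, Commute, SemiconjBy, ← integral_mul_left hi, ← integral_mul_right hi]
      congr 1
      ext1 σ
      rw [mul_smul_comm, mul_smul_comm, smul_mul_assoc, smul_mul_assoc,
        ((hcomm r hr.1.le).commute_resolvent (hA.contour_mem hv σ).1).eq]
    rw [h5.eq]
    rfl
  -- The rate is raised from `-b` to `-b + 1` so that the term `b S(t)` of `A S(t)`, which lacks the
  -- factor `1/t`, can be absorbed: `t ≤ e^t`.
  · refine ⟨(|C₁| + 1) * (|b| + 1) + |C₂|, -b + 1, by positivity, fun t ht => ?_⟩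
    have h1 : Real.exp (-(b * t)) ≤ Real.exp ((-b + 1) * t) :=
      Real.exp_le_exp.2 (by nlinarith)
    have h2 : ‖dunfordExp A b φ t‖ ≤ |C₁| * Real.exp (-(b * t)) :=
      (hC₁ t ht).trans (by gcongr; exact le_abs_self _)
    have h3 : t * Real.exp (-(b * t)) ≤ Real.exp ((-b + 1) * t) := by
      have : (-b + 1) * t = t + -(b * t) := by ring
      rw [this, Real.exp_add]
      gcongr
      linarith [Real.add_one_le_exp t]
    have ha := abs_nonneg C₁
    have hb0 := abs_nonneg b
    have hc := abs_nonneg C₂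
    constructor
    · rw [hS t ht]
      have h5 : |C₁| ≤ (|C₁| + 1) * (|b| + 1) + |C₂| := by nlinarith [mul_nonneg ha hb0]
      refine h2.trans (mul_le_mul h5 h1 (Real.exp_pos _).le (by positivity))
    · rw [hDt t ht]
      refine (norm_add_le _ _).trans ?_
      rw [norm_smul, Complex.norm_real, Real.norm_eq_abs]
      have h4 := hYn t ht
      calc _ ≤ |b| * (|C₁| * Real.exp (-(b * t))) + |C₂| * t⁻¹ * Real.exp (-(b * t)) := by
            gcongr
            exact h4.trans (by gcongr; exact le_abs_self _)
        _ = |b| * |C₁| * t⁻¹ * (t * Real.exp (-(b * t))) + |C₂| * t⁻¹ * Real.exp (-(b * t)) := by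
            field_simp
        _ ≤ |b| * |C₁| * t⁻¹ * Real.exp ((-b + 1) * t) + |C₂| * t⁻¹ * Real.exp ((-b + 1) * t) := by
            gcongr
        _ = (|b| * |C₁| + |C₂|) * t⁻¹ * Real.exp ((-b + 1) * t) := by ring
        _ ≤ _ := by
            have h5 : |b| * |C₁| + |C₂| ≤ (|C₁| + 1) * (|b| + 1) + |C₂| := by nlinarith
            exact mul_le_mul_of_nonneg_right (mul_le_mul_of_nonneg_right h5 (by positivity))
              (Real.exp_pos _).le

theorem exists_isAnalyticSemigroup (hA : IsSectorial A) :
    ∃ D, IsAnalyticSemigroup A (semigroup A) D := by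
  obtain ⟨b, φ, K, hA, hS0, hS⟩ := exists_semigroup_eq_dunfordExp hA
  exact hA.exists_isAnalyticSemigroup hS0 hS

end Complete

end

section
variable {A : X →ₗ.[ℂ] X} {b φ K : ℝ} {S D S' D' : ℝ → X →L[ℂ] X} {Q G : X →L[ℂ] X} {z w : ℂ}

section Complete

variable [CompleteSpace X]

/-! ### Continuity and uniqueness of the semigroup -/

namespace IsAnalyticSemigroup

theorem exists_norm_le (h : IsAnalyticSemigroup A S D) : ∃ C ω : ℝ, 0 < C ∧ 0 ≤ ω ∧ ∀ t, 0 ≤ t →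
    ‖S t‖ ≤ C * Real.exp (ω * t) := by
  obtain ⟨C, ω, hC, hb⟩ := h.bound
  refine ⟨C + ‖(1 : X →L[ℂ] X)‖, |ω|, by positivity, abs_nonneg ω, fun t ht => ?_⟩
  rcases ht.eq_or_lt with rfl | ht
  · rw [h.zero]; simp [hC.le]
  · refine (hb t ht).1.trans ?_
    gcongr
    · linarith [norm_nonneg (1 : X →L[ℂ] X)]
    · exact le_abs_self ω

theorem continuousOn_apply (h : IsAnalyticSemigroup A S D) (x : X) :
    ContinuousOn (fun t => S t x) (Ici 0) := by
  intro t ht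
  rcases (mem_Ici.1 ht).eq_or_lt with rfl | ht
  · rw [← continuousWithinAt_Ioi_iff_Ici, ContinuousWithinAt, h.zero]
    exact h.tendsto x
  · exact ((ContinuousLinearMap.apply ℂ X x).continuous.continuousAt.comp
      (h.deriv t ht).continuousAt).continuousWithinAt

theorem tendsto_apply (h : IsAnalyticSemigroup A S D) {ι : Type*} {l : Filter ι} {t : ι → ℝ}
    {y : ι → X} {t₀ : ℝ} {y₀ : X} (ht : Tendsto t l (𝓝 t₀)) (ht' : ∀ᶠ i in l, 0 ≤ t i)
    (ht₀ : 0 ≤ t₀) (hy : Tendsto y l (𝓝 y₀)) :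
    Tendsto (fun i => S (t i) (y i)) l (𝓝 (S t₀ y₀)) := by
  obtain ⟨C, ω, hC, hω, hb⟩ := h.exists_norm_le
  have h1 : Tendsto (fun i => S (t i) y₀) l (𝓝 (S t₀ y₀)) :=
    (h.continuousOn_apply y₀ t₀ ht₀).tendsto.comp (tendsto_nhdsWithin_iff.2 ⟨ht, ht'⟩)
  have h2 : Tendsto (fun i => S (t i) (y i - y₀)) l (𝓝 0) := by
    have h3 : Tendsto (fun i => C * Real.exp (ω * (t₀ + 1)) * ‖y i - y₀‖) l (𝓝 0) := by
      have : Tendsto (fun i => y i - y₀) l (𝓝 0) := by simpa using hy.sub_const y₀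
      simpa using this.norm.const_mul (C * Real.exp (ω * (t₀ + 1)))
    refine squeeze_zero_norm' ?_ h3
    filter_upwards [ht', ht.eventually (gt_mem_nhds (show t₀ < t₀ + 1 by linarith))] with i h0 h4
    refine (ContinuousLinearMap.le_opNorm _ _).trans ?_
    gcongr
    exact (hb _ h0).trans (by gcongr)
  have := h1.add h2
  rw [add_zero] at this
  refine this.congr fun i => ?_
  rw [map_sub]; abel

/-- `S' r * S (c - r)` is constant on `(0, c)`, with strong limits `S c` and `S' c` at the two ends.
As a consequence any admissible sector may be used in the Dunford integral. -/
theorem unique (h : IsAnalyticSemigroup A S D) (h' : IsAnalyticSemigroup A S' D') {c : ℝ}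
    (hc : 0 ≤ c) : S c = S' c := by
  rcases hc.eq_or_lt with rfl | hc
  · rw [h.zero, h'.zero]
  have hd : ∀ r ∈ Ioo 0 c, HasDerivAt (fun r => S' r * S (c - r)) 0 r := by
    intro r hr
    have hr' : 0 < c - r := sub_pos.2 hr.2
    have h1 : HasDerivAt (fun r => S (c - r)) (D (c - r)) r := by
      have := (h.deriv _ hr').scomp r ((hasDerivAt_id r).const_sub c)
      simp only [neg_smul, one_smul, neg_neg] at this
      exact this
    refine ((h'.deriv r hr.1).mul h1).congr_deriv ?_
    have h2 : S' r * D (c - r) = D' r * S (c - r) :=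
      ((h'.comm r hr.1.le).graphOp (h.graph _ hr')).unique ((h'.graph r hr.1).mul _)
    rw [h2, neg_mul, neg_add_cancel]
  ext x
  have hm : c / 2 ∈ Ioo 0 c := ⟨by linarith, by linarith⟩
  have hconst : ∀ r ∈ Ioo 0 c, S' r (S (c - r) x) = (S' (c / 2) * S (c - c / 2)) x := by
    intro r hr
    exact congrArg (fun T : X →L[ℂ] X => T x) (isOpen_Ioo.is_const_of_deriv_eq_zero
      isPreconnected_Ioo (fun r hr => (hd r hr).differentiableAt.differentiableWithinAt)
      (fun r hr => (hd r hr).deriv) hr hm)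
  have hcont : Continuous fun r : ℝ => c - r := by fun_prop
  have h1 : Tendsto (fun r => S' r (S (c - r) x)) (𝓝[>] 0) (𝓝 (S' 0 (S c x))) := by
    refine h'.tendsto_apply (tendsto_id.mono_left nhdsWithin_le_nhds) ?_ le_rfl
      (h.tendsto_apply (by simpa using (hcont.tendsto 0).mono_left nhdsWithin_le_nhds) ?_ hc.le
        tendsto_const_nhds)
    · filter_upwards [self_mem_nhdsWithin] with r hr using (mem_Ioi.1 hr).le
    · filter_upwards [Ioo_mem_nhdsGT hc] with r hr using (sub_pos.2 hr.2).le
  have h2 : Tendsto (fun r => S' r (S (c - r) x)) (𝓝[<] c) (𝓝 (S' c (S 0 x))) := by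
    refine h'.tendsto_apply (tendsto_id.mono_left nhdsWithin_le_nhds) ?_ hc.le
      (h.tendsto_apply (by simpa using (hcont.tendsto c).mono_left nhdsWithin_le_nhds) ?_ le_rfl
        tendsto_const_nhds)
    · filter_upwards [Ioo_mem_nhdsLT hc] with r hr using hr.1.le
    · filter_upwards [Ioo_mem_nhdsLT hc] with r hr using (sub_pos.2 hr.2).le
  rw [h'.zero, one_apply_eq_self] at h1
  rw [h.zero, one_apply_eq_self] at h2
  have h3 : ∀ᶠ r in 𝓝[>] 0, (S' (c / 2) * S (c - c / 2)) x = S' r (S (c - r) x) := by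
    filter_upwards [Ioo_mem_nhdsGT hc] with r hr using (hconst r hr).symm
  have h4 : ∀ᶠ r in 𝓝[<] c, (S' (c / 2) * S (c - c / 2)) x = S' r (S (c - r) x) := by
    filter_upwards [Ioo_mem_nhdsLT hc] with r hr using (hconst r hr).symm
  rw [← tendsto_nhds_unique (tendsto_const_nhds.congr' h3) h1,
    ← tendsto_nhds_unique (tendsto_const_nhds.congr' h4) h2]

end IsAnalyticSemigroup

/-! ### Exponential growth on spectral subspaces -/

theorem IsRelRes.sub {G' : X →L[ℂ] X} (h : IsRelRes A Q z G) (h' : IsRelRes A Q w G') :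
    G - G' = (w - z) • (G * G') := by
  ext x
  have h1 := h.apply_graph _ _ (h'.mem_graph x)
  have h4 : G (Q x) = G x := congrArg (fun T : X →L[ℂ] X => T x) h.right
  have h5 : Q (G' x) = G' x := congrArg (fun T : X →L[ℂ] X => T x) h'.left
  have h2 : z • G' x - (w • G' x - Q x) = Q x - (w - z) • G' x := by rw [sub_smul]; abel
  rw [h2, map_sub, map_smul, h4, h5] at h1
  simp only [sub_apply, smul_apply, mul_apply_eq_comp]
  rw [sub_eq_iff_eq_add, ← sub_eq_iff_eq_add', h1]

theorem hasDerivAt_relRes (h : z ∈ relSet A Q) :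
    HasDerivAt (relRes A Q) (-(relRes A Q z * relRes A Q z)) z := by
  rw [hasDerivAt_iff_tendsto_slope]
  have h1 : Tendsto (fun w => -(relRes A Q w * relRes A Q z)) (𝓝[≠] z)
      (𝓝 (-(relRes A Q z * relRes A Q z))) := by
    have := (differentiableAt_relRes h).continuousAt.tendsto
    exact ((this.mul_const (relRes A Q z)).neg).mono_left nhdsWithin_le_nhds
  refine h1.congr' ?_
  filter_upwards [self_mem_nhdsWithin, nhdsWithin_le_nhds (isOpen_relSet.mem_nhds h)]
    with w hw hw'
  rw [slope_def_module, (isRelRes_relRes hw').sub (isRelRes_relRes h), smul_smul, ← neg_sub w z,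
    mul_neg, inv_mul_cancel₀ (sub_ne_zero.2 hw), neg_one_smul]

namespace IsSectorialWith

variable (hA : IsSectorialWith A b φ K)
include hA

theorem mono_angle {φ' : ℝ} (h1 : φ ≤ φ') (h2 : φ' < Real.pi / 2) : IsSectorialWith A b φ' K where
  closed := hA.closed
  dense := hA.dense
  angle_pos := hA.angle_pos.trans_le h1
  angle_lt := h2
  one_le := hA.one_le
  mem_resolventSet z hz h := hA.mem_resolventSet z hz (h1.trans h)
  norm_resolvent_le z hz h := hA.norm_resolvent_le z hz (h1.trans h)

/-- A contour with vertex `v < m` may be opened so far that it leaves the half-plane `Re z < m`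
only inside the sector of the resolvent set. -/
theorem exists_angle {m' m : ℝ} (hm : m' < m) (hb : b ≤ m') :
    ∃ φ' s₀ : ℝ, φ ≤ φ' ∧ φ' < Real.pi / 2 ∧ 0 < s₀ ∧ s₀ * Real.cos φ' < m - m' ∧
      ∀ v ≤ m', ∀ s : ℝ, s₀ ≤ |s| →
        ((v + ray φ' s : ℂ).re - b) * Real.sin φ ≤ |(v + ray φ' s : ℂ).im| * Real.cos φ := by
  have hφ := hA.cos_pos
  have hs := hA.sin_pos
  -- `s₀` depends on the old angle only, so it is fixed before `φ' → π/2` makes `s₀ cos φ'` small.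
  -- Beyond `s₀` the opened contour lies in the old sector of the resolvent set.
  set s₀ := 2 * (m' - b + 1) * Real.sin φ / Real.cos φ with hs₀
  have hs₀' : 0 < s₀ := by have : 0 < m' - b + 1 := by linarith
                           positivity
  have hcont : Tendsto (fun φ' => s₀ * Real.cos φ') (𝓝[<] (Real.pi / 2)) (𝓝 0) := by
    have : Continuous fun φ' => s₀ * Real.cos φ' := by fun_prop
    have := (this.tendsto (Real.pi / 2)).mono_left (nhdsWithin_le_nhds (s := Iio (Real.pi / 2)))
    simpa using this
  have hcont2 : Tendsto (fun φ' => Real.sin φ' * Real.cos φ - Real.cos φ' * Real.sin φ)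
      (𝓝[<] (Real.pi / 2)) (𝓝 (Real.cos φ)) := by
    have : Continuous fun φ' => Real.sin φ' * Real.cos φ - Real.cos φ' * Real.sin φ := by
      fun_prop
    have := (this.tendsto (Real.pi / 2)).mono_left (nhdsWithin_le_nhds (s := Iio (Real.pi / 2)))
    simpa using this
  obtain ⟨φ', h1, h2, h3, h4⟩ := ((hcont.eventually (gt_mem_nhds (sub_pos.2 hm))).and
    ((hcont2.eventually (lt_mem_nhds (half_lt_self hφ))).and
    (Ioo_mem_nhdsLT hA.angle_lt))).exists
  have hsin' : 0 < Real.sin φ' :=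
    Real.sin_pos_of_pos_of_lt_pi (hA.angle_pos.trans h3) (by linarith [Real.pi_pos])
  refine ⟨φ', s₀, h3.le, h4, hs₀', h1, fun v hv s hs' => ?_⟩
  have e1 : (v + ray φ' s : ℂ).re = v + |s| * Real.cos φ' := by simp
  have e2 : |(v + ray φ' s : ℂ).im| = |s| * Real.sin φ' := by
    simp [abs_mul, abs_of_pos hsin']
  rw [e1, e2]
  have h5 : s₀ * (Real.cos φ / 2) = (m' - b + 1) * Real.sin φ := by
    rw [hs₀]; field_simp
  have h6 : s₀ * (Real.cos φ / 2) ≤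
      |s| * (Real.sin φ' * Real.cos φ - Real.cos φ' * Real.sin φ) :=
    mul_le_mul hs' h2.le (by positivity) (abs_nonneg s)
  have h7 : (v - b) * Real.sin φ ≤ (m' - b + 1) * Real.sin φ :=
    mul_le_mul_of_nonneg_right (by linarith) hs.le
  linarith


/-- For `|s| ≥ s₀` the sectorial estimate applies; for `|s| ≤ s₀` the contour lies in `Re z < m`,
where the relative resolvent is continuous, and compactness gives a bound for vertices in a bounded
interval. -/
theorem exists_norm_relRes_contour_le (hQ : GraphComm A Q) (hi : Q * Q = Q) {m m' φ' s₀ : ℝ}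
    (hm : {z : ℂ | z.re < m} ⊆ relSet A Q) (hφ' : 0 < Real.sin φ') (hs₀ : 0 < s₀)
    (hm' : s₀ * Real.cos φ' < m - m') (hc : 0 ≤ Real.cos φ')
    (h : ∀ v ≤ m', ∀ s : ℝ, s₀ ≤ |s| →
        ((v + ray φ' s : ℂ).re - b) * Real.sin φ ≤ |(v + ray φ' s : ℂ).im| * Real.cos φ) :
    (∀ v ≤ m', ∀ s : ℝ, (v : ℂ) + ray φ' s ∈ relSet A Q) ∧
      ∀ v₁, ∃ M, 0 ≤ M ∧ ∀ v ∈ Icc v₁ m', ∀ s : ℝ, ‖relRes A Q (v + ray φ' s)‖ ≤ M := by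
  have key : ∀ v ≤ m', ∀ s : ℝ, s₀ ≤ |s| → ((v : ℂ) + ray φ' s) ∈ relSet A Q ∧
      ‖relRes A Q (v + ray φ' s)‖ ≤ K / (s₀ * Real.sin φ') * ‖Q‖ := by
    intro v hv s hs
    have him : s₀ * Real.sin φ' ≤ |((v : ℂ) + ray φ' s).im| := by
      have e2 : |(v + ray φ' s : ℂ).im| = |s| * Real.sin φ' := by
        simp [abs_mul, abs_of_pos hφ']
      rw [e2]
      gcongr
    have hne : s₀ * Real.sin φ' ≤ ‖(v : ℂ) + ray φ' s - b‖ := by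
      refine him.trans (le_trans (le_of_eq ?_) (Complex.abs_im_le_norm _))
      simp
    have h0 : 0 < s₀ * Real.sin φ' := by positivity
    obtain ⟨h1, h2⟩ := hA.mem_resolventSet_of_le
      (sub_ne_zero.1 (norm_pos_iff.1 (h0.trans_le hne))) (h v hv s hs)
    have h3 := isRelRes_resolvent_mul h1 hQ hi
    refine ⟨h3.mem, ?_⟩
    rw [h3.eq]
    refine (norm_mul_le _ _).trans ?_
    gcongr
    exact h2.trans (div_le_div_of_nonneg_left hA.K_pos.le h0 hne)
  have key2 : ∀ v ≤ m', ∀ s : ℝ, |s| ≤ s₀ → ((v : ℂ) + ray φ' s) ∈ relSet A Q := by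
    intro v hv s hs
    apply hm
    simp only [mem_ofPred_eq, Complex.add_re, Complex.ofReal_re, ray_re]
    have : |s| * Real.cos φ' ≤ s₀ * Real.cos φ' := by gcongr
    linarith
  refine ⟨fun v hv s => ?_, fun v₁ => ?_⟩
  · rcases le_total s₀ |s| with hs | hs
    · exact (key v hv s hs).1
    · exact key2 v hv s hs
  · have hcpt : IsCompact (Icc v₁ m' ×ˢ Icc (-s₀) s₀) := isCompact_Icc.prod isCompact_Icc
    have hcont : ContinuousOn (fun p : ℝ × ℝ => relRes A Q ((p.1 : ℂ) + ray φ' p.2))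
        (Icc v₁ m' ×ˢ Icc (-s₀) s₀) := by
      intro p hp
      have h1 := (differentiableAt_relRes (key2 p.1 hp.1.2 p.2 (abs_le.2 hp.2))).continuousAt
      have hr := continuous_ray φ'
      have h2 : Continuous fun p : ℝ × ℝ => (p.1 : ℂ) + ray φ' p.2 := by fun_prop
      exact (ContinuousAt.comp (f := fun p : ℝ × ℝ => (p.1 : ℂ) + ray φ' p.2) h1
        h2.continuousAt).continuousWithinAt
    obtain ⟨M, hM⟩ := hcpt.exists_bound_of_continuousOn hcont
    refine ⟨max (K / (s₀ * Real.sin φ') * ‖Q‖) M, le_max_of_le_left ?_, fun v hv s => ?_⟩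
    · have := hA.K_pos
      positivity
    · rcases le_total s₀ |s| with hs | hs
      · exact le_max_of_le_left (key v hv.2 s hs).2
      · exact le_max_of_le_right (hM (v, s) ⟨hv, abs_le.1 hs⟩)

/-- After multiplication by `Q` the integrand is the relative resolvent, which is holomorphic
further to the right than the resolvent itself, so the vertex may pass `b`. -/
theorem dunfordExp_mul_eq (hQ : GraphComm A Q) (hi : Q * Q = Q) {m' t : ℝ} (hb : b ≤ m')
    (ht : 0 < t) (hrel : ∀ v < m', ∀ s : ℝ, (v : ℂ) + ray φ s ∈ relSet A Q)
    (hbd : ∀ v₁, ∃ M, 0 ≤ M ∧ ∀ v ∈ Ico v₁ m', ∀ s : ℝ, ‖relRes A Q (v + ray φ s)‖ ≤ M)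
    {v : ℝ} (hv : v < m') :
    dunfordExp A b φ t * Q = -((2 * Real.pi * Complex.I : ℂ)⁻¹ •
      contourInt φ (fun z => Complex.exp (-(z * t)) • relRes A Q z) v) := by
  have hb1 : b - 1 < b := by linarith
  have h0 : dunfordExp A b φ t * Q = -((2 * Real.pi * Complex.I : ℂ)⁻¹ •
      contourInt φ (fun z => Complex.exp (-(z * t)) • relRes A Q z) (b - 1)) := by
    rw [dunfordExp, neg_mul, smul_mul_assoc, contourInt, contourInt, ← integral_mul_right
      (hA.integrable_contour_exp (g := resolvent A) ht (hA.continuous_resolvent_contour hb1)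
        (hA.norm_resolvent_contour_le hb1))]
    congr 3
    ext1 s
    rw [smul_mul_assoc, smul_mul_assoc,
      (isRelRes_resolvent_mul (hA.contour_mem hb1 s).1 hQ hi).eq]
  rw [h0]
  congr 2
  refine contourInt_shift (V := Iio m')
    (F' := fun z => Complex.exp (-(z * t)) • -(relRes A Q z * relRes A Q z) +
      (-(t : ℂ) * Complex.exp (-(z * t))) • relRes A Q z)
    isOpen_Iio isPreconnected_Iio (fun v hv s => ?_) (fun v₀ hv₀ => ?_)
    (by simp only [mem_Iio]; linarith) hv
  · have h1 := hasDerivAt_relRes (hrel v hv s)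
    have h2 : HasDerivAt (fun z : ℂ => Complex.exp (-(z * t)))
        (-(t : ℂ) * Complex.exp (-(((v : ℂ) + ray φ s) * t))) ((v : ℂ) + ray φ s) := by
      have := ((hasDerivAt_id ((v : ℂ) + ray φ s)).mul_const (t : ℂ)).neg.cexp
      refine this.congr_deriv ?_
      simp [mul_comm]
    exact h2.smul h1
  · obtain ⟨C, hC0, hC⟩ := exists_exp_neg_abs_le (mul_pos hA.cos_pos ht)
    have hv₀' : v₀ < m' := hv₀
    obtain ⟨M, hM0, hM⟩ := hbd (v₀ - 1)
    refine ⟨Real.exp (-((v₀ - 1) * t)) * C * (M + M * M + t * M), ?_⟩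
    filter_upwards [Ioo_mem_nhds (show v₀ - 1 < v₀ by linarith) hv₀']
      with v hv s
    have hR : ‖relRes A Q (v + ray φ s)‖ ≤ M := hM v ⟨hv.1.le, hv.2⟩ s
    have hE : ‖Complex.exp (-(((v : ℂ) + ray φ s) * t))‖ ≤
        Real.exp (-((v₀ - 1) * t)) * (C / (1 + s ^ 2)) := by
      rw [norm_cexp_neg_mul]
      gcongr
      · exact hv.1.le
      · exact hC s
    have hs : (0 : ℝ) < 1 + s ^ 2 := by positivity
    set e := Real.exp (-((v₀ - 1) * t)) with he
    have he0 : 0 < e := Real.exp_pos _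
    have hq : 0 ≤ C / (1 + s ^ 2) := by positivity
    constructor
    · rw [norm_smul]
      calc _ ≤ (e * (C / (1 + s ^ 2))) * M := by gcongr
        _ = e * C * M / (1 + s ^ 2) := by ring
        _ ≤ _ := by
          gcongr
          have : 0 ≤ M * M + t * M := by positivity
          linarith
    · refine (norm_add_le _ _).trans ?_
      have hRR : ‖-(relRes A Q (v + ray φ s) * relRes A Q (v + ray φ s))‖ ≤ M * M := by
        rw [norm_neg]
        exact (norm_mul_le _ _).trans (by gcongr)
      have hE2 : ‖-(t : ℂ) * Complex.exp (-(((v : ℂ) + ray φ s) * t))‖ ≤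
          t * (e * (C / (1 + s ^ 2))) := by
        rw [norm_mul, norm_neg, Complex.norm_real, Real.norm_eq_abs, abs_of_pos ht]
        gcongr
      rw [norm_smul, norm_smul]
      calc _ ≤ (e * (C / (1 + s ^ 2))) * (M * M) + (t * (e * (C / (1 + s ^ 2)))) * M := by
            gcongr
        _ = e * C * (M * M + t * M) / (1 + s ^ 2) := by ring
        _ ≤ _ := by gcongr; linarith

end IsSectorialWith

/-- Exponential decay of the semigroup on a spectral subspace to the right of `Re z = m`. -/
theorem IsAnalyticSemigroup.exists_norm_mul_le (hA : IsSectorial A)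
    (h : IsAnalyticSemigroup A S D) (hQ : GraphComm A Q) (hi : Q * Q = Q) {m m' : ℝ}
    (hm : {z : ℂ | z.re < m} ⊆ relSet A Q) (hm' : m' < m) :
    ∃ C, 0 < C ∧ ∀ t, 0 < t → ‖S t * Q‖ ≤ C * Real.exp (-(m' * t)) := by
  obtain ⟨b, φ, K, hA⟩ := hA
  obtain ⟨C₀, ω, hC₀, hω, hb₀⟩ := h.exists_norm_le
  have hsmall : ∀ t, 0 < t → t ≤ 1 →
      ‖S t * Q‖ ≤ C₀ * Real.exp ω * ‖Q‖ * Real.exp |m'| * Real.exp (-(m' * t)) := by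
    intro t ht ht1
    have h1 : Real.exp (ω * t) ≤ Real.exp ω := by
      apply Real.exp_le_exp.2; nlinarith
    have h2 : 1 ≤ Real.exp |m'| * Real.exp (-(m' * t)) := by
      rw [← Real.exp_add]
      apply Real.one_le_exp
      have : m' * t ≤ |m'| * 1 := by
        refine (mul_le_mul_of_nonneg_right (le_abs_self m') ht.le).trans ?_
        gcongr
      linarith
    calc ‖S t * Q‖ ≤ ‖S t‖ * ‖Q‖ := norm_mul_le _ _
      _ ≤ C₀ * Real.exp ω * ‖Q‖ * 1 := by
        rw [mul_one]
        gcongr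
        exact (hb₀ t ht.le).trans (by gcongr)
      _ ≤ C₀ * Real.exp ω * ‖Q‖ * (Real.exp |m'| * Real.exp (-(m' * t))) := by gcongr
      _ = _ := by ring
  -- Uniqueness of the semigroup gives the Dunford representation for every sector, in particular
  -- for the opened one used below.
  have hrep : ∀ b' φ' K', IsSectorialWith A b' φ' K' → ∀ t, 0 < t → S t = dunfordExp A b' φ' t := by
    intro b' φ' K' hA' t ht
    obtain ⟨D', hD'⟩ := hA'.exists_isAnalyticSemigroup
      (S := fun t => if t = 0 then 1 else dunfordExp A b' φ' t) (by simp)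
      (fun t ht => by simp [ht.ne'])
    rw [h.unique hD' ht.le]
    simp [ht.ne']
  obtain ⟨C₁, hC₁⟩ : ∃ C₁, ∀ t, 1 ≤ t → ‖S t * Q‖ ≤ C₁ * Real.exp (-(m' * t)) := by
    rcases le_total m' b with hb | hb
    · obtain ⟨C, hC⟩ := hA.exists_norm_dunfordExp_le
      -- For `m' ≤ b` the rate of the semigroup itself suffices; the contour has to be moved only in
      -- the other case.
      refine ⟨|C| * ‖Q‖, fun t ht => ?_⟩
      have ht0 : 0 < t := by linarith
      rw [hrep b φ K hA t ht0]
      calc _ ≤ ‖dunfordExp A b φ t‖ * ‖Q‖ := norm_mul_le _ _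
        _ ≤ (|C| * Real.exp (-(m' * t))) * ‖Q‖ := by
          gcongr
          refine (hC t ht0).trans ?_
          gcongr
          exact le_abs_self C
        _ = _ := by ring
    -- The midpoint leaves room on both sides: `n < m` to open the contour, and `m' < n` to place
    -- its vertex exactly at `m'`.
    · set n := (m' + m) / 2 with hn
      obtain ⟨φ', s₀, h1, h2, h3, h4, h5⟩ := hA.exists_angle (m' := n) (m := m)
        (by rw [hn]; linarith) (by rw [hn]; linarith)
      have hA' := hA.mono_angle h1 h2
      obtain ⟨h6, h7⟩ := hA.exists_norm_relRes_contour_le hQ hi hm hA'.sin_pos h3 h4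
        hA'.cos_pos.le h5
      have hmn : m' < n := by rw [hn]; linarith
      obtain ⟨M, hM0, hM⟩ := h7 m'
      have hcos := hA'.cos_pos
      refine ⟨M * (2 / Real.cos φ'), fun t ht => ?_⟩
      have ht0 : 0 < t := by linarith
      rw [hrep b φ' K hA' t ht0, hA'.dunfordExp_mul_eq hQ hi (hb.trans hmn.le) ht0
        (fun v hv => h6 v hv.le) (fun v₁ => by
          obtain ⟨M, h8, h9⟩ := h7 v₁
          exact ⟨M, h8, fun v hv => h9 v ⟨hv.1, hv.2.le⟩⟩) hmn]
      refine (hA'.norm_two_pi_I_inv_smul_le _).trans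
        ((hA'.norm_contour_exp_le ht0 (hM m' ⟨le_rfl, hmn.le⟩)).trans ?_)
      have : 2 / (Real.cos φ' * t) ≤ 2 / Real.cos φ' := by
        apply div_le_div_of_nonneg_left zero_le_two hcos
        nlinarith
      calc _ ≤ Real.exp (-(m' * t)) * M * (2 / Real.cos φ') := by gcongr
        _ = _ := by ring
  refine ⟨C₀ * Real.exp ω * ‖Q‖ * Real.exp |m'| + |C₁| + 1, by positivity, fun t ht => ?_⟩
  rcases le_total t 1 with ht1 | ht1
  · refine (hsmall t ht ht1).trans ?_
    gcongr
    linarith [abs_nonneg C₁]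
  · refine (hC₁ t ht1).trans ?_
    gcongr
    have : 0 ≤ C₀ * Real.exp ω * ‖Q‖ * Real.exp |m'| := by positivity
    linarith [le_abs_self C₁]

theorem IsAnalyticSemigroup.deriv_add (h : IsAnalyticSemigroup A S D) {s t : ℝ} (hs : 0 < s)
    (ht : 0 ≤ t) : D (s + t) = D s * S t :=
  (h.add s t hs.le ht ▸ h.graph (s + t) (by linarith)).unique ((h.graph s hs).mul _)

/-- For large `t` write `D t = D 1 * S (t - 1)` and take the rate from `S (t - 1) * Q`; for `t ≤ 2`
the general bound for `D` differs only by constants. -/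
theorem IsAnalyticSemigroup.exists_norm_deriv_mul_le (h : IsAnalyticSemigroup A S D) {m' C₀ : ℝ}
    (hC : ∀ t, 0 < t → ‖S t * Q‖ ≤ C₀ * Real.exp (-(m' * t))) :
    ∃ C, 0 < C ∧ ∀ t, 0 < t → ‖D t * Q‖ ≤ C * (1 + t⁻¹) * Real.exp (-(m' * t)) := by
  obtain ⟨C, ω, hC0, hb⟩ := h.bound
  have hC₀ : 0 ≤ C₀ := by
    have := (norm_nonneg _).trans (hC 1 one_pos)
    exact nonneg_of_mul_nonneg_left this (Real.exp_pos _)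
  set E := C * Real.exp |ω| * ‖Q‖ * Real.exp |m'| with hE
  have hE0 : 0 ≤ E := by positivity
  set E' := Real.exp (2 * |ω|) * Real.exp (2 * |m'|) * (C * ‖Q‖) with hE'
  have hE0' : 0 ≤ E' := by positivity
  refine ⟨E' + ‖D 1‖ * C₀ * Real.exp m' + 1, by positivity, fun t ht => ?_⟩
  have hti : 0 < t⁻¹ := inv_pos.2 ht
  rcases le_or_gt t 2 with ht1 | ht1
  · have h1 : ω * t ≤ 2 * |ω| := by
      refine (mul_le_mul_of_nonneg_right (le_abs_self ω) ht.le).trans ?_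
      rw [mul_comm]; gcongr
    have h2 : 1 ≤ Real.exp (2 * |m'|) * Real.exp (-(m' * t)) := by
      rw [← Real.exp_add]
      apply Real.one_le_exp
      have : m' * t ≤ |m'| * 2 := by
        refine (mul_le_mul_of_nonneg_right (le_abs_self m') ht.le).trans ?_
        gcongr
      linarith
    calc ‖D t * Q‖ ≤ ‖D t‖ * ‖Q‖ := norm_mul_le _ _
      _ ≤ (C * t⁻¹ * Real.exp (2 * |ω|)) * ‖Q‖ := by
        gcongr
        exact (hb t ht).2.trans (by gcongr)
      _ = Real.exp (2 * |ω|) * (C * ‖Q‖) * t⁻¹ * 1 := by ring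
      _ ≤ Real.exp (2 * |ω|) * (C * ‖Q‖) * t⁻¹ * (Real.exp (2 * |m'|) * Real.exp (-(m' * t))) := by
        gcongr
      _ = E' * t⁻¹ * Real.exp (-(m' * t)) := by rw [hE']; ring
      _ ≤ _ := by
        gcongr
        · have : 0 ≤ ‖D 1‖ * C₀ * Real.exp m' := by positivity
          linarith
        · linarith
  · have e : D t = D 1 * S (t - 1) := by
      rw [← h.deriv_add one_pos (by linarith)]
      congr 1
      ring
    rw [e, mul_assoc]
    calc _ ≤ ‖D 1‖ * ‖S (t - 1) * Q‖ := norm_mul_le _ _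
      _ ≤ ‖D 1‖ * (C₀ * Real.exp (-(m' * (t - 1)))) := by
        gcongr
        exact hC _ (by linarith)
      _ = ‖D 1‖ * C₀ * Real.exp m' * 1 * Real.exp (-(m' * t)) := by
        rw [show -(m' * (t - 1)) = m' + -(m' * t) by ring, Real.exp_add]
        ring
      _ ≤ _ := by
        gcongr
        · linarith
        · linarith

end Complete

end

/-! ### Derivatives of operators applied to vectors, and the weight `t^{-γ} e^{-δt}` -/

section
section Apply

theorem _root_.HasDerivAt.op_apply {T : ℝ → X →L[ℂ] X} {u : ℝ → X} {T' : X →L[ℂ] X} {u' : X}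
    {t : ℝ} (hT : HasDerivAt T T' t) (hu : HasDerivAt u u' t) :
    HasDerivAt (fun s => T s (u s)) (T' (u t) + T t u') t := by
  have h1 := (ContinuousLinearMap.restrictScalarsL ℂ X X ℝ ℝ).hasFDerivAt.comp_hasDerivAt t hT
  exact h1.clm_apply hu

theorem _root_.HasDerivAt.op_apply_const {T : ℝ → X →L[ℂ] X} {T' : X →L[ℂ] X}
    {t : ℝ} (hT : HasDerivAt T T' t) (x : X) : HasDerivAt (fun s => T s x) (T' x) t := by
  simpa using hT.op_apply (hasDerivAt_const t x)

theorem integrableOn_rpow_mul_exp {γ δ : ℝ} (hγ : γ < 1) (hδ : 0 < δ) :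
    IntegrableOn (fun t : ℝ => t ^ (-γ) * Real.exp (-(δ * t))) (Ioi 0) := by
  have := integrableOn_rpow_mul_exp_neg_mul_rpow (p := 1) (s := -γ) (b := δ) (by linarith)
    one_pos hδ
  simpa only [Real.rpow_one, neg_mul] using this

theorem integrableOn_Ioi_of_norm_le {E : Type*} [NormedAddCommGroup E] {F : ℝ → E} {C γ δ : ℝ}
    (hF : ContinuousOn F (Ioi 0)) (hγ : γ < 1) (hδ : 0 < δ)
    (h : ∀ t, 0 < t → ‖F t‖ ≤ C * (t ^ (-γ) * Real.exp (-(δ * t)))) : IntegrableOn F (Ioi 0) := by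
  refine ((integrableOn_rpow_mul_exp hγ hδ).const_mul C).mono'
    (hF.aestronglyMeasurable measurableSet_Ioi) ?_
  exact (ae_restrict_iff' measurableSet_Ioi).2 (Eventually.of_forall fun t ht => h t ht)

end Apply

/-! ### Decaying analytic semigroups and fractional powers of the generator -/

/-- `T` is an exponentially decaying analytic semigroup, with `L t = -T' t`. -/
structure IsDecaying (T L : ℝ → X →L[ℂ] X) (C δ : ℝ) : Prop where
  C_pos : 0 < C
  δ_pos : 0 < δ
  zero : T 0 = 1
  add : ∀ s t, 0 ≤ s → 0 ≤ t → T (s + t) = T s * T t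
  deriv : ∀ t, 0 < t → HasDerivAt T (-L t) t
  tendsto : ∀ x, Tendsto (fun t => T t x) (𝓝[>] 0) (𝓝 x)
  norm_le : ∀ t, 0 ≤ t → ‖T t‖ ≤ C * Real.exp (-(δ * t))
  norm_deriv_le : ∀ t, 0 < t → ‖L t‖ ≤ C * t⁻¹ * Real.exp (-(δ * t))

/-- The fractional integral `Γ(α)⁻¹ ∫_0^∞ t^{α-1} T(t) dt`. -/
def fracInt (T : ℝ → X →L[ℂ] X) (α : ℝ) : X →L[ℂ] X :=
  if α = 0 then 1 else ((Real.Gamma α : ℂ))⁻¹ •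
    ∫ t in Ioi (0 : ℝ), ((t ^ (α - 1) : ℝ) : ℂ) • T t

/-- The Beta integral `B(α, 1 - α)`; it does not depend on `x` because the exponents add up to `-1`.
-/
theorem integral_rpow_mul_rpow {α x : ℝ} (h0 : 0 < α) (h1 : α < 1) (hx : 0 < x) :
    ∫ t in (0 : ℝ)..x, ((t ^ (α - 1) * (x - t) ^ (-α) : ℝ) : ℂ) =
      Real.Gamma α * Real.Gamma (1 - α) := by
  have h2 := Complex.betaIntegral_scaled α (1 - α : ℝ) hx
  have h3 := Complex.Gamma_mul_Gamma_eq_betaIntegral (s := α) (t := (1 - α : ℝ))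
    (by simpa using h0) (by rw [Complex.ofReal_re]; linarith)
  have e : (α : ℂ) + ((1 - α : ℝ) : ℂ) = 1 := by push_cast; ring
  rw [e, Complex.Gamma_one, one_mul, Complex.Gamma_ofReal, Complex.Gamma_ofReal] at h3
  rw [e, sub_self, Complex.cpow_zero, one_mul, ← h3] at h2
  rw [← h2]
  refine intervalIntegral.integral_congr_ae ?_
  have : ∀ᵐ t : ℝ, t ≠ x := by simp [ae_iff, measure_singleton]
  filter_upwards [this] with t htx ht
  rw [uIoc_of_le hx.le] at ht
  have ht' : 0 ≤ x - t := by linarith [ht.2]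
  rw [Complex.ofReal_mul, Complex.ofReal_cpow ht.1.le, Complex.ofReal_cpow ht']
  push_cast
  congr 2
  ring

namespace IsDecaying

variable {T L : ℝ → X →L[ℂ] X} {C δ α : ℝ}

theorem continuousOn (h : IsDecaying T L C δ) : ContinuousOn T (Ioi 0) :=
  fun t ht => (h.deriv t ht).continuousAt.continuousWithinAt

theorem deriv_add (h : IsDecaying T L C δ) {s t : ℝ} (hs : 0 < s) (ht : 0 ≤ t) :
    L (s + t) = L s * T t := by
  have h1 : HasDerivAt (fun s => T (s + t)) (-L (s + t)) s := by
    have := (h.deriv (s + t) (by linarith)).scomp s ((hasDerivAt_id s).add_const t)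
    rw [one_smul] at this
    exact this
  have h2 : HasDerivAt (fun s => T s * T t) (-L s * T t) s := (h.deriv s hs).mul_const (T t)
  have h3 : (fun s => T (s + t)) =ᶠ[𝓝 s] fun s => T s * T t := by
    filter_upwards [lt_mem_nhds hs] with r hr using h.add r t hr.le ht
  have := (h1.congr_of_eventuallyEq h3.symm).unique h2
  rw [neg_mul] at this
  exact neg_injective this

theorem commute (h : IsDecaying T L C δ) {s t : ℝ} (hs : 0 ≤ s) (ht : 0 ≤ t) :
    Commute (T s) (T t) := by
  rw [Commute, SemiconjBy, ← h.add s t hs ht, ← h.add t s ht hs, add_comm]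

theorem _root_.SectorialIM.commute_deriv {T : ℝ → X →L[ℂ] X} {B T' : X →L[ℂ] X} {s : ℝ}
    (hd : HasDerivAt T T' s) (hB : ∀ᶠ r in 𝓝 s, Commute B (T r)) : Commute B T' := by
  have h1 := hd.const_mul B
  have h2 := hd.mul_const B
  exact (h1.congr_of_eventuallyEq (hB.mono fun r hr => hr.eq.symm)).unique h2

theorem commute_deriv (h : IsDecaying T L C δ) {B : X →L[ℂ] X}
    (hB : ∀ t, 0 < t → Commute B (T t)) {s : ℝ} (hs : 0 < s) : Commute B (L s) := by
  have := SectorialIM.commute_deriv (h.deriv s hs)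
    (by filter_upwards [lt_mem_nhds hs] with r hr using hB r hr)
  simpa using this.neg_right

theorem continuousOn_deriv (h : IsDecaying T L C δ) : ContinuousOn L (Ioi 0) := by
  intro t ht
  have ht : 0 < t := ht
  have h1 : ContinuousAt (fun s => L (t / 2) * T (s - t / 2)) t := by
    have h2 : ContinuousAt T (t - t / 2) := (h.deriv (t - t / 2) (by linarith)).continuousAt
    exact continuousAt_const.mul
      (ContinuousAt.comp (f := fun s : ℝ => s - t / 2) h2 (by fun_prop))
  refine (h1.congr ?_).continuousWithinAt
  filter_upwards [lt_mem_nhds (show t / 2 < t by linarith)] with s hs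
  rw [← h.deriv_add (by linarith) (by linarith)]
  congr 1; ring

theorem continuousOn_apply (h : IsDecaying T L C δ) (x : X) :
    ContinuousOn (fun t => T t x) (Ici 0) := by
  intro t ht
  rcases (mem_Ici.1 ht).eq_or_lt with rfl | ht
  · rw [← continuousWithinAt_Ioi_iff_Ici, ContinuousWithinAt, h.zero]
    exact h.tendsto x
  · exact ((ContinuousLinearMap.apply ℂ X x).continuous.continuousAt.comp
      (h.deriv t ht).continuousAt).continuousWithinAt

theorem norm_le' (h : IsDecaying T L C δ) {t : ℝ} (ht : 0 ≤ t) : ‖T t‖ ≤ C := by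
  refine (h.norm_le t ht).trans ?_
  have : Real.exp (-(δ * t)) ≤ 1 := Real.exp_le_one_iff.2 (by have := h.δ_pos; nlinarith)
  exact mul_le_of_le_one_right h.C_pos.le this

theorem norm_rpow_smul_le (h : IsDecaying T L C δ) {γ t : ℝ} (ht : 0 < t) :
    ‖((t ^ γ : ℝ) : ℂ) • T t‖ ≤ C * (t ^ γ * Real.exp (-(δ * t))) := by
  rw [norm_smul, Complex.norm_real, Real.norm_eq_abs, abs_of_nonneg (Real.rpow_nonneg ht.le _)]
  calc _ ≤ t ^ γ * (C * Real.exp (-(δ * t))) := by gcongr; exact h.norm_le t ht.le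
    _ = _ := by ring

theorem continuousOn_rpow_smul {E : Type*} [NormedAddCommGroup E] [NormedSpace ℂ E] {F : ℝ → E}
    (hF : ContinuousOn F (Ioi 0)) (γ : ℝ) :
    ContinuousOn (fun t => ((t ^ γ : ℝ) : ℂ) • F t) (Ioi 0) := by
  refine ContinuousOn.smul (f := fun t : ℝ => ((t ^ γ : ℝ) : ℂ)) ?_ hF
  refine Complex.continuous_ofReal.comp_continuousOn ?_
  exact fun t ht => (Real.continuousAt_rpow_const t γ (Or.inl (ne_of_gt ht))).continuousWithinAt

theorem integrableOn (h : IsDecaying T L C δ) {γ : ℝ} (hγ : -1 < γ) :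
    IntegrableOn (fun t : ℝ => ((t ^ γ : ℝ) : ℂ) • T t) (Ioi 0) := by
  refine integrableOn_Ioi_of_norm_le (C := C) (γ := -γ) (continuousOn_rpow_smul h.continuousOn γ)
    (by linarith) h.δ_pos fun t ht => ?_
  rw [neg_neg]
  exact h.norm_rpow_smul_le ht

section Complete

variable [CompleteSpace X]

/-- The product of the two integrals is the integral of their convolution. Since `T t * T (x - t) =
T x`, the inner integral is a scalar Beta integral, which the Gamma factors cancel. -/
theorem fracInt_mul (h : IsDecaying T L C δ) (h0 : 0 ≤ α) (h1 : α < 1) :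
    fracInt T α * fracInt T (1 - α) = fracInt T 1 := by
  rcases h0.eq_or_lt with rfl | h0
  · rw [sub_zero]
    simp [fracInt]
  have hα : α ≠ 0 := h0.ne'
  have hα' : 1 - α ≠ 0 := by linarith
  rw [fracInt, if_neg hα, fracInt, if_neg hα', fracInt, if_neg one_ne_zero, smul_mul_smul_comm]
  have hi1 := h.integrableOn (γ := α - 1) (by linarith)
  have hi2 := h.integrableOn (γ := 1 - α - 1) (by linarith)
  have key := integral_posConvolution hi1 hi2 (ContinuousLinearMap.mul ℝ (X →L[ℂ] X))
  simp only [ContinuousLinearMap.mul_apply'] at key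
  rw [← key]
  have e : ∀ x ∈ Ioi (0 : ℝ), ∫ t in (0 : ℝ)..x, (((t ^ (α - 1) : ℝ) : ℂ) • T t) *
      ((((x - t) ^ (1 - α - 1) : ℝ) : ℂ) • T (x - t)) =
      ((Real.Gamma α : ℂ) * Real.Gamma (1 - α)) • (((x ^ ((1 : ℝ) - 1) : ℝ) : ℂ) • T x) := by
    intro x hx
    rw [sub_self, Real.rpow_zero, Complex.ofReal_one, one_smul, ← integral_rpow_mul_rpow h0 h1 hx]
    refine Eq.trans ?_ (intervalIntegral.integral_smul_const
      (fun t : ℝ => ((t ^ (α - 1) * (x - t) ^ (-α) : ℝ) : ℂ)) (T x))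
    refine intervalIntegral.integral_congr fun t ht => ?_
    rw [uIcc_of_le (le_of_lt hx)] at ht
    rw [smul_mul_smul_comm, ← h.add t (x - t) ht.1 (by linarith [ht.2]), add_sub_cancel,
      ← Complex.ofReal_mul, show 1 - α - 1 = -α by ring]
  rw [setIntegral_congr_fun measurableSet_Ioi e, integral_smul, Real.Gamma_one, smul_smul]
  congr 1
  have g1 : (Real.Gamma α : ℂ) ≠ 0 := Complex.ofReal_ne_zero.2 (Real.Gamma_pos_of_pos h0).ne'
  have g2 : (Real.Gamma (1 - α) : ℂ) ≠ 0 :=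
    Complex.ofReal_ne_zero.2 (Real.Gamma_pos_of_pos (by linarith)).ne'
  field_simp
  simp

theorem commute_fracInt (h : IsDecaying T L C δ) {B : X →L[ℂ] X}
    (hB : ∀ t, 0 < t → Commute B (T t)) (h0 : 0 ≤ α) : Commute B (fracInt T α) := by
  rcases h0.eq_or_lt with rfl | h0
  · simp [fracInt]
  rw [fracInt, if_neg h0.ne']
  refine Commute.smul_right ?_ _
  have hi := h.integrableOn (γ := α - 1) (by linarith)
  rw [Commute, SemiconjBy, ← integral_mul_left hi, ← integral_mul_right hi]
  refine setIntegral_congr_fun measurableSet_Ioi fun t ht => ?_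
  simp only [mul_smul_comm, smul_mul_assoc, (hB t ht).eq]

theorem fracInt_one (T : ℝ → X →L[ℂ] X) : fracInt T 1 = ∫ t in Ioi (0 : ℝ), T t := by
  simp [fracInt]

/-- `L t ∫ T s ds = ∫ L (t + s) ds = T t`. This is how `fracInt T 1` acts as `Λ⁻¹` before any
generator is mentioned. -/
theorem deriv_mul_fracInt_one (h : IsDecaying T L C δ) {t : ℝ} (ht : 0 < t) :
    L t * fracInt T 1 = T t := by
  have hi := h.integrableOn (γ := 0) (by norm_num)
  simp only [Real.rpow_zero, Complex.ofReal_one, one_smul] at hi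
  rw [fracInt_one, ← integral_mul_left hi]
  have hd : ∀ s ∈ Ioi (0 : ℝ), HasDerivAt (fun s => -T (t + s)) (L t * T s) s := by
    intro s hs
    have := ((h.deriv (t + s) (by linarith [mem_Ioi.1 hs])).scomp s
      ((hasDerivAt_id s).const_add t)).fun_neg
    refine this.congr_deriv ?_
    rw [one_smul, neg_neg, h.deriv_add ht (le_of_lt hs)]
  have hlim : Tendsto (fun s => -T (t + s)) atTop (𝓝 0) := by
    have h1 : Tendsto (fun s : ℝ => C * Real.exp (-(δ * s))) atTop (𝓝 0) := by
      have : Tendsto (fun s : ℝ => δ * s) atTop atTop := tendsto_id.const_mul_atTop h.δ_pos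
      simpa using (Real.tendsto_exp_neg_atTop_nhds_zero.comp this).const_mul C
    refine squeeze_zero_norm' ?_ h1
    filter_upwards [eventually_ge_atTop 0] with s hs
    rw [norm_neg]
    refine (h.norm_le (t + s) (by linarith)).trans ?_
    have := h.C_pos
    have := h.δ_pos
    gcongr
    linarith
  have hc : ContinuousWithinAt (fun s => -T (t + s)) (Ici 0) 0 := by
    have h2 : ContinuousAt T (t + 0) := by rw [add_zero]; exact (h.deriv t ht).continuousAt
    exact (ContinuousAt.comp (f := fun s : ℝ => t + s) h2 (by fun_prop)).neg.continuousWithinAt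
  rw [integral_Ioi_of_hasDerivAt_of_tendsto hc hd (hi.const_mul' (L t)) hlim]
  simp

theorem commute_fracInt_one (h : IsDecaying T L C δ) {t : ℝ} (ht : 0 < t) :
    Commute (fracInt T 1) (L t) :=
  h.commute_deriv (fun _ hs => (h.commute_fracInt (fun _ hr => h.commute hs.le hr.le)
    zero_le_one).symm) ht

theorem fracInt_one_mul_deriv (h : IsDecaying T L C δ) {t : ℝ} (ht : 0 < t) :
    fracInt T 1 * L t = T t := by
  rw [(h.commute_fracInt_one ht).eq, h.deriv_mul_fracInt_one ht]

theorem fracInt_one_injective (h : IsDecaying T L C δ) : Function.Injective (fracInt T 1) := by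
  rw [injective_iff_map_eq_zero]
  intro x hx
  refine tendsto_nhds_unique (h.tendsto x) (tendsto_const_nhds.congr' ?_)
  filter_upwards [self_mem_nhdsWithin] with t ht
  rw [← h.deriv_mul_fracInt_one ht, mul_apply_eq_comp, hx, map_zero]

theorem fracInt_commute (h : IsDecaying T L C δ) {α' : ℝ} (h0 : 0 ≤ α) (h0' : 0 ≤ α') :
    Commute (fracInt T α) (fracInt T α') :=
  h.commute_fracInt (fun _ ht => (h.commute_fracInt (fun _ hs => h.commute ht.le hs.le) h0).symm)
    h0'

theorem fracInt_injective (h : IsDecaying T L C δ) (h0 : 0 ≤ α) (h1 : α < 1) :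
    Function.Injective (fracInt T α) := by
  have e : fracInt T (1 - α) * fracInt T α = fracInt T 1 := by
    rw [(h.fracInt_commute (by linarith) h0).eq, h.fracInt_mul h0 h1]
  intro x y hxy
  apply h.fracInt_one_injective
  rw [← e, mul_apply_eq_comp, hxy]
  rfl

theorem exists_inv_Gamma_le : ∃ c : ℝ, 1 ≤ c ∧ ∀ α ∈ Ico (0 : ℝ) 1,
    (Real.Gamma (2 - α))⁻¹ ≤ c := by
  have hc : ContinuousOn (fun α => (Real.Gamma (2 - α))⁻¹) (Icc (0 : ℝ) 1) := by
    intro α hα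
    have h2 : 0 < 2 - α := by linarith [hα.2]
    have h1 : ContinuousAt Real.Gamma (2 - α) := by
      refine (Real.differentiableAt_Gamma fun m => ?_).continuousAt
      have : (0 : ℝ) ≤ m := Nat.cast_nonneg m
      linarith
    exact ((ContinuousAt.comp (f := fun α : ℝ => 2 - α) h1 (by fun_prop)).inv₀
      (Real.Gamma_pos_of_pos h2).ne').continuousWithinAt
  obtain ⟨M, hM⟩ := isCompact_Icc.exists_bound_of_continuousOn hc
  exact ⟨max M 1, le_max_right _ _, fun α hα => le_max_of_le_left
    ((le_abs_self _).trans (hM α ⟨hα.1, hα.2.le⟩))⟩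

theorem norm_integral_Ioc_le (h : IsDecaying T L C δ) (h1 : α < 1) {τ : ℝ} (hτ : 0 < τ) (z : X) :
    ‖∫ t in Ioc 0 τ, ((t ^ (-α) : ℝ) : ℂ) • T t z‖ ≤ C * τ ^ (1 - α) / (1 - α) * ‖z‖ := by
  have e : ∫ t in (0 : ℝ)..τ, C * ‖z‖ * t ^ (-α) = C * τ ^ (1 - α) / (1 - α) * ‖z‖ := by
    rw [intervalIntegral.integral_const_mul, integral_rpow (Or.inl (by linarith)),
      show -α + 1 = 1 - α by ring, Real.zero_rpow (by linarith)]
    ring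
  rw [← e, ← intervalIntegral.integral_of_le hτ.le]
  refine intervalIntegral.norm_integral_le_of_norm_le hτ.le (Eventually.of_forall fun t ht => ?_)
    ((intervalIntegral.intervalIntegrable_rpow' (by linarith)).const_mul _)
  rw [norm_smul, Complex.norm_real, Real.norm_eq_abs, abs_of_nonneg (Real.rpow_nonneg ht.1.le _)]
  have h2 : ‖T t z‖ ≤ C * ‖z‖ := (ContinuousLinearMap.le_opNorm _ _).trans
    (by gcongr; exact h.norm_le' ht.1.le)
  calc _ ≤ t ^ (-α) * (C * ‖z‖) := by
        gcongr
        exact Real.rpow_nonneg ht.1.le _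
    _ = _ := by ring

/-- Integrate by parts with `x = Λ⁻¹ z`, so that `T t z = -(T t x)'`. The boundary term and `α ∫
t^{-α-1} T t x dt` are each at most `C τ^{-α} ‖x‖`; the factor `α` cancels the one from integrating
the power. -/
theorem norm_integral_Ioi_le (h : IsDecaying T L C δ) (h0 : 0 < α) (h1 : α < 1) {τ : ℝ}
    (hτ : 0 < τ) (z : X) :
    ‖∫ t in Ioi τ, ((t ^ (-α) : ℝ) : ℂ) • T t z‖ ≤ 2 * C * τ ^ (-α) * ‖fracInt T 1 z‖ := by
  set x := fracInt T 1 z with hx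
  have hTL : ∀ t, 0 < t → T t z = L t x := fun t ht => by
    rw [← h.deriv_mul_fracInt_one ht]; rfl
  have hpos : ∀ t ∈ Ioi τ, 0 < t := fun t ht => hτ.trans ht
  have hi : IntegrableOn (fun t => ((t ^ (-α) : ℝ) : ℂ) • T t z) (Ioi τ) := by
    have : IntegrableOn (fun t => ((t ^ (-α) : ℝ) : ℂ) • T t z) (Ioi 0) :=
      (h.integrableOn (γ := -α) (by linarith)).apply_continuousLinearMap z
    exact this.mono_set (Ioi_subset_Ioi hτ.le)
  have hc2 : ContinuousOn (fun t => ((t ^ (-α - 1) : ℝ) : ℂ) • T t x) (Ioi 0) :=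
    continuousOn_rpow_smul ((h.continuousOn_apply x).mono Ioi_subset_Ici_self) _
  have hb2 : ∀ t ∈ Ioi τ, ‖((t ^ (-α - 1) : ℝ) : ℂ) • T t x‖ ≤ C * ‖x‖ * t ^ (-α - 1) := by
    intro t ht
    have ht := hpos t ht
    rw [norm_smul, Complex.norm_real, Real.norm_eq_abs, abs_of_nonneg (Real.rpow_nonneg ht.le _)]
    have h2 : ‖T t x‖ ≤ C * ‖x‖ := (ContinuousLinearMap.le_opNorm _ _).trans
      (by gcongr; exact h.norm_le' ht.le)
    calc _ ≤ t ^ (-α - 1) * (C * ‖x‖) := by gcongr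
      _ = _ := by ring
  have hr := integrableOn_Ioi_rpow_of_lt (a := -α - 1) (by linarith) hτ
  have hi2 : IntegrableOn (fun t => ((t ^ (-α - 1) : ℝ) : ℂ) • T t x) (Ioi τ) :=
    (hr.const_mul (C * ‖x‖)).mono'
      ((hc2.mono (Ioi_subset_Ioi hτ.le)).aestronglyMeasurable measurableSet_Ioi)
      ((ae_restrict_iff' measurableSet_Ioi).2 (Eventually.of_forall hb2))
  have hd : ∀ t, 0 < t → HasDerivAt (fun t => ((t ^ (-α) : ℝ) : ℂ) • T t x)
      (-(α : ℂ) • (((t ^ (-α - 1) : ℝ) : ℂ) • T t x) - ((t ^ (-α) : ℝ) : ℂ) • T t z) t := by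
    intro t ht
    have h2 := (Real.hasDerivAt_rpow_const (x := t) (p := -α) (Or.inl ht.ne')).ofReal_comp
    have h3 : HasDerivAt (fun s => T s x) (-(L t x)) t := (h.deriv t ht).op_apply_const x
    refine (h2.smul h3).congr_deriv ?_
    rw [hTL t ht]
    push_cast
    simp only [smul_neg, mul_smul, neg_smul]
    abel
  have hlim : Tendsto (fun t => ((t ^ (-α) : ℝ) : ℂ) • T t x) atTop (𝓝 0) := by
    have h2 : Tendsto (fun t : ℝ => t ^ (-α) * (C * ‖x‖)) atTop (𝓝 0) := by
      simpa using (tendsto_rpow_neg_atTop h0).mul_const (C * ‖x‖)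
    refine squeeze_zero_norm' ?_ h2
    filter_upwards [eventually_gt_atTop 0] with t ht
    rw [norm_smul, Complex.norm_real, Real.norm_eq_abs, abs_of_nonneg (Real.rpow_nonneg ht.le _)]
    gcongr
    exact (ContinuousLinearMap.le_opNorm _ _).trans (by gcongr; exact h.norm_le' ht.le)
  have key := integral_Ioi_of_hasDerivAt_of_tendsto (hd τ hτ).continuousAt.continuousWithinAt
    (fun t ht => hd t (hpos t ht)) ((hi2.smul (-(α : ℂ))).sub hi) hlim
  have hs := integral_sub (hi2.smul (-(α : ℂ))) hi
  simp only [Pi.smul_apply] at hs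
  rw [hs, integral_smul, zero_sub] at key
  have key2 : ∫ t in Ioi τ, ((t ^ (-α) : ℝ) : ℂ) • T t z = ((τ ^ (-α) : ℝ) : ℂ) • T τ x -
      (α : ℂ) • ∫ t in Ioi τ, ((t ^ (-α - 1) : ℝ) : ℂ) • T t x := by
    rw [sub_eq_iff_eq_add] at key
    rw [neg_smul, neg_eq_iff_eq_neg, neg_add, neg_neg] at key
    rw [key]; abel
  rw [key2]
  have b1 : ‖((τ ^ (-α) : ℝ) : ℂ) • T τ x‖ ≤ C * τ ^ (-α) * ‖x‖ := by
    rw [norm_smul, Complex.norm_real, Real.norm_eq_abs, abs_of_nonneg (Real.rpow_nonneg hτ.le _)]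
    calc _ ≤ τ ^ (-α) * (C * ‖x‖) := by
          gcongr
          exact (ContinuousLinearMap.le_opNorm _ _).trans (by gcongr; exact h.norm_le' hτ.le)
      _ = _ := by ring
  have b2 : ‖(α : ℂ) • ∫ t in Ioi τ, ((t ^ (-α - 1) : ℝ) : ℂ) • T t x‖ ≤ C * τ ^ (-α) * ‖x‖ := by
    rw [norm_smul, Complex.norm_real, Real.norm_eq_abs, abs_of_pos h0]
    have := norm_integral_le_of_norm_le (hr.const_mul (C * ‖x‖))
      ((ae_restrict_iff' measurableSet_Ioi).2 (Eventually.of_forall hb2))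
    rw [integral_const_mul, integral_Ioi_rpow_of_lt (by linarith) hτ, sub_add_cancel,
      neg_div_neg_eq] at this
    calc _ ≤ α * (C * ‖x‖ * (τ ^ (-α) / α)) := by gcongr
      _ = _ := by field_simp
  calc _ ≤ _ := norm_sub_le _ _
    _ ≤ C * τ ^ (-α) * ‖x‖ + C * τ ^ (-α) * ‖x‖ := add_le_add b1 b2
    _ = _ := by ring

/-- The moment inequality for fractional powers, with a constant uniform in the exponent. -/
theorem exists_norm_fracInt_le (h : IsDecaying T L C δ) : ∃ c, 0 < c ∧ ∀ α ∈ Ico (0 : ℝ) 1,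
    ∀ z : X, ∀ τ, 0 < τ → ‖fracInt T (1 - α) z‖ ≤
      c * (τ ^ (1 - α) * ‖z‖ + τ ^ (-α) * ‖fracInt T 1 z‖) := by
  obtain ⟨c, hc1, hc⟩ := exists_inv_Gamma_le
  have hC := h.C_pos
  refine ⟨2 * C * c + 1, by positivity, fun α hα z τ hτ => ?_⟩
  -- The tail estimate needs `α > 0`; for `α = 0` the left-hand side is `‖fracInt T 1 z‖` itself.
  rcases hα.1.eq_or_lt with rfl | h0
  · rw [sub_zero, neg_zero, Real.rpow_one, Real.rpow_zero, one_mul]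
    have : 0 ≤ τ * ‖z‖ := by positivity
    have h3 : 0 ≤ ‖fracInt T 1 z‖ := norm_nonneg _
    have h4 : 0 ≤ 2 * C * c := by positivity
    nlinarith
  have h1 : 0 < 1 - α := by linarith [hα.2]
  have hi : IntegrableOn (fun t => ((t ^ (-α) : ℝ) : ℂ) • T t z) (Ioi 0) :=
    (h.integrableOn (γ := -α) (by linarith)).apply_continuousLinearMap z
  have e : fracInt T (1 - α) z = ((Real.Gamma (1 - α) : ℂ))⁻¹ •
      ((∫ t in Ioc 0 τ, ((t ^ (-α) : ℝ) : ℂ) • T t z) +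
        ∫ t in Ioi τ, ((t ^ (-α) : ℝ) : ℂ) • T t z) := by
    rw [← setIntegral_union (Ioc_disjoint_Ioi le_rfl) measurableSet_Ioi
      (hi.mono_set Ioc_subset_Ioi_self) (hi.mono_set (Ioi_subset_Ioi hτ.le)),
      Ioc_union_Ioi_eq_Ioi hτ.le, fracInt, if_neg h1.ne', smul_apply,
      show 1 - α - 1 = -α by ring,
      ContinuousLinearMap.integral_apply (h.integrableOn (γ := -α) (by linarith))]
    simp only [smul_apply]
  -- The factor `1 - α` cancels the denominator that comes from `∫_0^τ t^{-α} dt`. This is the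
  -- source of uniformity as `α → 1`.
  have hG : (Real.Gamma (1 - α))⁻¹ = (1 - α) * (Real.Gamma (2 - α))⁻¹ := by
    rw [show 2 - α = 1 - α + 1 by ring, Real.Gamma_add_one h1.ne']
    have := Real.Gamma_pos_of_pos h1
    field_simp
  have hG0 : 0 < Real.Gamma (1 - α) := Real.Gamma_pos_of_pos h1
  have hG2 : 0 < (Real.Gamma (2 - α))⁻¹ := inv_pos.2 (Real.Gamma_pos_of_pos (by linarith))
  have hGc := hc α hα
  rw [e, norm_smul, norm_inv, Complex.norm_real, Real.norm_eq_abs, abs_of_pos hG0, hG]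
  have b1 := h.norm_integral_Ioc_le hα.2 hτ z
  have b2 := h.norm_integral_Ioi_le h0 hα.2 hτ z
  set u := fracInt T 1 z with hu
  have p1 : 0 ≤ τ ^ (1 - α) := Real.rpow_nonneg hτ.le _
  have p2 : 0 ≤ τ ^ (-α) := Real.rpow_nonneg hτ.le _
  calc _ ≤ (1 - α) * (Real.Gamma (2 - α))⁻¹ * (C * τ ^ (1 - α) / (1 - α) * ‖z‖ +
        2 * C * τ ^ (-α) * ‖u‖) := by
        gcongr
        exact (norm_add_le _ _).trans (add_le_add b1 b2)
    _ = (Real.Gamma (2 - α))⁻¹ * (C * τ ^ (1 - α) * ‖z‖ +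
        (1 - α) * (2 * C * τ ^ (-α) * ‖u‖)) := by field_simp
    _ ≤ c * (2 * C * (τ ^ (1 - α) * ‖z‖) + 1 * (2 * C * τ ^ (-α) * ‖u‖)) := by
        have q1 : C * τ ^ (1 - α) * ‖z‖ ≤ 2 * C * (τ ^ (1 - α) * ‖z‖) := by
          have : 0 ≤ C * (τ ^ (1 - α) * ‖z‖) := by positivity
          linarith
        have q2 : (1 - α) * (2 * C * τ ^ (-α) * ‖u‖) ≤ 1 * (2 * C * τ ^ (-α) * ‖u‖) :=
          mul_le_mul_of_nonneg_right (by linarith) (by positivity)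
        exact mul_le_mul hGc (add_le_add q1 q2) (by positivity) (by positivity)
    _ = 2 * C * c * (τ ^ (1 - α) * ‖z‖ + τ ^ (-α) * ‖u‖) := by ring
    _ ≤ _ := by
        gcongr
        linarith

end Complete

end IsDecaying

end

section
variable {A : X →ₗ.[ℂ] X} {a α : ℝ} {S D : ℝ → X →L[ℂ] X} {z w : ℂ} {T L : ℝ → X →L[ℂ] X} {C δ : ℝ}

/-! ### The spaces `X^α` and the semigroup `e^{-Λt}` -/

/-- `T t = e^{-Λt}`, `L t = Λ e^{-Λt}` for `Λ = A + a`, and `Λ⁻¹` is the integral of `T`. -/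
structure IsShiftedSemigroup (A : X →ₗ.[ℂ] X) (a : ℝ) (T L : ℝ → X →L[ℂ] X) (C δ : ℝ) : Prop
    extends IsDecaying T L C δ where
  eq_smul : ∀ t, T t = (Real.exp (-(a * t)) : ℂ) • semigroup A t
  mem_graph_iff : ∀ x y, (x, y) ∈ A.graph ↔ fracInt T 1 (y + (a : ℂ) • x) = x

section Complete

variable [CompleteSpace X]

theorem IsAnalyticSemigroup.deriv_apply (h : IsAnalyticSemigroup A S D) {t : ℝ} (ht : 0 < t)
    {x y : X} (hxy : (x, y) ∈ A.graph) : D t x = S t y :=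
  graph_snd_inj (h.graph t ht x) (h.comm t ht.le _ _ hxy)

/-- For a sectorial operator the spectrum in a left half-plane is compact, so `Re` attains a minimum
there, and positivity of `Re σ(Λ)` becomes a uniform gap. -/
theorem IsSectorial.exists_lt_forall_mem_resolventSet (hA : IsSectorial A)
    (ha : ∀ z ∈ spectrum A, 0 < z.re + a) :
    ∃ m, -a < m ∧ {z : ℂ | z.re < m} ⊆ resolventSet A := by
  obtain ⟨b, φ, K, hA⟩ := hA
  obtain ⟨R, hR⟩ := hA.exists_norm_le (-a + 1)
  have hcpt : IsCompact (spectrum A ∩ {z | z.re ≤ -a + 1}) := by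
    refine Metric.isCompact_of_isClosed_isBounded
      (isClosed_spectrum.inter (isClosed_le Complex.continuous_re continuous_const)) ?_
    exact (Metric.isBounded_closedBall (x := (0 : ℂ)) (r := R)).subset fun z hz => by
      simpa using hR z hz.1 hz.2
  rcases (spectrum A ∩ {z | z.re ≤ -a + 1}).eq_empty_or_nonempty with he | hne
  · refine ⟨-a + 1, by linarith, fun z hz => ?_⟩
    by_contra hz'
    have : z ∈ spectrum A ∩ {z | z.re ≤ -a + 1} := ⟨hz', le_of_lt (show z.re < -a + 1 from hz)⟩
    rw [he] at this
    exact this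
  · obtain ⟨w, hw, hmin⟩ := hcpt.exists_isMinOn hne Complex.continuous_re.continuousOn
    refine ⟨w.re, by linarith [ha w hw.1], fun z hz => ?_⟩
    by_contra hz'
    have hz : z.re < w.re := hz
    have hw2 : w.re ≤ -a + 1 := hw.2
    have h2 : w.re ≤ z.re := hmin (show z ∈ spectrum A ∩ {z | z.re ≤ -a + 1} from
      ⟨hz', (by linarith : z.re ≤ -a + 1)⟩)
    linarith

theorem exists_one_add_inv_mul_exp_le {κ κ' : ℝ} (hκ : κ < κ') :
    ∃ c, 1 ≤ c ∧ ∀ t, 0 < t → (t + 1) * Real.exp (-(κ' * t)) ≤ c * Real.exp (-(κ * t)) := by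
  refine ⟨1 + (κ' - κ)⁻¹, by have := sub_pos.2 hκ; simp [this.le], fun t ht => ?_⟩
  have h0 := sub_pos.2 hκ
  have h1 : (κ' - κ) * t + 1 ≤ Real.exp ((κ' - κ) * t) := Real.add_one_le_exp _
  have h2 : t + 1 ≤ (1 + (κ' - κ)⁻¹) * Real.exp ((κ' - κ) * t) := by
    have h3 : (1 + (κ' - κ)⁻¹) * ((κ' - κ) * t + 1) =
        t + 1 + (κ' - κ) * t + (κ' - κ)⁻¹ := by field_simp; ring
    have h4 : 0 ≤ (κ' - κ) * t + (κ' - κ)⁻¹ := by positivity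
    calc t + 1 ≤ (1 + (κ' - κ)⁻¹) * ((κ' - κ) * t + 1) := by linarith
      _ ≤ _ := by gcongr
  have h5 : Real.exp (-(κ * t)) = Real.exp ((κ' - κ) * t) * Real.exp (-(κ' * t)) := by
    rw [← Real.exp_add]; congr 1; ring
  rw [h5, ← mul_assoc]
  gcongr

theorem exists_isShiftedSemigroup (hA : IsSectorial A) (ha : ∀ z ∈ spectrum A, 0 < z.re + a) :
    ∃ T L : ℝ → X →L[ℂ] X, ∃ C δ : ℝ, IsShiftedSemigroup A a T L C δ := by
  obtain ⟨D, h⟩ := exists_isAnalyticSemigroup hA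
  obtain ⟨m, hm, hres⟩ := hA.exists_lt_forall_mem_resolventSet ha
  set m' := (m - a) / 2 with hm'
  have h1 : m' < m := by rw [hm']; linarith
  have h2 : -a < m' := by rw [hm']; linarith
  obtain ⟨C₁, hC₁, hb₁⟩ := h.exists_norm_mul_le hA graphComm_one (one_mul 1)
    (relSet_one (A := A) ▸ hres) h1
  obtain ⟨C₂, hC₂, hb₂⟩ := h.exists_norm_deriv_mul_le hb₁
  simp only [mul_one] at hb₁ hb₂
  -- Half of the available rate is given up in order to absorb the factor `1 + t⁻¹` in the bound for
  -- `Λ e^{-Λt}` into `t⁻¹`.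
  set δ := (m' + a) / 2 with hδ
  have hδ0 : 0 < δ := by rw [hδ]; linarith
  have hδ1 : δ < m' + a := by rw [hδ]; linarith
  obtain ⟨c, hc, hcb⟩ := exists_one_add_inv_mul_exp_le hδ1
  set T : ℝ → X →L[ℂ] X := fun t => (Real.exp (-(a * t)) : ℂ) • semigroup A t with hT
  set L : ℝ → X →L[ℂ] X := fun t =>
    (Real.exp (-(a * t)) : ℂ) • (D t + (a : ℂ) • semigroup A t) with hL
  set C := ‖(1 : X →L[ℂ] X)‖ + C₁ + (C₂ + |a| * C₁) * c with hC
  have hCpos : 0 < C := by positivity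
  have hnorm : ∀ t : ℝ, ‖(Real.exp (-(a * t)) : ℂ)‖ = Real.exp (-(a * t)) := fun t => by
    rw [Complex.norm_real, Real.norm_eq_abs, abs_of_pos (Real.exp_pos _)]
  have hexp : ∀ t, Real.exp (-((m' + a) * t)) = Real.exp (-(a * t)) * Real.exp (-(m' * t)) := by
    intro t; rw [← Real.exp_add]; congr 1; ring
  have hdec : IsDecaying T L C δ := by
    refine ⟨hCpos, hδ0, ?_, fun s t hs ht => ?_, fun t ht => ?_, fun x => ?_, fun t ht => ?_,
      fun t ht => ?_⟩
    · simp [hT, h.zero]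
    · simp only [hT]
      rw [h.add s t hs ht, smul_mul_smul_comm, ← Complex.ofReal_mul, ← Real.exp_add]
      congr 3
      ring_nf
    · have e1 : HasDerivAt (fun t : ℝ => (Real.exp (-(a * t)) : ℂ))
          ((Real.exp (-(a * t)) * -(a * 1) : ℝ) : ℂ) t :=
        (((hasDerivAt_id t).const_mul a).neg.exp).ofReal_comp
      have e2 := h.deriv t ht
      refine (e1.smul e2).congr_deriv ?_
      simp only [hL]
      push_cast
      module
    · have e1 : Tendsto (fun t : ℝ => (Real.exp (-(a * t)) : ℂ)) (𝓝[>] 0) (𝓝 1) := by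
        have : Continuous fun t : ℝ => (Real.exp (-(a * t)) : ℂ) := by fun_prop
        simpa using (this.tendsto 0).mono_left nhdsWithin_le_nhds
      have e2 := e1.smul (h.tendsto x)
      rw [one_smul] at e2
      exact e2
    · rcases ht.eq_or_lt with rfl | ht
      · have : T 0 = 1 := by simp [hT, h.zero]
        rw [this, mul_zero, neg_zero, Real.exp_zero, mul_one]
        have : 0 ≤ C₁ + (C₂ + |a| * C₁) * c := by positivity
        linarith
      · simp only [hT]
        rw [norm_smul, hnorm]
        have e3 : Real.exp (-((m' + a) * t)) ≤ Real.exp (-(δ * t)) := by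
          apply Real.exp_le_exp.2; nlinarith
        calc _ ≤ Real.exp (-(a * t)) * (C₁ * Real.exp (-(m' * t))) := by gcongr; exact hb₁ t ht
          _ = C₁ * Real.exp (-((m' + a) * t)) := by rw [hexp]; ring
          _ ≤ C * Real.exp (-(δ * t)) := by
            gcongr
            have : 0 ≤ ‖(1 : X →L[ℂ] X)‖ + (C₂ + |a| * C₁) * c := by positivity
            linarith
    · simp only [hL]
      rw [norm_smul, hnorm]
      have e4 : ‖D t + (a : ℂ) • semigroup A t‖ ≤
          (C₂ + |a| * C₁) * (t⁻¹ * ((t + 1) * Real.exp (-(m' * t)))) := by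
        have hti : 0 < t⁻¹ := inv_pos.2 ht
        have e5 : t⁻¹ * (t + 1) = 1 + t⁻¹ := by field_simp
        rw [← mul_assoc t⁻¹, e5]
        calc _ ≤ C₂ * (1 + t⁻¹) * Real.exp (-(m' * t)) + |a| * (C₁ * Real.exp (-(m' * t))) := by
              refine (norm_add_le _ _).trans (add_le_add (hb₂ t ht) ?_)
              rw [norm_smul, Complex.norm_real, Real.norm_eq_abs]
              gcongr
              exact hb₁ t ht
          _ ≤ C₂ * (1 + t⁻¹) * Real.exp (-(m' * t)) +
              |a| * (C₁ * ((1 + t⁻¹) * Real.exp (-(m' * t)))) := by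
              gcongr
              exact le_mul_of_one_le_left (Real.exp_pos _).le (by linarith)
          _ = _ := by ring
      calc _ ≤ Real.exp (-(a * t)) *
            ((C₂ + |a| * C₁) * (t⁻¹ * ((t + 1) * Real.exp (-(m' * t))))) := by gcongr
        _ = (C₂ + |a| * C₁) * t⁻¹ * ((t + 1) * Real.exp (-((m' + a) * t))) := by
          rw [hexp]; ring
        _ ≤ (C₂ + |a| * C₁) * t⁻¹ * (c * Real.exp (-(δ * t))) :=
          mul_le_mul_of_nonneg_left (hcb t ht) (by positivity)
        _ = ((C₂ + |a| * C₁) * c) * t⁻¹ * Real.exp (-(δ * t)) := by ring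
        _ ≤ _ := by
          gcongr
          have : 0 ≤ ‖(1 : X →L[ℂ] X)‖ + C₁ := by positivity
          linarith
  refine ⟨T, L, C, δ, { hdec with eq_smul := fun t => rfl, mem_graph_iff := fun x y => ?_ }⟩
  have hp : -(a : ℂ) ∈ resolventSet A := hres (by simpa using hm)
  have hL0 : ∀ t, 0 < t → ∀ x, L t (resolvent A (-(a : ℂ)) x) = -T t x := by
    intro t ht x
    have e1 := h.deriv_apply ht (resolvent_mem_graph hp x)
    simp only [hL, hT, smul_apply, add_apply]
    rw [e1]
    simp only [sub_apply, smul_apply, one_apply_eq_self, map_sub, map_smul]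
    module
  -- Both are inverses of `Λ`: every `T t` with `t > 0` annihilates the difference `y` of their
  -- values, and `T t y → y`.
  have hR : fracInt T 1 = -resolvent A (-(a : ℂ)) := by
    ext x
    refine eq_of_sub_eq_zero ?_
    set y := fracInt T 1 x - (-resolvent A (-(a : ℂ))) x with hy
    have e2 : ∀ t, 0 < t → T t y = 0 := by
      intro t ht
      rw [← hdec.fracInt_one_mul_deriv ht, mul_apply_eq_comp, hy, map_sub]
      have := congrArg (fun B : X →L[ℂ] X => B x) (hdec.deriv_mul_fracInt_one ht)
      simp only [mul_apply_eq_comp] at this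
      rw [this, neg_apply, map_neg, hL0 t ht x]
      simp
    refine tendsto_nhds_unique (hdec.tendsto y) (tendsto_const_nhds.congr' ?_)
    filter_upwards [self_mem_nhdsWithin] with t ht using (e2 t ht).symm
  rw [SectorialIM.mem_graph_iff hp, hR, neg_apply, ← map_neg]
  have : -(a : ℂ) • x - y = -(y + (a : ℂ) • x) := by rw [neg_smul]; abel
  rw [this]

namespace IsShiftedSemigroup

theorem negFracPow_eq (h : IsShiftedSemigroup A a T L C δ) (α : ℝ) :
    negFracPow A a α = fracInt T α := by
  rw [negFracPow, fracInt]
  split_ifs with h0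
  · rfl
  · congr 1
    refine integral_congr_ae (Eventually.of_forall fun t => ?_)
    simp only
    rw [h.eq_smul, smul_smul, Complex.ofReal_mul]

theorem injective (h : IsShiftedSemigroup A a T L C δ) (hα : α ∈ Ico (0 : ℝ) 1) :
    Function.Injective (negFracPow A a α : X →ₗ[ℂ] X) := by
  rw [h.negFracPow_eq]
  exact h.fracInt_injective hα.1 hα.2

theorem graphOp_iff (h : IsShiftedSemigroup A a T L C δ) {B B' : X →L[ℂ] X} :
    GraphOp A B B' ↔ fracInt T 1 * (B' + (a : ℂ) • B) = B := by
  constructor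
  · intro hB
    ext x
    exact (h.mem_graph_iff _ _).1 (hB x)
  · intro hB x
    exact (h.mem_graph_iff _ _).2 (congrArg (fun B : X →L[ℂ] X => B x) hB)

theorem commute_of_graphComm (h : IsShiftedSemigroup A a T L C δ) (hA : IsSectorial A)
    {Q : X →L[ℂ] X} (hQ : GraphComm A Q) {t : ℝ} (ht : 0 ≤ t) : Commute Q (T t) := by
  obtain ⟨b, φ, K, hA, h0, hS⟩ := exists_semigroup_eq_dunfordExp hA
  rw [h.eq_smul]
  refine Commute.smul_right ?_ _
  rcases ht.eq_or_lt with rfl | ht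
  · rw [h0]; exact Commute.one_right Q
  rw [hS t ht, dunfordExp, ← smul_neg]
  refine Commute.smul_right (Commute.neg_right ?_) _
  have hv : b - 1 < b := by linarith
  have hi := hA.integrable_contour_exp (g := resolvent A) ht
    (hA.continuous_resolvent_contour hv) (hA.norm_resolvent_contour_le hv)
  rw [contourInt, Commute, SemiconjBy, ← integral_mul_left hi, ← integral_mul_right hi]
  congr 1
  ext1 s
  rw [mul_smul_comm, mul_smul_comm, smul_mul_assoc, smul_mul_assoc,
    (hQ.commute_resolvent (hA.contour_mem hv s).1).eq]

end IsShiftedSemigroup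

end Complete

/-! ### Coordinates on `X^α` -/

namespace FracSpace

variable (hinj : Function.Injective (negFracPow A a α : X →ₗ[ℂ] X))

/-- `Λ^α : X^α → X` as an isometric isomorphism. -/
def coord (hinj : Function.Injective (negFracPow A a α : X →ₗ[ℂ] X)) : FracSpace A a α ≃ₗᵢ[ℂ] X where
  toLinearEquiv := (LinearEquiv.ofInjective (negFracPow A a α : X →ₗ[ℂ] X) hinj).symm
  norm_map' u := by
    have e : fracPow A a α =
        ((LinearEquiv.ofInjective (negFracPow A a α : X →ₗ[ℂ] X) hinj).symm :
          LinearMap.range (negFracPow A a α : X →ₗ[ℂ] X) →ₗ[ℂ] X) := dif_pos hinj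
    exact (congrArg (fun l : FracSpace A a α →ₗ[ℂ] X => ‖l u‖) e).symm

include hinj

theorem incl_coord_symm (v : X) : incl A a α ((coord hinj).symm v) = negFracPow A a α v := rfl

theorem negFracPow_coord (u : FracSpace A a α) : negFracPow A a α (coord hinj u) = incl A a α u := by
  rw [← incl_coord_symm hinj, LinearIsometryEquiv.symm_apply_apply]

/-- If `B = Λ^{-α} H`, then `H` is `Λ^α B`, and the estimate with values in `X^α` is an ordinary
operator bound for `H`. -/
theorem fracBound_iff {B H : X →L[ℂ] X} (hB : B = negFracPow A a α * H) {M : ℝ} :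
    FracBound A a α B M ↔ ∀ x, ‖H x‖ ≤ M * ‖x‖ := by
  subst hB
  refine forall_congr' fun x => ⟨fun ⟨y, hy, hy'⟩ => ?_, fun hx => ?_⟩
  · have : coord hinj y = H x := by
      apply hinj
      change negFracPow A a α (coord hinj y) = negFracPow A a α (H x)
      rw [negFracPow_coord hinj, hy]
      rfl
    rwa [← this, LinearIsometryEquiv.norm_map]
  · exact ⟨(coord hinj).symm (H x), rfl, by rwa [LinearIsometryEquiv.norm_map]⟩

/-- An operator that commutes with `Λ^{-α}` is not changed by the conjugation `Λ^α B Λ^{-α}`. -/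
theorem fracFracBound_iff {B : X →L[ℂ] X} (hB : Commute B (negFracPow A a α)) {M : ℝ} :
    FracFracBound A a α B M ↔ ∀ x, ‖B x‖ ≤ M * ‖x‖ := by
  have e : ∀ x, B (negFracPow A a α x) = negFracPow A a α (B x) := fun x =>
    congrArg (fun B : X →L[ℂ] X => B x) hB.eq
  constructor
  · intro h x
    obtain ⟨y, hy, hy'⟩ := h ((coord hinj).symm x)
    rw [incl_coord_symm, e] at hy
    have : coord hinj y = B x := by
      apply hinj
      change negFracPow A a α (coord hinj y) = negFracPow A a α (B x)
      rw [negFracPow_coord hinj, hy]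
    rwa [← this, LinearIsometryEquiv.norm_map, ← LinearIsometryEquiv.norm_map (coord hinj).symm x]
  · intro h u
    refine ⟨(coord hinj).symm (B (coord hinj u)), ?_, ?_⟩
    · rw [incl_coord_symm, ← e, negFracPow_coord]
    · rw [LinearIsometryEquiv.norm_map, ← LinearIsometryEquiv.norm_map (coord hinj) u]
      exact h _

end FracSpace

end

section
variable {A : X →ₗ.[ℂ] X} {a α lam β β₁ β₂ : ℝ} {S D E : ℝ → X →L[ℂ] X} {P B : X →L[ℂ] X}
  {z₀ : ℂ} {T L : ℝ → X →L[ℂ] X} {C δ b φ K c₀ : ℝ}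

/-! ### The group on a bounded spectral subspace -/

/-- `E t = e^{-(A - lam) t} P` is a group on the range of the spectral projection `P`, and
`B = A P` is bounded. -/
structure IsGroupPart (A : X →ₗ.[ℂ] X) (lam : ℝ) (P B : X →L[ℂ] X) (E : ℝ → X →L[ℂ] X) :
    Prop where
  comm : ∀ t, GraphComm A (E t)
  zero : E 0 = P
  add : ∀ s t, E (s + t) = E s * E t
  graph : ∀ t, GraphOp A (E t) (B * E t)
  deriv : ∀ t, HasDerivAt E ((lam : ℂ) • E t - B * E t) t

theorem IsGroupPart.continuous (h : IsGroupPart A lam P B E) : Continuous E :=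
  continuous_iff_continuousAt.2 fun t => (h.deriv t).continuousAt

theorem IsGroupPart.mul_eq (h : IsGroupPart A lam P B E) (t : ℝ) : E t * P = E t := by
  rw [← h.zero, ← h.add, add_zero]

theorem IsGroupPart.mul_eq' (h : IsGroupPart A lam P B E) (t : ℝ) : P * E t = E t := by
  rw [← h.zero, ← h.add, zero_add]

section Complete

variable [CompleteSpace X]

theorem Encloses.isGroupPart {s : Set ℂ} {c : ℂ} {r : ℝ} (h : Encloses A s c r) (lam : ℝ) :
    IsGroupPart A lam (spectralProj A s) (circleCalc A c r (fun z => z))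
      (fun t => dunford A s (fun z => Complex.exp (-((z - lam) * t)))) := by
  set P := spectralProj A s with hP
  set B := circleCalc A c r (fun z => z) with hB
  set M : X →L[ℂ] X := (lam : ℂ) • 1 - B with hM
  have hPc : P = circleCalc A c r (fun _ => 1) := h.spectralProj_eq
  have hPP : P * P = P := by rw [hPc]; exact circleProj_mul_self h.1 h.sphere_subset
  have hPg : GraphComm A P := by rw [hPc]; exact graphComm_circleProj h.1 h.sphere_subset
  have hPB : Commute P B := hPg.commute_circleCalc h.1 h.sphere_subset continuousOn_id
  have hgr : GraphOp A P B := by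
    have := graphOp_circleCalc_of_differentiable h.1 h.sphere_subset (differentiable_const (1 : ℂ))
    rw [hPc, hB]
    simpa using this
  have hPM : ∀ t : ℝ, Commute P (NormedSpace.exp (t • M)) := fun t =>
    (((Commute.one_right P).smul_right _).sub_right hPB |>.smul_right t).exp_right
  have hE : ∀ t : ℝ, dunford A s (fun z => Complex.exp (-((z - lam) * t))) =
      NormedSpace.exp (t • M) * P := fun t => h.dunford_exp_eq_exp lam t
  have hPE : ∀ t : ℝ, P * (NormedSpace.exp (t • M) * P) = NormedSpace.exp (t • M) * P := fun t => by
    rw [← mul_assoc, (hPM t).eq, mul_assoc, hPP]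
  refine ⟨fun t => ?_, ?_, fun s t => ?_, fun t => ?_, fun t => ?_⟩
  · rw [h.dunford_exp_eq]
    exact graphComm_circleCalc h.1 h.sphere_subset (by fun_prop)
  · rw [hE, zero_smul, NormedSpace.exp_zero, one_mul]
  · simp only [hE]
    let : NormedAlgebra ℚ (X →L[ℂ] X) := NormedAlgebra.restrictScalars ℚ ℝ (X →L[ℂ] X)
    rw [add_smul, NormedSpace.exp_add_of_commute
      (((Commute.refl M).smul_left s).smul_right t), mul_assoc, mul_assoc, hPE]
  · have := hgr.mul (NormedSpace.exp (t • M) * P)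
    rw [hPE] at this
    rwa [hE]
  · simp only [hE]
    refine ((hasDerivAt_exp_smul_const' M t).mul_const P).congr_deriv ?_
    rw [hM, mul_assoc, sub_mul, smul_mul_assoc, one_mul]

/-- On the range of `P` the semigroup and the group agree: `e^{lam r} S r * E (t + s - r)` has
derivative zero for `r > 0`, and its strong limit at `0` is `E (t + s)`. -/
theorem IsGroupPart.semigroup_mul (h : IsGroupPart A lam P B E) (hS : IsAnalyticSemigroup A S D)
    {t : ℝ} (ht : 0 ≤ t) (s : ℝ) :
    ((Real.exp (lam * t) : ℝ) : ℂ) • (S t * E s) = E (t + s) := by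
  rcases ht.eq_or_lt with rfl | ht
  · simp [hS.zero]
  set F : ℝ → X →L[ℂ] X := fun r => ((Real.exp (lam * r) : ℝ) : ℂ) • (S r * E (t + s - r)) with hF
  have hd : ∀ r ∈ Ioi (0 : ℝ), HasDerivAt F 0 r := by
    intro r hr
    have e1 : HasDerivAt (fun r : ℝ => ((Real.exp (lam * r) : ℝ) : ℂ))
        ((Real.exp (lam * r) * (lam * 1) : ℝ) : ℂ) r :=
      (((hasDerivAt_id r).const_mul lam).exp).ofReal_comp
    have e2 : HasDerivAt (fun r => E (t + s - r))
        (-((lam : ℂ) • E (t + s - r) - B * E (t + s - r))) r := by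
      have := (h.deriv (t + s - r)).scomp r ((hasDerivAt_id r).const_sub (t + s))
      rw [neg_one_smul] at this
      exact this
    have e3 := (hS.deriv r hr).mul e2
    refine (e1.smul e3).congr_deriv ?_
    have e4 : D r * E (t + s - r) = S r * (B * E (t + s - r)) := by
      ext x
      exact hS.deriv_apply hr (h.graph (t + s - r) x)
    rw [neg_mul, e4, mul_neg, mul_sub, mul_smul_comm]
    push_cast
    module
  have hconst : ∀ r ∈ Ioi (0 : ℝ), F r = F t := fun r hr =>
    isOpen_Ioi.is_const_of_deriv_eq_zero isPreconnected_Ioi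
      (fun r hr => (hd r hr).differentiableAt.differentiableWithinAt)
      (fun r hr => (hd r hr).deriv) hr ht
  have e5 : t + s - t = s := by ring
  have hFt : F t = ((Real.exp (lam * t) : ℝ) : ℂ) • (S t * E s) := by simp only [hF, e5]
  rw [← hFt]
  ext x
  have h1 : Tendsto (fun r => F r x) (𝓝[>] 0) (𝓝 (E (t + s) x)) := by
    have e6 : Tendsto (fun r : ℝ => ((Real.exp (lam * r) : ℝ) : ℂ)) (𝓝[>] 0) (𝓝 1) := by
      have : Continuous fun r : ℝ => ((Real.exp (lam * r) : ℝ) : ℂ) := by fun_prop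
      simpa using (this.tendsto 0).mono_left nhdsWithin_le_nhds
    have e7 : Tendsto (fun r : ℝ => E (t + s - r) x) (𝓝[>] 0) (𝓝 (E (t + s) x)) := by
      have hc := h.continuous
      have : Continuous fun r : ℝ => E (t + s - r) x := by fun_prop
      simpa using (this.tendsto 0).mono_left nhdsWithin_le_nhds
    have e8 := hS.tendsto_apply (tendsto_id.mono_left nhdsWithin_le_nhds) (by
      filter_upwards [self_mem_nhdsWithin] with r hr using (mem_Ioi.1 hr).le) le_rfl e7
    rw [hS.zero, one_apply_eq_self] at e8
    have e9 := e6.smul e8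
    rw [one_smul] at e9
    exact e9
  refine tendsto_nhds_unique (tendsto_const_nhds.congr' ?_) h1
  filter_upwards [self_mem_nhdsWithin] with r hr
  rw [hconst r hr]

/-! ### The three spectral projections -/

namespace SpectralSplitting

variable (h : SpectralSplitting A z₀ β₁ β₂)
include h

theorem exists_encloses_sigma1 (hA : IsSectorial A) {m : ℝ} (hm : β₁ < m) (hm' : m < z₀.re) :
    ∃ c : ℂ, ∃ r : ℝ, Encloses A (sigma1 A β₁) c r ∧ ∀ z ∈ Metric.closedBall c r, z.re ≤ m := by
  obtain ⟨b, φ, K, hA⟩ := hA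
  exact h.encloses_sigma1 hA hm hm'

theorem exists_isGroupPart1 (hA : IsSectorial A) (lam : ℝ) :
    ∃ B, IsGroupPart A lam (P1 A β₁) B (exp1 A β₁ lam) := by
  obtain ⟨m, h1, h2⟩ := exists_between h.lt_re
  obtain ⟨c, r, hc, -⟩ := h.exists_encloses_sigma1 hA h1 h2
  exact ⟨_, hc.isGroupPart lam⟩

theorem exists_encloses_singleton : ∃ r, 0 < r ∧ Encloses A {z₀} z₀ r := by
  obtain ⟨r, h1, h2⟩ := exists_between (lt_min (sub_pos.2 h.lt_re) (sub_pos.2 h.re_lt))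
  rw [lt_min_iff] at h2
  exact ⟨r, h1, h.encloses_singleton h1 h2.1 h2.2⟩

theorem exists_isGroupPart2 (lam : ℝ) :
    ∃ B, IsGroupPart A lam (P2 A z₀) B (exp2 A z₀ lam) := by
  obtain ⟨r, -, hc⟩ := h.exists_encloses_singleton
  exact ⟨_, hc.isGroupPart lam⟩

theorem graphComm_P1 (hA : IsSectorial A) : GraphComm A (P1 A β₁) := by
  obtain ⟨B, hB⟩ := h.exists_isGroupPart1 hA 0
  exact hB.zero ▸ hB.comm 0

theorem graphComm_P2 : GraphComm A (P2 A z₀) := by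
  obtain ⟨B, hB⟩ := h.exists_isGroupPart2 0
  exact hB.zero ▸ hB.comm 0

theorem P1_mul_P1 (hA : IsSectorial A) : P1 A β₁ * P1 A β₁ = P1 A β₁ := by
  obtain ⟨B, hB⟩ := h.exists_isGroupPart1 hA 0
  rw [← hB.zero, ← hB.add, add_zero]

theorem P2_mul_P2 : P2 A z₀ * P2 A z₀ = P2 A z₀ := by
  obtain ⟨B, hB⟩ := h.exists_isGroupPart2 0
  rw [← hB.zero, ← hB.add, add_zero]

theorem P1_mul_P2 (hA : IsSectorial A) : P1 A β₁ * P2 A z₀ = 0 := by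
  obtain ⟨m, h1, h2⟩ := exists_between h.lt_re
  obtain ⟨c, r, hc, -⟩ := h.exists_encloses_sigma1 hA h1 h2
  obtain ⟨r', -, hc'⟩ := h.exists_encloses_singleton
  rw [P1, P2, hc.spectralProj_eq, hc'.spectralProj_eq]
  exact hc.proj_mul_eq_zero hc' h.disjoint

theorem P2_mul_P1 (hA : IsSectorial A) : P2 A z₀ * P1 A β₁ = 0 := by
  obtain ⟨m, h1, h2⟩ := exists_between h.lt_re
  obtain ⟨c, r, hc, -⟩ := h.exists_encloses_sigma1 hA h1 h2
  obtain ⟨r', -, hc'⟩ := h.exists_encloses_singleton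
  rw [P1, P2, hc.spectralProj_eq, hc'.spectralProj_eq]
  exact hc'.proj_mul_eq_zero hc h.disjoint.symm

theorem P3_eq_mul (hA : IsSectorial A) :
    P3 A β₁ z₀ = (1 - P1 A β₁) * (1 - P2 A z₀) := by
  change 1 - P1 A β₁ - P2 A z₀ = _
  rw [mul_sub, mul_one, sub_mul, one_mul, h.P1_mul_P2 hA, sub_zero]

theorem P3_mul_P3 (hA : IsSectorial A) : P3 A β₁ z₀ * P3 A β₁ z₀ = P3 A β₁ z₀ := by
  change (1 - P1 A β₁ - P2 A z₀) * (1 - P1 A β₁ - P2 A z₀) = 1 - P1 A β₁ - P2 A z₀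
  simp only [mul_sub, sub_mul, mul_one, one_mul, h.P1_mul_P2 hA, h.P2_mul_P1 hA, h.P1_mul_P1 hA,
    h.P2_mul_P2]
  abel

theorem graphComm_P3 (hA : IsSectorial A) : GraphComm A (P3 A β₁ z₀) :=
  (graphComm_one.sub (h.graphComm_P1 hA)).sub h.graphComm_P2

/-- A point with `Re z < β₂` is regular, lies in `σ¹`, or is `z₀`. In the first two cases `1 - P₁`
already admits a relative resolvent at `z`, in the last one `1 - P₂` does; the other projection then
cuts it down to `P₃`. -/
theorem subset_relSet_P3 (hA : IsSectorial A) :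
    {z : ℂ | z.re < β₂} ⊆ relSet A (P3 A β₁ z₀) := by
  obtain ⟨m, h1, h2⟩ := exists_between h.lt_re
  obtain ⟨c, r, hc, -⟩ := h.exists_encloses_sigma1 hA h1 h2
  obtain ⟨r', -, hc'⟩ := h.exists_encloses_singleton
  intro z hz
  have hz : z.re < β₂ := hz
  have hcomm : Commute (1 - P1 A β₁) (1 - P2 A z₀) := by
    refine (Commute.one_right _).sub_right ((Commute.one_left _).sub_left ?_)
    rw [Commute, SemiconjBy, h.P1_mul_P2 hA, h.P2_mul_P1 hA]
  have g1 := graphComm_one.sub (h.graphComm_P1 hA)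
  have g2 := graphComm_one.sub h.graphComm_P2
  rw [h.P3_eq_mul hA]
  by_cases hz1 : z ∈ resolventSet A ∪ sigma1 A β₁
  · have := hc.mem_relSet_one_sub hz1
    rw [← hc.spectralProj_eq] at this
    exact ((isRelRes_relRes this).mul g2 hcomm.symm (mul_self_one_sub h.P2_mul_P2)).mem
  · rw [mem_union, not_or] at hz1
    have hz3 : z ∈ spectrum A := hz1.1
    have hz2 : z ∈ resolventSet A ∪ {z₀} := by
      right
      rcases h.spectrum_eq ▸ hz3 with (h4 | h4) | h4
      · exact absurd h4 hz1.2
      · exact h4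
      · exact absurd h4.2 (not_le.2 hz)
    have := hc'.mem_relSet_one_sub hz2
    rw [← hc'.spectralProj_eq] at this
    rw [hcomm.eq]
    exact ((isRelRes_relRes this).mul g1 hcomm (mul_self_one_sub (h.P1_mul_P1 hA))).mem

end SpectralSplitting

/-! ### The exponential estimates -/

/-- The constant of the moment inequality. -/
def IsMomentConstant (T : ℝ → X →L[ℂ] X) (c₀ : ℝ) : Prop :=
  0 < c₀ ∧ ∀ α ∈ Ico (0 : ℝ) 1, ∀ z : X, ∀ τ, 0 < τ → ‖fracInt T (1 - α) z‖ ≤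
      c₀ * (τ ^ (1 - α) * ‖z‖ + τ ^ (-α) * ‖fracInt T 1 z‖)

namespace IsShiftedSemigroup

theorem fracInt_mul_graphOp (hT : IsShiftedSemigroup A a T L C δ) (hα : α ∈ Ico (0 : ℝ) 1)
    {B B' : X →L[ℂ] X} (hB : GraphOp A B B') :
    B = negFracPow A a α * (fracInt T (1 - α) * (B' + (a : ℂ) • B)) := by
  rw [hT.negFracPow_eq, ← mul_assoc, hT.fracInt_mul hα.1 hα.2, hT.graphOp_iff.1 hB]

/-- `Λ^α B = Λ^{-(1-α)} (B' + a B)` where `B' = A B`; the moment inequality is applied to `z = (B' +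
a B) x`, for which `Λ⁻¹ z = B x`. The free parameter is `τ = 1` for the group parts and `τ = t` on
`X³`. -/
theorem fracBound_of_graphOp (hT : IsShiftedSemigroup A a T L C δ) (hc : IsMomentConstant T c₀)
    (hα : α ∈ Ico (0 : ℝ) 1) {B B' : X →L[ℂ] X} (hB : GraphOp A B B') {τ m₀ m₁ : ℝ} (hτ : 0 < τ)
    (h0 : ‖B‖ ≤ m₀) (h1 : ‖B'‖ ≤ m₁) :
    FracBound A a α B (c₀ * (τ ^ (1 - α) * (m₁ + |a| * m₀) + τ ^ (-α) * m₀)) := by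
  rw [FracSpace.fracBound_iff (hT.injective hα) (hT.fracInt_mul_graphOp hα hB)]
  intro x
  refine (hc.2 α hα ((B' + (a : ℂ) • B) x) τ hτ).trans ?_
  have e : fracInt T 1 ((B' + (a : ℂ) • B) x) = B x :=
    congrArg (fun B : X →L[ℂ] X => B x) (hT.graphOp_iff.1 hB)
  rw [e, mul_assoc]
  have p1 : 0 ≤ τ ^ (1 - α) := Real.rpow_nonneg hτ.le _
  have p2 : 0 ≤ τ ^ (-α) := Real.rpow_nonneg hτ.le _
  have h2 : ‖B x‖ ≤ m₀ * ‖x‖ := B.le_of_opNorm_le h0 x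
  have h3 : ‖(B' + (a : ℂ) • B) x‖ ≤ (m₁ + |a| * m₀) * ‖x‖ := by
    refine ContinuousLinearMap.le_of_opNorm_le _ ((norm_add_le _ _).trans (add_le_add h1 ?_)) x
    rw [norm_smul, Complex.norm_real, Real.norm_eq_abs]
    gcongr
  have := hc.1
  calc _ ≤ c₀ * (τ ^ (1 - α) * ((m₁ + |a| * m₀) * ‖x‖) + τ ^ (-α) * (m₀ * ‖x‖)) := by gcongr
    _ = _ := by ring

end IsShiftedSemigroup

theorem IsGroupPart.fracBound (h : IsGroupPart A lam P B E) (hT : IsShiftedSemigroup A a T L C δ)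
    (hc : IsMomentConstant T c₀) (hα : α ∈ Ico (0 : ℝ) 1) {t m : ℝ} (hm : ‖E t‖ ≤ m) :
    FracBound A a α (E t) (c₀ * (‖B‖ + |a| + 1) * m) := by
  have h1 : ‖B * E t‖ ≤ ‖B‖ * m := (norm_mul_le _ _).trans (by gcongr)
  have := hT.fracBound_of_graphOp hc hα (h.graph t) one_pos hm h1
  rw [Real.one_rpow, Real.one_rpow] at this
  convert this using 1
  ring

theorem Encloses.norm_dunford_exp_le {s : Set ℂ} {c : ℂ} {r : ℝ} (h : Encloses A s c r) {Cr m : ℝ}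
    (hCr : ∀ z ∈ Metric.sphere c r, ‖resolvent A z‖ ≤ Cr) {t : ℝ}
    (hm : ∀ z ∈ Metric.sphere c r, (lam - z.re) * t ≤ m) :
    ‖dunford A s (fun z => Complex.exp (-((z - lam) * t)))‖ ≤ r * Cr * Real.exp m := by
  rw [h.dunford_exp_eq, mul_assoc]
  refine norm_circleCalc_le h.1 h.sphere_subset fun z hz => ?_
  rw [norm_smul, Complex.norm_exp, mul_comm]
  have e : (-((z - lam) * t) : ℂ).re = (lam - z.re) * t := by simp; ring
  rw [e]
  exact mul_le_mul (hCr z hz) (Real.exp_le_exp.2 (hm z hz)) (Real.exp_pos _).le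
    ((norm_nonneg _).trans (hCr z hz))

end Complete

end

/-! ### Uniform constants in the exponential estimates -/

section
variable {A : X →ₗ.[ℂ] X} {a α lam β β₁ β₂ : ℝ} {z₀ : ℂ} {T L : ℝ → X →L[ℂ] X} {C δ c₀ : ℝ}

theorem FracBound.mono {B : X →L[ℂ] X} {M M' : ℝ} (h : FracBound A a α B M) (hM : M ≤ M') :
    FracBound A a α B M' := fun x => by
  obtain ⟨y, h1, h2⟩ := h x
  exact ⟨y, h1, h2.trans (mul_le_mul_of_nonneg_right hM (norm_nonneg x))⟩

theorem FracFracBound.mono {B : X →L[ℂ] X} {M M' : ℝ} (h : FracFracBound A a α B M)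
    (hM : M ≤ M') : FracFracBound A a α B M' := fun x => by
  obtain ⟨y, h1, h2⟩ := h x
  exact ⟨y, h1, h2.trans (mul_le_mul_of_nonneg_right hM (norm_nonneg x))⟩

section Complete

variable [CompleteSpace X]

theorem norm_exp_smul_le (c t : ℝ) (T : X →L[ℂ] X) :
    ‖((Real.exp (c * t) : ℝ) : ℂ) • T‖ = Real.exp (c * t) * ‖T‖ := by
  rw [norm_smul, Complex.norm_real, Real.norm_eq_abs, abs_of_pos (Real.exp_pos _)]

/-- The part of the exponential estimates that concerns `X²`. -/
def Exp2Bound (A : X →ₗ.[ℂ] X) (a : ℝ) (z₀ : ℂ) (β lam α M : ℝ) : Prop :=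
  ∀ t : ℝ, FracBound A a α (exp2 A z₀ lam t) (M * Real.exp (1 / 4 * β * |t|)) ∧
    ‖exp2 A z₀ lam t‖ ≤ M * Real.exp (1 / 4 * β * |t|)

namespace SpectralSplitting

variable (h : SpectralSplitting A z₀ β₁ β₂)
include h

theorem exists_exp1_bound (hA : IsSectorial A) (hT : IsShiftedSemigroup A a T L C δ)
    (hc : IsMomentConstant T c₀) (hβ : 0 < β) (hβ' : β < z₀.re - β₁) :
    ∃ M, 0 < M ∧ ∀ lam : ℝ, |lam - z₀.re| ≤ 1 / 4 * β → ∀ α ∈ Ico (0 : ℝ) 1, ∀ t ≤ 0,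
      FracBound A a α (exp1 A β₁ lam t) (M * Real.exp (3 / 4 * β * t)) ∧
      ‖exp1 A β₁ lam t‖ ≤ M * Real.exp (3 / 4 * β * t) := by
  -- On a circle in `Re z ≤ Re z₀ - β` one has `lam - Re z ≥ ¾ β` whenever `|lam - Re z₀| ≤ ¼ β`,
  -- and this is multiplied by `t ≤ 0`.
  obtain ⟨c, r, he, hre⟩ := h.exists_encloses_sigma1 hA (m := z₀.re - β) (by linarith)
    (by linarith)
  obtain ⟨Cr, hCr0, hCr⟩ := exists_norm_resolvent_le_sphere he.1 he.sphere_subset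
  set B := circleCalc A c r (fun z => z)
  have hr := he.1
  have hc0 := hc.1
  set M := r * Cr + c₀ * (‖B‖ + |a| + 1) * (r * Cr) + 1 with hM
  refine ⟨M, by positivity, fun lam hlam α hα t ht => ?_⟩
  rw [abs_le] at hlam
  have h1 : ‖exp1 A β₁ lam t‖ ≤ r * Cr * Real.exp (3 / 4 * β * t) := by
    refine he.norm_dunford_exp_le hCr fun z hz => ?_
    have := hre z (Metric.sphere_subset_closedBall hz)
    exact mul_le_mul_of_nonpos_right (by linarith) ht
  constructor
  · refine ((he.isGroupPart lam).fracBound hT hc hα h1).mono ?_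
    rw [← mul_assoc]
    gcongr
    have : 0 ≤ r * Cr := by positivity
    linarith
  · refine h1.trans ?_
    gcongr
    have : 0 ≤ c₀ * (‖B‖ + |a| + 1) * (r * Cr) := by positivity
    linarith

theorem exists_exp2_bound (hT : IsShiftedSemigroup A a T L C δ)
    (hc : IsMomentConstant T c₀) (hβ : 0 < β) (hβ' : β < min (z₀.re - β₁) (β₂ - z₀.re)) {θ : ℝ}
    (hθ : θ < 1 / 4 * β) :
    ∃ M, 0 < M ∧ ∀ lam : ℝ, |lam - z₀.re| ≤ θ → ∀ α ∈ Ico (0 : ℝ) 1,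
      Exp2Bound A a z₀ β lam α M := by
  rw [lt_min_iff] at hβ'
  -- The radius is the slack left by `θ`, so `|lam - Re z| ≤ ¼ β` on the circle; the bound `β / 2`
  -- keeps the other parts of the spectrum outside.
  set r := min (1 / 4 * β - θ) (β / 2) with hr'
  have hr : 0 < r := lt_min (by linarith) (by linarith)
  have hr1 : r ≤ 1 / 4 * β - θ := min_le_left _ _
  have hr2 : r ≤ β / 2 := min_le_right _ _
  have he := h.encloses_singleton hr (by linarith) (by linarith)
  obtain ⟨Cr, hCr0, hCr⟩ := exists_norm_resolvent_le_sphere he.1 he.sphere_subset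
  set B := circleCalc A z₀ r (fun z => z)
  have hc0 := hc.1
  set M := r * Cr + c₀ * (‖B‖ + |a| + 1) * (r * Cr) + 1 with hM
  refine ⟨M, by positivity, fun lam hlam α hα t => ?_⟩
  have h1 : ‖exp2 A z₀ lam t‖ ≤ r * Cr * Real.exp (1 / 4 * β * |t|) := by
    refine he.norm_dunford_exp_le hCr fun z hz => ?_
    have h3 : |z.re - z₀.re| ≤ r := by
      rw [mem_sphere_iff_norm] at hz
      rw [← Complex.sub_re]
      exact (Complex.abs_re_le_norm _).trans hz.le
    have h4 : |lam - z.re| ≤ 1 / 4 * β := by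
      have e : lam - z.re = (lam - z₀.re) - (z.re - z₀.re) := by ring
      rw [e]
      exact (abs_sub _ _).trans (by linarith)
    refine (le_abs_self _).trans ?_
    rw [abs_mul]
    gcongr
  constructor
  · refine ((he.isGroupPart lam).fracBound hT hc hα h1).mono ?_
    rw [← mul_assoc]
    gcongr
    have : 0 ≤ r * Cr := by positivity
    linarith
  · refine h1.trans ?_
    gcongr
    have : 0 ≤ c₀ * (‖B‖ + |a| + 1) * (r * Cr) := by positivity
    linarith

/-- In the semisimple case `e^{-A²t} P₂ = e^{(lam - z₀) t} P₂` exactly. The rate is `|lam - Re z₀|`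
without the loss of a circle radius, so one constant serves up to the ends of the interval. -/
theorem exists_exp2_bound_of_semisimple (hT : IsShiftedSemigroup A a T L C δ)
    (hc : IsMomentConstant T c₀) (hs : IsSemisimpleEigenvalue A z₀) :
    ∃ M, 0 < M ∧ ∀ lam : ℝ, |lam - z₀.re| ≤ 1 / 4 * β → ∀ α ∈ Ico (0 : ℝ) 1,
      Exp2Bound A a z₀ β lam α M := by
  obtain ⟨r, -, he⟩ := h.exists_encloses_singleton
  set B := circleCalc A z₀ r (fun z => z)
  have hc0 := hc.1
  set p := ‖P2 A z₀‖ with hp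
  have hp0 : 0 ≤ p := norm_nonneg _
  set M := p + c₀ * (‖B‖ + |a| + 1) * p + 1 with hM
  refine ⟨M, by positivity, fun lam hlam α hα t => ?_⟩
  have hG : IsGroupPart A lam (P2 A z₀) B (exp2 A z₀ lam) := he.isGroupPart lam
  have hG2 : GraphOp A (P2 A z₀) (z₀ • P2 A z₀) := fun x => mem_graph_iff_exists.2 (hs x)
  have hBE : ∀ t, B * exp2 A z₀ lam t = z₀ • exp2 A z₀ lam t := by
    intro t
    have h1 := hG2.mul (exp2 A z₀ lam t)
    have e : P2 A z₀ * exp2 A z₀ lam t = exp2 A z₀ lam t := hG.mul_eq' t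
    rw [smul_mul_assoc, e] at h1
    exact (hG.graph t).unique h1
  have hE : exp2 A z₀ lam t = Complex.exp ((lam - z₀) * t) • P2 A z₀ := by
    have hd : ∀ s : ℝ, HasDerivAt
        (fun s : ℝ => Complex.exp (-((lam - z₀) * s)) • exp2 A z₀ lam s) 0 s := by
      intro s
      have h1 : HasDerivAt (fun s : ℝ => -((lam - z₀) * (s : ℂ))) (-((lam - z₀) * 1)) s :=
        ((Complex.ofRealCLM.hasDerivAt).const_mul _).neg
      have h2 := hG.deriv s
      refine (h1.cexp.smul h2).congr_deriv ?_
      rw [hBE s]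
      module
    have h0 := is_const_of_deriv_eq_zero (fun s => (hd s).differentiableAt)
      (fun s => (hd s).deriv) t 0
    simp only [Complex.ofReal_zero, mul_zero, neg_zero, Complex.exp_zero, one_smul] at h0
    have e0 : exp2 A z₀ lam 0 = P2 A z₀ := hG.zero
    rw [e0] at h0
    rw [← h0, smul_smul, ← Complex.exp_add, add_neg_cancel, Complex.exp_zero, one_smul]
  have h1 : ‖exp2 A z₀ lam t‖ ≤ p * Real.exp (1 / 4 * β * |t|) := by
    rw [hE, norm_smul, Complex.norm_exp, mul_comm]
    gcongr
    have e : ((lam - z₀) * t : ℂ).re = (lam - z₀.re) * t := by simp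
    rw [e]
    refine (le_abs_self _).trans ?_
    rw [abs_mul]
    gcongr
  constructor
  · refine (hG.fracBound hT hc hα h1).mono ?_
    rw [← mul_assoc]
    gcongr
    linarith
  · refine h1.trans ?_
    gcongr
    have : 0 ≤ c₀ * (‖B‖ + |a| + 1) * p := by positivity
    linarith

theorem exists_exp3_bound (hA : IsSectorial A) (hT : IsShiftedSemigroup A a T L C δ)
    (hc : IsMomentConstant T c₀) (hβ' : β < β₂ - z₀.re) :
    ∃ M, 0 < M ∧ ∀ lam : ℝ, |lam - z₀.re| ≤ 1 / 4 * β → ∀ α ∈ Ico (0 : ℝ) 1, ∀ t : ℝ, 0 < t →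
      FracFracBound A a α (exp3 A β₁ z₀ lam t) (M * Real.exp (-(3 / 4 * β * t))) ∧
      FracBound A a α (exp3 A β₁ z₀ lam t) (M * t ^ (-α) * Real.exp (-(3 / 4 * β * t))) := by
  obtain ⟨D, hS⟩ := exists_isAnalyticSemigroup hA
  -- Any rate strictly between `Re z₀ + β` and `β₂` would do: the surplus `m - Re z₀ - β` over the
  -- required decay pays for the factor `t + 1` below.
  set m := (z₀.re + β + β₂) / 2 with hm
  have hm1 : m < β₂ := by rw [hm]; linarith
  have hm2 : z₀.re + β < m := by rw [hm]; linarith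
  have hP := h.graphComm_P3 hA
  obtain ⟨C₁, hC₁, hb₁⟩ := hS.exists_norm_mul_le hA hP (h.P3_mul_P3 hA) (h.subset_relSet_P3 hA) hm1
  obtain ⟨C₂, hC₂, hb₂⟩ := hS.exists_norm_deriv_mul_le hb₁
  obtain ⟨κ, hκ, hκb⟩ := exists_one_add_inv_mul_exp_le (κ := 3 / 4 * β)
    (κ' := 3 / 4 * β + (m - z₀.re - β)) (by linarith)
  have hc0 := hc.1
  set M := C₁ + c₀ * (C₂ + |a| * C₁ + C₁) * κ with hM
  refine ⟨M, by positivity, fun lam hlam α hα t ht => ?_⟩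
  rw [abs_le] at hlam
  have hexp : Real.exp (lam * t) * Real.exp (-(m * t)) ≤
      Real.exp (-((3 / 4 * β + (m - z₀.re - β)) * t)) := by
    rw [← Real.exp_add]
    apply Real.exp_le_exp.2
    nlinarith
  have hexp2 : Real.exp (-((3 / 4 * β + (m - z₀.re - β)) * t)) ≤ Real.exp (-(3 / 4 * β * t)) := by
    apply Real.exp_le_exp.2
    nlinarith
  set e := Real.exp (-((3 / 4 * β + (m - z₀.re - β)) * t)) with he
  have he0 : 0 < e := Real.exp_pos _
  have h1 : ‖exp3 A β₁ z₀ lam t‖ ≤ C₁ * e := by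
    rw [exp3, norm_exp_smul_le]
    calc _ ≤ Real.exp (lam * t) * (C₁ * Real.exp (-(m * t))) := by gcongr; exact hb₁ t ht
      _ = C₁ * (Real.exp (lam * t) * Real.exp (-(m * t))) := by ring
      _ ≤ _ := by gcongr
  have hg : GraphOp A (exp3 A β₁ z₀ lam t)
      (((Real.exp (lam * t) : ℝ) : ℂ) • (D t * P3 A β₁ z₀)) :=
    ((hS.graph t ht).mul _).smul _
  have h2 : ‖((Real.exp (lam * t) : ℝ) : ℂ) • (D t * P3 A β₁ z₀)‖ ≤ C₂ * (1 + t⁻¹) * e := by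
    have hti : 0 < t⁻¹ := inv_pos.2 ht
    rw [norm_exp_smul_le]
    calc _ ≤ Real.exp (lam * t) * (C₂ * (1 + t⁻¹) * Real.exp (-(m * t))) := by
          gcongr; exact hb₂ t ht
      _ = C₂ * (1 + t⁻¹) * (Real.exp (lam * t) * Real.exp (-(m * t))) := by ring
      _ ≤ _ := by gcongr
  constructor
  · have hcomm : Commute (exp3 A β₁ z₀ lam t) (negFracPow A a α) := by
      rw [hT.negFracPow_eq]
      refine hT.commute_fracInt (fun s hs => hT.commute_of_graphComm hA ?_ hs.le) hα.1
      exact ((hS.comm t ht.le).mul hP).smul _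
    rw [FracSpace.fracFracBound_iff (hT.injective hα) hcomm]
    intro x
    refine ContinuousLinearMap.le_of_opNorm_le _ (h1.trans ?_) x
    have : C₁ ≤ M := by
      have : 0 ≤ c₀ * (C₂ + |a| * C₁ + C₁) * κ := by positivity
      linarith
    gcongr
  -- With `τ = t` both terms of the moment inequality scale like `t^{-α}`, because the derivative
  -- bound carries `1 + t⁻¹`.
  · refine (hT.fracBound_of_graphOp hc hα hg ht h1 h2).mono ?_
    have e1 : t ^ (1 - α) = t ^ (-α) * t := by
      rw [sub_eq_neg_add, Real.rpow_add ht, Real.rpow_one]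
    have ht0 : 0 ≤ t ^ (-α) := Real.rpow_nonneg ht.le _
    have e2 : t * (1 + t⁻¹) = t + 1 := by field_simp
    calc _ = c₀ * t ^ (-α) * ((C₂ * (t * (1 + t⁻¹)) + |a| * C₁ * t + C₁) * e) := by rw [e1]; ring
      _ = c₀ * t ^ (-α) * ((C₂ * (t + 1) + |a| * C₁ * t + C₁) * e) := by rw [e2]
      _ ≤ c₀ * t ^ (-α) * ((C₂ + |a| * C₁ + C₁) * ((t + 1) * e)) := by
        have e3 : C₂ * (t + 1) + |a| * C₁ * t + C₁ ≤ (C₂ + |a| * C₁ + C₁) * (t + 1) := by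
          have : 0 ≤ C₁ * t + |a| * C₁ := by positivity
          linarith
        rw [← mul_assoc (C₂ + |a| * C₁ + C₁)]
        gcongr
      _ ≤ c₀ * t ^ (-α) * ((C₂ + |a| * C₁ + C₁) * (κ * Real.exp (-(3 / 4 * β * t)))) :=
        mul_le_mul_of_nonneg_left (mul_le_mul_of_nonneg_left (hκb t ht) (by positivity))
          (by positivity)
      _ = c₀ * (C₂ + |a| * C₁ + C₁) * κ * t ^ (-α) * Real.exp (-(3 / 4 * β * t)) := by ring
      _ ≤ _ := by
        gcongr
        linarith

/-- The exponential estimates hold, uniformly in `lam` and `α`, once those on `X²` do. -/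
theorem exists_expEstimates (hA : IsSectorial A) (hT : IsShiftedSemigroup A a T L C δ)
    (hc : IsMomentConstant T c₀) (hβ : 0 < β) (hβ' : β < min (z₀.re - β₁) (β₂ - z₀.re))
    {J : Set ℝ} (hJ : ∀ lam ∈ J, |lam - z₀.re| ≤ 1 / 4 * β) {M₂ : ℝ} (hM₂ : 0 < M₂)
    (h2 : ∀ lam ∈ J, ∀ α ∈ Ico (0 : ℝ) 1, Exp2Bound A a z₀ β lam α M₂) :
    ∃ M, 0 < M ∧ ∀ lam ∈ J, ∀ α ∈ Ico (0 : ℝ) 1, ExpEstimates A a z₀ β₁ β lam α M := by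
  rw [lt_min_iff] at hβ'
  obtain ⟨M₁, hM₁, h1⟩ := h.exists_exp1_bound hA hT hc hβ hβ'.1
  obtain ⟨M₃, hM₃, h3⟩ := h.exists_exp3_bound hA hT hc hβ'.2
  have l1 : M₁ ≤ M₁ + M₂ + M₃ := by linarith
  have l2 : M₂ ≤ M₁ + M₂ + M₃ := by linarith
  have l3 : M₃ ≤ M₁ + M₂ + M₃ := by linarith
  refine ⟨M₁ + M₂ + M₃, by positivity, fun lam hlam α hα => ⟨fun t ht => ?_, fun t ht => ?_,
    fun t => ?_, fun t => ?_, fun t ht => ?_, fun t ht => ?_⟩⟩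
  · exact (h1 lam (hJ lam hlam) α hα t ht).1.mono (by gcongr)
  · exact (h1 lam (hJ lam hlam) α hα t ht).2.trans (by gcongr)
  · exact (h2 lam hlam α hα t).1.mono (by gcongr)
  · exact (h2 lam hlam α hα t).2.trans (by gcongr)
  · exact (h3 lam (hJ lam hlam) α hα t ht).1.mono (by gcongr)
  · exact (h3 lam (hJ lam hlam) α hα t ht).2.mono (by gcongr)

end SpectralSplitting

end Complete

end

section
variable {T L : ℝ → X →L[ℂ] X} {C δ γ κ b : ℝ} {G : ℝ → X}

/-! ### Regularity of Duhamel integrals -/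

theorem integral_comp_add_right_Ioi (f : ℝ → X) (a b : ℝ) :
    ∫ x in Ioi a, f (x + b) = ∫ x in Ioi (a + b), f x := by
  have := (measurePreserving_add_right (volume : Measure ℝ) b).setIntegral_preimage_emb
    (measurableEmbedding_addRight b) f (Ioi (a + b))
  rwa [preimage_add_const_Ioi, add_sub_cancel_right] at this

section Complete

variable [CompleteSpace X]

namespace IsDecaying

theorem integral_apply_eq (h : IsDecaying T L C δ) {t : ℝ} (ht : 0 ≤ t) (y : X) :
    ∫ r in (0 : ℝ)..t, T r y = fracInt T 1 y - T t (fracInt T 1 y) := by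
  have hc : ContinuousOn (fun r => -T r (fracInt T 1 y)) (Icc 0 t) :=
    (((h.continuousOn_apply _).mono Icc_subset_Ici_self)).neg
  have hd : ∀ r ∈ Ioo 0 t, HasDerivAt (fun r => -T r (fracInt T 1 y)) (T r y) r := by
    intro r hr
    have := ((h.deriv r hr.1).op_apply_const (fracInt T 1 y)).fun_neg
    refine this.congr_deriv ?_
    have e := congrArg (fun B : X →L[ℂ] X => B y) (h.deriv_mul_fracInt_one hr.1)
    rw [neg_apply, neg_neg]
    exact e
  have hi : IntervalIntegrable (fun r => T r y) volume 0 t := by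
    refine ContinuousOn.intervalIntegrable ?_
    rw [uIcc_of_le ht]
    exact (h.continuousOn_apply y).mono Icc_subset_Ici_self
  rw [intervalIntegral.integral_eq_sub_of_hasDerivAt_of_le ht hc hd hi, h.zero,
    one_apply_eq_self]
  abel

variable (h : IsDecaying T L C δ) (hG : Continuous G) {B : ℝ} (hB : ∀ t, ‖G t‖ ≤ B)
include h hG hB

theorem norm_apply_shift_le {t r : ℝ} (hr : 0 < r) :
    ‖T r (G (t - r))‖ ≤ C * B * (r ^ (-0 : ℝ) * Real.exp (-(δ * r))) := by
  rw [neg_zero, Real.rpow_zero, one_mul]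
  have := h.C_pos
  calc _ ≤ ‖T r‖ * ‖G (t - r)‖ := ContinuousLinearMap.le_opNorm _ _
    _ ≤ (C * Real.exp (-(δ * r))) * B := by gcongr; exacts [h.norm_le r hr.le, hB _]
    _ = _ := by ring

theorem integrableOn_apply_shift (t : ℝ) : IntegrableOn (fun r => T r (G (t - r))) (Ioi 0) :=
  integrableOn_Ioi_of_norm_le (h.continuousOn.clm_apply (by fun_prop)) zero_lt_one
    h.δ_pos fun _ hr => h.norm_apply_shift_le hG hB hr

theorem continuous_duhamel : Continuous fun t => ∫ r in Ioi 0, T r (G (t - r)) := by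
  refine continuous_of_dominated (bound := fun r => C * B * (r ^ (-0 : ℝ) * Real.exp (-(δ * r))))
    (fun t => (h.integrableOn_apply_shift hG hB t).aestronglyMeasurable) (fun t => ?_)
    ((integrableOn_rpow_mul_exp zero_lt_one h.δ_pos).const_mul _)
    (Eventually.of_forall fun r => by fun_prop)
  exact (ae_restrict_iff' measurableSet_Ioi).2
    (Eventually.of_forall fun r hr => h.norm_apply_shift_le hG hB hr)

theorem duhamel_add (t : ℝ) {s : ℝ} (hs : 0 ≤ s) :
    ∫ r in Ioi 0, T r (G (t + s - r)) = T s (∫ r in Ioi 0, T r (G (t - r))) +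
      ∫ r in (0 : ℝ)..s, T r (G (t + s - r)) := by
  have hi := h.integrableOn_apply_shift hG hB
  have e1 : T s (∫ r in Ioi 0, T r (G (t - r))) = ∫ r in Ioi s, T r (G (t + s - r)) := by
    rw [← ContinuousLinearMap.integral_comp_comm _ (hi t)]
    have := integral_comp_add_right_Ioi (fun r => T r (G (t + s - r))) 0 s
    rw [zero_add] at this
    rw [← this]
    refine setIntegral_congr_fun measurableSet_Ioi fun r hr => ?_
    rw [add_comm r s, h.add s r hs (le_of_lt hr), mul_apply_eq_comp]
    congr 3
    ring
  rw [e1, intervalIntegral.integral_of_le hs, add_comm (∫ r in Ioi s, T r (G (t + s - r))),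
    ← setIntegral_union
    (Ioc_disjoint_Ioi le_rfl) measurableSet_Ioi ((hi (t + s)).mono_set Ioc_subset_Ioi_self)
    ((hi (t + s)).mono_set (Ioi_subset_Ioi hs)), Ioc_union_Ioi_eq_Ioi hs]

variable (hγ : 0 < γ) (hκ : ∀ s t, ‖G s - G t‖ ≤ κ * |s - t| ^ γ)
include hγ hκ

omit hG hB in
-- Subtracting `G t` turns the non-integrable `1/r` of `L r` into `r^{γ-1}`, thanks to the Hölder
-- condition.
theorem norm_deriv_apply_sub_le {t r : ℝ} (hr : 0 < r) :
    ‖L r (G (t - r) - G t)‖ ≤ C * κ * (r ^ (-(1 - γ)) * Real.exp (-(δ * r))) := by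
  have := h.C_pos
  have e : t - r - t = -r := by ring
  have h1 := hκ (t - r) t
  rw [e, abs_neg, abs_of_pos hr] at h1
  have e2 : r ^ (-(1 - γ)) = r⁻¹ * r ^ γ := by
    rw [show -(1 - γ) = -1 + γ by ring, Real.rpow_add hr, Real.rpow_neg_one]
  have hri : 0 < r⁻¹ := inv_pos.2 hr
  calc _ ≤ ‖L r‖ * ‖G (t - r) - G t‖ := ContinuousLinearMap.le_opNorm _ _
    _ ≤ (C * r⁻¹ * Real.exp (-(δ * r))) * (κ * r ^ γ) := by
      gcongr
      exact h.norm_deriv_le r hr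
    _ = _ := by rw [e2]; ring

omit hB in
theorem integrableOn_deriv_apply (t : ℝ) :
    IntegrableOn (fun r => L r (G (t - r) - G t)) (Ioi 0) :=
  integrableOn_Ioi_of_norm_le (h.continuousOn_deriv.clm_apply (by fun_prop)) (by linarith)
    h.δ_pos fun _ hr => h.norm_deriv_apply_sub_le hγ hκ hr

omit hB in
theorem continuous_deriv_duhamel : Continuous fun t => ∫ r in Ioi 0, L r (G (t - r) - G t) := by
  refine continuous_of_dominated
    (bound := fun r => C * κ * (r ^ (-(1 - γ)) * Real.exp (-(δ * r))))
    (fun t => (h.integrableOn_deriv_apply hG hγ hκ t).aestronglyMeasurable) (fun t => ?_)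
    ((integrableOn_rpow_mul_exp (by linarith) h.δ_pos).const_mul _)
    (Eventually.of_forall fun r => by fun_prop)
  exact (ae_restrict_iff' measurableSet_Ioi).2
    (Eventually.of_forall fun r hr => h.norm_deriv_apply_sub_le hγ hκ hr)

/-- This computes `Λ` of the Duhamel integral. The formal `∫ L r (G (t - r)) dr` diverges in
general; the part belonging to the constant `G t` is integrated exactly and contributes `G t`. -/
theorem fracInt_one_duhamel (t : ℝ) :
    fracInt T 1 ((∫ r in Ioi 0, L r (G (t - r) - G t)) + G t) = ∫ r in Ioi 0, T r (G (t - r)) := by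
  have hT : IntegrableOn T (Ioi 0) := by
    have hi := h.integrableOn (γ := 0) (by norm_num)
    simpa only [Real.rpow_zero, Complex.ofReal_one, one_smul] using hi
  rw [map_add, ← ContinuousLinearMap.integral_comp_comm _ (h.integrableOn_deriv_apply hG hγ hκ t)]
  have e : ∀ r ∈ Ioi (0 : ℝ), fracInt T 1 (L r (G (t - r) - G t)) = T r (G (t - r)) - T r (G t) := by
    intro r hr
    rw [← map_sub, ← h.fracInt_one_mul_deriv hr]
    rfl
  rw [setIntegral_congr_fun measurableSet_Ioi e, integral_sub (h.integrableOn_apply_shift hG hB t)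
    (hT.apply_continuousLinearMap (G t)), fracInt_one, ContinuousLinearMap.integral_apply hT,
    sub_add_cancel]

/-- The increment over a step `p` is `(T p - 1) W + ∫_0^p T r (G (t + p - r)) dr`. As `W = Λ⁻¹ (Z +
G t)`, its first term is `-∫_0^p T r (Z + G t) dr`, so the error in the difference quotient is an
average of `T r (G (t + p - r) - G t) - (T r Z - Z)` over `[0, p]`. -/
theorem hasDerivWithinAt_duhamel (t : ℝ) :
    HasDerivWithinAt (fun t => ∫ r in Ioi 0, T r (G (t - r)))
      (-∫ r in Ioi 0, L r (G (t - r) - G t)) (Ici t) t := by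
  set Z := ∫ r in Ioi 0, L r (G (t - r) - G t) with hZ
  have hW := h.fracInt_one_duhamel hG hB hγ hκ t
  rw [← hZ] at hW
  have hC := h.C_pos
  rw [hasDerivWithinAt_iff_isLittleO, Asymptotics.isLittleO_iff]
  intro ε hε
  have h1 : ∀ᶠ p in 𝓝 (0 : ℝ), ∀ r ∈ Icc 0 p, ‖T r Z - Z‖ ≤ ε / 2 := by
    have hc := h.continuousOn_apply Z 0 self_mem_Ici
    rw [ContinuousWithinAt, h.zero, one_apply_eq_self, Metric.tendsto_nhdsWithin_nhds] at hc
    obtain ⟨η, hη, hc⟩ := hc (ε / 2) (by positivity)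
    filter_upwards [gt_mem_nhds hη] with p hp r hr
    have := hc hr.1 (by rw [dist_zero_right, Real.norm_eq_abs, abs_of_nonneg hr.1]; linarith [hr.2])
    rw [dist_eq_norm] at this
    exact this.le
  have h2 : ∀ᶠ p in 𝓝 (0 : ℝ), C * ‖G (t + p) - G t‖ ≤ ε / 2 := by
    have : Continuous fun p => C * ‖G (t + p) - G t‖ := by fun_prop
    have := this.tendsto 0
    simp only [add_zero, sub_self, norm_zero, mul_zero] at this
    filter_upwards [this.eventually (gt_mem_nhds (half_pos hε))] with p hp using le_of_lt hp
  have h3 : ∀ᶠ p in 𝓝 (0 : ℝ), ∀ r ∈ Icc 0 p, C * ‖G (t + p - r) - G t‖ ≤ ε / 2 := by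
    obtain ⟨η, hη, hc⟩ := Metric.eventually_nhds_iff.1 h2
    filter_upwards [gt_mem_nhds hη] with p hp r hr
    have := hc (y := p - r) (by
      rw [dist_zero_right, Real.norm_eq_abs, abs_of_nonneg (by linarith [hr.2])]; linarith [hr.1])
    rwa [← add_sub_assoc] at this
  have hsub : Tendsto (fun s => s - t) (𝓝[≥] t) (𝓝 0) := by
    have : Continuous fun s : ℝ => s - t := by fun_prop
    simpa using (this.tendsto t).mono_left nhdsWithin_le_nhds
  filter_upwards [hsub.eventually h1, hsub.eventually h3, self_mem_nhdsWithin] with s hs1 hs3 hs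
  set p := s - t with hp
  have hp0 : 0 ≤ p := sub_nonneg.2 hs
  have hst : s = t + p := by rw [hp]; ring
  have e1 := h.duhamel_add hG hB t hp0
  have e2 := h.integral_apply_eq hp0 (Z + G t)
  rw [hW] at e2
  have hi1 : IntervalIntegrable (fun r => T r (G (t + p - r))) volume 0 p :=
    (intervalIntegrable_iff_integrableOn_Ioc_of_le hp0).2
      ((h.integrableOn_apply_shift hG hB (t + p)).mono_set Ioc_subset_Ioi_self)
  have hi2 : IntervalIntegrable (fun r => T r (Z + G t)) volume 0 p := by
    refine ContinuousOn.intervalIntegrable ?_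
    rw [uIcc_of_le hp0]
    exact (h.continuousOn_apply _).mono Icc_subset_Ici_self
  have e3 : (∫ r in Ioi 0, T r (G (s - r))) - (∫ r in Ioi 0, T r (G (t - r))) - p • -Z =
      ∫ r in (0 : ℝ)..p, (T r (G (t + p - r)) - T r (Z + G t) + Z) := by
    rw [intervalIntegral.integral_add (hi1.sub hi2) intervalIntegrable_const,
      intervalIntegral.integral_sub hi1 hi2, e2, hst, e1, intervalIntegral.integral_const,
      sub_zero, smul_neg]
    abel
  rw [e3]
  have hbd : ∀ r ∈ uIoc 0 p, ‖T r (G (t + p - r)) - T r (Z + G t) + Z‖ ≤ ε := by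
    intro r hr
    rw [uIoc_of_le hp0] at hr
    have hr' : r ∈ Icc 0 p := ⟨hr.1.le, hr.2⟩
    have e4 : T r (G (t + p - r)) - T r (Z + G t) + Z =
        T r (G (t + p - r) - G t) - (T r Z - Z) := by
      rw [map_add, map_sub]; abel
    rw [e4]
    have h5 : ‖T r (G (t + p - r) - G t)‖ ≤ ε / 2 :=
      ((T r).le_of_opNorm_le (h.norm_le' hr'.1) _).trans (hs3 r hr')
    calc _ ≤ _ := norm_sub_le _ _
      _ ≤ ε / 2 + ε / 2 := add_le_add h5 (hs1 r hr')
      _ = ε := by ring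
  have := intervalIntegral.norm_integral_le_of_norm_le_const hbd
  rw [sub_zero] at this
  exact this

/-- The right derivative is continuous, which makes it a derivative: adding its primitive gives a
continuous function with right derivative zero, hence a constant. -/
theorem hasDerivAt_duhamel (t : ℝ) :
    HasDerivAt (fun t => ∫ r in Ioi 0, T r (G (t - r)))
      (-∫ r in Ioi 0, L r (G (t - r) - G t)) t := by
  have hZc := h.continuous_deriv_duhamel hG hγ hκ
  set Z := fun t => ∫ r in Ioi 0, L r (G (t - r) - G t) with hZ
  set W := fun t => ∫ r in Ioi 0, T r (G (t - r)) with hW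
  have hI : ∀ s, HasDerivAt (fun s => ∫ r in t..s, Z r) (Z s) s := fun s =>
    intervalIntegral.integral_hasDerivAt_right (hZc.intervalIntegrable _ _)
      hZc.stronglyMeasurable.stronglyMeasurableAtFilter hZc.continuousAt
  have hconst : ∀ s ∈ Icc (t - 1) (t + 1), W s + ∫ r in t..s, Z r =
      W (t - 1) + ∫ r in t..(t - 1), Z r := by
    refine constant_of_has_deriv_right_zero (f := fun s => W s + ∫ r in t..s, Z r) ?_ ?_
    · exact ((h.continuous_duhamel hG hB).add (continuous_iff_continuousAt.2
        fun s => (hI s).continuousAt)).continuousOn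
    · intro s _
      have := (h.hasDerivWithinAt_duhamel hG hB hγ hκ s).add (hI s).hasDerivWithinAt
      rwa [neg_add_cancel] at this
  have h1 : HasDerivAt (fun s => (W (t - 1) + ∫ r in t..(t - 1), Z r) - ∫ r in t..s, Z r)
      (-Z t) t := (hI t).const_sub _
  refine h1.congr_of_eventuallyEq ?_
  filter_upwards [Icc_mem_nhds (show t - 1 < t by linarith) (show t < t + 1 by linarith)] with s hs
  rw [← hconst s hs, add_sub_cancel_right]

end IsDecaying

/-- `v` is Hölder continuous on `[a, b]`. -/
def HolderOnIcc (v : ℝ → X) (a b γ : ℝ) : Prop :=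
  ∃ κ, ∀ s ∈ Icc a b, ∀ t ∈ Icc a b, ‖v s - v t‖ ≤ κ * |s - t| ^ γ

/-- Extending `G` from `[0, b]` to the line by its end values makes the half-line results available.
The artificial history before time zero contributes only `T t (Λ⁻¹ G 0)`, which is subtracted from
the initial value. -/
theorem IsDecaying.exists_hasDerivAt (h : IsDecaying T L C δ) (hγ : 0 < γ) (hb : 0 ≤ b)
    (hG : HolderOnIcc G 0 b γ) (y₀ : X) {t : ℝ} (ht : t ∈ Ioo 0 b) :
    ∃ q, fracInt T 1 q = T t y₀ + ∫ s in (0 : ℝ)..t, T (t - s) (G s) ∧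
      HasDerivAt (fun t => T t y₀ + ∫ s in (0 : ℝ)..t, T (t - s) (G s)) (G t - q) t := by
  obtain ⟨κ, hκ⟩ := hG
  set F : ℝ → X := fun s => G (projIcc 0 b hb s) with hF
  have hκ' : ∀ s t, ‖F s - F t‖ ≤ |κ| * |s - t| ^ γ := by
    intro s t
    refine (hκ _ (projIcc 0 b hb s).2 _ (projIcc 0 b hb t).2).trans ?_
    have h1 : |(projIcc 0 b hb s : ℝ) - projIcc 0 b hb t| ≤ |s - t| := abs_projIcc_sub_projIcc hb
    gcongr
    exact le_abs_self κ
  have hFc : Continuous F := by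
    rw [Metric.continuous_iff']
    intro t ε hε
    have h1 : Tendsto (fun s : ℝ => |κ| * |s - t| ^ γ) (𝓝 t) (𝓝 (|κ| * |t - t| ^ γ)) := by
      refine Tendsto.const_mul _ (Tendsto.rpow_const ?_ (Or.inr hγ.le))
      exact (by fun_prop : Continuous fun s : ℝ => |s - t|).tendsto t
    rw [sub_self, abs_zero, Real.zero_rpow hγ.ne', mul_zero] at h1
    filter_upwards [h1.eventually (gt_mem_nhds hε)] with s hs
    rw [dist_eq_norm]
    exact (hκ' s t).trans_lt hs
  obtain ⟨B, hB⟩ : ∃ B, ∀ t, ‖F t‖ ≤ B := by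
    obtain ⟨B, hB⟩ := (isCompact_Icc (a := 0) (b := b)).exists_bound_of_continuousOn hFc.continuousOn
    refine ⟨B, fun t => ?_⟩
    have := hB (projIcc 0 b hb t) (projIcc 0 b hb t).2
    simp only [hF, projIcc_val] at this ⊢
    exact this
  have hFG : ∀ s ∈ Icc 0 b, F s = G s := fun s hs => by simp only [hF]; rw [projIcc_of_mem hb hs]
  have hF0 : ∀ s ≤ 0, F s = G 0 := fun s hs => by simp only [hF]; rw [projIcc_of_le_left hb hs]
  set R := fracInt T 1 with hR
  have key : ∀ s ∈ Ioo 0 b, T s y₀ + ∫ r in (0 : ℝ)..s, T (s - r) (G r) =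
      T s (y₀ - R (G 0)) + ∫ r in Ioi 0, T r (F (s - r)) := by
    intro s hs
    have hi := h.integrableOn_apply_shift hFc hB s
    have e1 : ∫ r in (0 : ℝ)..s, T (s - r) (G r) = ∫ r in Ioc 0 s, T r (F (s - r)) := by
      rw [← intervalIntegral.integral_of_le hs.1.le]
      have := intervalIntegral.integral_comp_sub_left (fun r => T r (F (s - r))) (a := 0) (b := s) s
      rw [sub_zero, sub_self] at this
      rw [← this]
      refine intervalIntegral.integral_congr fun r hr => ?_
      rw [uIcc_of_le hs.1.le] at hr
      simp only [sub_sub_cancel]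
      rw [hFG r ⟨hr.1, hr.2.trans hs.2.le⟩]
    have e2 : ∫ r in Ioi s, T r (F (s - r)) = T s (R (G 0)) := by
      have e3 : ∀ r ∈ Ioi s, T r (F (s - r)) = T r (G 0) := fun r hr => by
        rw [hF0 _ (by linarith [mem_Ioi.1 hr])]
      rw [setIntegral_congr_fun measurableSet_Ioi e3]
      have hT : IntegrableOn T (Ioi 0) := by
        have hi := h.integrableOn (γ := 0) (by norm_num)
        simpa only [Real.rpow_zero, Complex.ofReal_one, one_smul] using hi
      rw [hR, fracInt_one, ContinuousLinearMap.integral_apply hT,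
        ← ContinuousLinearMap.integral_comp_comm _ (hT.apply_continuousLinearMap (G 0))]
      have := integral_comp_add_right_Ioi (fun r => T r (G 0)) 0 s
      rw [zero_add] at this
      rw [← this]
      refine setIntegral_congr_fun measurableSet_Ioi fun r hr => ?_
      rw [add_comm r s, h.add s r hs.1.le (le_of_lt hr), mul_apply_eq_comp]
    rw [e1, ← Ioc_union_Ioi_eq_Ioi hs.1.le, setIntegral_union (Ioc_disjoint_Ioi le_rfl)
      measurableSet_Ioi (hi.mono_set Ioc_subset_Ioi_self)
      (hi.mono_set (Ioi_subset_Ioi hs.1.le)), e2, map_sub]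
    abel
  have hd := h.hasDerivAt_duhamel hFc hB hγ hκ' t
  have hd2 := (h.deriv t ht.1).op_apply_const (y₀ - R (G 0))
  refine ⟨L t (y₀ - R (G 0)) + ((∫ r in Ioi 0, L r (F (t - r) - F t)) + F t), ?_, ?_⟩
  · rw [key t ht, map_add, h.fracInt_one_duhamel hFc hB hγ hκ' t, ← h.fracInt_one_mul_deriv ht.1]
    rfl
  · refine ((hd2.add hd).congr_deriv ?_).congr_of_eventuallyEq ?_
    · rw [hFG t ⟨ht.1.le, ht.2.le⟩, neg_apply]
      abel
    · filter_upwards [Ioo_mem_nhds ht.1 ht.2] with s hs using key s hs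

end Complete

end

section
/-! ### Fixed points in exponentially weighted spaces -/

/-- `v` grows at most like `e^{κ|t|}`. -/
def IsExpBounded (κ : ℝ) (v : ℝ → X) : Prop := ∃ B, ∀ t, ‖v t‖ ≤ B * Real.exp (κ * |t|)

/-- A substitute for Gronwall's inequality: the best constant `B` is finite and satisfies `B ≤ q B +
k`. -/
theorem le_div_one_sub_mul {n ρ : ℝ → ℝ} {q k B₀ : ℝ} (hρ : ∀ t, 0 < ρ t) (hq : q < 1)
    (h₀ : ∀ t, n t ≤ B₀ * ρ t)
    (h : ∀ B, (∀ t, n t ≤ B * ρ t) → ∀ t, n t ≤ (q * B + k) * ρ t) (t : ℝ) :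
    n t ≤ k / (1 - q) * ρ t := by
  have hb : BddAbove (range fun t => n t / ρ t) :=
    ⟨B₀, by rintro _ ⟨t, rfl⟩; exact (div_le_iff₀ (hρ t)).2 (h₀ t)⟩
  set B := ⨆ t, n t / ρ t
  have h1 : ∀ t, n t ≤ B * ρ t := fun t => (div_le_iff₀ (hρ t)).1 (le_ciSup hb t)
  have h2 : B ≤ q * B + k := ciSup_le fun t => (div_le_iff₀ (hρ t)).2 (h B h1 t)
  have h3 : B ≤ k / (1 - q) := (le_div_iff₀ (by linarith)).2 (by linarith)
  exact (h1 t).trans (mul_le_mul_of_nonneg_right h3 (hρ t).le)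

/-- Multiplication by `e^{κ|t|}` identifies the bounded continuous functions with the weighted
space, so Banach's theorem can be applied there. -/
theorem exists_fixedPoint [CompleteSpace X] {κ q : ℝ} (hq0 : 0 ≤ q) (hq : q < 1)
    (Ψ : (ℝ → X) → ℝ → X)
    (hΨ : ∀ v, Continuous v → IsExpBounded κ v → Continuous (Ψ v) ∧ IsExpBounded κ (Ψ v))
    (h : ∀ v v' B, Continuous v → IsExpBounded κ v → Continuous v' → IsExpBounded κ v' →
      (∀ t, ‖v t - v' t‖ ≤ B * Real.exp (κ * |t|)) →
        ∀ t, ‖Ψ v t - Ψ v' t‖ ≤ q * B * Real.exp (κ * |t|)) :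
    ∃ v, Continuous v ∧ IsExpBounded κ v ∧ Ψ v = v := by
  let up : BoundedContinuousFunction ℝ X → ℝ → X := fun φ t => Real.exp (κ * |t|) • φ t
  have hup : ∀ φ, Continuous (up φ) := fun φ => by
    have := φ.continuous
    fun_prop
  have hup' : ∀ φ, IsExpBounded κ (up φ) := fun φ => ⟨‖φ‖, fun t => by
    rw [norm_smul, Real.norm_eq_abs, Real.abs_exp, mul_comm]
    exact mul_le_mul_of_nonneg_right (φ.norm_coe_le_norm t) (Real.exp_pos _).le⟩
  let F : BoundedContinuousFunction ℝ X → BoundedContinuousFunction ℝ X := fun φ =>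
    BoundedContinuousFunction.ofNormedAddCommGroup
      (fun t => Real.exp (-(κ * |t|)) • Ψ (up φ) t)
      (by have := (hΨ _ (hup φ) (hup' φ)).1; fun_prop)
      (hΨ _ (hup φ) (hup' φ)).2.choose fun t => by
        rw [norm_smul, Real.norm_eq_abs, Real.abs_exp, Real.exp_neg, inv_mul_le_iff₀ (Real.exp_pos _),
          mul_comm]
        exact (hΨ _ (hup φ) (hup' φ)).2.choose_spec t
  have hF : ContractingWith ⟨q, hq0⟩ F := by
    refine ⟨by exact_mod_cast hq, LipschitzWith.of_dist_le_mul fun φ ψ => ?_⟩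
    rw [BoundedContinuousFunction.dist_le (by positivity)]
    intro t
    have h1 : ∀ t, ‖up φ t - up ψ t‖ ≤ dist φ ψ * Real.exp (κ * |t|) := fun t => by
      rw [← smul_sub, norm_smul, Real.norm_eq_abs, Real.abs_exp, mul_comm, ← dist_eq_norm]
      exact mul_le_mul_of_nonneg_right (BoundedContinuousFunction.dist_coe_le_dist t)
        (Real.exp_pos _).le
    have h2 := h _ _ _ (hup φ) (hup' φ) (hup ψ) (hup' ψ) h1 t
    change dist (Real.exp (-(κ * |t|)) • Ψ (up φ) t) (Real.exp (-(κ * |t|)) • Ψ (up ψ) t) ≤ _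
    rw [dist_eq_norm, ← smul_sub, norm_smul, Real.norm_eq_abs, Real.abs_exp, Real.exp_neg,
      inv_mul_le_iff₀ (Real.exp_pos _), mul_comm]
    exact h2
  have hfix := hF.fixedPoint_isFixedPt
  set φ := ContractingWith.fixedPoint F hF
  refine ⟨up φ, hup φ, hup' φ, funext fun t => ?_⟩
  have h1 : Real.exp (-(κ * |t|)) • Ψ (up φ) t = φ t :=
    congrArg (fun ψ : BoundedContinuousFunction ℝ X => ψ t) hfix
  change _ = Real.exp (κ * |t|) • φ t
  rw [← h1, smul_smul, ← Real.exp_add, add_neg_cancel, Real.exp_zero, one_smul]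

/-! ### Mild solutions -/

/-- A semigroup `S` with a kernel `H` that is weakly singular at `0`, such as
`S t = e^{-Λt}`, `H t = Λ^α e^{-Λt}`. -/
structure IsKernel (S H : ℝ → X →L[ℂ] X) (α C ω : ℝ) : Prop where
  C_nonneg : 0 ≤ C
  α_lt : α < 1
  zero : S 0 = 1
  add : ∀ s t, 0 ≤ s → 0 ≤ t → S (s + t) = S s * S t
  continuousOn_apply : ∀ x, ContinuousOn (fun t => S t x) (Ici 0)
  norm_le : ∀ t, 0 ≤ t → ‖S t‖ ≤ C * Real.exp (ω * t)
  continuousOn_kernel : ContinuousOn H (Ioi 0)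
  norm_kernel_le : ∀ t, 0 < t → ‖H t‖ ≤ C * (t ^ (-α) * Real.exp (ω * t))
  mul : ∀ s t, 0 ≤ s → 0 < t → S s * H t = H (s + t)

/-- The Duhamel integral. -/
def duhamel (H : ℝ → X →L[ℂ] X) (G : ℝ → X) (t : ℝ) : X := ∫ s in (0 : ℝ)..t, H (t - s) (G s)

/-- `v` satisfies the variation of constants formula at the times `t ∈ J`. -/
def MildOn (S H : ℝ → X →L[ℂ] X) (g : X → X) (v : ℝ → X) (J : Set ℝ) : Prop :=
  ∀ t ∈ J, v t = S t (v 0) + duhamel H (fun s => g (v s)) t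

theorem duhamel_eq (H : ℝ → X →L[ℂ] X) (G : ℝ → X) (t : ℝ) :
    duhamel H G t = ∫ r in (0 : ℝ)..t, H r (G (t - r)) := by
  have := intervalIntegral.integral_comp_sub_left (fun r => H r (G (t - r))) (a := 0) (b := t) t
  simp only [sub_zero, sub_self, sub_sub_cancel] at this
  exact this

theorem duhamel_congr {H : ℝ → X →L[ℂ] X} {G G' : ℝ → X} {t : ℝ} (ht : 0 ≤ t)
    (h : ∀ s ∈ Icc 0 t, G s = G' s) : duhamel H G t = duhamel H G' t := by
  refine intervalIntegral.integral_congr fun s hs => ?_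
  rw [uIcc_of_le ht] at hs
  simp only [h s hs]

theorem integral_rpow_mul_exp_pos_le {α c : ℝ} (hα : α < 1) (hc : 0 < c) :
    ∫ r in Ioi (0 : ℝ), r ^ (-α) * Real.exp (-(c * r)) = Real.Gamma (1 - α) * c ^ (-(1 - α)) := by
  have := Real.integral_rpow_mul_exp_neg_mul_Ioi (a := 1 - α) (r := c) (by linarith) hc
  rw [show 1 - α - 1 = -α by ring] at this
  rw [this, one_div, Real.inv_rpow hc.le, ← Real.rpow_neg hc.le, mul_comm]

/-- The integral is `Γ(1 - α) c^{-(1-α)}`. A large exponential weight thus makes the initial value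
problem a contraction for every Lipschitz constant, without a restriction to short times. -/
theorem tendsto_integral_rpow_mul_exp {α : ℝ} (hα : α < 1) :
    Tendsto (fun c : ℝ => ∫ r in Ioi (0 : ℝ), r ^ (-α) * Real.exp (-(c * r))) atTop (𝓝 0) := by
  have h := (tendsto_rpow_neg_atTop (y := 1 - α) (by linarith)).const_mul (Real.Gamma (1 - α))
  rw [mul_zero] at h
  refine h.congr' ?_
  filter_upwards [eventually_gt_atTop 0] with c hc
  rw [integral_rpow_mul_exp_pos_le hα hc]

theorem continuous_comp_projIcc {v : ℝ → X} {b : ℝ} (hb : 0 ≤ b) (hv : ContinuousOn v (Icc 0 b)) :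
    Continuous fun t => v (projIcc 0 b hb t) :=
  hv.comp_continuous (by fun_prop) fun t => (projIcc 0 b hb t).2

theorem exists_norm_comp_projIcc_le {v : ℝ → X} {b : ℝ} (hb : 0 ≤ b)
    (hv : ContinuousOn v (Icc 0 b)) : ∃ B, 0 ≤ B ∧ ∀ t, ‖v (projIcc 0 b hb t)‖ ≤ B := by
  obtain ⟨B, hB⟩ := (isCompact_Icc (a := 0) (b := b)).exists_bound_of_continuousOn hv
  exact ⟨B, (norm_nonneg _).trans (hB 0 ⟨le_rfl, hb⟩), fun t => hB _ (projIcc 0 b hb t).2⟩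

theorem isExpBounded_comp {g : X → X} {K : ℝ≥0} (hg : LipschitzWith K g) {v : ℝ → X}
    {κ : ℝ} (hκ : 0 ≤ κ) (hv : IsExpBounded κ v) : IsExpBounded κ fun t => g (v t) := by
  obtain ⟨B, hB⟩ := hv
  refine ⟨‖g 0‖ + K * B, fun t => ?_⟩
  have h1 := hg.norm_sub_le (v t) 0
  have h2 : 1 ≤ Real.exp (κ * |t|) := Real.one_le_exp (by positivity)
  have h3 : ‖g (v t)‖ ≤ ‖g 0‖ + K * ‖v t‖ := by
    have := norm_le_norm_add_norm_sub' (g (v t)) (g 0)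
    rw [sub_zero] at h1
    linarith
  calc _ ≤ ‖g 0‖ + K * ‖v t‖ := h3
    _ ≤ ‖g 0‖ * Real.exp (κ * |t|) + K * (B * Real.exp (κ * |t|)) := by
      gcongr
      · exact le_mul_of_one_le_right (norm_nonneg _) h2
      · exact hB t
    _ = _ := by ring

section Complete

variable [CompleteSpace X]

namespace IsKernel

variable {S H : ℝ → X →L[ℂ] X} {α C ω : ℝ} {G G' : ℝ → X}

theorem integrableOn_Ioc (h : IsKernel S H α C ω) {F : ℝ → X} {B : ℝ} {b : ℝ}
    (hF : ContinuousOn F (Ioi 0)) (hB : ∀ r ∈ Ioc 0 b, ‖F r‖ ≤ B) :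
    IntegrableOn (fun r => H r (F r)) (Ioc 0 b) := by
  rcases le_or_gt b 0 with hb | hb
  · rw [Ioc_eq_empty (not_lt.2 hb)]
    exact integrableOn_empty
  have hi : IntegrableOn (fun r : ℝ => C * Real.exp (|ω| * b) * B * r ^ (-α)) (Ioc 0 b) := by
    refine Integrable.const_mul ?_ _
    have := intervalIntegral.intervalIntegrable_rpow' (a := 0) (b := b) (r := -α)
      (by linarith [h.α_lt])
    exact (intervalIntegrable_iff_integrableOn_Ioc_of_le hb.le).1 this
  refine hi.mono' (((h.continuousOn_kernel.clm_apply hF).mono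
    Ioc_subset_Ioi_self).aestronglyMeasurable measurableSet_Ioc) ?_
  refine (ae_restrict_iff' measurableSet_Ioc).2 (Eventually.of_forall fun r hr => ?_)
  have hC := h.C_nonneg
  have hr0 : 0 < r := hr.1
  have he : ω * r ≤ |ω| * b := by
    calc ω * r ≤ |ω| * r := by gcongr; exact le_abs_self ω
      _ ≤ _ := by gcongr; exact hr.2
  calc _ ≤ ‖H r‖ * ‖F r‖ := ContinuousLinearMap.le_opNorm _ _
    _ ≤ C * (r ^ (-α) * Real.exp (|ω| * b)) * B := by
      refine mul_le_mul ((h.norm_kernel_le r hr.1).trans ?_) (hB r hr) (norm_nonneg _) (by positivity)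
      gcongr
    _ = _ := by ring

theorem integrableOn_shift (h : IsKernel S H α C ω) (hG : Continuous G) (t : ℝ) :
    IntegrableOn (fun r => H r (G (t - r))) (Ioc 0 t) := by
  obtain ⟨B, hB⟩ := (isCompact_Icc (a := 0) (b := t)).exists_bound_of_continuousOn
    (f := fun r => G (t - r)) (by fun_prop)
  exact h.integrableOn_Ioc (by fun_prop) fun r hr => hB r ⟨hr.1.le, hr.2⟩

theorem intervalIntegrable (h : IsKernel S H α C ω) (hG : Continuous G) {t : ℝ} (ht : 0 ≤ t) :
    IntervalIntegrable (fun s => H (t - s) (G s)) volume 0 t := by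
  have h1 : IntervalIntegrable (fun r => H r (G (t - r))) volume 0 t :=
    (intervalIntegrable_iff_integrableOn_Ioc_of_le ht).2 (h.integrableOn_shift hG t)
  have := (h1.comp_sub_left t).symm
  simpa only [sub_sub_cancel, sub_zero, sub_self] using this

/-- Freezing `G` outside `[0, t₀ + 1]` allows an integral over a fixed interval, to which dominated
convergence applies. The error is a primitive of `H r (G 0)`, which is continuous. -/
theorem continuousOn_duhamel (h : IsKernel S H α C ω) (hG : Continuous G) :
    ContinuousOn (duhamel H G) (Ici 0) := by
  intro t₀ ht₀
  have hb : 0 ≤ t₀ + 1 := by linarith [mem_Ici.1 ht₀]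
  obtain ⟨B, hB0, hB⟩ := exists_norm_comp_projIcc_le hb (hG.continuousOn (s := Icc 0 (t₀ + 1)))
  set F : ℝ → X := fun t => G (projIcc 0 (t₀ + 1) hb t) with hF
  have hFc : Continuous F := continuous_comp_projIcc hb hG.continuousOn
  have hHi : IntegrableOn (fun r => ‖H r‖) (Ioc 0 (t₀ + 1)) := by
    have hi : IntegrableOn (fun r : ℝ => C * Real.exp (|ω| * (t₀ + 1)) * r ^ (-α))
        (Ioc 0 (t₀ + 1)) := by
      refine Integrable.const_mul ?_ _
      have := intervalIntegral.intervalIntegrable_rpow' (a := 0) (b := t₀ + 1) (r := -α)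
        (by linarith [h.α_lt])
      exact (intervalIntegrable_iff_integrableOn_Ioc_of_le hb).1 this
    refine hi.mono' ((h.continuousOn_kernel.norm.mono
      Ioc_subset_Ioi_self).aestronglyMeasurable measurableSet_Ioc) ?_
    refine (ae_restrict_iff' measurableSet_Ioc).2 (Eventually.of_forall fun r hr => ?_)
    have hC := h.C_nonneg
    have hr0 : 0 < r := hr.1
    have he : ω * r ≤ |ω| * (t₀ + 1) := by
      calc ω * r ≤ |ω| * r := by gcongr; exact le_abs_self ω
        _ ≤ _ := by gcongr; exact hr.2
    rw [norm_norm]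
    calc _ ≤ C * (r ^ (-α) * Real.exp (ω * r)) := h.norm_kernel_le r hr0
      _ ≤ C * (r ^ (-α) * Real.exp (|ω| * (t₀ + 1))) := by gcongr
      _ = _ := by ring
  have h1 : Continuous fun t => ∫ r in Ioc 0 (t₀ + 1), H r (F (t - r)) := by
    refine continuous_of_dominated (bound := fun r => ‖H r‖ * B)
      (fun t => (h.integrableOn_Ioc (by fun_prop)
        fun r _ => hB _).aestronglyMeasurable) (fun t => ?_) (hHi.mul_const B)
      (Eventually.of_forall fun r => by fun_prop)
    exact Eventually.of_forall fun r => (ContinuousLinearMap.le_opNorm _ _).trans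
      (mul_le_mul_of_nonneg_left (hB _) (norm_nonneg _))
  have h2 : ContinuousOn (fun t => ∫ r in (t₀ + 1)..t, H r (G 0)) (Icc 0 (t₀ + 1)) := by
    have hi := h.integrableOn_Ioc (b := t₀ + 1) (continuousOn_const (c := G 0)) fun r _ => le_rfl
    have := intervalIntegral.continuousOn_primitive_interval' (a := t₀ + 1)
      ((intervalIntegrable_iff_integrableOn_Ioc_of_le hb).2 hi) right_mem_uIcc
    rwa [uIcc_of_le hb] at this
  have key : ∀ t ∈ Icc 0 (t₀ + 1), duhamel H G t =
      (∫ r in Ioc 0 (t₀ + 1), H r (F (t - r))) + ∫ r in (t₀ + 1)..t, H r (G 0) := by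
    intro t ht
    have hi : IntegrableOn (fun r => H r (F (t - r))) (Ioc 0 (t₀ + 1)) :=
      h.integrableOn_Ioc (by fun_prop) fun r _ => hB _
    have hi' := (intervalIntegrable_iff_integrableOn_Ioc_of_le hb).2 hi
    have hs : uIcc 0 t ⊆ uIcc 0 (t₀ + 1) := by
      rw [uIcc_of_le ht.1, uIcc_of_le hb]; exact Icc_subset_Icc_right ht.2
    have hs' : uIcc (t₀ + 1) t ⊆ uIcc 0 (t₀ + 1) := by
      rw [uIcc_of_ge ht.2, uIcc_of_le hb]; exact Icc_subset_Icc_left ht.1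
    have e1 : ∫ r in (t₀ + 1)..t, H r (G 0) = ∫ r in (t₀ + 1)..t, H r (F (t - r)) := by
      refine intervalIntegral.integral_congr fun r hr => ?_
      rw [uIcc_of_ge ht.2] at hr
      simp only [hF]
      rw [projIcc_of_le_left hb (by linarith [hr.1])]
    have e2 : ∫ r in (0 : ℝ)..t, H r (G (t - r)) = ∫ r in (0 : ℝ)..t, H r (F (t - r)) := by
      refine intervalIntegral.integral_congr fun r hr => ?_
      rw [uIcc_of_le ht.1] at hr
      simp only [hF]
      rw [projIcc_of_mem hb ⟨by linarith [hr.2], by linarith [hr.1, ht.2]⟩]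
    rw [duhamel_eq, e2, e1, ← intervalIntegral.integral_of_le hb,
      intervalIntegral.integral_add_adjacent_intervals hi' (hi'.mono_set hs')]
  have h3 : ContinuousOn (duhamel H G) (Icc 0 (t₀ + 1)) :=
    (h1.continuousOn.add h2).congr key
  refine (h3 t₀ ⟨ht₀, by linarith⟩).mono_of_mem_nhdsWithin ?_
  exact mem_nhdsWithin.2 ⟨Iio (t₀ + 1), isOpen_Iio, by simp, fun t ht => ⟨ht.2, ht.1.le⟩⟩

theorem duhamel_sub (h : IsKernel S H α C ω) (hG : Continuous G) (hG' : Continuous G') {t : ℝ}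
    (ht : 0 ≤ t) : duhamel H G t - duhamel H G' t = duhamel H (fun s => G s - G' s) t := by
  simp only [duhamel, map_sub]
  exact (intervalIntegral.integral_sub (h.intervalIntegrable hG ht)
    (h.intervalIntegrable hG' ht)).symm

theorem norm_duhamel_le (h : IsKernel S H α C ω) {κ B t : ℝ} (hκ : ω < κ)
    (ht : 0 ≤ t) (hB : ∀ s ∈ Icc 0 t, ‖G s‖ ≤ B * Real.exp (κ * s)) :
    ‖duhamel H G t‖ ≤ C * (∫ r in Ioi (0 : ℝ), r ^ (-α) * Real.exp (-((κ - ω) * r))) * B *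
      Real.exp (κ * t) := by
  have hC := h.C_nonneg
  have hB0 : 0 ≤ B := by
    have := (norm_nonneg _).trans (hB 0 ⟨le_rfl, ht⟩)
    rwa [mul_zero, Real.exp_zero, mul_one] at this
  have hi := integrableOn_rpow_mul_exp h.α_lt (sub_pos.2 hκ)
  rw [duhamel_eq, intervalIntegral.integral_of_le ht]
  have h1 : ‖∫ r in Ioc 0 t, H r (G (t - r))‖ ≤ ∫ r in Ioc 0 t,
      C * B * Real.exp (κ * t) * (r ^ (-α) * Real.exp (-((κ - ω) * r))) := by
    refine norm_integral_le_of_norm_le ((hi.mono_set Ioc_subset_Ioi_self).const_mul _) ?_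
    refine (ae_restrict_iff' measurableSet_Ioc).2 (Eventually.of_forall fun r hr => ?_)
    have hr0 : 0 < r := hr.1
    have e : Real.exp (κ * t) * Real.exp (-((κ - ω) * r)) =
        Real.exp (ω * r) * Real.exp (κ * (t - r)) := by
      rw [← Real.exp_add, ← Real.exp_add]; ring_nf
    calc _ ≤ ‖H r‖ * ‖G (t - r)‖ := ContinuousLinearMap.le_opNorm _ _
      _ ≤ (C * (r ^ (-α) * Real.exp (ω * r))) * (B * Real.exp (κ * (t - r))) :=
        mul_le_mul (h.norm_kernel_le r hr0)
          (hB _ ⟨by linarith [hr.2], by linarith⟩) (norm_nonneg _) (by positivity)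
      _ = C * B * r ^ (-α) * (Real.exp (ω * r) * Real.exp (κ * (t - r))) := by ring
      _ = _ := by rw [← e]; ring
  refine h1.trans ?_
  rw [integral_const_mul]
  have h2 : ∫ r in Ioc 0 t, r ^ (-α) * Real.exp (-((κ - ω) * r)) ≤
      ∫ r in Ioi (0 : ℝ), r ^ (-α) * Real.exp (-((κ - ω) * r)) := by
    refine setIntegral_mono_set hi ?_ (Eventually.of_forall Ioc_subset_Ioi_self)
    refine (ae_restrict_iff' measurableSet_Ioi).2 (Eventually.of_forall fun r hr => ?_)
    have hr0 : 0 < r := hr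
    positivity
  calc _ ≤ C * B * Real.exp (κ * t) * _ := mul_le_mul_of_nonneg_left h2 (by positivity)
    _ = _ := by ring

/-- The exponent and the contraction constant of the initial value problem. -/
theorem exists_contraction (h : IsKernel S H α C ω) (K : ℝ≥0) : ∃ κ, ω < κ ∧ 0 ≤ κ ∧
    C * (∫ r in Ioi (0 : ℝ), r ^ (-α) * Real.exp (-((κ - ω) * r))) * K ≤ 1 / 2 := by
  have h1 := ((tendsto_integral_rpow_mul_exp h.α_lt).const_mul C).mul_const (K : ℝ)
  rw [mul_zero, zero_mul] at h1
  have h2 : Tendsto (fun κ : ℝ => κ - ω) atTop atTop := tendsto_atTop_add_const_right _ _ tendsto_id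
  have h3 := h2.eventually (h1.eventually (gt_mem_nhds (show (0 : ℝ) < 1 / 2 by norm_num)))
  obtain ⟨κ, h4, h5, h6⟩ := (h3.and ((eventually_gt_atTop ω).and (eventually_ge_atTop 0))).exists
  exact ⟨κ, h5, h6, h4.le⟩

variable {g : X → X} {K : ℝ≥0}

theorem norm_duhamel_sub_le (h : IsKernel S H α C ω) (hg : LipschitzWith K g) {κ : ℝ} (hκ : ω < κ)
    (hC : C * (∫ r in Ioi (0 : ℝ), r ^ (-α) * Real.exp (-((κ - ω) * r))) * K ≤ 1 / 2)
    {v v' : ℝ → X} (hv : Continuous v) (hv' : Continuous v') {B t : ℝ} (ht : 0 ≤ t)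
    (hB : ∀ s ∈ Icc 0 t, ‖v s - v' s‖ ≤ B * Real.exp (κ * s)) :
    ‖duhamel H (fun s => g (v s)) t - duhamel H (fun s => g (v' s)) t‖ ≤
      1 / 2 * B * Real.exp (κ * t) := by
  have hB0 : 0 ≤ B := by
    have := (norm_nonneg _).trans (hB 0 ⟨le_rfl, ht⟩)
    rwa [mul_zero, Real.exp_zero, mul_one] at this
  rw [h.duhamel_sub (G := fun s => g (v s)) (G' := fun s => g (v' s)) (hg.continuous.comp hv)
    (hg.continuous.comp hv') ht]
  refine (h.norm_duhamel_le (B := K * B) hκ ht fun s hs => ?_).trans ?_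
  · calc _ ≤ K * ‖v s - v' s‖ := hg.norm_sub_le _ _
      _ ≤ K * (B * Real.exp (κ * s)) := by gcongr; exact hB s hs
      _ = _ := by ring
  · rw [← mul_assoc]
    gcongr

theorem exists_mild (h : IsKernel S H α C ω) (hg : LipschitzWith K g) (x : X) :
    ∃ v, Continuous v ∧ v 0 = x ∧ MildOn S H g v (Ici 0) := by
  obtain ⟨κ, hκ, hκ0, hq⟩ := h.exists_contraction K
  have hC := h.C_nonneg
  -- `max t 0` keeps the initial value at negative times, so that the fixed point theorem on the
  -- whole line can be used.
  set Ψ : (ℝ → X) → ℝ → X := fun v t =>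
    S (max t 0) x + duhamel H (fun s => g (v s)) (max t 0) with hΨ
  have hexp : ∀ t, Real.exp (κ * max t 0) ≤ Real.exp (κ * |t|) := fun t => by
    gcongr
    exact max_le (le_abs_self t) (abs_nonneg t)
  obtain ⟨v, hv, -, hfix⟩ := exists_fixedPoint (κ := κ) (q := 1 / 2) (by norm_num) (by norm_num) Ψ
    (fun v hv hb => by
      have hc : Continuous fun t : ℝ => max t 0 := by fun_prop
      refine ⟨((h.continuousOn_apply x).comp_continuous hc fun t => mem_Ici.2 (le_max_right _ _)).add
        ((h.continuousOn_duhamel (hg.continuous.comp hv)).comp_continuous hc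
          fun t => mem_Ici.2 (le_max_right _ _)), ?_⟩
      obtain ⟨B, hB⟩ := isExpBounded_comp hg hκ0 hb
      refine ⟨C * ‖x‖ + C * (∫ r in Ioi (0 : ℝ), r ^ (-α) * Real.exp (-((κ - ω) * r))) * B,
        fun t => ?_⟩
      have ht : 0 ≤ max t 0 := le_max_right _ _
      have h1 : ‖S (max t 0) x‖ ≤ C * Real.exp (κ * max t 0) * ‖x‖ := by
        refine (S (max t 0)).le_of_opNorm_le ((h.norm_le _ ht).trans ?_) x
        gcongr
      have h2 := h.norm_duhamel_le (G := fun s => g (v s)) (B := B) hκ ht fun s hs => by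
        have := hB s
        rwa [abs_of_nonneg hs.1] at this
      calc _ ≤ _ := norm_add_le _ _
        _ ≤ _ := add_le_add h1 h2
        _ = (C * ‖x‖ + C * (∫ r in Ioi (0 : ℝ), r ^ (-α) * Real.exp (-((κ - ω) * r))) * B) *
            Real.exp (κ * max t 0) := by ring
        _ ≤ _ := by
          refine mul_le_mul_of_nonneg_left (hexp t) ?_
          have hB0 : 0 ≤ B := by
            have := (norm_nonneg _).trans (hB 0)
            rwa [abs_zero, mul_zero, Real.exp_zero, mul_one] at this
          have : 0 ≤ ∫ r in Ioi (0 : ℝ), r ^ (-α) * Real.exp (-((κ - ω) * r)) :=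
            setIntegral_nonneg measurableSet_Ioi fun r hr => by
              have hr0 : 0 < r := hr
              positivity
          positivity)
    (fun v v' B hv _ hv' _ hB t => by
      have ht : 0 ≤ max t 0 := le_max_right _ _
      have hB0 : 0 ≤ B := by
        have := (norm_nonneg _).trans (hB 0)
        rwa [abs_zero, mul_zero, Real.exp_zero, mul_one] at this
      have h1 := h.norm_duhamel_sub_le hg hκ hq hv hv' (B := B) ht fun s hs => by
        have := hB s
        rwa [abs_of_nonneg hs.1] at this
      simp only [hΨ, add_sub_add_left_eq_sub]
      refine h1.trans (mul_le_mul_of_nonneg_left (hexp t) (by positivity)))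
  have hv' : ∀ t, v t = S (max t 0) x + duhamel H (fun s => g (v s)) (max t 0) := fun t =>
    (congrFun hfix t).symm
  have h0 : v 0 = x := by
    rw [hv', max_self, h.zero, duhamel, intervalIntegral.integral_same, add_zero,
      one_apply_eq_self]
  refine ⟨v, hv, h0, fun t ht => ?_⟩
  rw [hv', max_eq_left ht, h0]

/-- Continuous dependence on the initial value, with `k` and `κ` independent of the length of the
interval. Freezing both functions at their end values turns it into a weighted estimate on the line.
-/
theorem exists_norm_mild_sub_le (h : IsKernel S H α C ω) (hg : LipschitzWith K g) :
    ∃ k κ, ∀ {v v' : ℝ → X} {b : ℝ}, 0 ≤ b → ContinuousOn v (Icc 0 b) → ContinuousOn v' (Icc 0 b) →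
      MildOn S H g v (Icc 0 b) → MildOn S H g v' (Icc 0 b) →
      ‖v b - v' b‖ ≤ k * ‖v 0 - v' 0‖ * Real.exp (κ * b) := by
  obtain ⟨κ, hκ, hκ0, hq⟩ := h.exists_contraction K
  have hC := h.C_nonneg
  refine ⟨2 * C, κ, fun {v v' b} hb hv hv' hm hm' => ?_⟩
  have hvc := continuous_comp_projIcc hb hv
  have hvc' := continuous_comp_projIcc hb hv'
  obtain ⟨B₁, hB₁, hb₁⟩ := exists_norm_comp_projIcc_le hb hv
  obtain ⟨B₂, hB₂, hb₂⟩ := exists_norm_comp_projIcc_le hb hv'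
  have key := le_div_one_sub_mul (n := fun t => ‖v (projIcc 0 b hb t) - v' (projIcc 0 b hb t)‖)
    (ρ := fun t => Real.exp (κ * |t|)) (q := 1 / 2) (k := C * ‖v 0 - v' 0‖) (B₀ := B₁ + B₂)
    (fun t => Real.exp_pos _) (by norm_num)
    (fun t => by
      have h2 : 1 ≤ Real.exp (κ * |t|) := Real.one_le_exp (by positivity)
      calc _ ≤ _ := norm_sub_le _ _
        _ ≤ B₁ + B₂ := add_le_add (hb₁ t) (hb₂ t)
        _ ≤ _ := le_mul_of_one_le_right (by positivity) h2)
    (fun B hB t => by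
      have hB0 : 0 ≤ B := by
        have := (norm_nonneg _).trans (hB 0)
        rwa [abs_zero, mul_zero, Real.exp_zero, mul_one] at this
      set s : ℝ := (projIcc 0 b hb t : ℝ) with hs
      have hs0 : s ∈ Icc 0 b := (projIcc 0 b hb t).2
      have hst : Real.exp (κ * s) ≤ Real.exp (κ * |t|) := by
        gcongr
        rw [hs, coe_projIcc]
        exact max_le (abs_nonneg t) ((min_le_right _ _).trans (le_abs_self t))
      have hp : ∀ r ∈ Icc 0 s, (projIcc 0 b hb r : ℝ) = r := fun r hr => by
        rw [projIcc_of_mem hb ⟨hr.1, hr.2.trans hs0.2⟩]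
      have e1 : duhamel H (fun r => g (v r)) s =
          duhamel H (fun r => g (v (projIcc 0 b hb r))) s :=
        duhamel_congr hs0.1 fun r hr => by rw [hp r hr]
      have e2 : duhamel H (fun r => g (v' r)) s =
          duhamel H (fun r => g (v' (projIcc 0 b hb r))) s :=
        duhamel_congr hs0.1 fun r hr => by rw [hp r hr]
      have h1 := h.norm_duhamel_sub_le hg hκ hq hvc hvc' (B := B) hs0.1 fun r hr => by
        have := hB r
        rwa [abs_of_nonneg hr.1] at this
      have h2 : ‖S s (v 0 - v' 0)‖ ≤ C * Real.exp (κ * s) * ‖v 0 - v' 0‖ := by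
        refine (S s).le_of_opNorm_le ((h.norm_le _ hs0.1).trans ?_) _
        gcongr
        exact hs0.1
      rw [hm s hs0, hm' s hs0, e1, e2, add_sub_add_comm, ← map_sub]
      calc _ ≤ _ := norm_add_le _ _
        _ ≤ _ := add_le_add h2 h1
        _ = (1 / 2 * B + C * ‖v 0 - v' 0‖) * Real.exp (κ * s) := by ring
        _ ≤ _ := mul_le_mul_of_nonneg_left hst (by positivity)) b
  rw [projIcc_right, abs_of_nonneg hb] at key
  calc _ ≤ _ := key
    _ = _ := by ring

theorem mild_unique (h : IsKernel S H α C ω) (hg : LipschitzWith K g) {v v' : ℝ → X} {b : ℝ}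
    (hb : 0 ≤ b) (hv : ContinuousOn v (Icc 0 b)) (hv' : ContinuousOn v' (Icc 0 b))
    (hm : MildOn S H g v (Icc 0 b)) (hm' : MildOn S H g v' (Icc 0 b)) (h0 : v 0 = v' 0) :
    v b = v' b := by
  obtain ⟨k, κ, hk⟩ := h.exists_norm_mild_sub_le hg
  have := hk hb hv hv' hm hm'
  rw [h0, sub_self, norm_zero, mul_zero, zero_mul] at this
  exact sub_eq_zero.1 (norm_le_zero_iff.1 this)

theorem apply_duhamel (h : IsKernel S H α C ω) (hG : Continuous G) {s t : ℝ} (hs : 0 ≤ s)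
    (ht : 0 ≤ t) : S t (duhamel H G s) = ∫ r in (0 : ℝ)..s, H (t + s - r) (G r) := by
  rw [duhamel, ← ContinuousLinearMap.intervalIntegral_comp_comm _ (h.intervalIntegrable hG hs)]
  refine intervalIntegral.integral_congr_ae ?_
  -- At `r = s` the kernel is evaluated at `0`, where `IsKernel.mul` says nothing; a single point
  -- does not matter.
  have : ∀ᵐ r : ℝ, r ≠ s := by simp [ae_iff]
  filter_upwards [this] with r hr hrs
  rw [uIoc_of_le hs] at hrs
  have hlt : 0 < s - r := sub_pos.2 (lt_of_le_of_ne hrs.2 hr)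
  rw [← mul_apply_eq_comp, h.mul t _ ht hlt, add_sub_assoc]

theorem duhamel_add (h : IsKernel S H α C ω) (hG : Continuous G) {s t : ℝ} (hs : 0 ≤ s)
    (ht : 0 ≤ t) : duhamel H G (t + s) = S t (duhamel H G s) + duhamel H (fun r => G (r + s)) t := by
  have hi := h.intervalIntegrable hG (add_nonneg ht hs)
  have h1 : uIcc 0 s ⊆ uIcc 0 (t + s) := by
    rw [uIcc_of_le hs, uIcc_of_le (by positivity)]; exact Icc_subset_Icc_right (by linarith)
  have h2 : uIcc s (t + s) ⊆ uIcc 0 (t + s) := by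
    rw [uIcc_of_le (by linarith), uIcc_of_le (by positivity)]; exact Icc_subset_Icc_left hs
  rw [h.apply_duhamel hG hs ht, duhamel, ← intervalIntegral.integral_add_adjacent_intervals
    (hi.mono_set h1) (hi.mono_set h2)]
  congr 1
  have := intervalIntegral.integral_comp_add_right (fun r => H (t + s - r) (G r)) (a := 0) (b := t) s
  rw [zero_add] at this
  rw [← this, duhamel]
  refine intervalIntegral.integral_congr fun r _ => ?_
  simp only [add_sub_add_right_eq_sub]

theorem mild_shift (h : IsKernel S H α C ω) (hg : Continuous g) {v : ℝ → X}
    (hv : Continuous v) (hm : MildOn S H g v (Ici 0)) {s : ℝ} (hs : 0 ≤ s) :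
    MildOn S H g (fun t => v (t + s)) (Ici 0) := by
  intro t ht
  have ht0 : 0 ≤ t := ht
  simp only
  rw [zero_add, hm (t + s) (add_nonneg ht0 hs), h.duhamel_add (G := fun r => g (v r)) (hg.comp hv) hs ht, hm s hs,
    h.add t s ht hs, map_add, mul_apply_eq_comp, add_assoc]

end IsKernel

end Complete

end

section
variable {A : X →ₗ.[ℂ] X} {a α : ℝ} {T L S H : ℝ → X →L[ℂ] X} {C δ ω : ℝ}

/-! ### The kernel `Λ^α e^{-Λt}` -/

/-- `e^{ct} T t`. -/
def scaled (c : ℝ) (T : ℝ → X →L[ℂ] X) (t : ℝ) : X →L[ℂ] X := (Real.exp (c * t) : ℂ) • T t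

/-- `Λ^α e^{-Λt}`, if `T t = e^{-Λt}` and `L t = Λ e^{-Λt}`. -/
def fracKernel (T L : ℝ → X →L[ℂ] X) (α t : ℝ) : X →L[ℂ] X := fracInt T (1 - α) * L t

theorem scaled_apply (c : ℝ) (T : ℝ → X →L[ℂ] X) (t : ℝ) (x : X) :
    scaled c T t x = Real.exp (c * t) • T t x := rfl

theorem norm_scaled (c : ℝ) (T : ℝ → X →L[ℂ] X) (t : ℝ) :
    ‖scaled c T t‖ = Real.exp (c * t) * ‖T t‖ := by
  rw [scaled, norm_smul, Complex.norm_real, Real.norm_eq_abs, Real.abs_exp]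

theorem IsKernel.scaled (h : IsKernel S H α C ω) (c : ℝ) :
    IsKernel (scaled c S) (scaled c H) α C (ω + c) where
  C_nonneg := h.C_nonneg
  α_lt := h.α_lt
  zero := by simp [SectorialIM.scaled, h.zero]
  add s t hs ht := by
    simp only [SectorialIM.scaled]
    rw [h.add s t hs ht, smul_mul_smul_comm, ← Complex.ofReal_mul, ← Real.exp_add, mul_add]
  continuousOn_apply x := by
    have h1 : Continuous fun t => Real.exp (c * t) := by fun_prop
    exact h1.continuousOn.smul (h.continuousOn_apply x)
  norm_le t ht := by
    rw [norm_scaled, add_mul, Real.exp_add]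
    have := mul_le_mul_of_nonneg_left (h.norm_le t ht) (Real.exp_pos (c * t)).le
    linarith
  continuousOn_kernel := by
    have h1 : Continuous fun t : ℝ => (Real.exp (c * t) : ℂ) := by fun_prop
    exact h1.continuousOn.smul h.continuousOn_kernel
  norm_kernel_le t ht := by
    rw [norm_scaled, add_mul, Real.exp_add]
    have := mul_le_mul_of_nonneg_left (h.norm_kernel_le t ht) (Real.exp_pos (c * t)).le
    linarith
  mul s t hs ht := by
    simp only [SectorialIM.scaled]
    rw [← h.mul s t hs ht, smul_mul_smul_comm, ← Complex.ofReal_mul, ← Real.exp_add, mul_add]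

theorem duhamel_scaled (c : ℝ) (H : ℝ → X →L[ℂ] X) (G : ℝ → X) (t : ℝ) :
    duhamel (scaled c H) G t =
      Real.exp (c * t) • duhamel H (fun s => Real.exp (-(c * s)) • G s) t := by
  rw [duhamel, duhamel, ← intervalIntegral.integral_smul]
  refine intervalIntegral.integral_congr fun s _ => ?_
  rw [scaled_apply, ContinuousLinearMap.map_smul_of_tower, smul_smul, ← Real.exp_add, mul_sub, sub_eq_add_neg]

section Complete

variable [CompleteSpace X]

theorem IsKernel.continuousOn_apply₂ (h : IsKernel S H α C ω) {r : ℝ → ℝ} {w : ℝ → X} {J : Set ℝ}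
    (hr : ContinuousOn r J) (hr0 : ∀ s ∈ J, 0 ≤ r s) (hw : ContinuousOn w J) :
    ContinuousOn (fun s => S (r s) (w s)) J := by
  intro s hs
  have h1 : Tendsto (fun x => S (r x) (w s)) (𝓝[J] s) (𝓝 (S (r s) (w s))) :=
    (((h.continuousOn_apply (w s)).comp hr hr0) s hs)
  have h2 : Tendsto (fun x => C * Real.exp (ω * r x) * ‖w x - w s‖) (𝓝[J] s)
      (𝓝 (C * Real.exp (ω * r s) * ‖w s - w s‖)) := by
    have h3 : Tendsto (fun x => Real.exp (ω * r x)) (𝓝[J] s) (𝓝 (Real.exp (ω * r s))) :=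
      (Real.continuous_exp.tendsto _).comp ((hr s hs).const_mul ω)
    exact (h3.const_mul C).mul ((hw s hs).sub_const _).norm
  rw [sub_self, norm_zero, mul_zero] at h2
  have h3 : Tendsto (fun x => S (r x) (w x - w s)) (𝓝[J] s) (𝓝 0) := by
    refine squeeze_zero_norm' ?_ h2
    filter_upwards [self_mem_nhdsWithin] with x hx
    exact (S (r x)).le_of_opNorm_le (h.norm_le _ (hr0 x hx)) _
  have h4 := h3.add h1
  rw [zero_add] at h4
  refine h4.congr fun x => ?_
  rw [← map_add, sub_add_cancel]

namespace IsDecaying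

theorem fracInt_mul_fracKernel (h : IsDecaying T L C δ) (hα : α ∈ Ico (0 : ℝ) 1) {t : ℝ}
    (ht : 0 < t) : fracInt T α * fracKernel T L α t = T t := by
  rw [fracKernel, ← mul_assoc, h.fracInt_mul hα.1 hα.2, h.fracInt_one_mul_deriv ht]

theorem mul_fracKernel (h : IsDecaying T L C δ) (hα : α ∈ Ico (0 : ℝ) 1) {s t : ℝ} (hs : 0 ≤ s)
    (ht : 0 < t) : T s * fracKernel T L α t = fracKernel T L α (s + t) := by
  have h1 : Commute (T s) (fracInt T (1 - α)) :=
    h.commute_fracInt (fun _ hr => h.commute hs hr.le) (by linarith [hα.2])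
  have h2 : Commute (T s) (L t) := h.commute_deriv (fun _ hr => h.commute hs hr.le) ht
  rw [fracKernel, fracKernel, ← mul_assoc, h1.eq, mul_assoc, h2.eq, ← h.deriv_add ht hs, add_comm]

/-- The moment inequality for `z = L t x` with `τ = t`, since `Λ⁻¹ z = T t x`. -/
theorem exists_norm_fracKernel_le (h : IsDecaying T L C δ) (hα : α ∈ Ico (0 : ℝ) 1) :
    ∃ C', 0 < C' ∧ ∀ t, 0 < t → ‖fracKernel T L α t‖ ≤ C' * t ^ (-α) := by
  obtain ⟨c, hc, hb⟩ := h.exists_norm_fracInt_le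
  have hC := h.C_pos
  refine ⟨c * (2 * C), by positivity, fun t ht => ?_⟩
  refine ContinuousLinearMap.opNorm_le_bound _ (by positivity) fun x => ?_
  have h1 := hb α hα (L t x) t ht
  have e : fracInt T 1 (L t x) = T t x :=
    congrArg (fun B : X →L[ℂ] X => B x) (h.fracInt_one_mul_deriv ht)
  rw [e] at h1
  have h2 : ‖L t x‖ ≤ C * t⁻¹ * ‖x‖ := by
    refine (L t).le_of_opNorm_le ((h.norm_deriv_le t ht).trans ?_) x
    have : Real.exp (-(δ * t)) ≤ 1 := Real.exp_le_one_iff.2 (by have := h.δ_pos; nlinarith)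
    exact mul_le_of_le_one_right (by positivity) this
  have h3 : ‖T t x‖ ≤ C * ‖x‖ := (T t).le_of_opNorm_le (h.norm_le' ht.le) x
  have e2 : t ^ (1 - α) = t ^ (-α) * t := by
    rw [show 1 - α = -α + 1 by ring, Real.rpow_add ht, Real.rpow_one]
  calc _ ≤ _ := h1
    _ ≤ c * (t ^ (1 - α) * (C * t⁻¹ * ‖x‖) + t ^ (-α) * (C * ‖x‖)) := by gcongr
    _ = c * (2 * C) * t ^ (-α) * ‖x‖ := by rw [e2]; field_simp; ring

theorem exists_isKernel (h : IsDecaying T L C δ) (hα : α ∈ Ico (0 : ℝ) 1) :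
    ∃ C', IsKernel T (fracKernel T L α) α C' 0 := by
  obtain ⟨C', hC', hb⟩ := h.exists_norm_fracKernel_le hα
  refine ⟨max C C', le_max_of_le_right hC'.le, hα.2, h.zero, h.add, h.continuousOn_apply,
    fun t ht => ?_, continuousOn_const.mul h.continuousOn_deriv, fun t ht => ?_,
    fun s t hs ht => h.mul_fracKernel hα hs ht⟩
  · rw [zero_mul, Real.exp_zero, mul_one]
    exact (h.norm_le' ht).trans (le_max_left _ _)
  · rw [zero_mul, Real.exp_zero, mul_one]
    exact (hb t ht).trans (mul_le_mul_of_nonneg_right (le_max_right _ _) (by positivity))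

theorem norm_sub_le (h : IsDecaying T L C δ) {s r : ℝ} (hs : 0 < s) (hr : 0 ≤ r) :
    ‖T (s + r) - T s‖ ≤ C * s⁻¹ * r := by
  have hC := h.C_pos
  have := (convex_Ici s).norm_image_sub_le_of_norm_hasDerivWithin_le (f := T)
    (f' := fun t => -L t) (C := C * s⁻¹) (x := s) (y := s + r)
    (fun t ht => (h.deriv t (hs.trans_le ht)).hasDerivWithinAt) (fun t ht => by
      have ht' : s ≤ t := ht
      have ht0 : 0 < t := hs.trans_le ht
      rw [norm_neg]
      refine (h.norm_deriv_le t ht0).trans ?_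
      have h1 : Real.exp (-(δ * t)) ≤ 1 := Real.exp_le_one_iff.2 (by have := h.δ_pos; nlinarith)
      calc _ ≤ C * t⁻¹ * 1 := by gcongr
        _ ≤ _ := by rw [mul_one]; gcongr)
    self_mem_Ici (mem_Ici.2 (by linarith))
  rwa [add_sub_cancel_left, Real.norm_eq_abs, abs_of_nonneg hr] at this

/-- Interpolation between the bound `C r / s` from the derivative and the trivial bound `2 C`. -/
theorem norm_sub_le_rpow (h : IsDecaying T L C δ) {γ s r : ℝ} (hγ : 0 < γ) (hγ1 : γ ≤ 1)
    (hs : 0 < s) (hr : 0 ≤ r) : ‖T (s + r) - T s‖ ≤ 2 * C * (r / s) ^ γ := by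
  have hC := h.C_pos
  rcases le_total (r / s) 1 with h1 | h1
  · have h2 : r / s ≤ (r / s) ^ γ := Real.self_le_rpow_of_le_one (by positivity) h1 hγ1
    calc _ ≤ C * s⁻¹ * r := h.norm_sub_le hs hr
      _ = C * (r / s) := by rw [div_eq_mul_inv]; ring
      _ ≤ C * (r / s) ^ γ := by gcongr
      _ ≤ _ := by nlinarith [Real.rpow_nonneg (show 0 ≤ r / s by positivity) γ]
  · have h2 : 1 ≤ (r / s) ^ γ := Real.one_le_rpow h1 hγ.le
    calc _ ≤ ‖T (s + r)‖ + ‖T s‖ := _root_.norm_sub_le _ _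
      _ ≤ C + C := add_le_add (h.norm_le' (by positivity)) (h.norm_le' hs.le)
      _ = 2 * C * 1 := by ring
      _ ≤ _ := by gcongr

/-- Half of the time is used for smoothing: the difference is `(T (t/2 + r) - T (t/2)) * fracKernel
T L α (t/2)`. -/
theorem exists_norm_fracKernel_sub_le (h : IsDecaying T L C δ) (hα : α ∈ Ico (0 : ℝ) 1) {γ : ℝ}
    (hγ : 0 < γ) (hγ1 : γ ≤ 1) : ∃ C', 0 < C' ∧ ∀ t r, 0 < t → 0 ≤ r →
      ‖fracKernel T L α (t + r) - fracKernel T L α t‖ ≤ C' * r ^ γ * t ^ (-(α + γ)) := by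
  obtain ⟨C', hC', hb⟩ := h.exists_norm_fracKernel_le hα
  have hC := h.C_pos
  refine ⟨2 ^ (α + γ) * (2 * C * C'), by positivity, fun t r ht hr => ?_⟩
  have ht2 : 0 < t / 2 := by positivity
  have e : fracKernel T L α (t + r) - fracKernel T L α t =
      (T (t / 2 + r) - T (t / 2)) * fracKernel T L α (t / 2) := by
    rw [sub_mul, h.mul_fracKernel hα (by positivity) ht2, h.mul_fracKernel hα ht2.le ht2]
    congr 2 <;> ring
  rw [e]
  have e2 : (t / 2) ^ (-(α + γ)) = 2 ^ (α + γ) * t ^ (-(α + γ)) := by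
    rw [Real.div_rpow ht.le (by norm_num), Real.rpow_neg (by norm_num : (0 : ℝ) ≤ 2), div_inv_eq_mul,
      mul_comm]
  have e3 : (r / (t / 2)) ^ γ * (t / 2) ^ (-α) = r ^ γ * (t / 2) ^ (-(α + γ)) := by
    rw [Real.div_rpow hr ht2.le, neg_add, Real.rpow_add ht2, Real.rpow_neg ht2.le γ]
    ring
  calc _ ≤ _ := norm_mul_le _ _
    _ ≤ (2 * C * (r / (t / 2)) ^ γ) * (C' * (t / 2) ^ (-α)) := by
      gcongr
      · exact h.norm_sub_le_rpow hγ hγ1 ht2 hr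
      · exact hb _ ht2
    _ = 2 * C * C' * ((r / (t / 2)) ^ γ * (t / 2) ^ (-α)) := by ring
    _ = _ := by rw [e3, e2]; ring

end IsDecaying

omit [CompleteSpace X] in
theorem norm_integral_le_of_le_rpow {F : ℝ → X} {K p t : ℝ} (hp : p < 1) (ht : 0 ≤ t)
    (hF : ∀ r ∈ Ioo 0 t, ‖F r‖ ≤ K * (t - r) ^ (-p)) :
    ‖∫ r in (0 : ℝ)..t, F r‖ ≤ K * (t ^ (1 - p) / (1 - p)) := by
  have hi : IntervalIntegrable (fun r : ℝ => K * (t - r) ^ (-p)) volume 0 t := by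
    have h1 := intervalIntegral.intervalIntegrable_rpow' (a := 0) (b := t) (r := -p) (by linarith)
    have := (h1.comp_sub_left t).symm
    rw [sub_zero, sub_self] at this
    exact this.const_mul K
  have e : ∫ r in (0 : ℝ)..t, K * (t - r) ^ (-p) = K * (t ^ (1 - p) / (1 - p)) := by
    rw [intervalIntegral.integral_const_mul,
      intervalIntegral.integral_comp_sub_left (fun r => r ^ (-p)) t, sub_zero, sub_self,
      integral_rpow (Or.inl (by linarith)), show -p + 1 = 1 - p by ring,
      Real.zero_rpow (by linarith), sub_zero]
  rw [← e]
  refine intervalIntegral.norm_integral_le_of_norm_le ht ?_ hi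
  have : ∀ᵐ r : ℝ, r ≠ t := by simp [ae_iff]
  filter_upwards [this] with r hr hr'
  exact hF r ⟨hr'.1, lt_of_le_of_ne hr'.2 hr⟩

/-! ### Hölder continuity of mild solutions -/

omit [CompleteSpace X] [NormedSpace ℂ X] in
theorem holderOnIcc_of_forall_add {v : ℝ → X} {a b γ κ : ℝ}
    (h : ∀ s r, a ≤ s → 0 ≤ r → s + r ≤ b → ‖v (s + r) - v s‖ ≤ κ * r ^ γ) :
    HolderOnIcc v a b γ := by
  refine ⟨κ, fun s hs t ht => ?_⟩
  rcases le_total s t with hst | hst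
  · have := h s (t - s) hs.1 (sub_nonneg.2 hst) (by linarith [ht.2])
    rw [norm_sub_rev, abs_sub_comm, abs_of_nonneg (sub_nonneg.2 hst)]
    rwa [add_sub_cancel] at this
  · have := h t (s - t) ht.1 (sub_nonneg.2 hst) (by linarith [hs.2])
    rw [abs_of_nonneg (sub_nonneg.2 hst)]
    rwa [add_sub_cancel] at this

theorem le_rpow_mul_rpow {r b γ p : ℝ} (hr : 0 ≤ r) (hrb : r ≤ b) (hγ : 0 < γ) (hγp : γ ≤ p) :
    r ^ p ≤ b ^ (p - γ) * r ^ γ := by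
  rcases hr.eq_or_lt with rfl | hr0
  · rw [Real.zero_rpow (by linarith), Real.zero_rpow hγ.ne', mul_zero]
  · have : r ^ p = r ^ (p - γ) * r ^ γ := by rw [← Real.rpow_add hr0, sub_add_cancel]
    rw [this]
    gcongr

namespace HolderOnIcc

omit [CompleteSpace X] in
theorem exp_smul {v : ℝ → X} {a b γ : ℝ} (hv : HolderOnIcc v a b γ) (hγ : 0 < γ) (hγ1 : γ ≤ 1)
    (c : ℝ) : HolderOnIcc (fun t => Real.exp (c * t) • v t) a b γ := by
  rcases lt_or_ge b a with hab | hab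
  · exact ⟨0, fun s hs => absurd (hs.1.trans hs.2) (not_le.2 hab)⟩
  obtain ⟨κ, hκ⟩ := hv
  obtain ⟨E, hE⟩ := (isCompact_Icc (a := a) (b := b)).exists_bound_of_continuousOn
    (f := fun t => Real.exp (c * t)) (by fun_prop)
  obtain ⟨E', hE'⟩ := (isCompact_Icc (a := a) (b := b)).exists_bound_of_continuousOn
    (f := fun t => Real.exp (c * t) * c) (by fun_prop)
  have haa : a ∈ Icc a b := ⟨le_rfl, hab⟩
  have hE0 : 0 ≤ E := (norm_nonneg _).trans (hE a haa)
  have hE0' : 0 ≤ E' := (norm_nonneg _).trans (hE' a haa)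
  have hV : ∀ t ∈ Icc a b, ‖v t‖ ≤ ‖v a‖ + |κ| * (b - a) ^ γ := fun t ht => by
    have h1 := hκ t ht a haa
    have h2 : ‖v t‖ ≤ ‖v a‖ + ‖v t - v a‖ := norm_le_norm_add_norm_sub' _ _
    have h3 : κ * |t - a| ^ γ ≤ |κ| * (b - a) ^ γ := by
      rw [abs_of_nonneg (sub_nonneg.2 ht.1)]
      have : 0 ≤ t - a := sub_nonneg.2 ht.1
      gcongr
      · exact le_abs_self κ
      · exact ht.2
    linarith
  refine ⟨E * |κ| + E' * (b - a) ^ (1 - γ) * (‖v a‖ + |κ| * (b - a) ^ γ), fun s hs t ht => ?_⟩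
  have e : Real.exp (c * s) • v s - Real.exp (c * t) • v t =
      Real.exp (c * s) • (v s - v t) + (Real.exp (c * s) - Real.exp (c * t)) • v t := by
    rw [smul_sub, sub_smul]; abel
  have h1 : ‖Real.exp (c * s) - Real.exp (c * t)‖ ≤ E' * ((b - a) ^ (1 - γ) * |s - t| ^ γ) := by
    have h2 := (convex_Icc a b).norm_image_sub_le_of_norm_hasDerivWithin_le
      (f := fun t => Real.exp (c * t)) (f' := fun t => Real.exp (c * t) * c) (C := E')
      (fun t _ => by
        have := (((hasDerivAt_id t).const_mul c).exp).hasDerivWithinAt (s := Icc a b)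
        simpa using this) hE' ht hs
    refine h2.trans (mul_le_mul_of_nonneg_left ?_ hE0')
    have h3 := le_rpow_mul_rpow (abs_nonneg (s - t)) (b := b - a) (by
      rw [abs_le]; constructor <;> linarith [hs.1, hs.2, ht.1, ht.2]) hγ hγ1
    rwa [Real.rpow_one] at h3
  have h4 := hE s hs
  rw [e]
  calc _ ≤ _ := norm_add_le _ _
    _ ≤ E * (|κ| * |s - t| ^ γ) +
        E' * ((b - a) ^ (1 - γ) * |s - t| ^ γ) * (‖v a‖ + |κ| * (b - a) ^ γ) := by
      rw [norm_smul, norm_smul]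
      refine add_le_add (mul_le_mul h4 ((hκ s hs t ht).trans ?_) (norm_nonneg _) hE0)
        (mul_le_mul h1 (hV t ht) (norm_nonneg _) ?_)
      · gcongr
        exact le_abs_self κ
      · have : 0 ≤ b - a := sub_nonneg.2 hab
        positivity
    _ = _ := by ring

omit [CompleteSpace X] [NormedSpace ℂ X] in
theorem lipschitz_comp {v : ℝ → X} {a b γ : ℝ} (hv : HolderOnIcc v a b γ) {g : X → X} {K : ℝ≥0}
    (hg : LipschitzWith K g) : HolderOnIcc (fun t => g (v t)) a b γ := by
  obtain ⟨κ, hκ⟩ := hv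
  refine ⟨K * κ, fun s hs t ht => (hg.norm_sub_le _ _).trans ?_⟩
  rw [mul_assoc]
  exact mul_le_mul_of_nonneg_left (hκ s hs t ht) K.2

omit [CompleteSpace X] [NormedSpace ℂ X] in
theorem add {v w : ℝ → X} {a b γ : ℝ} (hv : HolderOnIcc v a b γ) (hw : HolderOnIcc w a b γ) :
    HolderOnIcc (fun t => v t + w t) a b γ := by
  obtain ⟨κ, hκ⟩ := hv
  obtain ⟨κ', hκ'⟩ := hw
  refine ⟨κ + κ', fun s hs t ht => ?_⟩
  rw [add_sub_add_comm, add_mul]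
  exact (norm_add_le _ _).trans (add_le_add (hκ s hs t ht) (hκ' s hs t ht))

omit [CompleteSpace X] [NormedSpace ℂ X] in
theorem shift {v : ℝ → X} {b γ ε : ℝ} (hv : HolderOnIcc v ε (b + ε) γ) :
    HolderOnIcc (fun t => v (t + ε)) 0 b γ := by
  obtain ⟨κ, hκ⟩ := hv
  refine ⟨κ, fun s hs t ht => ?_⟩
  have := hκ (s + ε) ⟨by linarith [hs.1], by linarith [hs.2]⟩ (t + ε)
    ⟨by linarith [ht.1], by linarith [ht.2]⟩
  rwa [add_sub_add_right_eq_sub] at this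

omit [CompleteSpace X] [NormedSpace ℂ X] in
theorem mono {v : ℝ → X} {a a' b γ : ℝ} (hv : HolderOnIcc v a b γ) (h : a ≤ a') :
    HolderOnIcc v a' b γ := by
  obtain ⟨κ, hκ⟩ := hv
  exact ⟨κ, fun s hs t ht => hκ s ⟨h.trans hs.1, hs.2⟩ t ⟨h.trans ht.1, ht.2⟩⟩

omit [CompleteSpace X] [NormedSpace ℂ X] in
theorem congr {v w : ℝ → X} {a b γ : ℝ} (hv : HolderOnIcc v a b γ)
    (h : ∀ t ∈ Icc a b, w t = v t) : HolderOnIcc w a b γ := by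
  obtain ⟨κ, hκ⟩ := hv
  exact ⟨κ, fun s hs t ht => by rw [h s hs, h t ht]; exact hκ s hs t ht⟩

end HolderOnIcc

namespace IsDecaying

theorem holderOnIcc_apply (h : IsDecaying T L C δ) {ε b γ : ℝ} (hε : 0 < ε) (hγ : 0 < γ)
    (hγ1 : γ ≤ 1) (x : X) : HolderOnIcc (fun t => T t x) ε b γ := by
  have hC := h.C_pos
  refine holderOnIcc_of_forall_add (κ := 2 * C / ε ^ γ * ‖x‖) fun s r hs hr _ => ?_
  have hs0 : 0 < s := hε.trans_le hs
  rw [← sub_apply]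
  refine ((T (s + r) - T s).le_of_opNorm_le (h.norm_sub_le_rpow hγ hγ1 hs0 hr) x).trans ?_
  rw [Real.div_rpow hr hs0.le]
  calc 2 * C * (r ^ γ / s ^ γ) * ‖x‖ ≤ 2 * C * (r ^ γ / ε ^ γ) * ‖x‖ := by gcongr
    _ = _ := by ring

/-- Splitting the increment at time `s` leaves an integral of kernel differences, singular of order
`α + γ`, and an integral over the new interval, of size `r^{1-α}`. -/
theorem holderOnIcc_duhamel (h : IsDecaying T L C δ) (hα : α ∈ Ico (0 : ℝ) 1) {G : ℝ → X}
    (hG : Continuous G) (b : ℝ) :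
    HolderOnIcc (duhamel (fracKernel T L α) G) 0 b ((1 - α) / 2) := by
  -- Half of `1 - α` keeps `α + γ < 1`, so the singularity of the kernel differences is integrable.
  set γ := (1 - α) / 2 with hγ
  have hγ0 : 0 < γ := by rw [hγ]; linarith [hα.2]
  have hγ1 : γ ≤ 1 := by rw [hγ]; linarith [hα.1]
  obtain ⟨C₀, hk⟩ := h.exists_isKernel hα
  obtain ⟨C₁, hC₁, h1⟩ := h.exists_norm_fracKernel_le hα
  obtain ⟨C₂, hC₂, h2⟩ := h.exists_norm_fracKernel_sub_le hα hγ0 hγ1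
  obtain ⟨B, hB⟩ := (isCompact_Icc (a := 0) (b := b)).exists_bound_of_continuousOn hG.continuousOn
  refine holderOnIcc_of_forall_add (κ := C₂ * B * (b ^ (1 - (α + γ)) / (1 - (α + γ))) +
    C₁ * B * b ^ (1 - α - γ) / (1 - α)) fun s r hs hr hsr => ?_
  have hB0 : 0 ≤ B := (norm_nonneg _).trans (hB 0 ⟨le_rfl, by linarith⟩)
  have hp : 0 < 1 - (α + γ) := by rw [hγ]; linarith [hα.2]
  have hα1 : 0 < 1 - α := by linarith [hα.2]
  have i1 := hk.intervalIntegrable hG (add_nonneg hr hs)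
  have i2 := hk.intervalIntegrable hG hs
  have hsub : uIcc 0 s ⊆ uIcc 0 (r + s) := by
    rw [uIcc_of_le hs, uIcc_of_le (by positivity)]; exact Icc_subset_Icc_right (by linarith)
  have e : duhamel (fracKernel T L α) G (s + r) - duhamel (fracKernel T L α) G s =
      (∫ q in (0 : ℝ)..s, (fracKernel T L α (r + s - q) - fracKernel T L α (s - q)) (G q)) +
        duhamel (fracKernel T L α) (fun q => G (q + s)) r := by
    simp only [sub_apply]
    rw [intervalIntegral.integral_sub (i1.mono_set hsub) i2, ← hk.apply_duhamel hG hs hr, add_comm s,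
      hk.duhamel_add hG hs hr]
    simp only [duhamel]
    abel
  rw [e, add_mul]
  refine (norm_add_le _ _).trans (add_le_add ?_ ?_)
  · refine (norm_integral_le_of_le_rpow (p := α + γ) (K := C₂ * r ^ γ * B) (by linarith) hs
      fun q hq => ?_).trans ?_
    · have h3 := h2 (s - q) r (by linarith [hq.2]) hr
      rw [show s - q + r = r + s - q by ring] at h3
      refine ((fracKernel T L α (r + s - q) - fracKernel T L α (s - q)).le_of_opNorm_le_of_le h3
        (hB q ⟨hq.1.le, by linarith [hq.2]⟩)).trans (le_of_eq ?_)
      ring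
    · calc _ ≤ C₂ * r ^ γ * B * (b ^ (1 - (α + γ)) / (1 - (α + γ))) := by
            gcongr
            linarith
        _ = _ := by ring
  · refine (norm_integral_le_of_le_rpow (p := α) (K := C₁ * B) hα.2 hr fun q hq => ?_).trans ?_
    · refine ((fracKernel T L α (r - q)).le_of_opNorm_le_of_le (h1 _ (by linarith [hq.2]))
        (hB (q + s) ⟨by linarith [hq.1], by linarith [hq.2]⟩)).trans (le_of_eq ?_)
      ring
    · have h3 := le_rpow_mul_rpow hr (show r ≤ b by linarith) hγ0
        (show γ ≤ 1 - α by rw [hγ]; linarith)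
      calc _ ≤ C₁ * B * (b ^ (1 - α - γ) * r ^ γ / (1 - α)) := by gcongr
        _ = _ := by ring

theorem holderOnIcc_mild (h : IsDecaying T L C δ) (hα : α ∈ Ico (0 : ℝ) 1) {g : X → X}
    (hg : Continuous g) {v : ℝ → X} (hv : Continuous v)
    (hm : MildOn (scaled ω T) (scaled ω (fracKernel T L α)) g v (Ici 0)) {ε b : ℝ} (hε : 0 < ε) :
    HolderOnIcc v ε b ((1 - α) / 2) := by
  have hγ0 : 0 < (1 - α) / 2 := by linarith [hα.2]
  have hγ1 : (1 - α) / 2 ≤ 1 := by linarith [hα.1]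
  have hG : Continuous fun s => Real.exp (-(ω * s)) • g (v s) := by fun_prop
  refine (((h.holderOnIcc_apply hε hγ0 hγ1 (v 0)).add
    ((h.holderOnIcc_duhamel hα hG b).mono hε.le)).exp_smul hγ0 hγ1 ω).congr fun t ht => ?_
  rw [hm t (hε.le.trans ht.1), duhamel_scaled, scaled_apply, smul_add]

theorem fracInt_duhamel (h : IsDecaying T L C δ) (hα : α ∈ Ico (0 : ℝ) 1) {G : ℝ → X}
    (hG : Continuous G) {t : ℝ} (ht : 0 ≤ t) :
    fracInt T α (duhamel (fracKernel T L α) G t) = ∫ s in (0 : ℝ)..t, T (t - s) (G s) := by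
  obtain ⟨C₀, hk⟩ := h.exists_isKernel hα
  rw [duhamel, ← ContinuousLinearMap.intervalIntegral_comp_comm _ (hk.intervalIntegrable hG ht)]
  refine intervalIntegral.integral_congr_ae ?_
  have : ∀ᵐ r : ℝ, r ≠ t := by simp [ae_iff]
  filter_upwards [this] with r hr hrs
  rw [uIoc_of_le ht] at hrs
  have hlt : 0 < t - r := sub_pos.2 (lt_of_le_of_ne hrs.2 hr)
  rw [← mul_apply_eq_comp, h.fracInt_mul_fracKernel hα hlt]

end IsDecaying

/-! ### Mild solutions are classical solutions, and conversely -/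

namespace IsShiftedSemigroup

/-- Restarting at a positive time makes the nonlinearity along the solution Hölder continuous, and
then the Duhamel integral is differentiable in `X`. The factor `e^{(lam + a) t}` converts `e^{-Λt}`
into the semigroup of `A - lam`. -/
theorem hasDerivAt_of_mild (h : IsShiftedSemigroup A a T L C δ) (hα : α ∈ Ico (0 : ℝ) 1)
    {lam : ℝ} {g : X → X} {K : ℝ≥0} (hg : LipschitzWith K g) {v : ℝ → X} (hv : Continuous v)
    (hm : MildOn (scaled (lam + a) T) (scaled (lam + a) (fracKernel T L α)) g v (Ici 0)) {t : ℝ}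
    (ht : 0 < t) : ∃ z, (fracInt T α (v t), z) ∈ A.graph ∧
      HasDerivAt (fun s => fracInt T α (v s)) (-z + (lam : ℂ) • fracInt T α (v t) + g (v t)) t := by
  set ω := lam + a with hω
  have hγ0 : 0 < (1 - α) / 2 := by linarith [hα.2]
  have hγ1 : (1 - α) / 2 ≤ 1 := by linarith [hα.1]
  obtain ⟨C₀, hk₀⟩ := h.exists_isKernel hα
  have hk := hk₀.scaled ω
  -- Near time zero the orbit of a general initial value need not be Hölder continuous, so the
  -- solution is restarted at `t / 2`.
  set ε := t / 2 with hε
  have hε0 : 0 < ε := by positivity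
  set w : ℝ → X := fun s => v (s + ε) with hw
  have hwc : Continuous w := by fun_prop
  have hwm : MildOn (scaled ω T) (scaled ω (fracKernel T L α)) g w (Ici 0) :=
    hk.mild_shift hg.continuous hv hm hε0.le
  have hwH : HolderOnIcc w 0 t ((1 - α) / 2) :=
    (h.holderOnIcc_mild hα hg.continuous hv hm hε0).shift
  set G : ℝ → X := fun s => Real.exp (-(ω * s)) • g (w s) with hG
  have hgc := hg.continuous
  have hGc : Continuous G := by fun_prop
  have hGH : HolderOnIcc G 0 t ((1 - α) / 2) := by
    have := (hwH.lipschitz_comp hg).exp_smul hγ0 hγ1 (-ω)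
    simpa only [neg_mul] using this
  have key : ∀ s, 0 ≤ s → fracInt T α (w s) = Real.exp (ω * s) •
      (T s (fracInt T α (w 0)) + ∫ r in (0 : ℝ)..s, T (s - r) (G r)) := by
    intro s hs
    have hc : Commute (fracInt T α) (T s) :=
      (h.commute_fracInt (fun _ hr => h.commute hs hr.le) hα.1).symm
    rw [hwm s hs, duhamel_scaled, scaled_apply, ← smul_add, ContinuousLinearMap.map_smul_of_tower, map_add,
      h.fracInt_duhamel hα hGc hs, ← mul_apply_eq_comp, ← mul_apply_eq_comp, hc.eq]
  obtain ⟨q, hq, hd⟩ := h.exists_hasDerivAt hγ0 ht.le hGH (fracInt T α (w 0)) (t := ε)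
    ⟨hε0, by rw [hε]; linarith⟩
  have hwt : w ε = v t := by simp only [hw, hε]; congr 1; ring
  set U := fracInt T α (v t) with hU
  have hUq : U = fracInt T 1 (Real.exp (ω * ε) • q) := by
    rw [hU, ← hwt, key ε hε0.le, ContinuousLinearMap.map_smul_of_tower, hq]
  refine ⟨Real.exp (ω * ε) • q - (a : ℂ) • U, ?_, ?_⟩
  · rw [h.mem_graph_iff, sub_add_cancel, ← hUq]
  · have he : HasDerivAt (fun s => Real.exp (ω * s)) (Real.exp (ω * ε) * ω) ε := by
      simpa using ((hasDerivAt_id ε).const_mul ω).exp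
    have h1 := he.smul hd
    have h2 : HasDerivAt (fun s => fracInt T α (w s)) (Real.exp (ω * ε) • (G ε - q) +
        (Real.exp (ω * ε) * ω) • (T ε (fracInt T α (w 0)) +
          ∫ r in (0 : ℝ)..ε, T (ε - r) (G r))) ε := by
      refine h1.congr_of_eventuallyEq ?_
      filter_upwards [lt_mem_nhds hε0] with s hs using key s hs.le
    have h3 := h2.scomp_of_eq (h := fun s => s - ε) t ((hasDerivAt_id t).sub_const ε)
      (by rw [hε]; ring)
    rw [one_smul] at h3
    have e : ((fun s => fracInt T α (w s)) ∘ fun s => s - ε) = fun s => fracInt T α (v s) := by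
      funext s
      simp only [hw, Function.comp, sub_add_cancel]
    rw [e] at h3
    refine h3.congr_deriv ?_
    have e2 : Real.exp (ω * ε) • G ε = g (v t) := by
      simp only [hG]
      rw [smul_smul, ← Real.exp_add, add_neg_cancel, Real.exp_zero, one_smul, hwt]
    have e3 : (Real.exp (ω * ε) * ω) • (T ε (fracInt T α (w 0)) +
        ∫ r in (0 : ℝ)..ε, T (ε - r) (G r)) = ω • U := by
      rw [hU, ← hwt, key ε hε0.le, mul_comm, mul_smul]
    rw [e3, smul_sub, e2, hω, add_smul, Complex.coe_smul, Complex.coe_smul]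
    abel

/-- `S (t - s)` applied to the solution in `X` has derivative `S (t - s) (g (v s))`: the terms with
`A` and `lam` cancel. Integrate this over `[0, t]`. -/
theorem mild_of_hasDerivAt (h : IsShiftedSemigroup A a T L C δ) (hα : α ∈ Ico (0 : ℝ) 1)
    {lam : ℝ} {g : X → X} (hg : Continuous g) {v : ℝ → X} {t : ℝ} (ht : 0 ≤ t)
    (hv : ContinuousOn v (Icc 0 t))
    (hd : ∀ s ∈ Ioo 0 t, ∃ z, (fracInt T α (v s), z) ∈ A.graph ∧
      HasDerivAt (fun s => fracInt T α (v s)) (-z + (lam : ℂ) • fracInt T α (v s) + g (v s)) s) :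
    v t = scaled (lam + a) T t (v 0) +
      duhamel (scaled (lam + a) (fracKernel T L α)) (fun s => g (v s)) t := by
  set ω := lam + a with hω
  obtain ⟨C₀, hk₀⟩ := h.exists_isKernel hα
  have hk := hk₀.scaled ω
  set S := scaled ω T with hS
  have hu : ContinuousOn (fun s => fracInt T α (v s)) (Icc 0 t) :=
    (fracInt T α).continuous.comp_continuousOn hv
  have hsub : ContinuousOn (fun s : ℝ => t - s) (Icc 0 t) := by fun_prop
  have hsub0 : ∀ s ∈ Icc 0 t, 0 ≤ t - s := fun s hs => sub_nonneg.2 hs.2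
  have hφ : ContinuousOn (fun s => S (t - s) (fracInt T α (v s))) (Icc 0 t) :=
    hk.continuousOn_apply₂ hsub hsub0 hu
  have hφ' : ContinuousOn (fun s => S (t - s) (g (v s))) (Icc 0 t) :=
    hk.continuousOn_apply₂ hsub hsub0 (hg.comp_continuousOn hv)
  have hderiv : ∀ s ∈ Ioo 0 t, HasDerivAt (fun s => S (t - s) (fracInt T α (v s)))
      (S (t - s) (g (v s))) s := by
    intro s hs
    obtain ⟨z, hz, hd⟩ := hd s hs
    have hts : 0 < t - s := sub_pos.2 hs.2
    have he : HasDerivAt (fun r : ℝ => (Real.exp (ω * r) : ℂ)) ((Real.exp (ω * (t - s)) * ω : ℝ) : ℂ)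
        (t - s) := by
      have : HasDerivAt (fun r => Real.exp (ω * r)) (Real.exp (ω * (t - s)) * ω) (t - s) := by
        simpa using ((hasDerivAt_id (t - s)).const_mul ω).exp
      exact this.ofReal_comp
    have h1 : HasDerivAt S ((Real.exp (ω * (t - s)) : ℂ) • -L (t - s) +
        ((Real.exp (ω * (t - s)) * ω : ℝ) : ℂ) • T (t - s)) (t - s) := he.smul (h.deriv _ hts)
    have h2 : HasDerivAt (fun r => S (t - r)) (-((Real.exp (ω * (t - s)) : ℂ) • -L (t - s) +
        ((Real.exp (ω * (t - s)) * ω : ℝ) : ℂ) • T (t - s))) s := by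
      have := h1.scomp s ((hasDerivAt_id s).const_sub t)
      rwa [neg_one_smul] at this
    have h3 := h2.op_apply hd
    refine h3.congr_deriv ?_
    set U := fracInt T α (v s) with hU
    have hU' := (h.mem_graph_iff _ _).1 hz
    have e1 : L (t - s) U = T (t - s) (z + (a : ℂ) • U) := by
      conv_lhs => rw [← hU']
      exact congrArg (fun B : X →L[ℂ] X => B (z + (a : ℂ) • U)) (h.deriv_mul_fracInt_one hts)
    have e2 : S (t - s) = (Real.exp (ω * (t - s)) : ℂ) • T (t - s) := rfl
    rw [e2]
    simp only [neg_apply, add_apply, smul_apply, map_add, map_neg, map_smul, e1, smul_add, smul_neg]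
    rw [Complex.ofReal_mul, mul_smul, hω, Complex.ofReal_add, add_smul, smul_add,
      smul_comm (lam : ℂ) (Real.exp ((lam + a) * (t - s)) : ℂ)]
    abel
  have hint : IntervalIntegrable (fun s => S (t - s) (g (v s))) volume 0 t := by
    refine ContinuousOn.intervalIntegrable ?_
    rwa [uIcc_of_le ht]
  have key := intervalIntegral.integral_eq_sub_of_hasDerivAt_of_le ht hφ hderiv hint
  rw [sub_self, sub_zero, hk.zero, one_apply_eq_self] at key
  -- The derivative exists only in `X`, so the formula is proved for `Λ^{-α} v`, and `Λ^{-α}` is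
  -- cancelled at the end.
  apply h.fracInt_injective hα.1 hα.2
  have hGc := continuous_comp_projIcc ht (hg.comp_continuousOn hv)
  have hGc' : Continuous fun s => Real.exp (-(ω * s)) • g (v (projIcc 0 t ht s)) := by
    have h1 : Continuous fun s : ℝ => Real.exp (-(ω * s)) := by fun_prop
    exact h1.smul hGc
  have hcong : ∀ s ∈ Icc 0 t, g (v s) = g (v (projIcc 0 t ht s)) := fun s hs => by
    rw [projIcc_of_mem ht hs]
  have hc : Commute (fracInt T α) (T t) :=
    (h.commute_fracInt (fun _ hr => h.commute ht hr.le) hα.1).symm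
  have e3 : fracInt T α (duhamel (scaled ω (fracKernel T L α)) (fun s => g (v s)) t) =
      ∫ s in (0 : ℝ)..t, S (t - s) (g (v s)) := by
    rw [duhamel_congr ht hcong, duhamel_scaled, ContinuousLinearMap.map_smul_of_tower,
      h.fracInt_duhamel hα hGc' ht, ← intervalIntegral.integral_smul]
    refine intervalIntegral.integral_congr fun s hs => ?_
    rw [uIcc_of_le ht] at hs
    rw [← hcong s hs, ContinuousLinearMap.map_smul_of_tower, smul_smul, ← Real.exp_add, hS, scaled_apply, mul_sub,
      ← sub_eq_add_neg]
  rw [map_add, e3, key, hS, scaled_apply, scaled_apply, ContinuousLinearMap.map_smul_of_tower, ← mul_apply_eq_comp,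
    ← mul_apply_eq_comp, hc.eq]
  abel

end IsShiftedSemigroup

end Complete

end

section
/-! ### The Lyapunov–Perron equation -/

/-- The spectral splitting of a semigroup `S` with kernel `H` into an expanding part (`E₁`, `H₁`),
a central part (`E₂`, `H₂`), both of them groups, and a contracting part
(`S t (1 - P₁ - P₂)`, `H₃`). -/
structure IsTrichotomy (S H E₁ H₁ E₂ H₂ H₃ : ℝ → X →L[ℂ] X) (P₁ P₂ : X →L[ℂ] X)
    (α M ν η : ℝ) : Prop where
  α_lt : α < 1
  M_nonneg : 0 ≤ M
  E₁_zero : E₁ 0 = P₁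
  E₂_zero : E₂ 0 = P₂
  E₁_mul : ∀ s t, 0 ≤ t → E₁ s * S t = E₁ (s + t)
  E₂_mul : ∀ s t, 0 ≤ t → E₂ s * S t = E₂ (s + t)
  mul_E₁ : ∀ t s, 0 ≤ t → S t * E₁ s = E₁ (t + s)
  mul_E₂ : ∀ t s, 0 ≤ t → S t * E₂ s = E₂ (t + s)
  E₂_mul_P₂ : ∀ t, E₂ t * P₂ = E₂ t
  mul_H₁ : ∀ t s, 0 ≤ t → S t * H₁ s = H₁ (t + s)
  mul_H₂ : ∀ t s, 0 ≤ t → S t * H₂ s = H₂ (t + s)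
  mul_H₃ : ∀ t s, 0 ≤ t → 0 < s → S t * H₃ s = H₃ (t + s)
  kernel_eq : ∀ t, 0 < t → H t = H₁ t + H₂ t + H₃ t
  P₂_mul_H₁ : ∀ t, P₂ * H₁ t = 0
  P₂_mul_H₃ : ∀ t, 0 < t → P₂ * H₃ t = 0
  continuous_E₂ : Continuous E₂
  continuous_H₁ : Continuous H₁
  continuous_H₂ : Continuous H₂
  continuousOn_H₃ : ContinuousOn H₃ (Ioi 0)
  norm_E₁_le : ∀ t ≤ 0, ‖E₁ t‖ ≤ M * Real.exp (η * t)
  norm_H₁_le : ∀ t ≤ 0, ‖H₁ t‖ ≤ M * Real.exp (η * t)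
  norm_E₂_le : ∀ t, ‖E₂ t‖ ≤ M * Real.exp (ν * |t|)
  norm_H₂_le : ∀ t, ‖H₂ t‖ ≤ M * Real.exp (ν * |t|)
  norm_mul_le : ∀ t, 0 < t → ‖S t * (1 - P₁ - P₂)‖ ≤ M * Real.exp (-(η * t))
  norm_H₃_le : ∀ t, 0 < t → ‖H₃ t‖ ≤ M * t ^ (-α) * Real.exp (-(η * t))

/-- `∫_0^∞ N(r) G(t + σ r) dr`. -/
def halfLineConv (N : ℝ → X →L[ℂ] X) (σ : ℝ) (G : ℝ → X) (t : ℝ) : X :=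
  ∫ r in Ioi (0 : ℝ), N r (G (t + σ * r))

/-- The right-hand side of the Lyapunov–Perron equation. -/
def lyapunovPerron (E₂ H₁ H₂ H₃ : ℝ → X →L[ℂ] X) (w : X) (G : ℝ → X) (t : ℝ) : X :=
  E₂ t w + duhamel H₂ G t - halfLineConv (fun r => H₁ (-r)) 1 G t + halfLineConv H₃ (-1) G t

/-! ### Convolutions over a half-line in the weighted space -/

section HalfLine

variable {N : ℝ → X →L[ℂ] X} {σ M B γ η μ : ℝ} {G G' : ℝ → X}

theorem norm_apply_shift_le (hσ : |σ| = 1) (hμ : 0 ≤ μ)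
    (hN' : ∀ r, 0 < r → ‖N r‖ ≤ M * r ^ (-γ) * Real.exp (-(η * r)))
    (hB : ∀ t, ‖G t‖ ≤ B * Real.exp (μ * |t|)) (t : ℝ) {r : ℝ} (hr : 0 < r) :
    ‖N r (G (t + σ * r))‖ ≤
      M * B * Real.exp (μ * |t|) * (r ^ (-γ) * Real.exp (-((η - μ) * r))) := by
  have hB0 : 0 ≤ B := by
    have := (norm_nonneg _).trans (hB 0)
    rwa [abs_zero, mul_zero, Real.exp_zero, mul_one] at this
  have h1 : |t + σ * r| ≤ |t| + r := by
    refine (abs_add_le _ _).trans ?_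
    rw [abs_mul, hσ, one_mul, abs_of_pos hr]
  have h2 : ‖G (t + σ * r)‖ ≤ B * (Real.exp (μ * |t|) * Real.exp (μ * r)) := by
    refine (hB _).trans (mul_le_mul_of_nonneg_left ?_ hB0)
    rw [← Real.exp_add, ← mul_add]
    gcongr
  have e : Real.exp (-((η - μ) * r)) = Real.exp (-(η * r)) * Real.exp (μ * r) := by
    rw [← Real.exp_add]; ring_nf
  refine ((N r).le_of_opNorm_le_of_le (hN' r hr) h2).trans (le_of_eq ?_)
  rw [e]
  ring

variable (hσ : |σ| = 1) (hM : 0 ≤ M) (hμ : 0 ≤ μ) (hγ : γ < 1) (hημ : μ < η)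
  (hN : ContinuousOn N (Ioi 0)) (hN' : ∀ r, 0 < r → ‖N r‖ ≤ M * r ^ (-γ) * Real.exp (-(η * r)))
  (hG : Continuous G) (hB : ∀ t, ‖G t‖ ≤ B * Real.exp (μ * |t|))
include hσ hM hμ hγ hημ hN'

include hN hG hB in
theorem integrableOn_halfLine (t : ℝ) : IntegrableOn (fun r => N r (G (t + σ * r))) (Ioi 0) :=
  integrableOn_Ioi_of_norm_le (hN.clm_apply (by fun_prop)) hγ (sub_pos.2 hημ)
    fun _ hr => norm_apply_shift_le hσ hμ hN' hB t hr

include hB in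
theorem norm_halfLineConv_le (t : ℝ) : ‖halfLineConv N σ G t‖ ≤
    M * (∫ r in Ioi (0 : ℝ), r ^ (-γ) * Real.exp (-((η - μ) * r))) * B * Real.exp (μ * |t|) := by
  have h1 := norm_integral_le_of_norm_le (μ := volume.restrict (Ioi 0))
    (f := fun r => N r (G (t + σ * r)))
    ((integrableOn_rpow_mul_exp hγ (sub_pos.2 hημ)).const_mul (M * B * Real.exp (μ * |t|)))
    ((ae_restrict_iff' measurableSet_Ioi).2 (Eventually.of_forall fun r hr =>
      norm_apply_shift_le hσ hμ hN' hB t hr))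
  rw [integral_const_mul] at h1
  refine h1.trans (le_of_eq ?_)
  ring

include hN hG hB in
theorem continuous_halfLineConv : Continuous (halfLineConv N σ G) := by
  have hB0 : 0 ≤ B := by
    have := (norm_nonneg _).trans (hB 0)
    rwa [abs_zero, mul_zero, Real.exp_zero, mul_one] at this
  refine continuous_iff_continuousAt.2 fun t₀ => ?_
  refine continuousAt_of_dominated (bound := fun r => M * B * Real.exp (μ * (|t₀| + 1)) *
    (r ^ (-γ) * Real.exp (-((η - μ) * r))))
    (Eventually.of_forall fun t =>
      (integrableOn_halfLine hσ hM hμ hγ hημ hN hN' hG hB t).aestronglyMeasurable) ?_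
    ((integrableOn_rpow_mul_exp hγ (sub_pos.2 hημ)).const_mul _)
    (Eventually.of_forall fun r => by fun_prop)
  have h1 : ∀ᶠ t in 𝓝 t₀, |t| < |t₀| + 1 :=
    (continuous_abs.tendsto t₀).eventually (gt_mem_nhds (by linarith))
  filter_upwards [h1] with t ht
  refine (ae_restrict_iff' measurableSet_Ioi).2 (Eventually.of_forall fun r hr => ?_)
  have hr0 : 0 < r := hr
  refine (norm_apply_shift_le hσ hμ hN' hB t hr).trans ?_
  gcongr

include hN in
theorem halfLineConv_sub (hG : Continuous G) (hB : IsExpBounded μ G) (hG' : Continuous G')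
    (hB' : IsExpBounded μ G') (t : ℝ) : halfLineConv N σ G t - halfLineConv N σ G' t =
      halfLineConv N σ (fun s => G s - G' s) t := by
  obtain ⟨B, hB⟩ := hB
  obtain ⟨B', hB'⟩ := hB'
  simp only [halfLineConv, map_sub]
  exact (integral_sub (integrableOn_halfLine hσ hM hμ hγ hημ hN hN' hG hB t)
    (integrableOn_halfLine hσ hM hμ hγ hημ hN hN' hG' hB' t)).symm

end HalfLine

/-! ### Duhamel integrals of the central group -/

section Central

variable {N : ℝ → X →L[ℂ] X} {M B ν μ : ℝ} {G : ℝ → X}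

theorem norm_duhamel_le_of_nonneg (hM : 0 ≤ M) (hνμ : ν < μ)
    (hN' : ∀ r, 0 ≤ r → ‖N r‖ ≤ M * Real.exp (ν * r))
    (hB : ∀ t, ‖G t‖ ≤ B * Real.exp (μ * |t|)) {t : ℝ} (ht : 0 ≤ t) : ‖duhamel N G t‖ ≤
      M * (∫ r in Ioi (0 : ℝ), Real.exp (-((μ - ν) * r))) * B * Real.exp (μ * t) := by
  have hB0 : 0 ≤ B := by
    have := (norm_nonneg _).trans (hB 0)
    rwa [abs_zero, mul_zero, Real.exp_zero, mul_one] at this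
  have hi : IntegrableOn (fun r : ℝ => Real.exp (-((μ - ν) * r))) (Ioi 0) := by
    have := integrableOn_rpow_mul_exp (γ := 0) zero_lt_one (sub_pos.2 hνμ)
    simpa using this
  rw [duhamel_eq, intervalIntegral.integral_of_le ht]
  have h1 : ‖∫ r in Ioc 0 t, N r (G (t - r))‖ ≤ ∫ r in Ioc 0 t,
      M * B * Real.exp (μ * t) * Real.exp (-((μ - ν) * r)) := by
    refine norm_integral_le_of_norm_le ((hi.mono_set Ioc_subset_Ioi_self).const_mul _) ?_
    refine (ae_restrict_iff' measurableSet_Ioc).2 (Eventually.of_forall fun r hr => ?_)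
    have e : Real.exp (μ * t) * Real.exp (-((μ - ν) * r)) =
        Real.exp (ν * r) * Real.exp (μ * (t - r)) := by
      rw [← Real.exp_add, ← Real.exp_add]; ring_nf
    have h2 := hB (t - r)
    rw [abs_of_nonneg (sub_nonneg.2 hr.2)] at h2
    refine ((N r).le_of_opNorm_le_of_le (hN' r hr.1.le) h2).trans (le_of_eq ?_)
    rw [mul_assoc (M * B), e]
    ring
  refine h1.trans ?_
  rw [integral_const_mul]
  have h2 : ∫ r in Ioc 0 t, Real.exp (-((μ - ν) * r)) ≤
      ∫ r in Ioi (0 : ℝ), Real.exp (-((μ - ν) * r)) :=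
    setIntegral_mono_set hi (Eventually.of_forall fun r => (Real.exp_pos _).le)
      (Eventually.of_forall Ioc_subset_Ioi_self)
  calc _ ≤ M * B * Real.exp (μ * t) * _ := mul_le_mul_of_nonneg_left h2 (by positivity)
    _ = _ := by ring

/-- Time reversal, which reduces the estimate at negative times to the one at positive times. -/
theorem duhamel_neg (N : ℝ → X →L[ℂ] X) (G : ℝ → X) (t : ℝ) :
    duhamel N G (-t) = -duhamel (fun r => N (-r)) (fun s => G (-s)) t := by
  have := intervalIntegral.integral_comp_neg (fun s => N (-t - s) (G s)) (a := 0) (b := t)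
  rw [neg_zero] at this
  rw [duhamel, duhamel, intervalIntegral.integral_symm, ← this]
  congr 1
  refine intervalIntegral.integral_congr fun s _ => ?_
  simp only [neg_sub, sub_neg_eq_add, neg_add_eq_sub]

theorem norm_duhamel_le_of_abs (hM : 0 ≤ M) (hνμ : ν < μ)
    (hN' : ∀ r, ‖N r‖ ≤ M * Real.exp (ν * |r|))
    (hB : ∀ t, ‖G t‖ ≤ B * Real.exp (μ * |t|)) (t : ℝ) : ‖duhamel N G t‖ ≤
      M * (∫ r in Ioi (0 : ℝ), Real.exp (-((μ - ν) * r))) * B * Real.exp (μ * |t|) := by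
  rcases le_total 0 t with ht | ht
  · rw [abs_of_nonneg ht]
    refine norm_duhamel_le_of_nonneg hM hνμ (fun r hr => ?_) hB ht
    have := hN' r
    rwa [abs_of_nonneg hr] at this
  · rw [abs_of_nonpos ht, ← neg_neg t, duhamel_neg, norm_neg, neg_neg]
    refine norm_duhamel_le_of_nonneg hM hνμ (fun r hr => ?_) (fun s => ?_) (neg_nonneg.2 ht)
    · have := hN' (-r)
      rwa [abs_neg, abs_of_nonneg hr] at this
    · have := hB (-s)
      rwa [abs_neg] at this

theorem continuous_duhamel_of_continuous (hN : Continuous N) (hG : Continuous G) :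
    Continuous (duhamel N G) :=
  intervalIntegral.continuous_parametric_intervalIntegral_of_continuous (by fun_prop)
    continuous_id

end Central

/-! ### Solving the Lyapunov–Perron equation -/

namespace IsTrichotomy

section Complete

variable [CompleteSpace X] {S H E₁ H₁ E₂ H₂ H₃ : ℝ → X →L[ℂ] X} {P₁ P₂ : X →L[ℂ] X}
  {α M ν η μ C ω : ℝ} {G G' : ℝ → X} {w w' : X} {g : X → X} {K : ℝ≥0}

/-- The constant in the estimate of the Lyapunov–Perron integrals. -/
def bound (M ν η α μ : ℝ) : ℝ :=
  M * ((∫ s in Ioi (0 : ℝ), Real.exp (-((μ - ν) * s))) +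
    ∫ s in Ioi (0 : ℝ), (1 + s ^ (-α)) * Real.exp (-((η - μ) * s)))

omit [CompleteSpace X] in
theorem norm_H₁_neg_le (h : IsTrichotomy S H E₁ H₁ E₂ H₂ H₃ P₁ P₂ α M ν η) (r : ℝ) (hr : 0 < r) :
    ‖H₁ (-r)‖ ≤ M * r ^ (-(0 : ℝ)) * Real.exp (-(η * r)) := by
  have := h.norm_H₁_le (-r) (by linarith)
  rwa [neg_zero, Real.rpow_zero, mul_one, ← mul_neg]

omit [CompleteSpace X] in
theorem continuousOn_H₁_neg (h : IsTrichotomy S H E₁ H₁ E₂ H₂ H₃ P₁ P₂ α M ν η) :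
    ContinuousOn (fun r => H₁ (-r)) (Ioi 0) :=
  (h.continuous_H₁.comp continuous_neg).continuousOn

variable (h : IsTrichotomy S H E₁ H₁ E₂ H₂ H₃ P₁ P₂ α M ν η) (hk : IsKernel S H α C ω)
  (hμ : 0 ≤ μ) (hνμ : ν < μ) (hμη : μ < η)
include h

include hμ hμη in
theorem integrableOn_H₁ (hG : Continuous G) (hB : IsExpBounded μ G) (t : ℝ) :
    IntegrableOn (fun r => H₁ (-r) (G (t + 1 * r))) (Ioi 0) := by
  obtain ⟨B, hB⟩ := hB
  exact integrableOn_halfLine abs_one h.M_nonneg hμ zero_lt_one hμη h.continuousOn_H₁_neg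
    h.norm_H₁_neg_le hG hB t

include hμ hμη in
theorem integrableOn_H₃ (hG : Continuous G) (hB : IsExpBounded μ G) (t : ℝ) :
    IntegrableOn (fun r => H₃ r (G (t + -1 * r))) (Ioi 0) := by
  obtain ⟨B, hB⟩ := hB
  exact integrableOn_halfLine (by simp) h.M_nonneg hμ h.α_lt hμη h.continuousOn_H₃
    h.norm_H₃_le hG hB t

include hμ hνμ hμη in
theorem norm_integrals_le {B : ℝ} (hB : ∀ t, ‖G t‖ ≤ B * Real.exp (μ * |t|)) (t : ℝ) :
    ‖duhamel H₂ G t - halfLineConv (fun r => H₁ (-r)) 1 G t + halfLineConv H₃ (-1) G t‖ ≤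
      bound M ν η α μ * B * Real.exp (μ * |t|) := by
  have hi0 := integrableOn_rpow_mul_exp (γ := 0) zero_lt_one (sub_pos.2 hμη)
  have hi1 := integrableOn_rpow_mul_exp h.α_lt (sub_pos.2 hμη)
  -- In the weight `1 + s^{-α}` the `1` belongs to the expanding integral, whose kernel is bounded
  -- at `0`, and `s^{-α}` to the contracting one.
  have e : ∫ s in Ioi (0 : ℝ), (1 + s ^ (-α)) * Real.exp (-((η - μ) * s)) =
      (∫ s in Ioi (0 : ℝ), s ^ (-(0 : ℝ)) * Real.exp (-((η - μ) * s))) +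
        ∫ s in Ioi (0 : ℝ), s ^ (-α) * Real.exp (-((η - μ) * s)) := by
    rw [← integral_add hi0 hi1]
    simp only [neg_zero, Real.rpow_zero, add_mul]
  have b2 := norm_duhamel_le_of_abs h.M_nonneg hνμ h.norm_H₂_le hB t
  have b1 := norm_halfLineConv_le abs_one h.M_nonneg hμ zero_lt_one hμη h.norm_H₁_neg_le hB t
  have b3 := norm_halfLineConv_le (σ := -1) (by simp) h.M_nonneg hμ h.α_lt hμη h.norm_H₃_le hB t
  rw [bound, e]
  calc _ ≤ _ := (norm_add_le _ _).trans (add_le_add_left (norm_sub_le _ _) _)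
    _ ≤ _ := add_le_add (add_le_add b2 b1) b3
    _ = _ := by ring

omit [CompleteSpace X] in
include hμ hμη hνμ in
theorem bound_nonneg : 0 ≤ bound M ν η α μ := by
  refine mul_nonneg h.M_nonneg (add_nonneg
    (setIntegral_nonneg measurableSet_Ioi fun r _ => (Real.exp_pos _).le)
    (setIntegral_nonneg measurableSet_Ioi fun r hr => ?_))
  have hr0 : 0 < r := hr
  positivity

include hμ hμη in
theorem continuous_lyapunovPerron (hG : Continuous G) (hB : IsExpBounded μ G) :
    Continuous (lyapunovPerron E₂ H₁ H₂ H₃ w G) := by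
  obtain ⟨B, hB⟩ := hB
  have h0 := h.continuous_E₂
  have h2 := continuous_duhamel_of_continuous h.continuous_H₂ hG
  have h1 := continuous_halfLineConv abs_one h.M_nonneg hμ zero_lt_one hμη h.continuousOn_H₁_neg
    h.norm_H₁_neg_le hG hB
  have h3 := continuous_halfLineConv (σ := -1) (by simp) h.M_nonneg hμ h.α_lt hμη h.continuousOn_H₃
    h.norm_H₃_le hG hB
  unfold lyapunovPerron
  fun_prop

include hνμ in
theorem norm_E₂_apply_le (t : ℝ) : ‖E₂ t w‖ ≤ M * ‖w‖ * Real.exp (μ * |t|) := by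
  have hM := h.M_nonneg
  have h1 : ‖E₂ t‖ ≤ M * Real.exp (μ * |t|) := (h.norm_E₂_le t).trans (by gcongr)
  refine ((E₂ t).le_of_opNorm_le h1 w).trans (le_of_eq ?_)
  ring

include hμ hνμ hμη in
theorem isExpBounded_lyapunovPerron (hB : IsExpBounded μ G) :
    IsExpBounded μ (lyapunovPerron E₂ H₁ H₂ H₃ w G) := by
  obtain ⟨B, hB⟩ := hB
  refine ⟨M * ‖w‖ + bound M ν η α μ * B, fun t => ?_⟩
  have h1 := h.norm_integrals_le hμ hνμ hμη hB t
  have h2 := h.norm_E₂_apply_le hνμ (w := w) t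
  have e : lyapunovPerron E₂ H₁ H₂ H₃ w G t = E₂ t w +
      (duhamel H₂ G t - halfLineConv (fun r => H₁ (-r)) 1 G t + halfLineConv H₃ (-1) G t) := by
    rw [lyapunovPerron]; abel
  rw [e, add_mul]
  exact (norm_add_le _ _).trans (add_le_add h2 h1)

include hμ hνμ hμη in
theorem norm_lyapunovPerron_sub_le (hG : Continuous G) (hb : IsExpBounded μ G)
    (hG' : Continuous G') (hb' : IsExpBounded μ G') {B : ℝ}
    (hB : ∀ t, ‖G t - G' t‖ ≤ B * Real.exp (μ * |t|)) (t : ℝ) :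
    ‖lyapunovPerron E₂ H₁ H₂ H₃ w G t - lyapunovPerron E₂ H₁ H₂ H₃ w' G' t‖ ≤
      (bound M ν η α μ * B + M * ‖w - w'‖) * Real.exp (μ * |t|) := by
  have e1 := halfLineConv_sub abs_one h.M_nonneg hμ zero_lt_one hμη h.continuousOn_H₁_neg
    h.norm_H₁_neg_le hG hb hG' hb' t
  have e3 := halfLineConv_sub (σ := -1) (by simp) h.M_nonneg hμ h.α_lt hμη h.continuousOn_H₃
    h.norm_H₃_le hG hb hG' hb' t
  have e2 : duhamel H₂ G t - duhamel H₂ G' t = duhamel H₂ (fun s => G s - G' s) t := by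
    have hc := h.continuous_H₂
    simp only [duhamel, map_sub]
    exact (intervalIntegral.integral_sub (Continuous.intervalIntegrable (by fun_prop) _ _)
      (Continuous.intervalIntegrable (by fun_prop) _ _)).symm
  have e : lyapunovPerron E₂ H₁ H₂ H₃ w G t - lyapunovPerron E₂ H₁ H₂ H₃ w' G' t =
      (duhamel H₂ (fun s => G s - G' s) t -
        halfLineConv (fun r => H₁ (-r)) 1 (fun s => G s - G' s) t +
        halfLineConv H₃ (-1) (fun s => G s - G' s) t) + E₂ t (w - w') := by
    rw [← e1, ← e2, ← e3, map_sub, lyapunovPerron, lyapunovPerron]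
    abel
  rw [e, add_mul]
  exact (norm_add_le _ _).trans (add_le_add (h.norm_integrals_le hμ hνμ hμη hB t)
    (h.norm_E₂_apply_le hνμ t))

include hμ hνμ hμη in
theorem exists_lyapunovPerron (hg : LipschitzWith K g) (hK : bound M ν η α μ * K < 1) (w : X) :
    ∃ v, Continuous v ∧ IsExpBounded μ v ∧
      lyapunovPerron E₂ H₁ H₂ H₃ w (fun s => g (v s)) = v := by
  have h0 := h.bound_nonneg hμ hνμ hμη
  refine exists_fixedPoint (q := bound M ν η α μ * K) (by positivity) hK
    (fun v => lyapunovPerron E₂ H₁ H₂ H₃ w (fun s => g (v s))) (fun v hv hb => ?_)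
    fun v v' B hv hb hv' hb' hB t => ?_
  · have hb1 := isExpBounded_comp hg hμ hb
    exact ⟨h.continuous_lyapunovPerron hμ hμη (hg.continuous.comp hv) hb1,
      h.isExpBounded_lyapunovPerron hμ hνμ hμη hb1⟩
  · have := h.norm_lyapunovPerron_sub_le hμ hνμ hμη (w := w) (w' := w) (B := K * B)
      (hg.continuous.comp hv) (isExpBounded_comp hg hμ hb) (hg.continuous.comp hv')
      (isExpBounded_comp hg hμ hb') (fun t => by
        refine (hg.norm_sub_le _ _).trans ?_
        rw [mul_assoc]
        exact mul_le_mul_of_nonneg_left (hB t) K.2) t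
    rw [sub_self, norm_zero, mul_zero, add_zero, ← mul_assoc] at this
    exact this

include hμ hνμ hμη in
-- It gives uniqueness for `w = w'` and Lipschitz dependence on `w` in general.
theorem norm_sub_le_of_lyapunovPerron (hg : LipschitzWith K g) (hK : bound M ν η α μ * K < 1)
    {v v' : ℝ → X} (hv : Continuous v) (hb : IsExpBounded μ v) (hv' : Continuous v')
    (hb' : IsExpBounded μ v') (e : lyapunovPerron E₂ H₁ H₂ H₃ w (fun s => g (v s)) = v)
    (e' : lyapunovPerron E₂ H₁ H₂ H₃ w' (fun s => g (v' s)) = v') (t : ℝ) :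
    ‖v t - v' t‖ ≤ M * ‖w - w'‖ / (1 - bound M ν η α μ * K) * Real.exp (μ * |t|) := by
  obtain ⟨B₁, hB₁⟩ := hb
  obtain ⟨B₂, hB₂⟩ := hb'
  refine le_div_one_sub_mul (n := fun t => ‖v t - v' t‖) (ρ := fun t => Real.exp (μ * |t|))
    (B₀ := B₁ + B₂) (fun t => Real.exp_pos _) hK (fun t => ?_) (fun B hB t => ?_) t
  · rw [add_mul]
    exact (norm_sub_le _ _).trans (add_le_add (hB₁ t) (hB₂ t))
  · have := h.norm_lyapunovPerron_sub_le hμ hνμ hμη (w := w) (w' := w') (B := K * B)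
      (hg.continuous.comp hv) (isExpBounded_comp hg hμ ⟨B₁, hB₁⟩) (hg.continuous.comp hv')
      (isExpBounded_comp hg hμ ⟨B₂, hB₂⟩) (fun t => by
        refine (hg.norm_sub_le _ _).trans ?_
        rw [mul_assoc]
        exact mul_le_mul_of_nonneg_left (hB t) K.2) t
    rw [← mul_assoc] at this
    have e1 : v t - v' t = lyapunovPerron E₂ H₁ H₂ H₃ w (g ∘ v) t -
        lyapunovPerron E₂ H₁ H₂ H₃ w' (g ∘ v') t := by
      conv_lhs => rw [← e, ← e']
      rfl
    simp only [e1]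
    exact this

include hμ hμη in
-- At time zero the central integral is empty, and the other two take values in the kernel of `P₂`.
theorem P₂_lyapunovPerron_zero (hG : Continuous G) (hB : IsExpBounded μ G) :
    P₂ (lyapunovPerron E₂ H₁ H₂ H₃ w G 0) = P₂ w := by
  have i1 := h.integrableOn_H₁ hμ hμη hG hB 0
  have i3 := h.integrableOn_H₃ hμ hμη hG hB 0
  have z1 : P₂ (halfLineConv (fun r => H₁ (-r)) 1 G 0) = 0 := by
    rw [halfLineConv, ← ContinuousLinearMap.integral_comp_comm _ i1]
    refine integral_eq_zero_of_ae (Eventually.of_forall fun r => ?_)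
    exact congrArg (fun B : X →L[ℂ] X => B (G (0 + 1 * r))) (h.P₂_mul_H₁ (-r))
  have z3 : P₂ (halfLineConv H₃ (-1) G 0) = 0 := by
    rw [halfLineConv, ← ContinuousLinearMap.integral_comp_comm _ i3]
    refine integral_eq_zero_of_ae ((ae_restrict_iff' measurableSet_Ioi).2
      (Eventually.of_forall fun r hr => ?_))
    exact congrArg (fun B : X →L[ℂ] X => B (G (0 + -1 * r))) (h.P₂_mul_H₃ r hr)
  have z2 : P₂ (E₂ 0 w) = P₂ w := by
    have := congrArg (fun B : X →L[ℂ] X => B w) (h.E₂_mul_P₂ 0)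
    rw [h.E₂_zero] at this ⊢
    exact this
  rw [lyapunovPerron, duhamel, intervalIntegral.integral_same, add_zero, map_add, map_sub, z1, z2,
    z3, sub_zero, add_zero]

include hk hμ hμη in
-- The right-hand side of the equation obeys the variation of constants formula between any two
-- times. Advancing the expanding integral by `s` splits off `∫_0^s H₁ (s - r) G (r + τ) dr`, and
-- the minus sign in front of that integral restores the sign with which `H₁` occurs in `H = H₁ + H₂
-- + H₃`.
theorem lyapunovPerron_add (hG : Continuous G) (hB : IsExpBounded μ G) (τ : ℝ) {s : ℝ}
    (hs : 0 ≤ s) : lyapunovPerron E₂ H₁ H₂ H₃ w G (s + τ) =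
      S s (lyapunovPerron E₂ H₁ H₂ H₃ w G τ) + duhamel H (fun r => G (r + τ)) s := by
  have c1 := h.continuous_H₁
  have c2 := h.continuous_H₂
  have hGτ : Continuous fun r => G (r + τ) := by fun_prop
  have e2 : duhamel H₂ G (s + τ) = S s (duhamel H₂ G τ) + duhamel H₂ (fun r => G (r + τ)) s := by
    have hi : ∀ a b, IntervalIntegrable (fun r => H₂ (s + τ - r) (G r)) volume a b := fun a b =>
      Continuous.intervalIntegrable (by fun_prop) _ _
    have e3 : S s (duhamel H₂ G τ) = ∫ r in (0 : ℝ)..τ, H₂ (s + τ - r) (G r) := by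
      rw [duhamel, ← ContinuousLinearMap.intervalIntegral_comp_comm _
        (Continuous.intervalIntegrable (by fun_prop) _ _)]
      refine intervalIntegral.integral_congr fun r _ => ?_
      rw [← mul_apply_eq_comp, h.mul_H₂ s _ hs, add_sub_assoc]
    have e4 : duhamel H₂ (fun r => G (r + τ)) s = ∫ r in τ..(s + τ), H₂ (s + τ - r) (G r) := by
      have := intervalIntegral.integral_comp_add_right (fun r => H₂ (s + τ - r) (G r))
        (a := 0) (b := s) τ
      rw [zero_add] at this
      rw [← this, duhamel]
      refine intervalIntegral.integral_congr fun r _ => ?_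
      simp only [add_sub_add_right_eq_sub]
    rw [e3, e4, intervalIntegral.integral_add_adjacent_intervals (hi _ _) (hi _ _), duhamel]
  have e1 : S s (halfLineConv (fun r => H₁ (-r)) 1 G τ) =
      halfLineConv (fun r => H₁ (-r)) 1 G (s + τ) + duhamel H₁ (fun r => G (r + τ)) s := by
    have i1 := h.integrableOn_H₁ hμ hμη hG hB τ
    have hcongr : ∀ r, S s (H₁ (-r) (G (τ + 1 * r))) = H₁ (s - r) (G (r + τ)) := fun r => by
      rw [← mul_apply_eq_comp, h.mul_H₁ s _ hs, one_mul, add_comm τ, sub_eq_add_neg]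
    have hi : IntegrableOn (fun r => H₁ (s - r) (G (r + τ))) (Ioi 0) := by
      have := (S s).integrable_comp i1
      simp only [hcongr] at this
      exact this
    have e5 : ∫ r in Ioi s, H₁ (s - r) (G (r + τ)) =
        halfLineConv (fun r => H₁ (-r)) 1 G (s + τ) := by
      have := integral_comp_add_right_Ioi (fun r => H₁ (s - r) (G (r + τ))) 0 s
      rw [zero_add] at this
      rw [← this, halfLineConv]
      refine integral_congr_ae (Eventually.of_forall fun r => ?_)
      simp only
      congr 2 <;> ring
    rw [halfLineConv, ← ContinuousLinearMap.integral_comp_comm _ i1]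
    simp only [hcongr]
    rw [← Ioc_union_Ioi_eq_Ioi hs, setIntegral_union (Ioc_disjoint_Ioi le_rfl) measurableSet_Ioi
      (hi.mono_set Ioc_subset_Ioi_self) (hi.mono_set (Ioi_subset_Ioi hs)), e5, add_comm, duhamel,
      intervalIntegral.integral_of_le hs]
  have i3 := h.integrableOn_H₃ hμ hμη hG hB (s + τ)
  have e3 : halfLineConv H₃ (-1) G (s + τ) =
      S s (halfLineConv H₃ (-1) G τ) + duhamel H₃ (fun r => G (r + τ)) s := by
    have i3' := h.integrableOn_H₃ hμ hμη hG hB τ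
    have e5 : S s (halfLineConv H₃ (-1) G τ) = ∫ r in Ioi s, H₃ r (G (s + τ + -1 * r)) := by
      have := integral_comp_add_right_Ioi (fun r => H₃ r (G (s + τ + -1 * r))) 0 s
      rw [zero_add] at this
      rw [← this, halfLineConv, ← ContinuousLinearMap.integral_comp_comm _ i3']
      refine setIntegral_congr_fun measurableSet_Ioi fun r hr => ?_
      rw [← mul_apply_eq_comp, h.mul_H₃ s r hs hr, add_comm s r]
      congr 2
      ring
    have e6 : duhamel H₃ (fun r => G (r + τ)) s = ∫ r in Ioc 0 s, H₃ r (G (s + τ + -1 * r)) := by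
      rw [duhamel_eq, intervalIntegral.integral_of_le hs]
      refine integral_congr_ae (Eventually.of_forall fun r => ?_)
      simp only
      congr 2
      ring
    rw [e5, e6, halfLineConv, ← Ioc_union_Ioi_eq_Ioi hs,
      setIntegral_union (Ioc_disjoint_Ioi le_rfl) measurableSet_Ioi
        (i3.mono_set Ioc_subset_Ioi_self) (i3.mono_set (Ioi_subset_Ioi hs)), add_comm]
  have esum : duhamel H (fun r => G (r + τ)) s = duhamel H₁ (fun r => G (r + τ)) s +
      duhamel H₂ (fun r => G (r + τ)) s + duhamel H₃ (fun r => G (r + τ)) s := by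
    have j1 : IntervalIntegrable (fun r => H₁ (s - r) (G (r + τ))) volume 0 s :=
      Continuous.intervalIntegrable (by fun_prop) _ _
    have j2 : IntervalIntegrable (fun r => H₂ (s - r) (G (r + τ))) volume 0 s :=
      Continuous.intervalIntegrable (by fun_prop) _ _
    have j3 : IntervalIntegrable (fun r => H₃ (s - r) (G (r + τ))) volume 0 s := by
      have j4 : IntervalIntegrable (fun r => H₃ r (G (s + τ + -1 * r))) volume 0 s :=
        (intervalIntegrable_iff_integrableOn_Ioc_of_le hs).2 (i3.mono_set Ioc_subset_Ioi_self)
      have := (j4.comp_sub_left s).symm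
      rw [sub_zero, sub_self] at this
      have e4 : ∀ r, s + τ + -1 * (s - r) = r + τ := fun r => by ring
      simpa only [e4] using this
    simp only [duhamel]
    rw [← intervalIntegral.integral_add j1 j2, ← intervalIntegral.integral_add (j1.add j2) j3]
    refine intervalIntegral.integral_congr_ae ?_
    have : ∀ᵐ r : ℝ, r ≠ s := by simp [ae_iff]
    filter_upwards [this] with r hr hrs
    rw [uIoc_of_le hs] at hrs
    rw [h.kernel_eq _ (sub_pos.2 (lt_of_le_of_ne hrs.2 hr)), add_apply, add_apply]
  have e0 : S s (E₂ τ w) = E₂ (s + τ) w := by rw [← mul_apply_eq_comp, h.mul_E₂ s τ hs]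
  rw [lyapunovPerron, lyapunovPerron, map_add, map_sub, map_add, e0, e1, e2, e3, esum]
  abel

include hk hμ hμη in
theorem mild_of_lyapunovPerron (hg : LipschitzWith K g) {v : ℝ → X} (hv : Continuous v)
    (hb : IsExpBounded μ v) (e : lyapunovPerron E₂ H₁ H₂ H₃ w (fun s => g (v s)) = v) (τ : ℝ) :
    MildOn S H g (fun t => v (t + τ)) (Ici 0) := by
  intro t ht
  have := h.lyapunovPerron_add hk hμ hμη (w := w) (hg.continuous.comp hv)
    (isExpBounded_comp hg hμ hb) τ ht
  have e' : lyapunovPerron E₂ H₁ H₂ H₃ w (g ∘ v) = v := e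
  rw [e'] at this
  simp only [zero_add]
  exact this

include hμ hνμ hμη in
-- The expanding component is pulled back from time `t + s` and the contracting one is pushed
-- forward from `t - s`. Both are of order `e^{-(η-μ)s}` and vanish as `s → ∞`; the central one is
-- transported by the group from its value zero at time zero.
theorem eq_zero_of_forall_semigroup {d : ℝ → X} (hb : IsExpBounded μ d)
    (hd : ∀ τ s, 0 ≤ s → d (s + τ) = S s (d τ)) (h0 : P₂ (d 0) = 0) (t : ℝ) : d t = 0 := by
  obtain ⟨B, hB⟩ := hb
  have hM := h.M_nonneg
  have hB0 : 0 ≤ B := by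
    have := (norm_nonneg _).trans (hB 0)
    rwa [abs_zero, mul_zero, Real.exp_zero, mul_one] at this
  have hlim : Tendsto (fun s : ℝ => M * B * Real.exp (μ * |t|) * Real.exp (-((η - μ) * s))) atTop
      (𝓝 0) := by
    have h1 : Tendsto (fun s : ℝ => Real.exp (-((η - μ) * s))) atTop (𝓝 0) :=
      Real.tendsto_exp_atBot.comp (tendsto_neg_atTop_atBot.comp
        (tendsto_id.const_mul_atTop (sub_pos.2 hμη)))
    simpa using h1.const_mul (M * B * Real.exp (μ * |t|))
  have hbd : ∀ s, 0 ≤ s → ∀ x, |x| ≤ |t| + s → ∀ Q : X →L[ℂ] X, ‖Q‖ ≤ M * Real.exp (-(η * s)) →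
      ‖Q (d x)‖ ≤ M * B * Real.exp (μ * |t|) * Real.exp (-((η - μ) * s)) := by
    intro s hs x hx Q hQ
    have h1 : ‖d x‖ ≤ B * Real.exp (μ * (|t| + s)) := (hB x).trans (by gcongr)
    refine (Q.le_of_opNorm_le_of_le hQ h1).trans (le_of_eq ?_)
    have : Real.exp (-((η - μ) * s)) = Real.exp (-(η * s)) * Real.exp (μ * s) := by
      rw [← Real.exp_add]; ring_nf
    rw [this, mul_add, Real.exp_add]
    ring
  have z1 : P₁ (d t) = 0 := by
    refine norm_le_zero_iff.1 (ge_of_tendsto hlim ?_)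
    filter_upwards [eventually_ge_atTop 0] with s hs
    have e : P₁ (d t) = E₁ (-s) (d (s + t)) := by
      rw [hd t s hs, ← mul_apply_eq_comp, h.E₁_mul _ _ hs, neg_add_cancel, h.E₁_zero]
    rw [e]
    refine hbd s hs _ ?_ _ ?_
    · refine (abs_add_le _ _).trans ?_
      rw [abs_of_nonneg hs, add_comm]
    · have := h.norm_E₁_le (-s) (by linarith)
      rwa [mul_neg] at this
  have z2 : P₂ (d t) = 0 := by
    rcases le_total 0 t with ht | ht
    · have := hd 0 t ht
      rw [add_zero] at this
      rw [this, ← mul_apply_eq_comp, ← h.E₂_zero, h.E₂_mul _ _ ht, zero_add, ← h.E₂_mul_P₂,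
        mul_apply_eq_comp, h0, map_zero]
    · have := hd t (-t) (by linarith)
      rw [neg_add_cancel] at this
      have e : E₂ t (d 0) = P₂ (d t) := by
        rw [this, ← mul_apply_eq_comp, h.E₂_mul _ _ (by linarith), add_neg_cancel, h.E₂_zero]
      rw [← e, ← h.E₂_mul_P₂, mul_apply_eq_comp, h0, map_zero]
  have z3 : (1 - P₁ - P₂) (d t) = 0 := by
    refine norm_le_zero_iff.1 (ge_of_tendsto hlim ?_)
    filter_upwards [eventually_gt_atTop 0] with s hs
    have hcomm : (1 - P₁ - P₂) * S s = S s * (1 - P₁ - P₂) := by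
      rw [sub_mul, sub_mul, mul_sub, mul_sub, mul_one, one_mul, ← h.E₁_zero, ← h.E₂_zero,
        h.E₁_mul _ _ hs.le, h.E₂_mul _ _ hs.le, h.mul_E₁ _ _ hs.le, h.mul_E₂ _ _ hs.le, add_zero,
        zero_add]
    have e : (1 - P₁ - P₂) (d t) = (S s * (1 - P₁ - P₂)) (d (t - s)) := by
      have := hd (t - s) s hs.le
      rw [add_sub_cancel] at this
      rw [this, ← mul_apply_eq_comp, hcomm]
    rw [e]
    refine hbd s hs.le _ ?_ _ (h.norm_mul_le s hs)
    have := abs_sub t s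
    rwa [abs_of_pos hs] at this
  rw [sub_apply, sub_apply, z1, z2, sub_zero, sub_zero, one_apply_eq_self] at z3
  exact z3

include hk hμ hνμ hμη in
-- Both sides satisfy the variation of constants formula with the same forcing, so their difference
-- is a trajectory of the linear equation with growth rate `μ` and no central component at time
-- zero.
theorem lyapunovPerron_of_mild (hg : LipschitzWith K g) {v : ℝ → X} (hv : Continuous v)
    (hb : IsExpBounded μ v) (hm : ∀ τ, MildOn S H g (fun t => v (t + τ)) (Ici 0)) :
    lyapunovPerron E₂ H₁ H₂ H₃ (P₂ (v 0)) (fun s => g (v s)) = v := by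
  have hG : Continuous fun s => g (v s) := hg.continuous.comp hv
  have hGb := isExpBounded_comp hg hμ hb
  set u := lyapunovPerron E₂ H₁ H₂ H₃ (P₂ (v 0)) (fun s => g (v s)) with hu
  have hub : IsExpBounded μ u := h.isExpBounded_lyapunovPerron hμ hνμ hμη hGb
  funext t
  refine (sub_eq_zero.1 (h.eq_zero_of_forall_semigroup hμ hνμ hμη (d := fun t => u t - v t) ?_ ?_
    ?_ t))
  · obtain ⟨B₁, hB₁⟩ := hub
    obtain ⟨B₂, hB₂⟩ := hb
    exact ⟨B₁ + B₂, fun t => by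
      rw [add_mul]; exact (norm_sub_le _ _).trans (add_le_add (hB₁ t) (hB₂ t))⟩
  · intro τ s hs
    have h1 := h.lyapunovPerron_add hk hμ hμη (w := P₂ (v 0)) hG hGb τ hs
    have h2 := hm τ s hs
    simp only [zero_add] at h2
    rw [hu, h1, h2, map_sub]
    abel
  · have e2 : P₂ (P₂ (v 0)) = P₂ (v 0) := by
      have := congrArg (fun B : X →L[ℂ] X => B (v 0)) (h.E₂_mul_P₂ 0)
      rw [h.E₂_zero] at this
      exact this
    rw [map_sub, hu, h.P₂_lyapunovPerron_zero hμ hμη hG hGb, e2, sub_self]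

end Complete

end IsTrichotomy

end

section
variable {A : X →ₗ.[ℂ] X} {a α lam β β₁ β₂ M μ : ℝ} {T L S H E : ℝ → X →L[ℂ] X}
  {P B : X →L[ℂ] X} {z₀ : ℂ} {C δ ω : ℝ}

section Complete

variable [CompleteSpace X]

/-! ### The spectral splitting of the semigroup -/

namespace IsShiftedSemigroup

theorem scaled_eq (h : IsShiftedSemigroup A a T L C δ) (lam t : ℝ) :
    scaled (lam + a) T t = (Real.exp (lam * t) : ℂ) • semigroup A t := by
  rw [scaled, h.eq_smul, smul_smul, ← Complex.ofReal_mul, ← Real.exp_add]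
  congr 3
  ring

theorem mul_left_cancel_fracInt (h : IsShiftedSemigroup A a T L C δ) (hα : α ∈ Ico (0 : ℝ) 1)
    {B B' : X →L[ℂ] X} (e : fracInt T α * B = fracInt T α * B') : B = B' := by
  ext x
  exact h.fracInt_injective hα.1 hα.2 (congrArg (fun B : X →L[ℂ] X => B x) e)

theorem commute_scaled_fracInt (h : IsShiftedSemigroup A a T L C δ) (hα : 0 ≤ α) (c : ℝ) {t : ℝ}
    (ht : 0 ≤ t) : Commute (scaled c T t) (fracInt T α) :=
  (h.commute_fracInt (fun _ hr => h.commute ht hr.le) hα).smul_left _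

theorem commute_graphComm_fracInt (h : IsShiftedSemigroup A a T L C δ) (hA : IsSectorial A)
    (hP : GraphComm A P) (hα : 0 ≤ α) : Commute P (fracInt T α) :=
  h.commute_fracInt (fun _ hr => h.commute_of_graphComm hA hP hr.le) hα

theorem fracInt_mul_scaled (h : IsShiftedSemigroup A a T L C δ) (hα : α ∈ Ico (0 : ℝ) 1) (c : ℝ)
    {t : ℝ} (ht : 0 < t) : fracInt T α * scaled c (fracKernel T L α) t = scaled c T t := by
  rw [scaled, mul_smul_comm, h.fracInt_mul_fracKernel hα ht, scaled]

/-- `Λ^α E t` for the group `E` on a bounded spectral subspace. -/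
theorem exists_groupKernel (hT : IsShiftedSemigroup A a T L C δ) (hA : IsSectorial A)
    (h : IsGroupPart A lam P B E) (hα : α ∈ Ico (0 : ℝ) 1) :
    ∃ H : ℝ → X →L[ℂ] X, Continuous H ∧ (∀ t, fracInt T α * H t = E t) ∧
      (∀ t s, 0 ≤ t → scaled (lam + a) T t * H s = H (t + s)) ∧
      (∀ t s, 0 ≤ t → scaled (lam + a) T t * E s = E (t + s)) ∧
      ∀ s t, 0 ≤ t → E s * scaled (lam + a) T t = E (s + t) := by
  obtain ⟨D, hS⟩ := exists_isAnalyticSemigroup hA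
  have hHE : ∀ t, fracInt T α * (fracInt T (1 - α) * (B * E t + (a : ℂ) • E t)) = E t := fun t => by
    rw [← hT.negFracPow_eq, ← hT.fracInt_mul_graphOp hα (h.graph t)]
  have hSE : ∀ t s, 0 ≤ t → scaled (lam + a) T t * E s = E (t + s) := fun t s ht => by
    rw [hT.scaled_eq, smul_mul_assoc, h.semigroup_mul hS ht s]
  refine ⟨fun t => fracInt T (1 - α) * (B * E t + (a : ℂ) • E t), ?_, hHE, fun t s ht => ?_, hSE,
    fun s t ht => ?_⟩
  · have := h.continuous
    fun_prop
  · refine hT.mul_left_cancel_fracInt hα ?_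
    rw [hHE, ← mul_assoc, ← (hT.commute_scaled_fracInt hα.1 _ ht).eq, mul_assoc, hHE, hSE t s ht]
  · have : Commute (E s) (scaled (lam + a) T t) :=
      (hT.commute_of_graphComm hA (h.comm s) ht).smul_right _
    rw [this.eq, hSE t s ht, add_comm]

end IsShiftedSemigroup

/-- In the coordinates `Λ^α u` the kernels are `H i = Λ^α e^{-Aⁱt} Pᵢ`. Identities involving `H₁` or
`H₂`, and the vanishing of `P₂ H₃`, are checked after applying the injective operator `Λ^{-α}`,
where they reduce to the group and semigroup laws and to `Pᵢ Pⱼ = 0`. -/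
theorem SpectralSplitting.exists_isTrichotomy (h : SpectralSplitting A z₀ β₁ β₂)
    (hA : IsSectorial A) (hT : IsShiftedSemigroup A a T L C δ) (hα : α ∈ Ico (0 : ℝ) 1)
    (hE : ExpEstimates A a z₀ β₁ β lam α M) :
    ∃ H₁ H₂ H₃, IsTrichotomy (scaled (lam + a) T) (scaled (lam + a) (fracKernel T L α))
      (exp1 A β₁ lam) H₁ (exp2 A z₀ lam) H₂ H₃ (P1 A β₁) (P2 A z₀) α M (1 / 4 * β)
      (3 / 4 * β) := by
  have hinj := hT.injective hα
  obtain ⟨B₁, g1⟩ := h.exists_isGroupPart1 hA lam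
  obtain ⟨B₂, g2⟩ := h.exists_isGroupPart2 lam
  obtain ⟨H₁, c1, f1, m1, n1, r1⟩ := hT.exists_groupKernel hA g1 hα
  obtain ⟨H₂, c2, f2, m2, n2, r2⟩ := hT.exists_groupKernel hA g2 hα
  obtain ⟨C₀, hk₀⟩ := hT.exists_isKernel hα
  have hk := hk₀.scaled (lam + a)
  set S := scaled (lam + a) T with hS
  set H := scaled (lam + a) (fracKernel T L α) with hH
  have fH : ∀ t, 0 < t → fracInt T α * H t = S t := fun t ht => hT.fracInt_mul_scaled hα _ ht
  have eP3 : (1 : X →L[ℂ] X) - P1 A β₁ - P2 A z₀ = P3 A β₁ z₀ := rfl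
  have e3 : ∀ t, exp3 A β₁ z₀ lam t = S t * P3 A β₁ z₀ := fun t => by
    rw [hS, hT.scaled_eq]; rfl
  have hM : 0 ≤ M := by
    have := (norm_nonneg _).trans (hE.norm2 0)
    rwa [abs_zero, mul_zero, Real.exp_zero, mul_one] at this
  have p2 := hT.commute_graphComm_fracInt hA h.graphComm_P2 hα.1
  have p3 := hT.commute_graphComm_fracInt hA (h.graphComm_P3 hA) hα.1
  have p23 : P2 A z₀ * P3 A β₁ z₀ = 0 := by
    rw [← eP3, mul_sub, mul_sub, mul_one, h.P2_mul_P1 hA, h.P2_mul_P2]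
    abel
  refine ⟨H₁, H₂, fun t => H t * P3 A β₁ z₀, ?_⟩
  constructor
  case α_lt => exact hα.2
  case M_nonneg => exact hM
  case E₁_zero => exact g1.zero
  case E₂_zero => exact g2.zero
  case E₁_mul => exact r1
  case E₂_mul => exact r2
  case mul_E₁ => exact n1
  case mul_E₂ => exact n2
  case E₂_mul_P₂ => exact g2.mul_eq
  case mul_H₁ => exact m1
  case mul_H₂ => exact m2
  case mul_H₃ => exact fun t s ht hs => by rw [← mul_assoc, hk.mul t s ht hs]
  case kernel_eq =>
    intro t ht
    refine hT.mul_left_cancel_fracInt hα ?_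
    have q1 := n1 t 0 ht.le
    have q2 := n2 t 0 ht.le
    rw [add_zero, g1.zero] at q1
    rw [add_zero, g2.zero] at q2
    rw [mul_add, mul_add, f1, f2, ← mul_assoc, fH t ht, ← eP3, mul_sub, mul_sub, mul_one, q1, q2]
    abel
  case P₂_mul_H₁ =>
    intro t
    refine hT.mul_left_cancel_fracInt hα ?_
    rw [← mul_assoc, ← p2.eq, mul_assoc, f1, mul_zero, ← g1.mul_eq', ← mul_assoc, h.P2_mul_P1 hA,
      zero_mul]
  case P₂_mul_H₃ =>
    intro t ht
    refine hT.mul_left_cancel_fracInt hα ?_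
    have hc : Commute (P2 A z₀) (S t) :=
      (hT.commute_of_graphComm hA h.graphComm_P2 ht.le).smul_right _
    rw [mul_zero, ← mul_assoc, ← p2.eq, mul_assoc, ← mul_assoc (fracInt T α), fH t ht, ← mul_assoc,
      hc.eq, mul_assoc, p23, mul_zero]
  case continuous_E₂ => exact g2.continuous
  case continuous_H₁ => exact c1
  case continuous_H₂ => exact c2
  case continuousOn_H₃ => exact hk.continuousOn_kernel.mul continuousOn_const
  case norm_E₁_le => exact hE.norm1
  case norm_H₁_le =>
    intro t ht
    refine ContinuousLinearMap.opNorm_le_bound _ (by positivity) ?_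
    exact (FracSpace.fracBound_iff hinj (by rw [hT.negFracPow_eq, f1])).1 (hE.frac1 t ht)
  case norm_E₂_le => exact hE.norm2
  case norm_H₂_le =>
    intro t
    refine ContinuousLinearMap.opNorm_le_bound _ (by positivity) ?_
    exact (FracSpace.fracBound_iff hinj (by rw [hT.negFracPow_eq, f2])).1 (hE.frac2 t)
  case norm_mul_le =>
    intro t ht
    refine ContinuousLinearMap.opNorm_le_bound _ (by positivity) ?_
    have hc : Commute (S t * P3 A β₁ z₀) (negFracPow A a α) := by
      rw [hT.negFracPow_eq]
      exact (hT.commute_scaled_fracInt hα.1 _ ht.le).mul_left p3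
    have := hE.fracfrac3 t ht
    rw [e3] at this
    exact (FracSpace.fracFracBound_iff hinj hc).1 this
  case norm_H₃_le =>
    intro t ht
    refine ContinuousLinearMap.opNorm_le_bound _ (by positivity) ?_
    have := hE.frac3 t ht
    rw [e3] at this
    exact (FracSpace.fracBound_iff hinj
      (by rw [hT.negFracPow_eq, ← mul_assoc, fH t ht])).1 this

/-! ### The semiflow of mild solutions -/

theorem IsKernel.exists_flow (h : IsKernel S H α C ω) {g : X → X} {K : ℝ≥0}
    (hg : LipschitzWith K g) : ∃ φ : Flow ℝ≥0 X,
      (∀ x, Continuous (fun t : ℝ => φ t.toNNReal x) ∧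
        MildOn S H g (fun t : ℝ => φ t.toNNReal x) (Ici 0)) ∧
      ∀ (v : ℝ → X) (b : ℝ), 0 ≤ b → ContinuousOn v (Icc 0 b) → MildOn S H g v (Icc 0 b) →
        v b = φ b.toNNReal (v 0) := by
  choose sol hc h0 hm using h.exists_mild hg
  have huniq : ∀ (v : ℝ → X) (b : ℝ), 0 ≤ b → ContinuousOn v (Icc 0 b) →
      MildOn S H g v (Icc 0 b) → v b = sol (v 0) b := fun v b hb hv hv' =>
    h.mild_unique hg hb hv (hc _).continuousOn hv' (fun t ht => hm _ t ht.1) (h0 _).symm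
  obtain ⟨k, κ, hk⟩ := h.exists_norm_mild_sub_le hg
  -- Joint continuity: the dependence on the initial value is Lipschitz with a locally bounded
  -- constant, and the orbit of the fixed point `x₀` is continuous in time.
  have hcont : Continuous (Function.uncurry fun (t : ℝ≥0) (x : X) => sol x t) := by
    refine continuous_iff_continuousAt.2 fun ⟨t₀, x₀⟩ => ?_
    rw [ContinuousAt, tendsto_iff_norm_sub_tendsto_zero]
    have hb : Continuous fun p : ℝ≥0 × X => k * ‖p.2 - x₀‖ * Real.exp (κ * (p.1 : ℝ)) +
        ‖sol x₀ p.1 - sol x₀ t₀‖ := by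
      have := hc x₀
      fun_prop
    have hb' := hb.tendsto (t₀, x₀)
    simp only [sub_self, norm_zero, mul_zero, zero_mul, add_zero] at hb'
    refine squeeze_zero (fun _ => norm_nonneg _) (fun p => ?_) hb'
    have h1 := hk p.1.2 (hc p.2).continuousOn (hc x₀).continuousOn (fun t ht => hm p.2 t ht.1)
      fun t ht => hm x₀ t ht.1
    rw [h0, h0] at h1
    have e : sol p.2 p.1 - sol x₀ t₀ = (sol p.2 p.1 - sol x₀ p.1) + (sol x₀ p.1 - sol x₀ t₀) := by
      abel
    change ‖sol p.2 p.1 - sol x₀ t₀‖ ≤ _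
    rw [e]
    exact (norm_add_le _ _).trans (add_le_add h1 le_rfl)
  have hadd : ∀ (t s : ℝ≥0) (x : X), sol x ((t + s : ℝ≥0) : ℝ) = sol (sol x s) t := by
    intro t s x
    have h1 := h.mild_shift hg.continuous (hc x) (hm x) s.2
    have h2 := huniq (fun r => sol x (r + s)) t t.2
      ((hc x).comp (by fun_prop)).continuousOn fun r hr => h1 r hr.1
    simp only [zero_add] at h2
    rw [NNReal.coe_add]
    exact h2
  let φ : Flow ℝ≥0 X :=
    { toFun := fun t x => sol x t
      cont' := hcont
      map_add' := hadd
      map_zero' := h0 }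
  have hφ : ∀ t, 0 ≤ t → ∀ x, φ t.toNNReal x = sol x t := fun t ht x => by
    change sol x (t.toNNReal : ℝ) = sol x t
    rw [Real.coe_toNNReal t ht]
  refine ⟨φ, fun x => ⟨?_, fun t ht => ?_⟩, fun v b hb hv hv' => ?_⟩
  · change Continuous fun t : ℝ => sol x (t.toNNReal : ℝ)
    have := hc x
    fun_prop
  · beta_reduce
    rw [hφ t ht, hφ 0 le_rfl, h0, hm x t ht, h0]
    congr 1
    exact duhamel_congr ht fun s hs => by rw [hφ s hs.1]
  · rw [hφ b hb]
    exact huniq v b hb hv hv'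

/-! ### Solutions in coordinates -/

namespace IsShiftedSemigroup

variable (hT : IsShiftedSemigroup A a T L C δ) (hα : α ∈ Ico (0 : ℝ) 1)
  {f : FracSpace A a α → X} {K : ℝ≥0}
include hT hα

theorem fracInt_coord (u : FracSpace A a α) :
    fracInt T α (FracSpace.coord (hT.injective hα) u) = FracSpace.incl A a α u := by
  rw [← hT.negFracPow_eq]
  exact FracSpace.negFracPow_coord _ u

theorem solvesOn_iff {u : ℝ → FracSpace A a α} {I : Set ℝ} :
    SolvesOn A a α lam f u I ↔ ∀ t ∈ I, ∃ z,
      (fracInt T α (FracSpace.coord (hT.injective hα) (u t)), z) ∈ A.graph ∧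
      HasDerivAt (fun s => fracInt T α (FracSpace.coord (hT.injective hα) (u s)))
        (-z + (lam : ℂ) • fracInt T α (FracSpace.coord (hT.injective hα) (u t)) + f (u t)) t := by
  simp only [hT.fracInt_coord hα]
  refine forall₂_congr fun t _ => ⟨fun ⟨hmem, hd⟩ => ⟨_, A.mem_graph ⟨_, hmem⟩, hd⟩,
    fun ⟨z, hz, hd⟩ => ?_⟩
  obtain ⟨⟨y, hy⟩, e1, e2⟩ := A.mem_graph_iff.1 hz
  simp only at e1 e2
  subst e1 e2
  exact ⟨hy, hd⟩

variable (hf : LipschitzWith K f)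
include hf

theorem lipschitzWith_comp_coord_symm :
    LipschitzWith K fun x => f ((FracSpace.coord (hT.injective hα)).symm x) := by
  have := hf.comp (FracSpace.coord (hT.injective hα)).symm.isometry.lipschitz
  rwa [mul_one] at this

theorem solvesOn_of_mild {u : ℝ → FracSpace A a α} (hu : Continuous u)
    (hm : MildOn (scaled (lam + a) T) (scaled (lam + a) (fracKernel T L α))
      (fun x => f ((FracSpace.coord (hT.injective hα)).symm x))
      (fun t => FracSpace.coord (hT.injective hα) (u t)) (Ici 0)) :
    SolvesOn A a α lam f u (Ioi 0) := by
  rw [hT.solvesOn_iff hα]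
  intro t ht
  have := hT.hasDerivAt_of_mild hα (hT.lipschitzWith_comp_coord_symm hα hf)
    ((FracSpace.coord (hT.injective hα)).continuous.comp hu) hm ht
  simpa only [Function.comp, LinearIsometryEquiv.symm_apply_apply] using this

theorem mild_of_solvesOn {u : ℝ → FracSpace A a α} {b : ℝ} (hu : ContinuousOn u (Icc 0 b))
    (hs : SolvesOn A a α lam f u (Ioo 0 b)) :
    MildOn (scaled (lam + a) T) (scaled (lam + a) (fracKernel T L α))
      (fun x => f ((FracSpace.coord (hT.injective hα)).symm x))
      (fun t => FracSpace.coord (hT.injective hα) (u t)) (Icc 0 b) := by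
  intro t ht
  rw [hT.solvesOn_iff hα] at hs
  refine hT.mild_of_hasDerivAt hα (v := fun t => FracSpace.coord (hT.injective hα) (u t)) (hT.lipschitzWith_comp_coord_symm hα hf).continuous ht.1
    (((FracSpace.coord (hT.injective hα)).continuous.comp_continuousOn hu).mono
      (Icc_subset_Icc_right ht.2)) fun s hst => ?_
  simpa only [LinearIsometryEquiv.symm_apply_apply] using hs s ⟨hst.1, hst.2.trans_le ht.2⟩

theorem isFullSolution_iff {u : ℝ → FracSpace A a α} :
    IsFullSolution A a α lam f u ↔ Continuous u ∧
      ∀ τ, MildOn (scaled (lam + a) T) (scaled (lam + a) (fracKernel T L α))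
        (fun x => f ((FracSpace.coord (hT.injective hα)).symm x))
        (fun t => FracSpace.coord (hT.injective hα) (u (t + τ))) (Ici 0) := by
  refine and_congr_right fun hu => ⟨fun hs τ t ht => ?_, fun hm => ?_⟩
  · have hs' : SolvesOn A a α lam f (fun t => u (t + τ)) (Ioo 0 t) := by
      intro s _
      obtain ⟨h1, h2⟩ := hs (s + τ) (mem_univ _)
      exact ⟨h1, h2.comp_add_const s τ⟩
    exact hT.mild_of_solvesOn hα hf (by fun_prop) hs' t ⟨ht, le_rfl⟩
  · intro t _
    -- The formula yields the equation only at positive times, so at `t` it is used with starting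
    -- time `t - 1`.
    have hs := hT.solvesOn_of_mild hα hf (lam := lam) (u := fun s => u (s + (t - 1)))
      (by fun_prop) (hm (t - 1))
    obtain ⟨h1, h2⟩ := hs 1 (mem_Ioi.2 one_pos)
    have e : 1 + (t - 1) = t := by ring
    simp only [e] at h1 h2
    refine ⟨h1, ?_⟩
    have e' : t + (1 - t) = 1 := by ring
    have key : ∀ (F : ℝ → X) (F' : X), HasDerivAt F F' 1 →
        HasDerivAt (fun s => F (s + (1 - t))) F' t := fun F F' hF => by
      rw [← e'] at hF
      exact hF.comp_add_const t (1 - t)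
    have h3 := key _ _ h2
    have e2 : ∀ s, s + (1 - t) + (t - 1) = s := fun s => by ring
    simpa only [e2] using h3

end IsShiftedSemigroup

theorem mem_weightedSpace_iff (hinj : Function.Injective (negFracPow A a α : X →ₗ[ℂ] X))
    {u : ℝ → FracSpace A a α} : u ∈ weightedSpace A a α μ ↔
      Continuous u ∧ IsExpBounded μ fun t => FracSpace.coord hinj (u t) := by
  refine and_congr_right fun _ => ?_
  simp only [IsExpBounded, LinearIsometryEquiv.norm_map, bddAbove_def, forall_mem_range,
    Real.exp_neg, inv_mul_le_iff₀ (Real.exp_pos _), mul_comm (Real.exp _)]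

end Complete

end

section
variable {A : X →ₗ.[ℂ] X} {a α lam β β₁ β₂ M μ : ℝ} {T L : ℝ → X →L[ℂ] X}
  {z₀ : ℂ} {C δ : ℝ}

section Complete

variable [CompleteSpace X]

/-! ### The invariant manifold -/

theorem IsShiftedSemigroup.exists_isGeneratedSemiflow (hT : IsShiftedSemigroup A a T L C δ)
    (hα : α ∈ Ico (0 : ℝ) 1) (lam : ℝ) {f : FracSpace A a α → X} {K : ℝ≥0}
    (hf : LipschitzWith K f) : ∃ Φ : Flow ℝ≥0 (FracSpace A a α),
      IsGeneratedSemiflow A a α lam f Φ ∧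
      ∀ u, IsFullSolution A a α lam f u → ∀ (t : ℝ≥0) (s : ℝ), Φ t (u s) = u (t + s) := by
  obtain ⟨C₀, hk₀⟩ := hT.exists_isKernel hα
  have hk := hk₀.scaled (lam + a)
  have hg := hT.lipschitzWith_comp_coord_symm hα hf
  set J := FracSpace.coord (hT.injective hα)
  obtain ⟨φ, h1, h2⟩ := hk.exists_flow hg
  let Φ : Flow ℝ≥0 (FracSpace A a α) :=
    { toFun := fun t u => J.symm (φ t (J u))
      cont' := J.symm.continuous.comp (φ.continuous continuous_fst (J.continuous.comp continuous_snd))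
      map_add' := fun t s u => by
        rw [LinearIsometryEquiv.apply_symm_apply, φ.map_add]
      map_zero' := fun u => by
        rw [φ.map_zero_apply, LinearIsometryEquiv.symm_apply_apply] }
  have huniq : ∀ (u : ℝ → FracSpace A a α) (b : ℝ), 0 ≤ b → ContinuousOn u (Icc 0 b) →
      SolvesOn A a α lam f u (Ioo 0 b) → u b = Φ b.toNNReal (u 0) := by
    intro u b hb hu hs
    have := h2 (fun t => J (u t)) b hb (J.continuous.comp_continuousOn hu)
      (hT.mild_of_solvesOn hα hf hu hs)
    change u b = J.symm (φ b.toNNReal (J (u 0)))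
    rw [← this, LinearIsometryEquiv.symm_apply_apply]
  refine ⟨Φ, ⟨fun u₀ => ?_, fun b u hu hs t ht => ?_⟩, fun u hu t s => ?_⟩
  · have e : ∀ t : ℝ, J (Φ t.toNNReal u₀) = φ t.toNNReal (J u₀) := fun t =>
      J.apply_symm_apply _
    refine hT.solvesOn_of_mild hα hf (J.symm.continuous.comp (h1 (J u₀)).1) ?_
    change MildOn _ _ _ (fun t : ℝ => J (Φ t.toNNReal u₀)) _
    simp only [e]
    exact (h1 (J u₀)).2
  · exact huniq u t ht.1 (hu.mono (Icc_subset_Ico_right ht.2)) fun s hs' =>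
      hs s ⟨hs'.1, hs'.2.trans ht.2⟩
  · have := huniq (fun r => u (r + s)) t t.2 (by have := hu.1; fun_prop) fun r _ => by
      obtain ⟨h3, h4⟩ := hu.2 (r + s) (mem_univ _)
      exact ⟨h3, h4.comp_add_const r s⟩
    rw [Real.toNNReal_coe, zero_add] at this
    exact this.symm

/-- For a central vector `w` take the unique Lyapunov–Perron solution with that parameter. Its value
at time zero has central component `w`, and the remainder is `ξ(w)`. -/
theorem SpectralSplitting.exists_invariantManifold (h : SpectralSplitting A z₀ β₁ β₂)
    (hA : IsSectorial A) (hT : IsShiftedSemigroup A a T L C δ) (hα : α ∈ Ico (0 : ℝ) 1)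
    (hβ : 0 < β) (hE : ExpEstimates A a z₀ β₁ β lam α M)
    (hμ : μ ∈ Ioo (1 / 4 * β) (3 / 4 * β)) {f : FracSpace A a α → X} {K : ℝ≥0}
    (hf : LipschitzWith K f) (hK : Fmu M β α μ * K < 1) :
    ∃ (ξ : X2 A a α z₀ → X13 A a α β₁ z₀) (K' : ℝ≥0), LipschitzWith K' ξ ∧
      manifold ξ = {u₀ | ∃ u ∈ weightedSpace A a α μ, IsFullSolution A a α lam f u ∧ u 0 = u₀} := by
  have hinj := hT.injective hα
  obtain ⟨C₀, hk₀⟩ := hT.exists_isKernel hα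
  have hk := hk₀.scaled (lam + a)
  have hg := hT.lipschitzWith_comp_coord_symm hα hf
  obtain ⟨H₁, H₂, H₃, htri⟩ := h.exists_isTrichotomy hA hT hα hE
  have hμ0 : 0 ≤ μ := by linarith [hμ.1]
  have hK' : IsTrichotomy.bound M (1 / 4 * β) (3 / 4 * β) α μ * K < 1 := hK
  set J := FracSpace.coord hinj with hJ
  set g : X → X := fun x => f (J.symm x)
  choose sol hc hb hsol using htri.exists_lyapunovPerron hμ0 hμ.1 hμ.2 hg hK'
  set k := M / (1 - IsTrichotomy.bound M (1 / 4 * β) (3 / 4 * β) α μ * K) with hkdef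
  have hk0 : 0 ≤ k := div_nonneg htri.M_nonneg (by linarith)
  have hlip : ∀ w w', ‖sol w 0 - sol w' 0‖ ≤ k * ‖w - w'‖ := fun w w' => by
    have := htri.norm_sub_le_of_lyapunovPerron hμ0 hμ.1 hμ.2 hg hK' (hc w) (hb w) (hc w') (hb w')
      (hsol w) (hsol w') 0
    rw [abs_zero, mul_zero, Real.exp_zero, mul_one] at this
    rwa [hkdef, div_mul_eq_mul_div]
  have hP2 : ∀ w, P2 A z₀ (sol w 0) = P2 A z₀ w := fun w => by
    have := htri.P₂_lyapunovPerron_zero hμ0 hμ.2 (w := w) (hg.continuous.comp (hc w))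
      (isExpBounded_comp hg hμ0 (hb w))
    have e : lyapunovPerron (exp2 A z₀ lam) H₁ H₂ H₃ w (g ∘ sol w) = sol w := hsol w
    rwa [e] at this
  have hmem : ∀ Q : X →L[ℂ] X, GraphComm A Q → ∀ x, J.symm (Q x) ∈ fracPart A a α Q := by
    intro Q hQ x
    refine ⟨negFracPow A a α x, ?_⟩
    change Q (negFracPow A a α x) = negFracPow A a α (Q x)
    rw [hT.negFracPow_eq]
    exact congrArg (fun B : X →L[ℂ] X => B x) (hT.commute_graphComm_fracInt hA hQ hα.1).eq
  -- The difference has no central component, so it is the sum of its `P₁` and `P₃` parts; these lie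
  -- in `X^α` since the projections commute with `Λ^{-α}`.
  have h13 : ∀ w : X2 A a α z₀, J.symm (sol (J w) 0) - w ∈ X13 A a α β₁ z₀ := by
    intro w
    set y := sol (J w) 0 - J w with hy
    have hy2 : P2 A z₀ y = 0 := by rw [hy, map_sub, hP2, sub_self]
    have e : J.symm (sol (J w) 0) - w = J.symm (P1 A β₁ y) + J.symm (P3 A β₁ z₀ y) := by
      have e3 : P3 A β₁ z₀ y = y - P1 A β₁ y - P2 A z₀ y := rfl
      rw [← map_add, e3, hy2, sub_zero, add_sub_cancel, hy, map_sub,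
        LinearIsometryEquiv.symm_apply_apply]
    rw [e]
    exact Submodule.add_mem_sup (hmem _ (h.graphComm_P1 hA) y) (hmem _ (h.graphComm_P3 hA) y)
  -- `k` is the Lipschitz constant of the value at time zero, and the additional `1` comes from
  -- subtracting `w`.
  refine ⟨fun w => ⟨_, h13 w⟩, ⟨k + 1, by positivity⟩, LipschitzWith.of_dist_le_mul fun w w' => ?_, ?_⟩
  · rw [dist_eq_norm, dist_eq_norm]
    change ‖(J.symm (sol (J w) 0) - (w : FracSpace A a α)) -
      (J.symm (sol (J w') 0) - (w' : FracSpace A a α))‖ ≤ (k + 1) * ‖(w : FracSpace A a α) - w'‖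
    have e : (J.symm (sol (J w) 0) - (w : FracSpace A a α)) -
        (J.symm (sol (J w') 0) - (w' : FracSpace A a α)) =
        J.symm (sol (J w) 0 - sol (J w') 0) - ((w : FracSpace A a α) - w') := by
      rw [map_sub]; abel
    have h1 := hlip (J w) (J w')
    rw [← map_sub, LinearIsometryEquiv.norm_map] at h1
    rw [e, add_mul, one_mul]
    refine (norm_sub_le _ _).trans (add_le_add ?_ le_rfl)
    rw [LinearIsometryEquiv.norm_map]
    exact h1
  · ext u₀
    constructor
    · rintro ⟨w, rfl⟩
      have e : ∀ t, J (J.symm (sol (J w) t)) = sol (J w) t := fun t => J.apply_symm_apply _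
      refine ⟨fun t => J.symm (sol (J w) t), ?_, ?_, ?_⟩
      · rw [mem_weightedSpace_iff hinj, ← hJ]
        simp only [e]
        exact ⟨J.symm.continuous.comp (hc _), hb _⟩
      · rw [hT.isFullSolution_iff hα hf]
        refine ⟨J.symm.continuous.comp (hc _), fun τ => ?_⟩
        change MildOn _ _ g (fun t => J (J.symm (sol (J w) (t + τ)))) _
        simp only [e]
        exact htri.mild_of_lyapunovPerron hk hμ0 hμ.2 hg (hc _) (hb _) (hsol _) τ
      · exact (add_sub_cancel (w : FracSpace A a α) _).symm
    · rintro ⟨u, huw, huf, rfl⟩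
      rw [mem_weightedSpace_iff hinj, ← hJ] at huw
      rw [hT.isFullSolution_iff hα hf] at huf
      have hv : Continuous fun t => J (u t) := J.continuous.comp huw.1
      -- Such a full solution satisfies the Lyapunov–Perron equation with `w = P₂ u(0)`, and by
      -- uniqueness it has the value prescribed by the graph.
      have hLP := htri.lyapunovPerron_of_mild hk hμ0 hμ.1 hμ.2 hg hv huw.2 huf.2
      set w := P2 A z₀ (J (u 0)) with hw
      have h0 := htri.norm_sub_le_of_lyapunovPerron hμ0 hμ.1 hμ.2 hg hK' (hc w) (hb w) hv huw.2
        (hsol w) hLP 0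
      rw [sub_self, norm_zero, mul_zero, zero_div, zero_mul] at h0
      have h1 : sol w 0 = J (u 0) := sub_eq_zero.1 (norm_le_zero_iff.1 h0)
      refine ⟨⟨J.symm w, hmem _ h.graphComm_P2 _⟩, ?_⟩
      change J.symm w + (J.symm (sol (J (J.symm w)) 0) - J.symm w) = u 0
      rw [add_sub_cancel, LinearIsometryEquiv.apply_symm_apply, h1,
        LinearIsometryEquiv.symm_apply_apply]

omit [CompleteSpace X] in
theorem weightedSpace_comp_add {u : ℝ → FracSpace A a α} (hμ : 0 ≤ μ)
    (hu : u ∈ weightedSpace A a α μ) (s : ℝ) : (fun t => u (t + s)) ∈ weightedSpace A a α μ := by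
  obtain ⟨hc, B, hB⟩ := hu
  refine ⟨by fun_prop, Real.exp (μ * |s|) * B, ?_⟩
  rintro _ ⟨t, rfl⟩
  have h1 : Real.exp (-(μ * |t + s|)) * ‖u (t + s)‖ ≤ B := hB ⟨t + s, rfl⟩
  have h2 : Real.exp (-(μ * |t|)) ≤ Real.exp (μ * |s|) * Real.exp (-(μ * |t + s|)) := by
    rw [← Real.exp_add]
    gcongr
    have := mul_le_mul_of_nonneg_left (abs_add_le t s) hμ
    linarith
  calc _ ≤ Real.exp (μ * |s|) * Real.exp (-(μ * |t + s|)) * ‖u (t + s)‖ :=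
        mul_le_mul_of_nonneg_right h2 (norm_nonneg _)
    _ = Real.exp (μ * |s|) * (Real.exp (-(μ * |t + s|)) * ‖u (t + s)‖) := mul_assoc _ _ _
    _ ≤ _ := by gcongr

omit [CompleteSpace X] in
theorem IsFullSolution.comp_add {f : FracSpace A a α → X} {u : ℝ → FracSpace A a α}
    (hu : IsFullSolution A a α lam f u) (s : ℝ) : IsFullSolution A a α lam f fun t => u (t + s) := by
  refine ⟨by have := hu.1; fun_prop, fun t _ => ?_⟩
  obtain ⟨h1, h2⟩ := hu.2 (t + s) (mem_univ _)
  exact ⟨h1, h2.comp_add_const t s⟩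

end Complete

end

end SectorialIM

end

/-! ### The theorem -/

theorem theorem3p1 {X : Type*} [NormedAddCommGroup X] [NormedSpace ℂ X] [CompleteSpace X]
    (A : X →ₗ.[ℂ] X) (hA : SectorialIM.IsSectorial A)
    (a : ℝ) (ha : ∀ z ∈ SectorialIM.spectrum A, 0 < z.re + a)
    (z₀ : ℂ) (β₁ β₂ : ℝ) (hsplit : SectorialIM.SpectralSplitting A z₀ β₁ β₂)
    (β : ℝ) (hβ : 0 < β) (hβ' : β < min (z₀.re - β₁) (β₂ - z₀.re)) :
    -- constants `M` exist, uniformly for `lam` in compact parts of `J` ...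
    (∀ θ : ℝ, θ < 1 / 4 * β → ∃ M : ℝ, 0 < M ∧
      ∀ lam : ℝ, |lam - z₀.re| ≤ θ → ∀ α ∈ Set.Ico (0 : ℝ) 1,
        SectorialIM.ExpEstimates A a z₀ β₁ β lam α M) ∧
    -- ... and uniformly for `lam ∈ J` if the eigenvalue is semisimple
    (SectorialIM.IsSemisimpleEigenvalue A z₀ → ∃ M : ℝ, 0 < M ∧
      ∀ lam ∈ Set.Ioo (z₀.re - 1 / 4 * β) (z₀.re + 1 / 4 * β), ∀ α ∈ Set.Ico (0 : ℝ) 1,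
        SectorialIM.ExpEstimates A a z₀ β₁ β lam α M) ∧
    -- the global invariant manifold
    (∀ α ∈ Set.Ico (0 : ℝ) 1,
      ∀ lam ∈ Set.Ioo (z₀.re - 1 / 4 * β) (z₀.re + 1 / 4 * β),
      ∀ M : ℝ, SectorialIM.ExpEstimates A a z₀ β₁ β lam α M →
      ∀ μ ∈ Set.Ioo (1 / 4 * β) (3 / 4 * β),
      ∀ (f : SectorialIM.FracSpace A a α → X) (L : ℝ≥0), LipschitzWith L f →
        SectorialIM.Fmu M β α μ * L < 1 →
        ∃ (Φ : Flow ℝ≥0 (SectorialIM.FracSpace A a α))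
          (ξ : SectorialIM.X2 A a α z₀ → SectorialIM.X13 A a α β₁ z₀) (K : ℝ≥0),
          SectorialIM.IsGeneratedSemiflow A a α lam f Φ ∧
          LipschitzWith K ξ ∧
          (∀ t : ℝ≥0, Φ t '' SectorialIM.manifold ξ = SectorialIM.manifold ξ) ∧
          SectorialIM.manifold ξ =
            {u₀ | ∃ u ∈ SectorialIM.weightedSpace A a α μ,
              SectorialIM.IsFullSolution A a α lam f u ∧ u 0 = u₀}) := by
  obtain ⟨T, L₀, C, δ, hT⟩ := SectorialIM.exists_isShiftedSemigroup hA ha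
  obtain ⟨c₀, hc⟩ := hT.exists_norm_fracInt_le
  refine ⟨fun θ hθ => ?_, fun hs => ?_, fun α hα lam _ M hE μ hμ f L hf hL => ?_⟩
  · obtain ⟨M₂, hM₂, h2⟩ := hsplit.exists_exp2_bound hT hc hβ hβ' hθ
    exact hsplit.exists_expEstimates hA hT hc hβ hβ' (J := {lam | |lam - z₀.re| ≤ θ})
      (fun lam hlam => le_trans hlam hθ.le) hM₂ h2
  · obtain ⟨M₂, hM₂, h2⟩ := hsplit.exists_exp2_bound_of_semisimple (β := β) hT hc hs
    have hJ : ∀ lam ∈ Set.Ioo (z₀.re - 1 / 4 * β) (z₀.re + 1 / 4 * β),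
        |lam - z₀.re| ≤ 1 / 4 * β := fun lam hlam =>
      abs_le.2 ⟨by linarith [hlam.1], by linarith [hlam.2]⟩
    exact hsplit.exists_expEstimates hA hT hc hβ hβ' hJ hM₂ fun lam hlam => h2 lam (hJ lam hlam)
  · obtain ⟨Φ, hΦ, hfull⟩ := hT.exists_isGeneratedSemiflow hα lam hf
    obtain ⟨ξ, K, hξ, hman⟩ := hsplit.exists_invariantManifold hA hT hα hβ hE hμ hf hL
    refine ⟨Φ, ξ, K, hΦ, hξ, fun t => ?_, hman⟩
    have hμ0 : 0 ≤ μ := by linarith [hμ.1]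
    rw [hman]
    -- Both inclusions are translations in time: `u(· + t)` shows that the image lies in the
    -- manifold, and `u(-t)`, the value of a translated full solution, is the required preimage.
    apply Set.Subset.antisymm
    · rintro _ ⟨_, ⟨u, huw, hu, rfl⟩, rfl⟩
      refine ⟨fun r => u (r + t), SectorialIM.weightedSpace_comp_add hμ0 huw t, hu.comp_add t, ?_⟩
      simp only [hfull u hu t 0, zero_add, add_zero]
    · rintro _ ⟨u, huw, hu, rfl⟩
      refine ⟨u (-t), ⟨fun r => u (r + -t), SectorialIM.weightedSpace_comp_add hμ0 huw (-t),
        hu.comp_add (-t), by simp only [zero_add]⟩, ?_⟩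
      rw [hfull u hu t (-t), add_neg_cancel]
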